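/- Let $p$ be a prime number and let $\mathbb X=\mathbb X_0=\mathbb P^1_{\mathbb Z_p}$, covered by the two standard charts $U_x=\mathrm{Spec}\,\mathbb Z_p[x]$ and $U_y=\mathrm{Spec}\,\mathbb Z_p[y]$ with $xy=1$ on the overlap. For $n\ge 1$ let $\mathbb X_n$ be the scheme obtained by blowing up $\mathbb X_{n-1}$ in the (reduced closed subscheme of) smooth $\mathbb F_p$-rational points of the special fibre of $\mathbb X_{n-1}$, and let $pr_n:\mathbb X_n\to\mathbb X$ be the canonical projection ($pr_0=\mathrm{id}$). Let $\mathcal T_{\mathbb X}$ be the relative tangent sheaf of $\mathbb X$ over $\mathbb Z_p$, i.e. the sheaf of $\mathbb Z_p$-derivations of $\mathcal O_{\mathbb X}$. Let $\mathcal T_{\mathbb X_n,\log}$ be the logarithmic tangent sheaf of $\mathbb X_n$ over $\mathbb Z_p$ with respect to the divisor $\{p=0\}$, i.e. the sheaf of those $\mathbb Z_p$-derivations $D$ of $\mathcal O_{\mathbb X_n}$ such that $D(m)\in m\,\mathcal O_{\mathbb X_n}$ for each local section $m$ of $\mathcal O_{\mathbb X_n}$ that is invertible on the generic fibre. (For $n=0$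 this is $\mathcal T_{\mathbb X}$.) For $n,d\ge 0$ let $\mathcal I_{n,d}\subset\mathcal O_{\mathbb X}$ be the ideal sheaf which on $U_x$ is associated to the ideal $$\bigcap_{a\in\mathbb Z/(p^n)}(x-a,\,p^n)^d\ \subset\ \mathbb Z_p[x]$$ and on $U_y$ to the ideal $\bigcap_{a\in\mathbb Z/(p^n)}(y-a,\,p^n)^d\subset\mathbb Z_p[y]$. Then for each $n\ge 0$: (a) The sheaf $pr_n^*\mathcal T_{\mathbb X}$ is invertible, and $\mathcal T_{\mathbb X_n,\log}$ is a subsheaf of it: the differential $D\mapsto D\circ pr_n^{\#}$ of $pr_n$, with values in $\mathcal{D}er_{\mathbb Z_p}(pr_n^{-1}\mathcal O_{\mathbb X},\mathcal O_{\mathbb X_n})$, factors as an injective map $\mathcal T_{\mathbb X_n,\log}\hookrightarrow pr_n^*\mathcal T_{\mathbb X}$ followed by the canonical map $pr_n^*\mathcal T_{\mathbb X}\to\mathcal{D}er_{\mathbb Z_p}(pr_n^{-1}\mathcal O_{\mathbb X},\mathcal O_{\mathbb X_n})$. (b) $\mathcal O_{\mathbb X}\to(pr_n)_*\mathcal O_{\mathbb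 X_n}$ is an isomorphism. (c) For all $d\ge 0$ one has $$(pr_n)_*\bigl(\mathcal T_{\mathbb X_n,\log}^{\otimes d}\bigr)=\mathcal I_{n,d}\cdot\mathcal T_{\mathbb X}^{\otimes d}.$$ This is an equality of subsheaves of $(pr_n)_*\bigl((pr_n^*\mathcal T_{\mathbb X})^{\otimes d}\bigr)$, where the left side is embedded by the $d$-th tensor power of the inclusion in (a), and $\mathcal T_{\mathbb X}^{\otimes d}$ by the canonical map $\mathcal T_{\mathbb X}^{\otimes d}\to(pr_n)_*\bigl((pr_n^*\mathcal T_{\mathbb X})^{\otimes d}\bigr)$; both maps are injective. -/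

import Mathlib

open CategoryTheory AlgebraicGeometry Opposite TopologicalSpace

namespace SemistableModel
universe u
variable {X Y S : Scheme.{u}}

/-- Let `f : Y ⟶ X` and `s : X ⟶ S` be morphisms of schemes. A section over the open `V ⊆ Y` of the
sheaf `Der_S(f⁻¹ 𝒪_X, 𝒪_Y)`: a family of derivations `Γ(X, U) → Γ(Y, W)` for `W ⊆ V ∩ f⁻¹(U)`,
compatible with restriction, that kill the functions coming from `S`. For `f = 𝟙 X` this is a section
over `V` of the relative tangent sheaf of `X` over `S`. -/
@[ext]
structure DerivationAlong (f : Y ⟶ X) (s : X ⟶ S) (V : Y.Opens) where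
  app : ∀ (U : X.Opens) (W : Y.Opens), W ≤ V → W ≤ f ⁻¹ᵁ U → Γ(X, U) →+ Γ(Y, W)
  leibniz : ∀ (U : X.Opens) (W : Y.Opens) (hV : W ≤ V) (hU : W ≤ f ⁻¹ᵁ U) (a b : Γ(X, U)),
    app U W hV hU (a * b) =
      f.appLE U W hU a * app U W hV hU b + f.appLE U W hU b * app U W hV hU a
  map_base : ∀ (Z : S.Opens) (W : Y.Opens) (hV : W ≤ V) (hU : W ≤ f ⁻¹ᵁ (s ⁻¹ᵁ Z)) (c : Γ(S, Z)),
    app (s ⁻¹ᵁ Z) W hV hU (s.app Z c) = 0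
  map_res : ∀ (U U' : X.Opens) (W W' : Y.Opens) (hV : W ≤ V) (hU : W ≤ f ⁻¹ᵁ U)
    (hU' : W' ≤ f ⁻¹ᵁ U') (iU : U' ≤ U) (iW : W' ≤ W) (a : Γ(X, U)),
    app U' W' (iW.trans hV) hU' (X.presheaf.map (homOfLE iU).op a) =
      Y.presheaf.map (homOfLE iW).op (app U W hV hU a)

/-- Restricting a function twice is the same as restricting it once. -/
lemma map_map {X : Scheme.{u}} {W W' W'' : X.Opens} (h : W' ≤ W) (h' : W'' ≤ W') (r : Γ(X, W)) :
    X.presheaf.map (homOfLE h').op (X.presheaf.map (homOfLE h).op r) =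
      X.presheaf.map (homOfLE (h'.trans h)).op r := by
  rw [← CommRingCat.comp_apply, ← Functor.map_comp]; rfl

lemma appLE_map_apply (f : Y ⟶ X) {U : X.Opens} {W W' : Y.Opens} (hU : W ≤ f ⁻¹ᵁ U) (h : W' ≤ W)
    (a : Γ(X, U)) :
    Y.presheaf.map (homOfLE h).op (f.appLE U W hU a) = f.appLE U W' (h.trans hU) a := by
  rw [← CommRingCat.comp_apply, Scheme.Hom.appLE_map]

lemma map_appLE_apply (f : Y ⟶ X) {U U' : X.Opens} {W : Y.Opens} (hU : W ≤ f ⁻¹ᵁ U) (i : U ≤ U')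
    (hU' : W ≤ f ⁻¹ᵁ U') (a : Γ(X, U')) :
    f.appLE U W hU (X.presheaf.map (homOfLE i).op a) = f.appLE U' W hU' a := by
  rw [← CommRingCat.comp_apply, Scheme.Hom.map_appLE]

lemma id_appLE_apply {U W : X.Opens} (hU : W ≤ (𝟙 X : X ⟶ X) ⁻¹ᵁ U) (h : W ≤ U) (a : Γ(X, U)) :
    (𝟙 X : X ⟶ X).appLE U W hU a = X.presheaf.map (homOfLE h).op a := by
  simp [Scheme.Hom.appLE]; rfl

lemma le_preimage_inf (f : Y ⟶ X) {U U' : X.Opens} {W : Y.Opens} (h : W ≤ f ⁻¹ᵁ U)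
    (h' : W ≤ f ⁻¹ᵁ U') : W ≤ f ⁻¹ᵁ (U ⊓ U') := le_inf h h'

lemma map_self {U : X.Opens} (a : Γ(X, U)) : X.presheaf.map (homOfLE (le_refl U)).op a = a := by
  change X.presheaf.map (𝟙 _) a = a
  simp

namespace DerivationAlong
variable {f : Y ⟶ X} {s : X ⟶ S} {V : Y.Opens}

instance : Zero (DerivationAlong f s V) where
  zero := { app := fun _ _ _ _ => 0, leibniz := by simp, map_base := by simp, map_res := by simp }

instance : Add (DerivationAlong f s V) where
  add D E :=
    { app := fun U W hV hU => D.app U W hV hU + E.app U W hV hU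
      leibniz := by intros; simp [D.leibniz, E.leibniz]; ring
      map_base := by intros; simp [D.map_base, E.map_base]
      map_res := fun U U' W W' hV hU hU' iU iW a => by
        simp [D.map_res U U' W W' hV hU hU' iU iW, E.map_res U U' W W' hV hU hU' iU iW] }

instance : Neg (DerivationAlong f s V) where
  neg D :=
    { app := fun U W hV hU => - D.app U W hV hU
      leibniz := by intros; simp [D.leibniz]; ring
      map_base := by intros; simp [D.map_base]
      map_res := fun U U' W W' hV hU hU' iU iW a => by
        simp [D.map_res U U' W W' hV hU hU' iU iW] }

instance : SMul Γ(Y, V) (DerivationAlong f s V) where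
  smul r D :=
    { app := fun U W hV hU =>
        (AddMonoidHom.mulLeft (Y.presheaf.map (homOfLE hV).op r)).comp (D.app U W hV hU)
      leibniz := by intros; simp [D.leibniz]; ring
      map_base := by intros; simp [D.map_base]
      map_res := by
        intro U U' W W' hV hU hU' iU iW a
        simp [← map_map hV iW r, D.map_res U U' W W' hV hU hU' iU iW a] }

@[simp] lemma zero_app (U W hV hU) (a : Γ(X, U)) :
    (0 : DerivationAlong f s V).app U W hV hU a = 0 := rfl
@[simp] lemma add_app (D E : DerivationAlong f s V) (U W hV hU) (a : Γ(X, U)) :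
    (D + E).app U W hV hU a = D.app U W hV hU a + E.app U W hV hU a := rfl
@[simp] lemma neg_app (D : DerivationAlong f s V) (U W hV hU) (a : Γ(X, U)) :
    (-D).app U W hV hU a = -D.app U W hV hU a := rfl
@[simp] lemma smul_app (r : Γ(Y, V)) (D : DerivationAlong f s V) (U W hV hU) (a : Γ(X, U)) :
    (r • D).app U W hV hU a = Y.presheaf.map (homOfLE hV).op r * D.app U W hV hU a := rfl

lemma ext_app {D E : DerivationAlong f s V}
    (h : ∀ U W hV hU a, D.app U W hV hU a = E.app U W hV hU a) : D = E := by
  ext U W hV hU a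
  exact h U W hV hU a

instance : AddCommGroup (DerivationAlong f s V) where
  add_assoc _ _ _ := ext_app fun _ _ _ _ _ => add_assoc _ _ _
  zero_add _ := ext_app fun _ _ _ _ _ => zero_add _
  add_zero _ := ext_app fun _ _ _ _ _ => add_zero _
  add_comm _ _ := ext_app fun _ _ _ _ _ => add_comm _ _
  neg_add_cancel _ := ext_app fun _ _ _ _ _ => neg_add_cancel _
  nsmul := nsmulRec
  zsmul := zsmulRec

instance : Module Γ(Y, V) (DerivationAlong f s V) where
  one_smul _ := ext_app fun _ _ _ _ _ => by simp
  mul_smul _ _ _ := ext_app fun _ _ _ _ _ => by simp [mul_assoc]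
  smul_zero _ := ext_app fun _ _ _ _ _ => by simp
  smul_add _ _ _ := ext_app fun _ _ _ _ _ => by simp [mul_add]
  add_smul _ _ _ := ext_app fun _ _ _ _ _ => by simp [add_mul]
  zero_smul _ := ext_app fun _ _ _ _ _ => by simp

/-- Restriction to a smaller open. -/
def res {V' : Y.Opens} (i : V' ≤ V) : DerivationAlong f s V →+ DerivationAlong f s V' where
  toFun D :=
    { app := fun U W hV hU => D.app U W (hV.trans i) hU
      leibniz := fun U W hV hU => D.leibniz U W (hV.trans i) hU
      map_base := fun Z W hV hU => D.map_base Z W (hV.trans i) hU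
      map_res := fun U U' W W' hV hU hU' iU iW => D.map_res U U' W W' (hV.trans i) hU hU' iU iW }
  map_zero' := rfl
  map_add' _ _ := rfl

@[simp] lemma res_app {V' : Y.Opens} (i : V' ≤ V) (D : DerivationAlong f s V) (U W hV hU)
    (a : Γ(X, U)) : (res i D).app U W hV hU a = D.app U W (hV.trans i) hU a := rfl

variable (f s) in
/-- The presheaf `V ↦ Der_S(f⁻¹ 𝒪_X, 𝒪_Y)(V)` of abelian groups. -/
def abPresheaf : TopCat.Presheaf Ab.{u} Y where
  obj V := AddCommGrpCat.of (DerivationAlong f s V.unop)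
  map i := AddCommGrpCat.ofHom (res i.unop.le)
  map_id _ := rfl
  map_comp _ _ := rfl

noncomputable instance (V : (Y.Opens)ᵒᵖ) : Module (Y.ringCatSheaf.obj.obj V) ((abPresheaf f s).obj V) :=
  inferInstanceAs (Module Γ(Y, V.unop) (DerivationAlong f s V.unop))

variable (f s) in
/-- The presheaf of `𝒪_Y`-modules `V ↦ Der_S(f⁻¹ 𝒪_X, 𝒪_Y)(V)`. -/
noncomputable def presheafOfModules : Y.PresheafOfModules :=
  PresheafOfModules.ofPresheaf (abPresheaf f s) (fun V V' i r D => by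
    refine ext_app (f := f) (s := s) fun U W hV hU a => ?_
    exact congr($((map_map i.unop.le hV r).symm) * DerivationAlong.app D U W _ hU a))

variable (f s) in
lemma isSheaf_abPresheaf : (abPresheaf f s).IsSheaf := by
  rw [TopCat.Presheaf.isSheaf_iff_isSheafUniqueGluing]
  intro ι V sf hsf
  change ∀ i, DerivationAlong f s (V i) at sf
  have hc : ∀ (i j : ι) (U : X.Opens) (W : Y.Opens) (hi : W ≤ V i) (hj : W ≤ V j)
      (hU : W ≤ f ⁻¹ᵁ U) (a : Γ(X, U)), (sf i).app U W hi hU a = (sf j).app U W hj hU a := by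
    intro i j U W hi hj hU a
    have h := hsf i j
    change res (V' := V i ⊓ V j) inf_le_left (sf i) = res (V' := V i ⊓ V j) inf_le_right (sf j) at h
    exact congr($(h).app U W (le_inf hi hj) hU a)
  -- gluing
  have key : ∀ (U : X.Opens) (W : Y.Opens) (hV : W ≤ iSup V) (hU : W ≤ f ⁻¹ᵁ U) (a : Γ(X, U)),
      ∃! b : Γ(Y, W), ∀ (i : ι) (W' : Y.Opens) (hW' : W' ≤ W) (hi : W' ≤ V i),
        Y.presheaf.map (homOfLE hW').op b = (sf i).app U W' hi (hW'.trans hU) a := by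
    intro U W hV hU a
    have := Y.sheaf.existsUnique_gluing' (fun i => W ⊓ V i) W (fun i => homOfLE inf_le_left)
      (fun x hx => by
        obtain ⟨i, hi⟩ := Opens.mem_iSup.mp (hV hx)
        exact Opens.mem_iSup.mpr ⟨i, hx, hi⟩)
      (fun i => (sf i).app U (W ⊓ V i) inf_le_right (inf_le_left.trans hU) a)
      (fun i j => by
        have h1 := (sf i).map_res U U (W ⊓ V i) ((W ⊓ V i) ⊓ (W ⊓ V j)) inf_le_right
          (inf_le_left.trans hU) (inf_le_left.trans (inf_le_left.trans hU)) le_rfl inf_le_left a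
        have h2 := (sf j).map_res U U (W ⊓ V j) ((W ⊓ V i) ⊓ (W ⊓ V j)) inf_le_right
          (inf_le_left.trans hU) (inf_le_left.trans (inf_le_left.trans hU)) le_rfl inf_le_right a
        refine h1.symm.trans (Eq.trans ?_ h2)
        apply hc)
    obtain ⟨b, hb, hb'⟩ := this
    refine ⟨b, ?_, ?_⟩
    · intro i W' hW' hi
      have h := (sf i).map_res U U (W ⊓ V i) W' inf_le_right (inf_le_left.trans hU)
        (hW'.trans hU) le_rfl (le_inf hW' hi) a
      have e := hb i
      change Y.presheaf.map _ b = _ at e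
      rw [← e] at h
      replace h := h.trans (map_map _ _ _)
      have : X.presheaf.map (homOfLE (le_refl U)).op a = a := by
        change X.presheaf.map (𝟙 _) a = a
        simp
      rw [this] at h
      exact h.symm
    · intro c hcc
      exact hb' c fun i => hcc i _ _ inf_le_right
  choose g hg hg' using key
  have uniq : ∀ (W : Y.Opens) (hV : W ≤ iSup V) (b c : Γ(Y, W)),
      (∀ (i : ι) (W' : Y.Opens) (hW' : W' ≤ W), W' ≤ V i →
        Y.presheaf.map (homOfLE hW').op b = Y.presheaf.map (homOfLE hW').op c) → b = c := by
    intro W hV b c h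
    exact Y.sheaf.eq_of_locally_eq' (fun i => W ⊓ V i) W (fun i => homOfLE inf_le_left)
      (fun x hx => by
        obtain ⟨i, hi⟩ := Opens.mem_iSup.mp (hV hx)
        exact Opens.mem_iSup.mpr ⟨i, hx, hi⟩) b c (fun i => h i _ inf_le_left inf_le_right)
  have happ : ∀ (U : X.Opens) (W W' : Y.Opens) (hU : W ≤ f ⁻¹ᵁ U) (h : W' ≤ W) (a : Γ(X, U)),
      Y.presheaf.map (homOfLE h).op (f.appLE U W hU a) = f.appLE U W' (h.trans hU) a := by
    intro U W W' hU h a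
    rw [← CommRingCat.comp_apply, Scheme.Hom.appLE_map]
  refine ⟨{ app := fun U W hV hU => AddMonoidHom.mk' (g U W hV hU) ?_
            leibniz := ?_, map_base := ?_, map_res := ?_ }, ?_, ?_⟩
  · intro a b
    refine uniq W hV _ _ fun i W' hW' hi => ?_
    rw [map_add, hg _ _ _ _ _ i W' hW' hi, hg _ _ _ _ _ i W' hW' hi, hg _ _ _ _ _ i W' hW' hi,
      map_add]
  · intro U W hV hU a b
    refine uniq W hV _ _ fun i W' hW' hi => ?_
    simp only [AddMonoidHom.mk'_apply, map_add, map_mul, hg _ _ _ _ _ i W' hW' hi, happ,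
      (sf i).leibniz]
  · intro Z W hV hU c
    refine uniq W hV _ _ fun i W' hW' hi => ?_
    simp only [AddMonoidHom.mk'_apply, hg _ _ _ _ _ i W' hW' hi, (sf i).map_base, map_zero]
  · intro U U' W W' hV hU hU' iU iW a
    refine uniq W' (iW.trans hV) _ _ fun i W'' hW'' hi => ?_
    simp only [AddMonoidHom.mk'_apply, hg _ _ _ _ _ i W'' hW'' hi]
    rw [← CommRingCat.comp_apply, ← Functor.map_comp]
    have h2 := hg U W hV hU a i W'' (hW''.trans iW) hi
    refine Eq.trans ?_ h2.symm
    have h3 := (sf i).map_res U U' W'' W'' hi (hW''.trans (iW.trans hU)) (hW''.trans hU') iU le_rfl a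
    rw [h3]
    change Y.presheaf.map (𝟙 _) _ = _
    simp
  · intro i
    refine ext_app (f := f) (s := s) fun U W hV hU a => ?_
    have := hg U W (hV.trans (le_iSup V i)) hU a i W le_rfl hV
    change g U W _ hU a = _
    rw [← this]
    change _ = Y.presheaf.map (𝟙 _) _
    simp
  · intro D hD
    refine ext_app (f := f) (s := s) fun U W hV hU a => ?_
    change D.app U W hV hU a = g U W hV hU a
    refine uniq W hV _ _ fun i W' hW' hi => ?_
    rw [hg U W hV hU a i W' hW' hi]
    have h1 : res (le_iSup V i) D = sf i := hD i
    rw [← h1]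
    have h3 := D.map_res U U W W' hV hU (hW'.trans hU) le_rfl hW' a
    rw [← h3]
    change _ = D.app U W' _ _ a
    congr 1
    change X.presheaf.map (𝟙 _) a = a
    simp

end DerivationAlong

section Sheaves

variable (f : Y ⟶ X) (s : X ⟶ S)

/-- The action of a derivation of `𝒪_X` over `V` on functions. -/
def DerivationAlong.act {s : X ⟶ S} {V : X.Opens} (D : DerivationAlong (𝟙 X) s V) (U W : X.Opens)
    (hV : W ≤ V) (hU : W ≤ U) : Γ(X, U) →+ Γ(X, W) :=
  D.app U W hV hU

namespace DerivationAlong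
variable {s : X ⟶ S} {V : X.Opens} (D E : DerivationAlong (𝟙 X) s V)

lemma act_mul (U W : X.Opens) (hV : W ≤ V) (hU : W ≤ U) (a b : Γ(X, U)) :
    D.act U W hV hU (a * b) = X.presheaf.map (homOfLE hU).op a * D.act U W hV hU b +
      X.presheaf.map (homOfLE hU).op b * D.act U W hV hU a := by
  rw [← id_appLE_apply (W := W) hU hU, ← id_appLE_apply (W := W) hU hU]
  exact D.leibniz U W hV hU a b

lemma act_res (U U' W W' : X.Opens) (hV : W ≤ V) (hU : W ≤ U) (hU' : W' ≤ U') (iU : U' ≤ U)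
    (iW : W' ≤ W) (a : Γ(X, U)) :
    D.act U' W' (iW.trans hV) hU' (X.presheaf.map (homOfLE iU).op a) =
      X.presheaf.map (homOfLE iW).op (D.act U W hV hU a) :=
  D.map_res U U' W W' hV hU hU' iU iW a

lemma zero_act (U W : X.Opens) (hV : W ≤ V) (hU : W ≤ U) (a : Γ(X, U)) :
    (0 : DerivationAlong (𝟙 X) s V).act U W hV hU a = 0 := rfl

lemma add_act (U W : X.Opens) (hV : W ≤ V) (hU : W ≤ U) (a : Γ(X, U)) :
    (D + E).act U W hV hU a = D.act U W hV hU a + E.act U W hV hU a := rfl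

lemma smul_act (r : Γ(X, V)) (U W : X.Opens) (hV : W ≤ V) (hU : W ≤ U) (a : Γ(X, U)) :
    (r • D).act U W hV hU a = X.presheaf.map (homOfLE hV).op r * D.act U W hV hU a := rfl

end DerivationAlong

/-- The sheaf of `𝒪_Y`-modules `Der_S(f⁻¹ 𝒪_X, 𝒪_Y)`. -/
noncomputable def tangentAlong : Y.Modules :=
  ⟨DerivationAlong.presheafOfModules f s, DerivationAlong.isSheaf_abPresheaf f s⟩

/-- The tangent sheaf of `X` over `S`, that is the sheaf of `S`-derivations of `𝒪_X`. -/
noncomputable abbrev tangentSheaf : X.Modules := tangentAlong (𝟙 X) s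

/-- `D` is a logarithmic derivation for the divisorial log structure
`{m ∈ 𝒪_Y | m is invertible on G}`, where `G` is the (open) complement of the divisor: for each local
section `m` of the log structure, `D m` is a multiple of `m` in each stalk. -/
def DerivationAlong.IsLog {t : Y ⟶ S} {V : Y.Opens} (G : Y.Opens)
    (D : DerivationAlong (𝟙 Y) t V) : Prop :=
  ∀ (W : Y.Opens) (hW : W ≤ V) (m : Γ(Y, W)),
    IsUnit (Y.presheaf.map (homOfLE (inf_le_left : W ⊓ G ≤ W)).op m) →
    ∀ (y : Y) (hy : y ∈ W), Y.presheaf.germ W y hy (D.act W W hW le_rfl m) ∈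
      Ideal.span {Y.presheaf.germ W y hy m}

/-- The logarithmic derivations form a subpresheaf of modules of the sheaf of derivations. -/
noncomputable def logSubmodule (t : Y ⟶ S) (G : Y.Opens) :
    (DerivationAlong.presheafOfModules (𝟙 Y) t).Submodule where
  obj V :=
    { carrier := {D | DerivationAlong.IsLog (t := t) (V := V.unop) G D}
      add_mem' := by
        intro D E hD hE W hW m hm y hy
        change Y.presheaf.germ W y hy (DerivationAlong.act D W W hW le_rfl m +
          DerivationAlong.act E W W hW le_rfl m) ∈ _
        rw [map_add]
        exact add_mem (hD W hW m hm y hy) (hE W hW m hm y hy)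
      zero_mem' := by
        intro W hW m hm y hy
        change Y.presheaf.germ W y hy 0 ∈ _
        rw [map_zero]
        exact zero_mem _
      smul_mem' := by
        intro r D hD W hW m hm y hy
        change Y.presheaf.germ W y hy (Y.presheaf.map (homOfLE hW).op r *
          DerivationAlong.act D W W hW le_rfl m) ∈ _
        rw [map_mul]
        exact Ideal.mul_mem_left _ _ (hD W hW m hm y hy) }
  map {V V'} i D hD := fun W hW m hm y hy => hD W (hW.trans i.unop.le) m hm y hy

lemma isSheaf_logSubmodule (t : Y ⟶ S) (G : Y.Opens) :
    TopCat.Presheaf.IsSheaf (logSubmodule t G).toPresheafOfModules.presheaf := by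
  rw [TopCat.Presheaf.isSheaf_iff_isSheafUniqueGluing]
  intro ι V sf hsf
  have hs := DerivationAlong.isSheaf_abPresheaf (𝟙 Y) t
  rw [TopCat.Presheaf.isSheaf_iff_isSheafUniqueGluing] at hs
  obtain ⟨D, hD, hD'⟩ := hs V (fun i => (sf i).1) (fun i j => congrArg Subtype.val (hsf i j))
  refine ⟨⟨D, ?_⟩, ?_, ?_⟩
  · intro W hW m hm y hy
    obtain ⟨i, hi⟩ := Opens.mem_iSup.mp (hW hy)
    have h1 : DerivationAlong.res (le_iSup V i) D = (sf i).1 := hD i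
    have h2 : DerivationAlong.IsLog G (DerivationAlong.res (le_iSup V i) D) := h1 ▸ (sf i).2
    have hy' : y ∈ W ⊓ V i := ⟨hy, hi⟩
    have h3 := h2 (W ⊓ V i) inf_le_right (Y.presheaf.map (homOfLE inf_le_left).op m) (by
      have := hm.map (Y.presheaf.map (homOfLE (inf_le_inf_right G inf_le_left :
        (W ⊓ V i) ⊓ G ≤ W ⊓ G)).op).hom
      rw [map_map]
      exact (map_map _ _ m) ▸ this) y hy'
    rw [TopCat.Presheaf.germ_res_apply] at h3
    have h4 := DerivationAlong.act_res D W (W ⊓ V i) W (W ⊓ V i) hW le_rfl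
      le_rfl inf_le_left inf_le_left m
    have h5 := congrArg (Y.presheaf.germ (W ⊓ V i) y hy') h4
    rw [TopCat.Presheaf.germ_res_apply] at h5
    exact h5 ▸ h3
  · intro i
    exact Subtype.ext (hD i)
  · intro E hE
    exact Subtype.ext (hD' E.1 fun i => congrArg Subtype.val (hE i))

/-- The logarithmic tangent sheaf of `Y` over `S`, for the log structure of the divisor `Y ∖ G`. -/
noncomputable def logTangentSheaf (t : Y ⟶ S) (G : Y.Opens) : Y.Modules :=
  ⟨(logSubmodule t G).toPresheafOfModules, isSheaf_logSubmodule t G⟩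

/-- `D ↦ f^# ∘ D`. -/
noncomputable def DerivationAlong.postcomp {U : X.Opens} (D : DerivationAlong (𝟙 X) s U) :
    DerivationAlong f s (f ⁻¹ᵁ U) where
  app U' W hV hU := (f.appLE (U ⊓ U') W (le_preimage_inf f hV hU)).hom.toAddMonoidHom.comp
    (D.act U' (U ⊓ U') inf_le_left inf_le_right)
  leibniz := by
    intro U' W hV hU a b
    change f.appLE (U ⊓ U') W _ _ = f.appLE U' W hU a * f.appLE (U ⊓ U') W _ _ +
      f.appLE U' W hU b * f.appLE (U ⊓ U') W _ _
    rw [D.act_mul, map_add, map_mul, map_mul,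
      map_appLE_apply f _ _ hU, map_appLE_apply f _ _ hU]
  map_base := by
    intro Z W hV hU c
    have := D.map_base Z (U ⊓ s ⁻¹ᵁ Z) inf_le_left inf_le_right c
    change f.appLE (U ⊓ s ⁻¹ᵁ Z) W _ (D.app (s ⁻¹ᵁ Z) (U ⊓ s ⁻¹ᵁ Z) inf_le_left inf_le_right _) = 0
    exact (congrArg _ this).trans (map_zero _)
  map_res := by
    intro U₁ U₂ W W' hV hU hU' iU iW a
    have := D.act_res U₁ U₂ (U ⊓ U₁) (U ⊓ U₂) inf_le_left inf_le_right inf_le_right iU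
      (inf_le_inf_left U iU) a
    change f.appLE (U ⊓ U₂) W' _ (D.act U₂ (U ⊓ U₂) _ _ _) = Y.presheaf.map _ (f.appLE (U ⊓ U₁) W _ (D.act U₁ (U ⊓ U₁) _ _ _))
    rw [this, map_appLE_apply f _ _ (iW.trans (le_preimage_inf f hV hU)), appLE_map_apply]

/-- `D ↦ D ∘ f^#`. -/
noncomputable def DerivationAlong.precomp {V : Y.Opens} (D : DerivationAlong (𝟙 Y) (f ≫ s) V) :
    DerivationAlong f s V where
  app U W hV hU := (D.act (f ⁻¹ᵁ U) W hV hU).comp (f.app U).hom.toAddMonoidHom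
  leibniz := by
    intro U W hV hU a b
    change D.act (f ⁻¹ᵁ U) W hV hU (f.app U (a * b)) =
      f.appLE U W hU a * D.act (f ⁻¹ᵁ U) W hV hU (f.app U b) +
      f.appLE U W hU b * D.act (f ⁻¹ᵁ U) W hV hU (f.app U a)
    rw [map_mul, D.act_mul]
    rfl
  map_base := by
    intro Z W hV hU c
    exact D.map_base Z W hV hU c
  map_res := by
    intro U₁ U₂ W W' hV hU hU' iU iW a
    have := D.map_res (f ⁻¹ᵁ U₁) (f ⁻¹ᵁ U₂) W W' hV hU hU' (fun _ h => iU h) iW (f.app U₁ a)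
    change D.app (f ⁻¹ᵁ U₂) W' _ _ (f.app U₂ _) = _
    refine Eq.trans ?_ this
    congr 1
    rw [← CommRingCat.comp_apply, Scheme.Hom.naturality]
    rfl

@[simp] lemma DerivationAlong.postcomp_app {U : X.Opens} (D : DerivationAlong (𝟙 X) s U)
    (U' W hV hU) (a : Γ(X, U')) : (D.postcomp f s).app U' W hV hU a =
      f.appLE (U ⊓ U') W (le_preimage_inf f hV hU) (D.act U' (U ⊓ U') inf_le_left inf_le_right a) :=
  rfl

@[simp] lemma DerivationAlong.precomp_app {V : Y.Opens} (D : DerivationAlong (𝟙 Y) (f ≫ s) V)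
    (U W hV hU) (a : Γ(X, U)) : (D.precomp f s).app U W hV hU a =
      D.act (f ⁻¹ᵁ U) W hV hU (f.app U a) :=
  rfl

/-- `D ↦ f^# ∘ D`, as a homomorphism. -/
noncomputable def postcompHom (U : X.Opens) :
    DerivationAlong (𝟙 X) s U →+ DerivationAlong f s (f ⁻¹ᵁ U) where
  toFun D := D.postcomp f s
  map_zero' := DerivationAlong.ext_app fun U' W hV hU a => by
    simp [DerivationAlong.zero_act]
  map_add' D E := DerivationAlong.ext_app fun U' W hV hU a => by
    simp [DerivationAlong.add_act]

lemma postcompHom_smul (U : X.Opens) (r : Γ(X, U)) (D : DerivationAlong (𝟙 X) s U) :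
    postcompHom f s U (r • D) = f.app U r • postcompHom f s U D := by
  refine DerivationAlong.ext_app fun U' W hV hU a => ?_
  change f.appLE (U ⊓ U') W (le_preimage_inf f hV hU) (X.presheaf.map (homOfLE inf_le_left).op r *
    D.act U' (U ⊓ U') inf_le_left inf_le_right a) = Y.presheaf.map (homOfLE hV).op (f.app U r) *
      f.appLE (U ⊓ U') W (le_preimage_inf f hV hU) (D.act U' (U ⊓ U') inf_le_left inf_le_right a)
  rw [map_mul, map_appLE_apply f _ inf_le_left hV]
  rfl

lemma postcompHom_res {U U' : X.Opens} (i : U' ≤ U) (D : DerivationAlong (𝟙 X) s U) :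
    postcompHom f s U' (DerivationAlong.res i D) =
      DerivationAlong.res (f := f) (V := f ⁻¹ᵁ U) (V' := f ⁻¹ᵁ U') (fun _ h => i h)
        (postcompHom f s U D) := by
  refine DerivationAlong.ext_app fun U₁ W hV hU a => ?_
  change f.appLE (U' ⊓ U₁) W (le_preimage_inf f hV hU) (D.act U₁ (U' ⊓ U₁) _ _ a) =
    f.appLE (U ⊓ U₁) W _ (D.act U₁ (U ⊓ U₁) _ _ a)
  have := D.act_res U₁ U₁ (U ⊓ U₁) (U' ⊓ U₁) inf_le_left
    inf_le_right inf_le_right le_rfl (inf_le_inf_right U₁ i) a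
  rw [map_self] at this
  rw [this, map_appLE_apply]

/-- The map `T_{X/S} → f_* Der_S(f⁻¹ 𝒪_X, 𝒪_Y)`, `D ↦ f^# ∘ D`. -/
noncomputable def tangentToPushforward :
    tangentSheaf s ⟶ (Scheme.Modules.pushforward f).obj (tangentAlong f s) where
  val := PresheafOfModules.homMk
    { app := fun U => AddCommGrpCat.ofHom (postcompHom f s U.unop)
      naturality := fun _ _ i => AddCommGrpCat.hom_ext
        (AddMonoidHom.ext fun D => postcompHom_res f s i.unop.le D) }
    (fun U r D => postcompHom_smul f s U.unop r D)

/-- The canonical map `f^* T_{X/S} → Der_S(f⁻¹ 𝒪_X, 𝒪_Y)`, the `𝒪_Y`-linear map that corresponds to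
`D ↦ f^# ∘ D` under adjunction. It is an isomorphism if `X` is smooth over `S`. -/
noncomputable def pullbackTangentToAlong :
    (Scheme.Modules.pullback f).obj (tangentSheaf s) ⟶ tangentAlong f s :=
  ((Scheme.Modules.pullbackPushforwardAdjunction f).homEquiv _ _).symm (tangentToPushforward f s)

/-- The differential of `f` on logarithmic derivations, `D ↦ D ∘ f^#`. -/
noncomputable def logTangentToAlong (G : Y.Opens) :
    logTangentSheaf (f ≫ s) G ⟶ tangentAlong f s where
  val := (logSubmodule (f ≫ s) G).ι ≫ PresheafOfModules.homMk
    { app := fun V => AddCommGrpCat.ofHom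
        { toFun := fun D => DerivationAlong.precomp f s (V := V.unop) D
          map_zero' := rfl
          map_add' := fun _ _ => rfl }
      naturality := fun _ _ _ => rfl }
    (fun _ _ _ => rfl)

end Sheaves

section TensorPowers

open MonoidalCategory
/-- The functor `M ↦ M^{⊗ d}` on a monoidal category. -/
noncomputable def tensorPowFunctor (C : Type*) [Category* C] [MonoidalCategory C] : ℕ → C ⥤ C
  | 0 => (Functor.const C).obj (𝟙_ C)
  | d + 1 =>
    { obj := fun M => (tensorPowFunctor C d).obj M ⊗ M
      map := fun φ => (tensorPowFunctor C d).map φ ⊗ₘ φ }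

/-- Presheaves of `𝒪_X`-modules, in the form for which Mathlib provides the tensor product. -/
abbrev Psh (X : Scheme.{u}) : Type (u + 1) :=
  PresheafOfModules.{u} (X.presheaf ⋙ forget₂ CommRingCat RingCat)

/-- The pushforward of presheaves of modules along `f : Y ⟶ X`. -/
noncomputable def pushPsh (f : Y ⟶ X) : Psh Y ⥤ Psh X :=
  PresheafOfModules.pushforward (F := Opens.map f.base) (Functor.whiskerRight f.c _)

/-- The map `f^# : 𝒪_X → f_* 𝒪_Y`. -/
noncomputable def pushPshUnit (f : Y ⟶ X) : 𝟙_ (Psh X) ⟶ (pushPsh f).obj (𝟙_ (Psh Y)) :=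
  PresheafOfModules.homMk
    { app := fun U => AddCommGrpCat.ofHom (f.app U.unop).hom.toAddMonoidHom
      naturality := fun _ _ i => AddCommGrpCat.hom_ext
        (AddMonoidHom.ext fun x => congr($(f.naturality i) x)) }
    (fun U r m => map_mul (f.app U.unop).hom r m)

/-- The map `f_* M ⊗ f_* N → f_* (M ⊗ N)` of presheaves, `m ⊗ n ↦ m ⊗ n`. -/
noncomputable def pushPshTensor (f : Y ⟶ X) (M N : Psh Y) :
    (pushPsh f).obj M ⊗ (pushPsh f).obj N ⟶ (pushPsh f).obj (M ⊗ N) where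
  app U := ModuleCat.MonoidalCategory.tensorLift
    (M₃ := (ModuleCat.restrictScalars (f.app U.unop).hom).obj
      (M.obj (op (f ⁻¹ᵁ U.unop)) ⊗ N.obj (op (f ⁻¹ᵁ U.unop))))
    (fun (m : M.obj (op (f ⁻¹ᵁ U.unop))) (n : N.obj (op (f ⁻¹ᵁ U.unop))) =>
      m ⊗ₜ[Γ(Y, f ⁻¹ᵁ U.unop)] n)
    (fun (m m' : M.obj (op (f ⁻¹ᵁ U.unop))) (n : N.obj (op (f ⁻¹ᵁ U.unop))) =>
      TensorProduct.add_tmul m m' n)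
    (fun _ _ _ => rfl)
    (fun (m : M.obj (op (f ⁻¹ᵁ U.unop))) (n n' : N.obj (op (f ⁻¹ᵁ U.unop))) =>
      TensorProduct.tmul_add m n n')
    (fun a (m : M.obj (op (f ⁻¹ᵁ U.unop))) (n : N.obj (op (f ⁻¹ᵁ U.unop))) =>
      TensorProduct.tmul_smul (R := Γ(Y, f ⁻¹ᵁ U.unop)) (f.app U.unop a) m n)
  naturality _ := ModuleCat.MonoidalCategory.tensor_ext fun _ _ => rfl

/-- The map `A^{⊗ d} → f_* (B^{⊗ d})` of presheaves that is induced by a map `φ : A → f_* B`;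
it sends `a₁ ⊗ ⋯ ⊗ a_d` to `φ a₁ ⊗ ⋯ ⊗ φ a_d`. -/
noncomputable def tensorPowPush (f : Y ⟶ X) {A : Psh X} {B : Psh Y} (φ : A ⟶ (pushPsh f).obj B) :
    (d : ℕ) → ((tensorPowFunctor (Psh X) d).obj A ⟶
      (pushPsh f).obj ((tensorPowFunctor (Psh Y) d).obj B))
  | 0 => pushPshUnit f
  | d + 1 => (tensorPowPush f φ d ⊗ₘ φ) ≫ pushPshTensor f _ _

/-- Sheafification of presheaves of `𝒪_X`-modules. -/
noncomputable def sheafificationFunctor (X : Scheme.{u}) : X.PresheafOfModules ⥤ X.Modules :=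
  PresheafOfModules.sheafification (R := X.ringCatSheaf) (𝟙 X.ringCatSheaf.obj)

/-- Sheafification is left adjoint to the forgetful functor. -/
noncomputable def sheafificationAdj (X : Scheme.{u}) :
    sheafificationFunctor X ⊣ Scheme.Modules.toPresheafOfModules X :=
  PresheafOfModules.sheafificationAdjunction (R := X.ringCatSheaf) (𝟙 X.ringCatSheaf.obj)

/-- Sheafification, on `Psh X`. -/
noncomputable def sheafify (X : Scheme.{u}) : Psh X ⥤ X.Modules := sheafificationFunctor X

/-- The underlying presheaf of modules of a sheaf of modules. -/
noncomputable def toPsh (X : Scheme.{u}) : X.Modules ⥤ Psh X :=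
  Scheme.Modules.toPresheafOfModules X

/-- The adjunction of `sheafify X` and `toPsh X`. -/
noncomputable def sheafifyAdj (X : Scheme.{u}) : sheafify X ⊣ toPsh X := sheafificationAdj X

/-- The `d`-th tensor power over `𝒪_X` of a sheaf of modules: the sheafification of the tensor power
of presheaves. -/
noncomputable def tensorPow (X : Scheme.{u}) (d : ℕ) : X.Modules ⥤ X.Modules :=
  toPsh X ⋙ tensorPowFunctor (Psh X) d ⋙ sheafify X

/-- The canonical map `M^{⊗ d} → f_* ((f^* M)^{⊗ d})`. -/
noncomputable def tensorPowComparison (f : Y ⟶ X) (d : ℕ) (M : X.Modules) :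
    (tensorPow X d).obj M ⟶ (Scheme.Modules.pushforward f).obj
      ((tensorPow Y d).obj ((Scheme.Modules.pullback f).obj M)) :=
  ((sheafifyAdj X).homEquiv _ _).symm (tensorPowPush f
      ((toPsh X).map ((Scheme.Modules.pullbackPushforwardAdjunction f).unit.app M)) d ≫
    (pushPsh f).map ((sheafifyAdj Y).unit.app _))

end TensorPowers

section General


/-- The ideal sheaf `J` is invertible: locally it is generated by one nonzerodivisor. -/
def IsInvertibleIdeal (J : Y.IdealSheafData) : Prop :=
  ∀ y : Y, ∃ (U : Y.affineOpens) (g : Γ(Y, U.1)),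
    y ∈ U.1 ∧ g ∈ nonZeroDivisors Γ(Y, U.1) ∧ J.ideal U = Ideal.span {g}

/-- `b : Y ⟶ X` is the blowing-up of `X` in the ideal sheaf `I`: the inverse image ideal sheaf of `I`
on `Y` is invertible, and `b` is universal (terminal) with this property. -/
structure IsBlowUp (b : Y ⟶ X) (I : X.IdealSheafData) : Prop where
  invertible : IsInvertibleIdeal (I.comap b)
  existsUnique_lift : ∀ (T : Scheme.{u}) (f : T ⟶ X), IsInvertibleIdeal (I.comap f) →
    ∃! g : T ⟶ Y, g ≫ b = f

/-- The sheaf of modules `M` is invertible: locally it is free with a basis of one element. -/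
def IsInvertibleModule (M : X.Modules) : Prop :=
  ∀ x : X, ∃ (U : X.Opens) (e : Γ(M, U)), x ∈ U ∧ ∀ (V : X.Opens) (h : V ≤ U),
    Function.Bijective fun r : Γ(X, V) => r • M.presheaf.map (homOfLE h).op e

/-- The sections over `U` of the subsheaf `I · M` of `M`. -/
def idealMulSections (I : X.IdealSheafData) (M : X.Modules) (U : X.Opens) : Set Γ(M, U) :=
  {σ | ∀ x ∈ U, ∃ (V : X.affineOpens) (h : V.1 ≤ U), x ∈ V.1 ∧
    M.presheaf.map (homOfLE h).op σ ∈ (I.ideal V • ⊤ : Submodule Γ(X, V.1) Γ(M, V.1))}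

end General

section Models

variable (p : ℕ) [Fact p.Prime]

attribute [local instance] MvPolynomial.gradedAlgebra

/-- `Spec ℤ_p`. -/
noncomputable abbrev base : Scheme.{0} := Spec (CommRingCat.of ℤ_[p])

/-- The projective line over `ℤ_p`, with homogeneous coordinates `X 0`, `X 1`. -/
noncomputable abbrev projLine : Scheme.{0} :=
  Proj (MvPolynomial.homogeneousSubmodule (Fin 2) ℤ_[p])

/-- The structure morphism of the projective line over `ℤ_p`. -/
noncomputable def projLineStr : projLine p ⟶ base p :=
  Proj.toSpecZero _ ≫ Spec.map (CommRingCat.ofHom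
    (algebraMap ℤ_[p] (MvPolynomial.homogeneousSubmodule (Fin 2) ℤ_[p] 0)))

/-- The two standard affine charts of the projective line. -/
noncomputable def chart (k : Fin 2) : (projLine p).affineOpens :=
  ⟨Proj.basicOpen _ (MvPolynomial.X k), Proj.isAffineOpen_basicOpen _ _
    ((MvPolynomial.mem_homogeneousSubmodule _ _).mpr (MvPolynomial.isHomogeneous_X _ k)) one_pos⟩

/-- The coordinate of the chart `k`: `x = X 1 / X 0` for `k = 0`, and `y = X 0 / X 1` for `k = 1`. -/
noncomputable def coord (k : Fin 2) : Γ(projLine p, (chart p k).1) :=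
  Proj.awayToSection (MvPolynomial.homogeneousSubmodule (Fin 2) ℤ_[p]) (MvPolynomial.X k)
    (HomogeneousLocalization.Away.mk _ (d := 1)
      ((MvPolynomial.mem_homogeneousSubmodule _ _).mpr (MvPolynomial.isHomogeneous_X _ k)) 1
      (MvPolynomial.X (1 - k))
      ((MvPolynomial.mem_homogeneousSubmodule _ _).mpr (MvPolynomial.isHomogeneous_X _ _)))

/-- The ideal `⋂_{a mod p^n} (x - a, p^n)^d` of the ring of functions on a chart with coordinate `x`.
(The ideal `(x - a, p^n)` depends only on the class of `a` modulo `p^n`.) -/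
noncomputable def chartIdeal (n d : ℕ) (k : Fin 2) : Ideal Γ(projLine p, (chart p k).1) :=
  ⨅ a : ZMod (p ^ n), Ideal.span {coord p k - (a.val : Γ(projLine p, (chart p k).1)),
    (p : Γ(projLine p, (chart p k).1)) ^ n} ^ d

/-- The generic fibre, the open complement of the divisor `{p = 0}`. -/
noncomputable def genericFibre {X : Scheme.{0}} (t : X ⟶ base p) : X.Opens :=
  t ⁻¹ᵁ (PrimeSpectrum.basicOpen (p : ℤ_[p]) : (base p).Opens)

/-- `Spec 𝔽_p`. -/
noncomputable abbrev specFp : Scheme.{0} := Spec (CommRingCat.of (ZMod p))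

/-- The closed point `Spec 𝔽_p ⟶ Spec ℤ_p`. -/
noncomputable def closedPoint : specFp p ⟶ base p :=
  Spec.map (CommRingCat.ofHom (PadicInt.toZMod (p := p)))

/-- The special fibre. -/
noncomputable abbrev specialFibre {X : Scheme.{0}} (t : X ⟶ base p) : Scheme.{0} :=
  Limits.pullback t (closedPoint p)

/-- The structure morphism of the special fibre. -/
noncomputable abbrev specialFibreStr {X : Scheme.{0}} (t : X ⟶ base p) :
    specialFibre p t ⟶ specFp p :=
  Limits.pullback.snd t (closedPoint p)

/-- The set of the smooth `𝔽_p`-rational points of the special fibre, as a subset of `X`. -/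
def smoothRationalPoints {X : Scheme.{0}} (t : X ⟶ base p) : Set X :=
  {x | ∃ σ : specFp p ⟶ specialFibre p t, σ ≫ specialFibreStr p t = 𝟙 _ ∧
    (∃ V : (specialFibre p t).Opens, Set.range σ ⊆ V ∧ Smooth (V.ι ≫ specialFibreStr p t)) ∧
    x ∈ Set.range (σ ≫ Limits.pullback.fst t (closedPoint p))}

/-- The ideal sheaf of the closed set of the smooth `𝔽_p`-rational points of the special fibre, with
its reduced structure. -/
noncomputable def centre {X : Scheme.{0}} (t : X ⟶ base p) : X.IdealSheafData :=
  Scheme.IdealSheafData.vanishingIdeal (Closeds.closure (smoothRationalPoints p t))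

/-- `IsModel p n X π` says that `X`, with its projection `π` to `ℙ¹`, is the model `X_n`: `X_0` is the
projective line over `ℤ_p`, and `X_{n+1}` is obtained from `X_n` by blowing up the smooth
`𝔽_p`-rational points of the special fibre of `X_n`. -/
inductive IsModel : ℕ → (X : Scheme.{0}) → (X ⟶ projLine p) → Prop
  | zero : IsModel 0 (projLine p) (𝟙 _)
  | succ {n : ℕ} {X Y : Scheme.{0}} {π : X ⟶ projLine p} (h : IsModel n X π) (b : Y ⟶ X)
      (hb : IsBlowUp b (centre p (π ≫ projLineStr p))) : IsModel (n + 1) Y (b ≫ π)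

end Models

end SemistableModel

open SemistableModel

/-! Write `P(T) = ∏_{0 ≤ b < p} (T - b)`. Above a standard chart of the projective line with
coordinate `x`, the model of level `n` is covered by affine opens of two kinds. A disc chart is an
affine line over `ℤ_p` with coordinate `z` and `x = a + p ^ n z`. A node chart has a level `m < n`
and coordinates `z`, `w` with `x = a + p ^ m z` and `w P(z) = p`, and `1 - w ^ (p - 1)` is
invertible on it. This is an induction on `n` (`IsModel.exists_mem_chart`). On an affine line the
centre is the ideal `(p, P(z))`; where it becomes principal, either `p` divides some `z - c`, which
gives a disc of the next level, or `P(z)` divides `p` with quotient `w`. Rational points of the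
second locus with `w ≠ 0` already lie in discs, and inverting `1 - w ^ (p - 1)` discards them. The
rational points that remain have `w = 0`; they are nodes and not smooth
(`IsNodeCoord.not_mem_smoothRationalPoints`), so all later blow-ups are isomorphisms over a node
chart. The charts of a blow-up come from its universal property (`IsBlowUp.exists_chart`).

The generic point of the projective line lifts uniquely to the model and lies in every nonempty
open, and the charts have domains as rings of functions; hence the model is integral
(`IsModel.isIntegral`). For (b), a function above a basic open is, after multiplication by a power
of the denominator, a polynomial in `x` divided by a power of `p`, as one sees on a disc. On the
node chart of level `0` it is a fraction whose denominator is prime to `p`, so the power of `p`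
cancels (`IsModel.exists_app_eq`).

For (a), derivations along the projection are free on the value at `x`, which identifies them with
the inverse image of the tangent sheaf. On a disc the logarithmic derivations have the basis `d/dz =
p ^ n d/dx`. On a node chart they have the basis `P(z) d/dz`, which equals `p ^ m P(z) d/dx`: since
`w` and the `z - b` divide `p`, a logarithmic derivation must map `z - b` to a multiple of `z - b`,
and conversely the factors of `p` are primes whose ideals this derivation preserves
(`IsCoordChart.hasCoeff`, `isLog_of_prod`). So on each chart the inclusion is multiplication by `g =
p ^ n` or `g = p ^ m P(z)`.

For (c), a section `f (d/dx) ^ d` comes from logarithmic tensors exactly when `g ^ d` divides `f` on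
every chart. Divisibility by `p ^ (n d)` on the discs already forces `f ∈ (x - a, p ^ n) ^ d` for
all `a`, by looking at the coefficients of `f(a + T)`. Conversely, on a node chart `f` lies in `p ^
(m d) (z - j, p) ^ d` for every `j`; these ideals `(z - j, p)` are comaximal, so the intersection of
their `d`-th powers is contained in `(P(z), p) ^ d = (P(z)) ^ d`, because `p = w P(z)`. -/

namespace SemistableModel
universe u
variable {X Y S : Scheme.{u}}

/-! ### Gluing of functions and of sections of sheaves of modules. -/

section LocalSections

/-- Two sections of a sheaf of modules agree if they agree locally. -/
lemma modules_eq_of_local (M : X.Modules) {V : X.Opens} (σ τ : Γ(M, V))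
    (h : ∀ x ∈ V, ∃ (W : X.Opens) (i : W ≤ V), x ∈ W ∧
      M.presheaf.map (homOfLE i).op σ = M.presheaf.map (homOfLE i).op τ) : σ = τ := by
  choose W i hx e using h
  exact TopCat.Sheaf.eq_of_locally_eq' ⟨M.presheaf, M.isSheaf⟩ (fun x : V => W x.1 x.2) V
    (fun x => homOfLE (i x.1 x.2)) (fun x hxV => Opens.mem_iSup.mpr ⟨⟨x, hxV⟩, hx x hxV⟩) σ τ
    (fun x => e x.1 x.2)

/-- Two functions agree if they agree locally. -/
lemma section_eq_of_local {V : X.Opens} (a b : Γ(X, V))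
    (h : ∀ x ∈ V, ∃ (W : X.Opens) (i : W ≤ V), x ∈ W ∧
      X.presheaf.map (homOfLE i).op a = X.presheaf.map (homOfLE i).op b) : a = b := by
  choose W i hx e using h
  exact X.sheaf.eq_of_locally_eq' (fun x : V => W x.1 x.2) V
    (fun x => homOfLE (i x.1 x.2)) (fun x hxV => Opens.mem_iSup.mpr ⟨⟨x, hxV⟩, hx x hxV⟩) a b
    (fun x => e x.1 x.2)

/-- A locally solvable problem whose solutions are unique and stable under restriction is
solvable, for functions. -/
lemma exists_section_of_local {V : X.Opens} (Q : ∀ W : X.Opens, W ≤ V → Γ(X, W) → Prop)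
    (res : ∀ (W W' : X.Opens) (hW : W ≤ V) (h : W' ≤ W) (a : Γ(X, W)), Q W hW a →
      Q W' (h.trans hW) (X.presheaf.map (homOfLE h).op a))
    (uniq : ∀ (W : X.Opens) (hW : W ≤ V) (a b : Γ(X, W)), Q W hW a → Q W hW b → a = b)
    (ex : ∀ x ∈ V, ∃ (W : X.Opens) (hW : W ≤ V) (a : Γ(X, W)), x ∈ W ∧ Q W hW a) :
    ∃ a : Γ(X, V), ∀ x ∈ V, ∃ (W : X.Opens) (hW : W ≤ V), x ∈ W ∧
      Q W hW (X.presheaf.map (homOfLE hW).op a) := by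
  choose W hW a hx hQ using ex
  obtain ⟨b, hb, -⟩ := X.sheaf.existsUnique_gluing' (fun x : V => W x.1 x.2) V
    (fun x => homOfLE (hW x.1 x.2)) (fun x hxV => Opens.mem_iSup.mpr ⟨⟨x, hxV⟩, hx x hxV⟩)
    (fun x => a x.1 x.2) (fun x y => uniq _ (inf_le_left.trans (hW x.1 x.2)) _ _
      (res _ _ _ inf_le_left _ (hQ x.1 x.2)) (res _ _ _ inf_le_right _ (hQ y.1 y.2)))
  refine ⟨b, fun x hxV => ⟨W x hxV, hW x hxV, hx x hxV, ?_⟩⟩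
  have := hb ⟨x, hxV⟩
  change X.presheaf.map _ b = _ at this
  rw [this]
  exact hQ x hxV

lemma modules_map_map (M : X.Modules) {W W' W'' : X.Opens} (h : W' ≤ W) (h' : W'' ≤ W')
    (σ : Γ(M, W)) : M.presheaf.map (homOfLE h').op (M.presheaf.map (homOfLE h).op σ) =
      M.presheaf.map (homOfLE (h'.trans h)).op σ := by
  rw [← ConcreteCategory.comp_apply, ← Functor.map_comp]; rfl

lemma modules_map_self (M : X.Modules) {U : X.Opens} (σ : Γ(M, U)) :
    M.presheaf.map (homOfLE (le_refl U)).op σ = σ := by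
  change M.presheaf.map (𝟙 _) σ = σ
  simp

/-- A locally solvable problem whose solutions are unique and stable under restriction is
solvable, for sections of a sheaf of modules. -/
lemma exists_modules_section_of_local (M : X.Modules) {V : X.Opens}
    (Q : ∀ W : X.Opens, W ≤ V → Γ(M, W) → Prop)
    (res : ∀ (W W' : X.Opens) (hW : W ≤ V) (h : W' ≤ W) (a : Γ(M, W)), Q W hW a →
      Q W' (h.trans hW) (M.presheaf.map (homOfLE h).op a))
    (uniq : ∀ (W : X.Opens) (hW : W ≤ V) (a b : Γ(M, W)), Q W hW a → Q W hW b → a = b)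
    (ex : ∀ x ∈ V, ∃ (W : X.Opens) (hW : W ≤ V) (a : Γ(M, W)), x ∈ W ∧ Q W hW a) :
    ∃ a : Γ(M, V), ∀ x ∈ V, ∃ (W : X.Opens) (hW : W ≤ V), x ∈ W ∧
      Q W hW (M.presheaf.map (homOfLE hW).op a) := by
  choose W hW a hx hQ using ex
  obtain ⟨b, hb, -⟩ := TopCat.Sheaf.existsUnique_gluing' ⟨M.presheaf, M.isSheaf⟩
    (fun x : V => W x.1 x.2) V
    (fun x => homOfLE (hW x.1 x.2)) (fun x hxV => Opens.mem_iSup.mpr ⟨⟨x, hxV⟩, hx x hxV⟩)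
    (fun x => a x.1 x.2) (fun x y => uniq _ (inf_le_left.trans (hW x.1 x.2)) _ _
      (res _ _ _ inf_le_left _ (hQ x.1 x.2)) (res _ _ _ inf_le_right _ (hQ y.1 y.2)))
  refine ⟨b, fun x hxV => ⟨W x hxV, hW x hxV, hx x hxV, ?_⟩⟩
  have := hb ⟨x, hxV⟩
  change M.presheaf.map _ b = _ at this
  rw [this]
  exact hQ x hxV

end LocalSections

/-! ### Local bases of sheaves of modules. -/

section Generators

/-- `e` is a basis of the restriction of `M` to `U`. -/
def IsGen (M : X.Modules) {U : X.Opens} (e : Γ(M, U)) : Prop :=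
  ∀ (V : X.Opens) (h : V ≤ U),
    Function.Bijective fun r : Γ(X, V) => r • M.presheaf.map (homOfLE h).op e

variable {M N : X.Modules} {U : X.Opens}

lemma IsGen.res {e : Γ(M, U)} (he : IsGen M e) {U' : X.Opens} (i : U' ≤ U) :
    IsGen M (M.presheaf.map (homOfLE i).op e) := by
  intro V h
  simpa only [modules_map_map] using he V (h.trans i)

lemma modules_map_smul {V W : X.Opens} (h : W ≤ V) (r : Γ(X, V)) (σ : Γ(M, V)) :
    M.presheaf.map (homOfLE h).op (r • σ) =
      X.presheaf.map (homOfLE h).op r • M.presheaf.map (homOfLE h).op σ :=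
  Scheme.Modules.map_smul M (homOfLE h) r σ

lemma modules_app_map (φ : M ⟶ N) {V W : X.Opens} (h : W ≤ V) (σ : Γ(M, V)) :
    φ.app W (M.presheaf.map (homOfLE h).op σ) = N.presheaf.map (homOfLE h).op (φ.app V σ) :=
  congr($((φ.mapPresheaf).naturality (homOfLE h).op) σ)

/-- A section is a basis as soon as it has no torsion and generates locally. -/
lemma isGen_of_local {e : Γ(M, U)}
    (inj : ∀ (V : X.Opens) (h : V ≤ U) (r : Γ(X, V)),
      r • M.presheaf.map (homOfLE h).op e = 0 → r = 0)
    (surj : ∀ (V : X.Opens) (h : V ≤ U) (σ : Γ(M, V)), ∀ x ∈ V, ∃ (W : X.Opens) (i : W ≤ V)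
      (r : Γ(X, W)), x ∈ W ∧ r • M.presheaf.map (homOfLE (i.trans h)).op e =
        M.presheaf.map (homOfLE i).op σ) : IsGen M e := by
  have inj' : ∀ (V : X.Opens) (h : V ≤ U) (r r' : Γ(X, V)),
      r • M.presheaf.map (homOfLE h).op e = r' • M.presheaf.map (homOfLE h).op e → r = r' := by
    intro V h r r' hr
    exact sub_eq_zero.mp (inj V h _ (by rw [sub_smul, hr, sub_self]))
  intro V h
  refine ⟨fun r r' hr => inj' V h r r' hr, fun σ => ?_⟩
  obtain ⟨a, ha⟩ := exists_section_of_local (V := V)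
    (fun W hW r => r • M.presheaf.map (homOfLE (hW.trans h)).op e =
        M.presheaf.map (homOfLE hW).op σ)
    (by
      intro W W' hW i r hr
      rw [← modules_map_map M hW i, ← hr, modules_map_smul, modules_map_map])
    (by
      intro W hW a b ha hb
      exact inj' W (hW.trans h) _ _ (ha.trans hb.symm))
    (by
      intro x hx
      obtain ⟨W, i, r, hxW, hr⟩ := surj V h σ x hx
      exact ⟨W, i, r, hxW, hr⟩)
  refine ⟨a, modules_eq_of_local M _ _ fun x hx => ?_⟩
  obtain ⟨W, hW, hxW, hr⟩ := ha x hx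
  exact ⟨W, hW, hxW, by rw [← hr, modules_map_smul, modules_map_map]⟩

/-- A morphism that maps bases to bases is an isomorphism. -/
lemma isIso_of_isGen (φ : M ⟶ N) (h : ∀ x : X, ∃ (U : X.Opens) (e : Γ(M, U)), x ∈ U ∧
    IsGen M e ∧ IsGen N (φ.app U e)) : IsIso φ := by
  -- Below an open with a basis, both sides are identified with the functions on `V`, and `φ`
  -- becomes the identity. The global statement then follows by gluing, injectivity providing the
  -- uniqueness.
  have key : ∀ (V U : X.Opens) (hV : V ≤ U) (e : Γ(M, U)), IsGen M e → IsGen N (φ.app U e) →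
      Function.Bijective (φ.app V) := by
    intro V U hV e he hf
    have h1 := he V hV
    have h2 := hf V hV
    have : (fun r : Γ(X, V) => r • N.presheaf.map (homOfLE hV).op (φ.app U e)) =
        φ.app V ∘ fun r : Γ(X, V) => r • M.presheaf.map (homOfLE hV).op e := by
      funext r
      simp only [Function.comp, Scheme.Modules.Hom.app_smul, modules_app_map]
    rw [this] at h2
    exact (Function.Bijective.of_comp_iff _ h1).mp h2
  rw [Scheme.Modules.Hom.isIso_iff_isIso_app]
  intro V
  rw [ConcreteCategory.isIso_iff_bijective]
  have inj : ∀ V : X.Opens, Function.Injective (φ.app V) := by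
    intro V σ τ hστ
    refine modules_eq_of_local M _ _ fun x hx => ?_
    obtain ⟨U, e, hxU, he, hf⟩ := h x
    refine ⟨V ⊓ U, inf_le_left, ⟨hx, hxU⟩, (key (V ⊓ U) U inf_le_right e he hf).1 ?_⟩
    rw [modules_app_map, modules_app_map, hστ]
  refine ⟨inj V, fun σ => ?_⟩
  obtain ⟨a, ha⟩ := exists_modules_section_of_local M (V := V)
    (fun W hW a => φ.app W a = N.presheaf.map (homOfLE hW).op σ)
    (by
      intro W W' hW i r hr
      rw [modules_app_map, hr, modules_map_map])
    (fun W hW a b ha hb => inj W (ha.trans hb.symm))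
    (by
      intro x hx
      obtain ⟨U, e, hxU, he, hf⟩ := h x
      obtain ⟨a, ha⟩ := (key (V ⊓ U) U inf_le_right e he hf).2
        (N.presheaf.map (homOfLE inf_le_left).op σ)
      exact ⟨V ⊓ U, inf_le_left, a, ⟨hx, hxU⟩, ha⟩)
  refine ⟨a, modules_eq_of_local N _ _ fun x hx => ?_⟩
  obtain ⟨W, hW, hxW, hr⟩ := ha x hx
  exact ⟨W, hW, hxW, by rw [← hr, modules_app_map]⟩

lemma IsGen.map_iso {e : Γ(M, U)} (he : IsGen M e) (φ : M ⟶ N) [IsIso φ] :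
    IsGen N (φ.app U e) := by
  intro V hV
  have h2 : Function.Bijective (φ.app V) := (ConcreteCategory.isIso_iff_bijective _).mp
    (Scheme.Modules.Hom.isIso_iff_isIso_app.mp ‹_› V)
  have : (fun r : Γ(X, V) => r • N.presheaf.map (homOfLE hV).op (φ.app U e)) =
      φ.app V ∘ fun r : Γ(X, V) => r • M.presheaf.map (homOfLE hV).op e := by
    funext r
    simp only [Function.comp, Scheme.Modules.Hom.app_smul, modules_app_map]
  rw [this]
  exact h2.comp (he V hV)

end Generators

/-! ### Tensor powers computed on sections. -/

section TensorPowers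
open MonoidalCategory

/-- The sections of a presheaf of modules over an open. -/
abbrev PSec (M : Psh X) (U : X.Opens) : Type u := M.obj (op U)

/-- Restriction of sections of a presheaf of modules. -/
noncomputable def pres (M : Psh X) {U V : X.Opens} (i : V ≤ U) (m : PSec M U) : PSec M V :=
  M.map (homOfLE i).op m

/-- The action of a morphism of presheaves of modules on sections. -/
noncomputable def pmap {M N : Psh X} (φ : M ⟶ N) (U : X.Opens) (m : PSec M U) : PSec N U :=
  φ.app (op U) m

/-- The action of a morphism `A ⟶ f_* B` on sections. -/
noncomputable def pushMap (f : Y ⟶ X) {A : Psh X} {B : Psh Y} (φ : A ⟶ (pushPsh f).obj B)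
    (U : X.Opens) (m : PSec A U) : PSec B (f ⁻¹ᵁ U) :=
  φ.app (op U) m

/-- `m ⊗ ⋯ ⊗ m`, with `d` factors. -/
noncomputable def tpow (M : Psh X) {U : X.Opens} (m : PSec M U) :
    (d : ℕ) → PSec ((tensorPowFunctor (Psh X) d).obj M) U
  | 0 => (1 : Γ(X, U))
  | d + 1 => TensorProduct.tmul Γ(X, U) (tpow M m d) m

lemma tpow_succ (M : Psh X) {U : X.Opens} (m : PSec M U) (d : ℕ) :
    tpow M m (d + 1) = TensorProduct.tmul Γ(X, U) (tpow M m d) m := rfl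

lemma tpow_res {M : Psh X} {U V : X.Opens} (i : V ≤ U) (m : PSec M U) (d : ℕ) :
    pres _ i (tpow M m d) = tpow M (pres M i m) d := by
  induction d with
  | zero => exact map_one (X.presheaf.map (homOfLE i).op).hom
  | succ d ih =>
    rw [tpow_succ, tpow_succ, ← ih]
    rfl

lemma tpow_map {M N : Psh X} (φ : M ⟶ N) {U : X.Opens} (m : PSec M U) (d : ℕ) :
    pmap ((tensorPowFunctor (Psh X) d).map φ) U (tpow M m d) = tpow N (pmap φ U m) d := by
  induction d with
  | zero => rfl
  | succ d ih =>
    rw [tpow_succ, tpow_succ, ← ih]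
    rfl

lemma tpow_push (f : Y ⟶ X) {A : Psh X} {B : Psh Y} (φ : A ⟶ (pushPsh f).obj B) {U : X.Opens}
    (m : PSec A U) (d : ℕ) :
    pushMap f (tensorPowPush f φ d) U (tpow A m d) = tpow B (pushMap f φ U m) d := by
  induction d with
  | zero => exact map_one (f.app U).hom
  | succ d ih =>
    rw [tpow_succ, tpow_succ, ← ih]
    rfl

lemma tpow_smul {M : Psh X} {U : X.Opens} (g : Γ(X, U)) (m : PSec M U) (d : ℕ) :
    tpow M (g • m) d = g ^ d • tpow M m d := by
  induction d with
  | zero =>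
    rw [pow_zero, one_smul]
    rfl
  | succ d ih =>
    rw [tpow_succ, tpow_succ, ih, pow_succ]
    exact TensorProduct.smul_tmul_smul _ _ _ _

/-- Free modules of rank one with bases `t` and `m` have a tensor product that is free on `t ⊗ m`;
the induction composes `R ≅ R ⊗ R` with the two given isomorphisms. -/
lemma tpow_bijective {M : Psh X} {U : X.Opens} (m : PSec M U)
    (h : Function.Bijective fun r : Γ(X, U) => r • m) (d : ℕ) :
    Function.Bijective fun r : Γ(X, U) => r • tpow M m d := by
  induction d with
  | zero =>
    have : (fun r : Γ(X, U) => r • tpow M m 0) = (fun r => r) :=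
      funext fun r => mul_one (r : Γ(X, U))
    rw [this]
    exact Function.bijective_id
  | succ d ih =>
    let R := Γ(X, U)
    let e₁ := LinearEquiv.ofBijective
      (LinearMap.toSpanSingleton R (PSec ((tensorPowFunctor (Psh X) d).obj M) U) (tpow M m d)) ih
    let e₂ := LinearEquiv.ofBijective (LinearMap.toSpanSingleton R (PSec M U) m) h
    let e := (TensorProduct.rid R R).symm.trans (TensorProduct.congr e₁ e₂)
    have : (fun r : Γ(X, U) => r • tpow M m (d + 1)) = e := by
      funext r
      change _ = TensorProduct.tmul R (r • tpow M m d) ((1 : R) • m)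
      rw [one_smul]
      rfl
    rw [this]
    exact e.bijective

/-- The unit `N ⟶ N⁺` of sheafification, on sections. -/
noncomputable def shUnit (N : Psh X) (U : X.Opens) (n : PSec N U) : Γ((sheafify X).obj N, U) :=
  pmap ((sheafifyAdj X).unit.app N) U n

lemma shUnit_res (N : Psh X) {U V : X.Opens} (i : V ≤ U) (n : PSec N U) :
    ((sheafify X).obj N).presheaf.map (homOfLE i).op (shUnit N U n) = shUnit N V (pres N i n) :=
  (PresheafOfModules.naturality_apply ((sheafifyAdj X).unit.app N) (homOfLE i).op n).symm

lemma shUnit_smul (N : Psh X) {U : X.Opens} (r : Γ(X, U)) (n : PSec N U) :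
    shUnit N U (r • n) = r • shUnit N U n :=
  (((sheafifyAdj X).unit.app N).app (op U)).hom.map_smul r n

lemma shUnit_zero (N : Psh X) (U : X.Opens) : shUnit N U 0 = 0 :=
  (((sheafifyAdj X).unit.app N).app (op U)).hom.map_zero

/-- Sheafification is controlled on sections by this property and `shUnit_locally_surjective`: they
suffice to carry bases of presheaves over to their sheafifications. -/
lemma shUnit_locally_injective (N : Psh X) {U : X.Opens} (n n' : PSec N U)
    (h : shUnit N U n = shUnit N U n') (x : X) (hx : x ∈ U) :
    ∃ (V : X.Opens) (i : V ≤ U), x ∈ V ∧ pres N i n = pres N i n' := by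
  have := Presheaf.equalizerSieve_mem (Opens.grothendieckTopology X)
    (CategoryTheory.toSheafify (Opens.grothendieckTopology X) N.presheaf) (X := op U) n n' h x hx
  obtain ⟨V, i, hi, hxV⟩ := this
  exact ⟨V, i.le, hxV, hi⟩

lemma shUnit_locally_surjective (N : Psh X) {U : X.Opens} (σ : Γ((sheafify X).obj N, U)) (x : X)
    (hx : x ∈ U) : ∃ (V : X.Opens) (i : V ≤ U) (n : PSec N V), x ∈ V ∧
      shUnit N V n = ((sheafify X).obj N).presheaf.map (homOfLE i).op σ := by
  have := Presheaf.imageSieve_mem (Opens.grothendieckTopology X)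
    (CategoryTheory.toSheafify (Opens.grothendieckTopology X) N.presheaf) (U := op U) σ x hx
  obtain ⟨V, i, ⟨n, hn⟩, hxV⟩ := this
  exact ⟨V, i.le, n, hxV, hn⟩

/-- A section of a presheaf that is a basis gives a basis of the sheafification. -/
lemma isGen_shUnit (N : Psh X) {U : X.Opens} (n : PSec N U)
    (h : ∀ (V : X.Opens) (i : V ≤ U), Function.Bijective fun r : Γ(X, V) => r • pres N i n) :
    IsGen ((sheafify X).obj N) (shUnit N U n) := by
  have hp : ∀ {V W : X.Opens} (hV : V ≤ U) (i : W ≤ V) (r : Γ(X, V)),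
      pres N i (r • pres N hV n) = X.presheaf.map (homOfLE i).op r • pres N (i.trans hV) n := by
    intro V W hV i r
    have h1 := N.map_smul (homOfLE i).op r (pres N hV n)
    have h2 : pres N i (pres N hV n) = pres N (i.trans hV) n :=
      (PresheafOfModules.map_comp_apply N (homOfLE hV).op (homOfLE i).op n).symm
    rw [← h2]
    exact h1
  apply isGen_of_local
  · intro V hV r hr
    rw [shUnit_res, ← shUnit_smul, ← shUnit_zero] at hr
    refine section_eq_of_local _ _ fun x hx => ?_
    obtain ⟨W, i, hxW, e⟩ := shUnit_locally_injective N _ _ hr x hx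
    refine ⟨W, i, hxW, (h W (i.trans hV)).1 ?_⟩
    rw [hp] at e
    change _ • _ = _ • _
    rw [e, map_zero, zero_smul]
    exact (N.map (homOfLE i).op).hom.map_zero
  · intro V hV σ x hx
    obtain ⟨W, i, m, hxW, e⟩ := shUnit_locally_surjective N σ x hx
    obtain ⟨r, hr⟩ := (h W (i.trans hV)).2 m
    refine ⟨W, i, r, hxW, ?_⟩
    rw [← e, ← hr, shUnit_res, ← shUnit_smul]

/-- A section of a sheaf of modules as a section of the underlying presheaf. -/
noncomputable def toPSec {M : X.Modules} {U : X.Opens} (m : Γ(M, U)) : PSec ((toPsh X).obj M) U := m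

/-- The section `m ⊗ ⋯ ⊗ m` of the tensor power of a sheaf of modules. -/
noncomputable def secPow (d : ℕ) {M : X.Modules} {U : X.Opens} (m : Γ(M, U)) :
    Γ((tensorPow X d).obj M, U) :=
  shUnit _ U (tpow ((toPsh X).obj M) (toPSec m) d)

variable {M N : X.Modules} {U : X.Opens} (d : ℕ)

lemma secPow_res {V : X.Opens} (i : V ≤ U) (m : Γ(M, U)) :
    ((tensorPow X d).obj M).presheaf.map (homOfLE i).op (secPow d m) =
      secPow d (M.presheaf.map (homOfLE i).op m) :=
  (shUnit_res _ i _).trans (congrArg (shUnit _ V) (tpow_res i (toPSec m) d))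

lemma secPow_smul (g : Γ(X, U)) (m : Γ(M, U)) : secPow d (g • m) = g ^ d • secPow d m :=
  (congrArg (shUnit _ U) (tpow_smul (M := (toPsh X).obj M) g (toPSec m) d)).trans
    (shUnit_smul _ _ _)

lemma secPow_app (φ : M ⟶ N) (m : Γ(M, U)) :
    ((tensorPow X d).map φ).app U (secPow d m) = secPow d (φ.app U m) := by
  have h := (sheafifyAdj X).unit.naturality ((tensorPowFunctor (Psh X) d).map ((toPsh X).map φ))
  have h2 := congr($(h).app (op U) (tpow ((toPsh X).obj M) (toPSec m) d))
  exact h2.symm.trans (congrArg (shUnit _ U) (tpow_map ((toPsh X).map φ) (toPSec m) d))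

lemma IsGen.secPow {e : Γ(M, U)} (he : IsGen M e) : IsGen _ (secPow d e) := by
  refine isGen_shUnit _ _ fun V i => ?_
  have := tpow_bijective (M := (toPsh X).obj M) (pres _ i (toPSec e)) (he V i) d
  rwa [← tpow_res] at this

/-- The comparison map is defined through an adjunction; composition with the unit of sheafification
gives back the explicit map `tensorPowPush`, which can be evaluated on a pure power. Thus bases can
be followed through it. -/
lemma tensorPowComparison_secPow (f : Y ⟶ X) (m : Γ(M, U)) :
    (tensorPowComparison f d M).app U (secPow d m) =
      secPow d (U := f ⁻¹ᵁ U)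
        (((Scheme.Modules.pullbackPushforwardAdjunction f).unit.app M).app U m) := by
  let ψ := tensorPowPush f
      ((toPsh X).map ((Scheme.Modules.pullbackPushforwardAdjunction f).unit.app M)) d ≫
    (pushPsh f).map ((sheafifyAdj Y).unit.app _)
  have h : (sheafifyAdj X).unit.app _ ≫ (toPsh X).map (tensorPowComparison f d M) = ψ := by
    have := (sheafifyAdj X).homEquiv_unit (f := tensorPowComparison f d M)
    rw [← this]
    exact Equiv.apply_symm_apply _ _
  have h2 := congr($(h).app (op U) (tpow ((toPsh X).obj M) (toPSec m) d))
  exact h2.trans (congrArg (shUnit _ (f ⁻¹ᵁ U)) (tpow_push f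
    ((toPsh X).map ((Scheme.Modules.pullbackPushforwardAdjunction f).unit.app M)) (toPSec m) d))

end TensorPowers

/-! ### Inverse images of sheaves of modules described by local bases. -/

section PullbackGenerators

variable (f : Y ⟶ X) {M : X.Modules} {N Q : Y.Modules}

/-- The action of a morphism `M ⟶ f_* N` on sections. -/
noncomputable def pushSec (φ : M ⟶ (Scheme.Modules.pushforward f).obj N) (U : X.Opens)
    (m : Γ(M, U)) : Γ(N, f ⁻¹ᵁ U) := φ.app U m

variable {f}

lemma pushSec_res (φ : M ⟶ (Scheme.Modules.pushforward f).obj N) {U V : X.Opens} (i : V ≤ U)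
    (m : Γ(M, U)) : pushSec f φ V (M.presheaf.map (homOfLE i).op m) =
      N.presheaf.map (homOfLE (show f ⁻¹ᵁ V ≤ f ⁻¹ᵁ U from fun _ h => i h)).op (pushSec f φ U m) :=
  modules_app_map φ i m

lemma pushSec_smul (φ : M ⟶ (Scheme.Modules.pushforward f).obj N) {U : X.Opens} (r : Γ(X, U))
    (m : Γ(M, U)) : pushSec f φ U (r • m) = f.app U r • pushSec f φ U m :=
  Scheme.Modules.Hom.app_smul φ r m

/-- `φ : M ⟶ f_* N` maps a basis of `M` on `U` to a basis of `N` on `f⁻¹ U`. -/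
def MapsGen (φ : M ⟶ (Scheme.Modules.pushforward f).obj N) (U : X.Opens) (e : Γ(M, U)) : Prop :=
  IsGen M e ∧ IsGen N (pushSec f φ U e)

/-- `q` is the image of `n` under the map `N ⟶ Q` that is induced by `α : M ⟶ f_* Q`. -/
def IsImage (φ : M ⟶ (Scheme.Modules.pushforward f).obj N)
    (α : M ⟶ (Scheme.Modules.pushforward f).obj Q) {V : Y.Opens} (n : Γ(N, V)) (q : Γ(Q, V)) :
    Prop :=
  ∀ (U : X.Opens) (e : Γ(M, U)), MapsGen φ U e → ∀ (W : Y.Opens) (hV : W ≤ V) (hU : W ≤ f ⁻¹ᵁ U)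
    (r : Γ(Y, W)), N.presheaf.map (homOfLE hV).op n =
      r • N.presheaf.map (homOfLE hU).op (pushSec f φ U e) →
    Q.presheaf.map (homOfLE hV).op q = r • Q.presheaf.map (homOfLE hU).op (pushSec f α U e)

variable (φ : M ⟶ (Scheme.Modules.pushforward f).obj N)
    (α : M ⟶ (Scheme.Modules.pushforward f).obj Q)

lemma IsImage.res {V V' : Y.Opens} (i : V' ≤ V) {n : Γ(N, V)} {q : Γ(Q, V)}
    (h : IsImage φ α n q) : IsImage φ α (N.presheaf.map (homOfLE i).op n)
      (Q.presheaf.map (homOfLE i).op q) := by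
  intro U e he W hV hU r hr
  rw [modules_map_map] at hr ⊢
  exact h U e he W (hV.trans i) hU r hr

/-- The prescription does not depend on the basis used: the function that expresses `e` in another
basis `e'` pulls back to the same factor in `N` and in `Q`. -/
lemma isImage_of_eq {U : X.Opens} {e : Γ(M, U)} {V : Y.Opens}
    (hU : V ≤ f ⁻¹ᵁ U) (r : Γ(Y, V)) :
    IsImage φ α (r • N.presheaf.map (homOfLE hU).op (pushSec f φ U e))
      (r • Q.presheaf.map (homOfLE hU).op (pushSec f α U e)) := by
  intro U' e' he' W hV hU' r' hr
  obtain ⟨c, hc⟩ := (he'.1 (U ⊓ U') inf_le_right).2 (M.presheaf.map (homOfLE inf_le_left).op e)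
  have hW : W ≤ f ⁻¹ᵁ (U ⊓ U') := le_preimage_inf f (hV.trans hU) hU'
  have key : ∀ {P : Y.Modules} (β : M ⟶ (Scheme.Modules.pushforward f).obj P),
      P.presheaf.map (homOfLE (hV.trans hU)).op (pushSec f β U e) =
        f.appLE (U ⊓ U') W hW c • P.presheaf.map (homOfLE hU').op (pushSec f β U' e') := by
    intro P β
    have h := congrArg (fun m => P.presheaf.map (homOfLE hW).op (pushSec f β _ m)) hc
    simp only [pushSec_smul, pushSec_res, modules_map_smul, modules_map_map] at h
    exact h.symm
  simp only [modules_map_smul, modules_map_map, key, smul_smul] at hr ⊢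
  rw [(he'.2 W hU').1 hr]

lemma IsImage.add {V : Y.Opens} {n n' : Γ(N, V)} {q q' : Γ(Q, V)} (h : IsImage φ α n q)
    (h' : IsImage φ α n' q') : IsImage φ α (n + n') (q + q') := by
  intro U e he W hV hU r hr
  obtain ⟨s, hs⟩ := (he.2 W hU).2 (N.presheaf.map (homOfLE hV).op n)
  obtain ⟨s', hs'⟩ := (he.2 W hU).2 (N.presheaf.map (homOfLE hV).op n')
  dsimp only at hs hs'
  rw [map_add, ← hs, ← hs', ← add_smul] at hr
  rw [map_add, h U e he W hV hU s hs.symm, h' U e he W hV hU s' hs'.symm,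
    ← add_smul, (he.2 W hU).1 hr]

lemma IsImage.smul {V : Y.Opens} (r : Γ(Y, V)) {n : Γ(N, V)} {q : Γ(Q, V)}
    (h : IsImage φ α n q) : IsImage φ α (r • n) (r • q) := by
  intro U e he W hV hU s hs
  obtain ⟨t, ht⟩ := (he.2 W hU).2 (N.presheaf.map (homOfLE hV).op n)
  dsimp only at ht
  rw [modules_map_smul, ← ht, smul_smul] at hs
  rw [modules_map_smul, h U e he W hV hU t ht.symm, smul_smul, (he.2 W hU).1 hs]

variable (hφ : ∀ x : X, ∃ (U : X.Opens) (e : Γ(M, U)), x ∈ U ∧ MapsGen φ U e)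

include hφ in
lemma isImage_unique {V : Y.Opens} {n : Γ(N, V)} {q q' : Γ(Q, V)} (h : IsImage φ α n q)
    (h' : IsImage φ α n q') : q = q' := by
  refine modules_eq_of_local Q _ _ fun y hy => ?_
  obtain ⟨U, e, hxU, he⟩ := hφ (f y)
  obtain ⟨r, hr⟩ := (he.2 (V ⊓ f ⁻¹ᵁ U) inf_le_right).2 (N.presheaf.map (homOfLE inf_le_left).op n)
  exact ⟨V ⊓ f ⁻¹ᵁ U, inf_le_left, ⟨hy, hxU⟩, (h U e he _ _ _ r hr.symm).trans
    (h' U e he _ _ _ r hr.symm).symm⟩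

include hφ in
lemma exists_isImage {V : Y.Opens} (n : Γ(N, V)) : ∃ q : Γ(Q, V), IsImage φ α n q := by
  obtain ⟨q, hq⟩ := exists_modules_section_of_local Q (V := V)
    (fun W hW q => IsImage φ α (N.presheaf.map (homOfLE hW).op n) q)
    (fun W W' hW i a ha => modules_map_map N hW i n ▸ ha.res φ α i)
    (fun W hW a b ha hb => isImage_unique φ α hφ ha hb)
    (fun y hy => by
      obtain ⟨U, e, hxU, he⟩ := hφ (f y)
      obtain ⟨r, hr⟩ := (he.2 (V ⊓ f ⁻¹ᵁ U) inf_le_right).2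
        (N.presheaf.map (homOfLE inf_le_left).op n)
      have := isImage_of_eq φ α (e := e) inf_le_right r
      dsimp only at hr
      rw [hr] at this
      exact ⟨V ⊓ f ⁻¹ᵁ U, inf_le_left, _, ⟨hy, hxU⟩, this⟩)
  refine ⟨q, fun U e he W hV hU r hr => modules_eq_of_local Q _ _ fun y hy => ?_⟩
  obtain ⟨W', hW', hyW', h⟩ := hq y (hV hy)
  refine ⟨W ⊓ W', inf_le_left, ⟨hy, hyW'⟩, ?_⟩
  have h2 := h U e he (W ⊓ W') inf_le_right (inf_le_left.trans hU)
    (Y.presheaf.map (homOfLE inf_le_left).op r) (by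
      rw [modules_map_map, ← modules_map_map N hV inf_le_left, hr, modules_map_smul,
        modules_map_map])
  rw [modules_map_map] at h2
  rw [modules_map_map, h2, modules_map_smul, modules_map_map]

include hφ in
/-- A map `φ : M ⟶ f_* N` that locally maps bases to bases has the universal property of `f^* M`. -/
lemma exists_factor_pushforward :
    ∃ β : N ⟶ Q, φ ≫ (Scheme.Modules.pushforward f).map β = α := by
  choose b hb using fun (V : Y.Opens) (n : Γ(N, V)) => exists_isImage φ α hφ n
  have uniq : ∀ {V : Y.Opens} {n : Γ(N, V)} {q : Γ(Q, V)}, IsImage φ α n q → b V n = q :=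
    fun h => isImage_unique φ α hφ (hb _ _) h
  let β : N ⟶ Q := ⟨PresheafOfModules.homMk
    { app := fun V => AddCommGrpCat.ofHom (AddMonoidHom.mk' (b V.unop)
        (fun n n' => uniq ((hb _ n).add φ α (hb _ n'))))
      naturality := fun V V' i => AddCommGrpCat.hom_ext (AddMonoidHom.ext fun n =>
        uniq ((hb V.unop n).res φ α i.unop.le)) }
    (fun V r n => uniq ((hb V.unop n).smul φ α r))⟩
  refine ⟨β, ?_⟩
  ext U m
  change b (f ⁻¹ᵁ U) (pushSec f φ U m) = pushSec f α U m
  refine uniq ?_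
  intro U' e he W hV hU r hr
  obtain ⟨c, hc⟩ := (he.1 (U ⊓ U') inf_le_right).2 (M.presheaf.map (homOfLE inf_le_left).op m)
  have hW : W ≤ f ⁻¹ᵁ (U ⊓ U') := le_preimage_inf f hV hU
  have key : ∀ {P : Y.Modules} (β : M ⟶ (Scheme.Modules.pushforward f).obj P),
      P.presheaf.map (homOfLE hV).op (pushSec f β U m) =
        f.appLE (U ⊓ U') W hW c • P.presheaf.map (homOfLE hU).op (pushSec f β U' e) := by
    intro P β
    have h := congrArg (fun m => P.presheaf.map (homOfLE hW).op (pushSec f β _ m)) hc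
    simp only [pushSec_smul, pushSec_res, modules_map_smul, modules_map_map] at h
    exact h.symm
  rw [key] at hr ⊢
  rw [(he.2 W hU).1 hr]

include hφ in
lemma factor_pushforward_unique {β β' : N ⟶ Q} (h : φ ≫ (Scheme.Modules.pushforward f).map β =
    φ ≫ (Scheme.Modules.pushforward f).map β') : β = β' := by
  ext V n
  refine modules_eq_of_local Q _ _ fun y hy => ?_
  obtain ⟨U, e, hxU, he⟩ := hφ (f y)
  obtain ⟨r, hr⟩ := (he.2 (V ⊓ f ⁻¹ᵁ U) inf_le_right).2 (N.presheaf.map (homOfLE inf_le_left).op n)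
  refine ⟨V ⊓ f ⁻¹ᵁ U, inf_le_left, ⟨hy, hxU⟩, ?_⟩
  have h2 : β.app (f ⁻¹ᵁ U) (pushSec f φ U e) = β'.app (f ⁻¹ᵁ U) (pushSec f φ U e) :=
    congr(($h).app U e)
  rw [← modules_app_map, ← modules_app_map, ← hr, Scheme.Modules.Hom.app_smul,
    Scheme.Modules.Hom.app_smul, modules_app_map, modules_app_map, h2]

include hφ in
/-- If `φ : M ⟶ f_* N` locally maps bases to bases, then the adjoint map `f^* M ⟶ N` is an
isomorphism. -/
lemma isIso_homEquiv_symm :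
    IsIso (((Scheme.Modules.pullbackPushforwardAdjunction f).homEquiv _ _).symm φ) := by
  let adj := Scheme.Modules.pullbackPushforwardAdjunction f
  let ψ := (adj.homEquiv M N).symm φ
  have hψ : adj.unit.app M ≫ (Scheme.Modules.pushforward f).map ψ = φ := by
    exact (adj.homEquiv_unit (f := ψ)).symm.trans (Equiv.apply_symm_apply _ _)
  -- The inverse map comes from the universal property of `φ`, applied to the unit of the
  -- adjunction.
  obtain ⟨β, hβ⟩ := exists_factor_pushforward φ (adj.unit.app M) hφ
  refine ⟨β, ?_, ?_⟩
  · have h : adj.unit.app M ≫ (Scheme.Modules.pushforward f).map (ψ ≫ β) =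
        adj.unit.app M ≫ (Scheme.Modules.pushforward f).map (𝟙 _) := by
      rw [Functor.map_comp, reassoc_of% hψ, hβ, CategoryTheory.Functor.map_id]
      exact (Category.comp_id _).symm
    exact (adj.homEquiv M _).injective (by rw [adj.homEquiv_unit, adj.homEquiv_unit]; exact h)
  · apply factor_pushforward_unique φ hφ
    rw [Functor.map_comp, CategoryTheory.Functor.map_id, Category.comp_id, reassoc_of% hβ]
    exact hψ

/-- The section of `f^* M` over `f⁻¹ U` that is defined by a section of `M` over `U`. -/
noncomputable def pullSec (f : Y ⟶ X) {M : X.Modules} {U : X.Opens} (e : Γ(M, U)) :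
    Γ((Scheme.Modules.pullback f).obj M, f ⁻¹ᵁ U) :=
  pushSec f ((Scheme.Modules.pullbackPushforwardAdjunction f).unit.app M) U e

end PullbackGenerators

/-! ### Direct images of tensor powers described by coefficients. -/

section Comparison

variable {π : Y ⟶ X} {M : X.Modules} {L : Y.Modules}

lemma mono_of_injective_app {N N' : X.Modules} (φ : N ⟶ N')
    (h : ∀ U, Function.Injective (φ.app U)) : Mono φ := by
  refine ⟨fun α β hαβ => ?_⟩
  ext U σ
  exact h U congr(($hαβ).app U σ)

lemma isGen_pushforward (hπ : ∀ U : X.Opens, Function.Bijective (π.app U)) {N : Y.Modules}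
    {U : X.Opens} (e : Γ(N, π ⁻¹ᵁ U)) (he : IsGen N e) :
    IsGen ((Scheme.Modules.pushforward π).obj N) (U := U) e := by
  intro V hV
  have := (he (π ⁻¹ᵁ V) (fun _ h => hV h)).comp (hπ V)
  exact this

variable (d : ℕ) (i : L ⟶ (Scheme.Modules.pullback π).obj M)

/-- `g` describes the map `i : L ⟶ π^* M` over `V ⊆ π⁻¹ U`, with respect to a basis of `L` and to
the basis of `π^* M` that comes from the section `e` of `M`. -/
def HasCoeff {U : X.Opens} (e : Γ(M, U)) (V : Y.Opens) (g : Γ(Y, V)) : Prop :=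
  ∃ (hV : V ≤ π ⁻¹ᵁ U) (l : Γ(L, V)), IsGen L l ∧
    i.app V l = g • ((Scheme.Modules.pullback π).obj M).presheaf.map (homOfLE hV).op (pullSec π e) ∧
    ∀ (W : Y.Opens) (hW : W ≤ V) (r : Γ(Y, W)), Y.presheaf.map (homOfLE hW).op g * r = 0 → r = 0

variable {d i}

lemma HasCoeff.tensorPow_map {U : X.Opens} {e : Γ(M, U)} {V : Y.Opens} {g : Γ(Y, V)}
    (h : HasCoeff i e V g) : ∃ (hV : V ≤ π ⁻¹ᵁ U) (l : Γ((tensorPow Y d).obj L, V)), IsGen _ l ∧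
      ∀ (W : Y.Opens) (hW : W ≤ V) (c : Γ(Y, W)), ((tensorPow Y d).map i).app W
        (c • ((tensorPow Y d).obj L).presheaf.map (homOfLE hW).op l) =
      (Y.presheaf.map (homOfLE hW).op g ^ d * c) •
        ((tensorPow Y d).obj ((Scheme.Modules.pullback π).obj M)).presheaf.map
          (homOfLE (hW.trans hV)).op (secPow d (pullSec π e)) := by
  obtain ⟨hV, l, hl, hg, -⟩ := h
  refine ⟨hV, secPow d l, hl.secPow d, fun W hW c => ?_⟩
  rw [Scheme.Modules.Hom.app_smul, modules_app_map, secPow_app, hg, secPow_smul, modules_map_smul,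
    smul_smul, map_pow, mul_comm, ← secPow_res, modules_map_map]

lemma HasCoeff.pow_mul_eq_zero {U : X.Opens} {e : Γ(M, U)} {V : Y.Opens} {g : Γ(Y, V)}
    (h : HasCoeff i e V g) {W : Y.Opens} (hW : W ≤ V) (r : Γ(Y, W)) (d : ℕ)
    (hr : Y.presheaf.map (homOfLE hW).op g ^ d * r = 0) : r = 0 := by
  obtain ⟨-, -, -, -, hg⟩ := h
  induction d with
  | zero => simpa using hr
  | succ d ih =>
    rw [pow_succ', mul_assoc] at hr
    exact ih (hg W hW _ hr)

variable (d i)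

lemma tensorPow_map_injective (hcov : ∀ y : Y, ∃ (U : X.Opens) (e : Γ(M, U)) (V : Y.Opens)
      (g : Γ(Y, V)), y ∈ V ∧ IsGen _ (pullSec π e) ∧ HasCoeff i e V g) (O : Y.Opens) :
    Function.Injective (((tensorPow Y d).map i).app O) := by
  rw [injective_iff_map_eq_zero]
  intro σ hσ
  refine modules_eq_of_local _ _ _ fun y hy => ?_
  obtain ⟨U, e, V, g, hyV, he, hg⟩ := hcov y
  obtain ⟨hV, l, hl, h⟩ := hg.tensorPow_map (d := d)
  refine ⟨O ⊓ V, inf_le_left, ⟨hy, hyV⟩, ?_⟩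
  obtain ⟨c, hc⟩ := (hl (O ⊓ V) inf_le_right).2
    (((tensorPow Y d).obj L).presheaf.map (homOfLE inf_le_left).op σ)
  dsimp only at hc
  have h2 := h (O ⊓ V) inf_le_right c
  rw [hc, modules_app_map, hσ, map_zero] at h2
  have h3 := ((he.secPow d) (O ⊓ V) (inf_le_right.trans hV)).1
    (a₁ := Y.presheaf.map (homOfLE inf_le_right).op g ^ d * c) (a₂ := 0)
    (h2.symm.trans (zero_smul _ _).symm)
  rw [← hc, hg.pow_mul_eq_zero inf_le_right c d h3, zero_smul, map_zero]

lemma isIso_tensorPowComparison (hπ : ∀ U : X.Opens, Function.Bijective (π.app U))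
    (hcov : ∀ x : X, ∃ (U : X.Opens) (e : Γ(M, U)), x ∈ U ∧ IsGen M e ∧ IsGen _ (pullSec π e)) :
    IsIso (tensorPowComparison π d M) := by
  refine isIso_of_isGen _ fun x => ?_
  obtain ⟨U, e, hxU, he, he'⟩ := hcov x
  refine ⟨U, secPow d e, hxU, he.secPow d, ?_⟩
  rw [tensorPowComparison_secPow]
  exact isGen_pushforward hπ _ (he'.secPow d)

lemma mem_smul_top_iff (I : X.IdealSheafData) {N : X.Modules} {V : X.affineOpens} {e : Γ(N, V.1)}
    (he : IsGen N e) (r : Γ(X, V.1)) :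
    r • e ∈ (I.ideal V • ⊤ : Submodule Γ(X, V.1) Γ(N, V.1)) ↔ r ∈ I.ideal V := by
  have hb := he V.1 le_rfl
  simp only [modules_map_self] at hb
  refine ⟨fun h => ?_, fun h => Submodule.smul_mem_smul h trivial⟩
  have : ∀ m ∈ (I.ideal V • ⊤ : Submodule Γ(X, V.1) Γ(N, V.1)), ∃ a ∈ I.ideal V, m = a • e := by
    intro m hm
    refine Submodule.smul_induction_on hm (fun a ha n hn => ?_) fun x y hx hy => ?_
    · obtain ⟨s, rfl⟩ := hb.2 n
      exact ⟨a * s, Ideal.mul_mem_right _ _ ha, smul_smul _ _ _⟩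
    · obtain ⟨a, ha, rfl⟩ := hx
      obtain ⟨b, hb, rfl⟩ := hy
      exact ⟨a + b, add_mem ha hb, (add_smul _ _ _).symm⟩
  obtain ⟨a, ha, h2⟩ := this _ h
  rwa [hb.1 h2]

variable {d i}

/-- The description of `π_* (L^{⊗ d})` inside `π_* (π^* M)^{⊗ d}`, from local data. -/
lemma range_tensorPow_map (hπ : ∀ U : X.Opens, Function.Bijective (π.app U))
    (I : X.IdealSheafData)
    (hloc : ∀ x : X, ∃ (U : X.Opens) (e : Γ(M, U)) (G : ∀ V : Y.Opens, Γ(Y, V) → Prop),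
      x ∈ U ∧ IsGen M e ∧ IsGen _ (pullSec π e) ∧ (∀ V g, G V g → HasCoeff i e V g) ∧
      (∀ y ∈ π ⁻¹ᵁ U, ∃ V g, G V g ∧ y ∈ V) ∧
      ∀ (O : X.Opens) (_ : O ≤ U) (r : Γ(X, O)), (∀ V g, G V g → ∃ c : Γ(Y, V ⊓ π ⁻¹ᵁ O),
          π.appLE O (V ⊓ π ⁻¹ᵁ O) inf_le_right r =
            Y.presheaf.map (homOfLE inf_le_left).op g ^ d * c) ↔
        ∀ x ∈ O, ∃ (V : X.affineOpens) (h : V.1 ≤ O), x ∈ V.1 ∧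
          X.presheaf.map (homOfLE h).op r ∈ I.ideal V) (O : X.Opens) :
    Set.range (((Scheme.Modules.pushforward π).map ((tensorPow Y d).map i)).app O) =
      (tensorPowComparison π d M).app O '' idealMulSections I ((tensorPow X d).obj M) O := by
  have hinj := tensorPow_map_injective (π := π) d i (by
    intro y
    obtain ⟨U, e, G, hxU, -, he, hG, hGc, -⟩ := hloc (π y)
    obtain ⟨V, g, hg, hy⟩ := hGc y hxU
    exact ⟨U, e, V, g, hy, he, hG V g hg⟩)
  have hiso := isIso_tensorPowComparison (π := π) (M := M) d hπ (by
    intro x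
    obtain ⟨U, e, G, hxU, he, he', -⟩ := hloc x
    exact ⟨U, e, hxU, he, he'⟩)
  have hκ : Function.Bijective (pushSec π (tensorPowComparison π d M) O) :=
    (ConcreteCategory.isIso_iff_bijective _).mp
      (Scheme.Modules.Hom.isIso_iff_isIso_app.mp hiso O)
  have hκe : ∀ {U : X.Opens} (e : Γ(M, U)), pushSec π (tensorPowComparison π d M) U (secPow d e) =
      secPow d (pullSec π e) := fun e => tensorPowComparison_secPow d π e
  -- The coefficient of `σ` in the basis `e ^ d` pulls back to the coefficient of its image in the
  -- pulled back basis. Both inclusions thereby become statements on coefficients, which are the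
  -- content of the hypothesis `hloc`.
  have hκr : ∀ {U : X.Opens} (e : Γ(M, U)) (r : Γ(X, O ⊓ U)) (σ : Γ((tensorPow X d).obj M, O))
      (W : Y.Opens) (hW : W ≤ π ⁻¹ᵁ (O ⊓ U)), r • ((tensorPow X d).obj M).presheaf.map
        (homOfLE inf_le_right).op (secPow d e) =
          ((tensorPow X d).obj M).presheaf.map (homOfLE inf_le_left).op σ →
      π.appLE (O ⊓ U) W hW r • ((tensorPow Y d).obj ((Scheme.Modules.pullback π).obj M)).presheaf.map
        (homOfLE (hW.trans fun _ h => h.2)).op (secPow d (pullSec π e)) =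
      ((tensorPow Y d).obj ((Scheme.Modules.pullback π).obj M)).presheaf.map
        (homOfLE (hW.trans fun _ h => h.1)).op (pushSec π (tensorPowComparison π d M) O σ) := by
    intro U e r σ W hW hr
    have h4 := congrArg (fun s => ((tensorPow Y d).obj
        ((Scheme.Modules.pullback π).obj M)).presheaf.map
          (homOfLE hW).op (pushSec π (tensorPowComparison π d M) (O ⊓ U) s)) hr
    dsimp only at h4
    rw [pushSec_smul, pushSec_res, pushSec_res, modules_map_smul, modules_map_map,
      modules_map_map, hκe] at h4
    exact h4
  have hset : ∀ lam : Γ((tensorPow Y d).obj L, π ⁻¹ᵁ O),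
      ((Scheme.Modules.pushforward π).map ((tensorPow Y d).map i)).app O lam =
        ((tensorPow Y d).map i).app (π ⁻¹ᵁ O) lam := fun _ => rfl
  apply Set.Subset.antisymm
  · rintro _ ⟨(lam : Γ((tensorPow Y d).obj L, π ⁻¹ᵁ O)), rfl⟩
    rw [hset]
    obtain ⟨σ, hσ⟩ := hκ.2 (((tensorPow Y d).map i).app (π ⁻¹ᵁ O) lam)
    refine ⟨σ, fun x hx => ?_, hσ⟩
    obtain ⟨U, e, G, hxU, he, he', hG, -, hI⟩ := hloc x
    obtain ⟨r, hr⟩ := ((he.secPow d) (O ⊓ U) inf_le_right).2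
      (((tensorPow X d).obj M).presheaf.map (homOfLE inf_le_left).op σ)
    dsimp only at hr
    have h1 : ∀ V g, G V g → ∃ c : Γ(Y, V ⊓ π ⁻¹ᵁ (O ⊓ U)),
        π.appLE (O ⊓ U) (V ⊓ π ⁻¹ᵁ (O ⊓ U)) inf_le_right r =
          Y.presheaf.map (homOfLE inf_le_left).op g ^ d * c := by
      intro V g hg
      obtain ⟨hV, l, hl, h⟩ := (hG V g hg).tensorPow_map (d := d)
      have hVO : V ⊓ π ⁻¹ᵁ (O ⊓ U) ≤ π ⁻¹ᵁ O := inf_le_right.trans fun _ h => h.1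
      obtain ⟨c, hc⟩ := (hl (V ⊓ π ⁻¹ᵁ (O ⊓ U)) inf_le_left).2
        (((tensorPow Y d).obj L).presheaf.map (homOfLE hVO).op lam)
      dsimp only at hc
      refine ⟨c, ?_⟩
      have h2 := h _ inf_le_left c
      rw [hc, modules_app_map, ← hσ, ← hκr e r σ _ inf_le_right hr] at h2
      exact ((he'.secPow d) _ (inf_le_left.trans hV)).1 h2
    obtain ⟨V, hV, hxV, hm⟩ := (hI (O ⊓ U) inf_le_right r).mp h1 x ⟨hx, hxU⟩
    refine ⟨V, hV.trans inf_le_left, hxV, ?_⟩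
    rw [← modules_map_map _ inf_le_left hV, ← hr, modules_map_smul, modules_map_map]
    exact Submodule.smul_mem_smul hm trivial
  · rintro _ ⟨σ, hσ, rfl⟩
    -- A preimage exists locally, as a multiple of the basis of the tensor power of `L`; since the
    -- map is injective, the local preimages glue.
    obtain ⟨lam, hlam⟩ := exists_modules_section_of_local ((tensorPow Y d).obj L) (V := π ⁻¹ᵁ O)
      (fun W hW lam => ((tensorPow Y d).map i).app W lam =
        ((tensorPow Y d).obj ((Scheme.Modules.pullback π).obj M)).presheaf.map (homOfLE hW).op
          (pushSec π (tensorPowComparison π d M) O σ))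
      (fun W W' hW h a ha => by rw [modules_app_map, ha, modules_map_map])
      (fun W hW a b ha hb => hinj W (ha.trans hb.symm))
      (by
        intro y hy
        obtain ⟨U, e, G, hxU, he, he', hG, hGc, hI⟩ := hloc (π y)
        obtain ⟨V, g, hg, hyV⟩ := hGc y hxU
        obtain ⟨r, hr⟩ := ((he.secPow d) (O ⊓ U) inf_le_right).2
          (((tensorPow X d).obj M).presheaf.map (homOfLE inf_le_left).op σ)
        dsimp only at hr
        -- The affine opens that witness membership of `σ` need not lie in `U`; they are shrunk to
        -- smaller affine opens, where `e ^ d` is a basis and membership can be read off the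
        -- coefficient.
        have h1 : ∀ x ∈ O ⊓ U, ∃ (V : X.affineOpens) (h : V.1 ≤ O ⊓ U), x ∈ V.1 ∧
            X.presheaf.map (homOfLE h).op r ∈ I.ideal V := by
          rintro x ⟨hx, hxU⟩
          obtain ⟨V₀, hV₀, hxV₀, hm⟩ := hσ x hx
          obtain ⟨_, ⟨V, hV, rfl⟩, hxV, hVle⟩ := X.isBasis_affineOpens.exists_subset_of_mem_open
            (show x ∈ ((V₀.1 ⊓ (O ⊓ U) : X.Opens) : Set X) from ⟨hxV₀, hx, hxU⟩)
            (V₀.1 ⊓ (O ⊓ U)).2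
          have hV0 : V ≤ V₀.1 := fun x hx => (hVle hx).1
          have hVO : V ≤ O ⊓ U := fun x hx => (hVle hx).2
          refine ⟨⟨V, hV⟩, hVO, hxV, ?_⟩
          rw [← mem_smul_top_iff I (V := ⟨V, hV⟩) ((he.secPow d).res (hVO.trans inf_le_right))]
          have h3 := congrArg (((tensorPow X d).obj M).presheaf.map (homOfLE hVO).op) hr
          rw [modules_map_smul, modules_map_map, modules_map_map,
            ← modules_map_map _ hV₀ hV0] at h3
          rw [h3]
          refine Submodule.smul_induction_on hm (fun a ha n hn => ?_) fun x y hx hy => ?_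
          · rw [modules_map_smul]
            exact Submodule.smul_mem_smul
              (I.ideal_le_comap_ideal (U := ⟨V, hV⟩) (V := V₀) hV0 ha) trivial
          · rw [map_add]
            exact add_mem hx hy
        obtain ⟨c, hc⟩ := (hI (O ⊓ U) inf_le_right r).mpr h1 V g hg
        obtain ⟨hV, l, hl, h⟩ := (hG V g hg).tensorPow_map (d := d)
        refine ⟨V ⊓ π ⁻¹ᵁ (O ⊓ U), inf_le_right.trans fun _ h => h.1,
          c • ((tensorPow Y d).obj L).presheaf.map (homOfLE inf_le_left).op l, ⟨hyV, hy, hxU⟩, ?_⟩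
        rw [h, ← hc]
        exact hκr e r σ _ inf_le_right hr)
    refine ⟨lam, modules_eq_of_local ((tensorPow Y d).obj ((Scheme.Modules.pullback π).obj M)) _ _
      fun y hy => ?_⟩
    obtain ⟨W, hW, hyW, h⟩ := hlam y hy
    refine ⟨W, hW, hyW, ?_⟩
    rw [modules_app_map] at h
    exact h

end Comparison

/-! ### Inverse images of ideal sheaves on affine opens. -/

section IdealComap

/-- Both inclusions are the adjunction between `map` and `comap` of ideal sheaves: the extended
ideal defines an ideal sheaf on `Y` whose direct image contains `I`, and conversely `I` is contained
in the direct image of its inverse image. -/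
lemma ideal_comap_top [IsAffine X] [IsAffine Y] (I : X.IdealSheafData) (f : Y ⟶ X) :
    (I.comap f).ideal ⟨⊤, isAffineOpen_top Y⟩ =
      (I.ideal ⟨⊤, isAffineOpen_top X⟩).map (f.appTop).hom := by
  apply le_antisymm
  · have h : I ≤ (Scheme.IdealSheafData.ofIdealTop
        ((I.ideal ⟨⊤, isAffineOpen_top X⟩).map (f.appTop).hom)).map f := by
      apply Scheme.IdealSheafData.le_of_isAffine
      rw [Scheme.IdealSheafData.ideal_map_of_isAffineHom, ← Ideal.map_le_iff_le_comap]
      rw [Scheme.IdealSheafData.ofIdealTop_ideal]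
      refine le_of_eq ?_
      change _ = Ideal.map (Y.presheaf.map (𝟙 _)).hom _
      rw [CategoryTheory.Functor.map_id]
      exact (Ideal.map_id _).symm
    refine (Scheme.IdealSheafData.le_map_iff_comap_le.mp h _).trans ?_
    rw [Scheme.IdealSheafData.ofIdealTop_ideal]
    refine le_of_eq ?_
    change Ideal.map (Y.presheaf.map (𝟙 _)).hom _ = _
    rw [CategoryTheory.Functor.map_id]
    exact Ideal.map_id _
  · rw [Ideal.map_le_iff_le_comap]
    refine (I.le_map_comap f _).trans ?_
    rw [Scheme.IdealSheafData.ideal_map_of_isAffineHom]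
    rfl

lemma ideal_comap_ι (J : X.IdealSheafData) (U : X.affineOpens) (h : IsAffineOpen (⊤ : U.1.toScheme.Opens)) :
    (J.comap U.1.ι).ideal ⟨⊤, h⟩ = (J.ideal U).map U.1.topIso.inv.hom := by
  rw [Scheme.IdealSheafData.ideal_comap_of_isOpenImmersion]
  have h2 := J.map_ideal' (U := ⟨U.1.ι ''ᵁ ⊤, h.image_of_isOpenImmersion _⟩) (V := U)
    (eqToHom (by simp))
  rw [← h2, Scheme.Opens.ι_appIso]
  simp only [Iso.refl_inv]
  refine (Ideal.comap_id _).trans ?_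
  congr 2
  exact congrArg X.presheaf.map (Subsingleton.elim _ _)

/-- The inverse image of an ideal sheaf, over affine opens. -/
lemma ideal_comap_of_le (I : X.IdealSheafData) (f : Y ⟶ X) (V : X.affineOpens) (U : Y.affineOpens)
    (h : U.1 ≤ f ⁻¹ᵁ V.1) : (I.comap f).ideal U = (I.ideal V).map (f.appLE V U h).hom := by
  have : IsAffine U.1 := U.2
  have : IsAffine V.1 := V.2
  have h1 : (I.comap f).comap U.1.ι = (I.comap V.1.ι).comap (f.resLE V U h) := by
    rw [← Scheme.IdealSheafData.comap_comp, ← Scheme.IdealSheafData.comap_comp,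
      Scheme.Hom.resLE_comp_ι]
  have h2 := congr(($h1).ideal ⟨⊤, isAffineOpen_top _⟩)
  rw [ideal_comap_ι, ideal_comap_top, ideal_comap_ι] at h2
  have h3 : V.1.topIso.inv ≫ (f.resLE V U h).appTop = f.appLE V U h ≫ U.1.topIso.inv := by
    rw [Iso.inv_comp_eq, ← Category.assoc, Iso.eq_comp_inv]
    have h5 := f.resLE_appLE h ⊤ ⊤ le_top
    have h6 : (f.resLE V U h).appTop = (f.resLE V U h).appLE ⊤ ⊤ le_top := by
      simp [Scheme.Hom.appLE]; rfl
    rw [h6, h5]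
    change f.appLE _ _ _ ≫ Y.presheaf.map _ = X.presheaf.map _ ≫ f.appLE _ _ _
    rw [Scheme.Hom.appLE_map]
    exact (Scheme.Hom.map_appLE _ _ _).symm
  rw [Ideal.map_map, ← CommRingCat.hom_comp, h3, CommRingCat.hom_comp, ← Ideal.map_map] at h2
  have h4 := congrArg (Ideal.map U.1.topIso.hom.hom) h2
  simp only [Ideal.map_map, ← CommRingCat.hom_comp, Category.assoc, Iso.inv_hom_id] at h4
  simpa only [CommRingCat.hom_comp, ← Ideal.map_map, CommRingCat.hom_id, Ideal.map_id] using h4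

end IdealComap

/-! ### Stalks of invertible ideal sheaves. -/

section Invertible

lemma germ_mem_nonZeroDivisors {U : Y.Opens} (hU : IsAffineOpen U) {g : Γ(Y, U)}
    (hg : g ∈ nonZeroDivisors Γ(Y, U)) (y : Y) (hy : y ∈ U) :
    Y.presheaf.germ U y hy g ∈ nonZeroDivisors (Y.presheaf.stalk y) := by
  let _ := Y.presheaf.algebra_section_stalk ⟨y, hy⟩
  have := hU.isLocalization_stalk ⟨y, hy⟩
  exact IsLocalization.map_nonZeroDivisors_le (hU.primeIdealOf ⟨y, hy⟩).asIdeal.primeCompl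
    (Y.presheaf.stalk y) ⟨g, hg, rfl⟩

lemma mul_eq_zero_of_germ {W : Y.Opens} (g r : Γ(Y, W))
    (hg : ∀ (y : Y) (hy : y ∈ W), Y.presheaf.germ W y hy g ∈ nonZeroDivisors (Y.presheaf.stalk y))
    (h : r * g = 0) : r = 0 := by
  refine TopCat.Presheaf.section_ext Y.sheaf W _ _ fun y hy => ?_
  have := congr(Y.presheaf.germ W y hy $h)
  rw [map_mul, map_zero] at this
  exact ((hg y hy).2 _ this).trans (map_zero (Y.presheaf.germ W y hy).hom).symm

lemma germ_map {W W' : Y.Opens} (h : W' ≤ W) (y : Y) (hy : y ∈ W') (r : Γ(Y, W)) :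
    Y.presheaf.germ W' y hy (Y.presheaf.map (homOfLE h).op r) = Y.presheaf.germ W y (h hy) r :=
  TopCat.Presheaf.germ_res_apply ..

lemma germ_appLE (f : Y ⟶ X) {V : X.Opens} {W : Y.Opens} (h : W ≤ f ⁻¹ᵁ V) (y : Y) (hy : y ∈ W)
    (r : Γ(X, V)) : Y.presheaf.germ W y hy (f.appLE V W h r) =
      Y.presheaf.germ (f ⁻¹ᵁ V) y (h hy) (f.app V r) :=
  germ_map h y hy _

lemma map_germ_ideal_of_le (J : Y.IdealSheafData) {U W : Y.affineOpens} (h : W ≤ U) (y : Y)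
    (hy : y ∈ W.1) : (J.ideal W).map (Y.presheaf.germ W.1 y hy).hom =
      (J.ideal U).map (Y.presheaf.germ U.1 y (h hy)).hom := by
  rw [← J.map_ideal h, Ideal.map_map, ← CommRingCat.hom_comp]
  congr 2
  exact TopCat.Presheaf.germ_res ..

lemma map_germ_ideal_eq (J : Y.IdealSheafData) (U W : Y.affineOpens) (y : Y)
    (hU : y ∈ U.1) (hW : y ∈ W.1) : (J.ideal W).map (Y.presheaf.germ W.1 y hW).hom =
      (J.ideal U).map (Y.presheaf.germ U.1 y hU).hom := by
  obtain ⟨_, ⟨W', hW', rfl⟩, hy, hle⟩ := Y.isBasis_affineOpens.exists_subset_of_mem_open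
    (⟨hU, hW⟩ : y ∈ (U.1 ⊓ W.1 : Y.Opens)) (U.1 ⊓ W.1).2
  rw [← map_germ_ideal_of_le J (W := ⟨W', hW'⟩) (fun _ h => (hle h).1 : W' ≤ U.1) y hy,
    ← map_germ_ideal_of_le J (W := ⟨W', hW'⟩) (fun _ h => (hle h).2 : W' ≤ W.1) y hy]

lemma IsInvertibleIdeal.exists_generator {J : Y.IdealSheafData} (hJ : IsInvertibleIdeal J)
    (W : Y.affineOpens) (y : Y) (hy : y ∈ W.1) : ∃ γ ∈ nonZeroDivisors (Y.presheaf.stalk y),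
      (J.ideal W).map (Y.presheaf.germ W.1 y hy).hom = Ideal.span {γ} := by
  obtain ⟨U, g, hyU, hg, e⟩ := hJ y
  refine ⟨_, germ_mem_nonZeroDivisors U.2 hg y hyU, ?_⟩
  rw [map_germ_ideal_eq J U W y hyU hy, e, Ideal.map_span, Set.image_singleton]

/-- The stalks of the inverse image of an invertible ideal sheaf. -/
lemma exists_stalk_generator {I : X.IdealSheafData} {f : Y ⟶ X} (hJ : IsInvertibleIdeal (I.comap f))
    (V : X.affineOpens) (y : Y) (hy : y ∈ f ⁻¹ᵁ V.1) :
    ∃ γ ∈ nonZeroDivisors (Y.presheaf.stalk y),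
      (I.ideal V).map (f.app V.1 ≫ Y.presheaf.germ (f ⁻¹ᵁ V.1) y hy).hom = Ideal.span {γ} := by
  obtain ⟨_, ⟨W', hW', rfl⟩, hyW, hle⟩ := Y.isBasis_affineOpens.exists_subset_of_mem_open
    hy (f ⁻¹ᵁ V.1).2
  obtain ⟨γ, hγ, e⟩ := hJ.exists_generator ⟨W', hW'⟩ y hyW
  refine ⟨γ, hγ, ?_⟩
  rw [← e, ideal_comap_of_le I f V ⟨W', hW'⟩ hle, Ideal.map_map, ← CommRingCat.hom_comp]
  congr 2
  ext r
  exact (germ_appLE f hle y hyW r).symm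

lemma IsInvertibleIdeal.comap_ι {J : Y.IdealSheafData} (hJ : IsInvertibleIdeal J) (W : Y.Opens) :
    IsInvertibleIdeal (J.comap W.ι) := by
  intro y
  obtain ⟨U, g, hyU, hg, e⟩ := hJ y.1
  obtain ⟨_, ⟨U', hU', rfl⟩, hyU', hle⟩ := W.toScheme.isBasis_affineOpens.exists_subset_of_mem_open
    (show y ∈ (W.ι ⁻¹ᵁ U.1 : W.toScheme.Opens) from hyU) (W.ι ⁻¹ᵁ U.1).2
  refine ⟨⟨U', hU'⟩, W.ι.appLE U.1 U' hle g, hyU', ?_, ?_⟩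
  · have hle' : W.ι ''ᵁ U' ≤ U.1 := by
      rintro _ ⟨z, hz, rfl⟩
      exact hle hz
    have key : ∀ r : Γ(Y, W.ι ''ᵁ U'), r * Y.presheaf.map (homOfLE hle').op g = 0 → r = 0 :=
      fun r => mul_eq_zero_of_germ _ r fun z hz => by
        rw [germ_map]
        exact germ_mem_nonZeroDivisors U.2 hg _ _
    rw [mem_nonZeroDivisors_iff_right]
    intro r hr
    refine key r (Eq.trans ?_ hr)
    congr 1
    exact congr($(Scheme.Opens.ι_appLE W U.1 U' hle) g).symm
  · rw [ideal_comap_of_le J W.ι U ⟨U', hU'⟩ hle, e, Ideal.map_span, Set.image_singleton]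

end Invertible

/-! ### Morphisms from and to affine schemes through ring homomorphisms. -/

section SpecMaps

/-- The morphism to an affine open given by a ring homomorphism. -/
noncomputable def toAffine {V : X.Opens} (hV : IsAffineOpen V) {R : CommRingCat.{u}}
    (ψ : Γ(X, V) ⟶ R) : Spec R ⟶ X := Spec.map ψ ≫ hV.fromSpec

lemma le_toAffine_preimage {V : X.Opens} (hV : IsAffineOpen V) {R : CommRingCat.{u}}
    (ψ : Γ(X, V) ⟶ R) : ⊤ ≤ toAffine hV ψ ⁻¹ᵁ V := by
  rintro x -
  change hV.fromSpec (Spec.map ψ x) ∈ (V : Set X)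
  rw [← hV.range_fromSpec]
  exact ⟨_, rfl⟩

lemma toAffine_appLE {V : X.Opens} (hV : IsAffineOpen V) {R : CommRingCat.{u}}
    (ψ : Γ(X, V) ⟶ R) : (toAffine hV ψ).appLE V ⊤ (le_toAffine_preimage hV ψ) =
      ψ ≫ (Scheme.ΓSpecIso R).inv := by
  have h1 : ⊤ ≤ hV.fromSpec ⁻¹ᵁ V := hV.fromSpec_preimage_self.ge
  have h2 : hV.fromSpec.appLE V ⊤ h1 = (Scheme.ΓSpecIso Γ(X, V)).inv := by
    rw [Scheme.Hom.appLE, hV.fromSpec_app_self, Category.assoc, ← Functor.map_comp]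
    convert Category.comp_id _
    exact CategoryTheory.Functor.map_id _ _
  rw [Scheme.ΓSpecIso_inv_naturality, ← h2]
  have h3 : ⊤ ≤ Spec.map ψ ⁻¹ᵁ ⊤ := fun _ _ => trivial
  have h4 : (Spec.map ψ).appTop = (Spec.map ψ).appLE ⊤ ⊤ h3 := by
    simp [Scheme.Hom.appLE]; rfl
  rw [h4]
  exact (Scheme.Hom.appLE_comp_appLE _ _ _ _ _ h1 h3).symm

/-- The morphism from an open to an affine scheme given by a ring homomorphism. -/
noncomputable def ofSections {W : Y.Opens} {R : CommRingCat.{u}} (θ : R ⟶ Γ(Y, W)) :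
    W.toScheme ⟶ Spec R := W.toSpecΓ ≫ Spec.map θ

lemma ofSections_toAffine {V : X.Opens} (hV : IsAffineOpen V) (f : Y ⟶ X) {W : Y.Opens}
    (h : W ≤ f ⁻¹ᵁ V) {R : CommRingCat.{u}} (ψ : Γ(X, V) ⟶ R) (θ : R ⟶ Γ(Y, W))
    (e : ψ ≫ θ = f.appLE V W h) : ofSections θ ≫ toAffine hV ψ = W.ι ≫ f := by
  rw [ofSections, toAffine, Category.assoc, ← Spec.map_comp_assoc, e,
    Scheme.Opens.toSpecΓ_SpecMap_appLE_assoc, hV.toSpecΓ_fromSpec, Scheme.Hom.resLE_comp_ι]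

lemma toAffine_injective {V : X.Opens} (hV : IsAffineOpen V) {R : CommRingCat.{u}}
    {ψ ψ' : Γ(X, V) ⟶ R} (h : toAffine hV ψ = toAffine hV ψ') : ψ = ψ' := by
  rw [toAffine, toAffine, cancel_mono] at h
  exact Spec.map_injective h

lemma isAffineOpen_of_isIso {W : Y.Opens} {R : CommRingCat.{u}} (θ : R ⟶ Γ(Y, W))
    (h : IsIso (ofSections θ)) : IsAffineOpen W ∧ IsIso θ := by
  have hW : IsAffineOpen W := IsAffine.of_isIso (ofSections θ)
  refine ⟨hW, ?_⟩
  have : IsIso W.toSpecΓ := by rw [← hW.isoSpec_hom]; infer_instance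
  have : IsIso (Spec.map θ) := by
    rw [ofSections] at h
    exact IsIso.of_isIso_comp_left W.toSpecΓ _
  rw [ConcreteCategory.isIso_iff_bijective]
  exact isIso_SpecMap_iff.mp this

end SpecMaps

/-! ### Affine charts of a blow-up from its universal property. -/

section Chart

lemma exists_local_quotient {W : Y.Opens} (s u : Γ(Y, W)) (y : Y) (hy : y ∈ W)
    (h : Y.presheaf.germ W y hy u ∈ Ideal.span {Y.presheaf.germ W y hy s}) :
    ∃ (W' : Y.Opens) (hW : W' ≤ W) (t : Γ(Y, W')), y ∈ W' ∧
      Y.presheaf.map (homOfLE hW).op s * t = Y.presheaf.map (homOfLE hW).op u := by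
  obtain ⟨τ, hτ⟩ := Ideal.mem_span_singleton.mp h
  obtain ⟨W₁, hy₁, t₁, rfl⟩ := Y.presheaf.exists_germ_eq τ
  have hy₀ : y ∈ W ⊓ W₁ := ⟨hy, hy₁⟩
  have h1 : Y.presheaf.germ (W ⊓ W₁) y hy₀ (Y.presheaf.map (homOfLE inf_le_left).op u) =
      Y.presheaf.germ (W ⊓ W₁) y hy₀ (Y.presheaf.map (homOfLE inf_le_left).op s *
        Y.presheaf.map (homOfLE inf_le_right).op t₁) := by
    rw [map_mul, germ_map, germ_map]
    exact hτ.trans congr(_ * $((germ_map inf_le_right y hy₀ t₁).symm))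
  obtain ⟨W₂, hy₂, i, j, e⟩ := Y.presheaf.germ_eq _ _ _ _ _ h1
  refine ⟨W₂, i.le.trans inf_le_left, Y.presheaf.map (homOfLE (j.le.trans inf_le_right)).op t₁,
    hy₂, ?_⟩
  rw [← map_map inf_le_left i.le, ← map_map inf_le_left i.le]
  refine Eq.trans ?_ e.symm
  rw [map_mul]
  exact congr(_ * $((map_map _ _ _).symm))

/-- The functions on an open of `Y` along which `u` is divisible by a nonzerodivisor `s`. -/
lemma exists_quotient {W : Y.Opens} (s u : Γ(Y, W))
    (hs : ∀ (y : Y) (hy : y ∈ W), Y.presheaf.germ W y hy s ∈ nonZeroDivisors (Y.presheaf.stalk y))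
    (hu : ∀ (y : Y) (hy : y ∈ W), Y.presheaf.germ W y hy u ∈
      Ideal.span {Y.presheaf.germ W y hy s}) : ∃ t, s * t = u := by
  have res {W' : Y.Opens} (h : W' ≤ W) (y : Y) (hy : y ∈ W') :
      Y.presheaf.germ W' y hy (Y.presheaf.map (homOfLE h).op s) ∈
        nonZeroDivisors (Y.presheaf.stalk y) := by
    rw [germ_map]
    exact hs y (h hy)
  obtain ⟨t, ht⟩ := exists_section_of_local (V := W)
    (fun W' h t => Y.presheaf.map (homOfLE h).op s * t = Y.presheaf.map (homOfLE h).op u)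
    (by
      intro W' W'' hW h t e
      rw [← map_map hW h, ← map_mul, e, map_map])
    (by
      intro W' h a b ha hb
      refine sub_eq_zero.mp (mul_eq_zero_of_germ (Y.presheaf.map (homOfLE h).op s) _ (res h) ?_)
      linear_combination ha - hb)
    (by
      intro y hy
      exact exists_local_quotient s u y hy (hu y hy))
  refine ⟨t, section_eq_of_local _ _ fun y hy => ?_⟩
  obtain ⟨W', h, hy', e⟩ := ht y hy
  exact ⟨W', h, hy', by rw [map_mul]; exact e⟩

/-- The set of the points at which `u` is divisible by `s`. -/
def quotientLocus {W : Y.Opens} (s u : Γ(Y, W)) : Y.Opens :=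
  sSup {W' | ∃ h : W' ≤ W, ∃ t, Y.presheaf.map (homOfLE h).op s * t =
    Y.presheaf.map (homOfLE h).op u}

lemma quotientLocus_le {W : Y.Opens} (s u : Γ(Y, W)) : quotientLocus s u ≤ W :=
  sSup_le fun _ h => h.1

lemma mem_quotientLocus {W : Y.Opens} (s u : Γ(Y, W)) (y : Y) (hy : y ∈ W) :
    y ∈ quotientLocus s u ↔ Y.presheaf.germ W y hy u ∈ Ideal.span {Y.presheaf.germ W y hy s} := by
  constructor
  · intro h
    obtain ⟨W', ⟨hW', t, ht⟩, hyW'⟩ := Opens.mem_sSup.mp h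
    refine Ideal.mem_span_singleton.mpr ⟨Y.presheaf.germ W' y hyW' t, ?_⟩
    rw [← germ_map hW' y hyW', ← germ_map hW' y hyW', ← map_mul, ht]
  · intro h
    obtain ⟨W', hW, t, hy', e⟩ := exists_local_quotient s u y hy h
    exact Opens.mem_sSup.mpr ⟨W', ⟨hW, t, e⟩, hy'⟩

end Chart

section BlowUpChart

lemma stalkMap_germ_app {Z : Scheme.{u}} {g : Z ⟶ Y} {b : Y ⟶ X} {f : Z ⟶ X} (hg : g ≫ b = f)
    {V : X.Opens} {W : Z.Opens} (h : W ≤ f ⁻¹ᵁ V) (q : Z) (hq : q ∈ W) (hq' : g q ∈ b ⁻¹ᵁ V)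
    (a : Γ(X, V)) : g.stalkMap q (Y.presheaf.germ (b ⁻¹ᵁ V) (g q) hq' (b.app V a)) =
      Z.presheaf.germ W q hq (f.appLE V W h a) := by
  subst hg
  rw [germ_appLE, Scheme.Hom.germ_stalkMap_apply, Scheme.Hom.comp_app]
  rfl

/-- A chart of the blow-up: if `B` is the algebra obtained by adjoining `u / s`, and the inverse
image of the ideal in `B` is generated by the nonzerodivisor `s`, then the locus where `u` is
divisible by `s` is affine, with ring of functions `B`. -/
theorem IsBlowUp.exists_chart {b : Y ⟶ X} {I : X.IdealSheafData} (hb : IsBlowUp b I)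
    (V : X.affineOpens) {B : CommRingCat.{u}} (φ : Γ(X, V.1) ⟶ B) (s u v : Γ(X, V.1))
    (hs : s ∈ I.ideal V) (t : B) (ht : φ s * t = φ u)
    (hB : ∀ (C : CommRingCat.{u}) (ψ : Γ(X, V.1) ⟶ C) (c : C), ψ s * c = ψ u →
      ∃ θ : B ⟶ C, φ ≫ θ = ψ ∧ θ t = c)
    (hB' : ∀ (C : CommRingCat.{u}) (θ θ' : B ⟶ C), φ ≫ θ = φ ≫ θ' → θ t = θ' t → θ = θ')
    (hnzd : φ s ∈ nonZeroDivisors B) (hJ : (I.ideal V).map φ.hom ≤ Ideal.span {φ s})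
    (hv : v * u ∈ I.ideal V) (hvs : IsCoprime (φ v) (φ s)) :
    ∃ (W : Y.affineOpens) (h : W.1 ≤ b ⁻¹ᵁ V.1) (θ : B ⟶ Γ(Y, W.1)), IsIso θ ∧
      φ ≫ θ = b.appLE V.1 W.1 h ∧ ∀ (y : Y) (hy : y ∈ b ⁻¹ᵁ V.1),
        Y.presheaf.germ (b ⁻¹ᵁ V.1) y hy (b.app V.1 u) ∈
          Ideal.span {Y.presheaf.germ (b ⁻¹ᵁ V.1) y hy (b.app V.1 s)} → y ∈ W.1 := by
  have hV : IsAffineOpen V.1 := V.2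
  -- The chart is defined as the whole divisibility locus. The proof constructs mutually inverse
  -- morphisms between it and `Spec B`.
  set W := quotientLocus (b.app V.1 s) (b.app V.1 u)
  have hW : W ≤ b ⁻¹ᵁ V.1 := quotientLocus_le _ _
  -- along `W` the ideal is generated by `s`
  have hgen (y : Y) (hy : y ∈ W) : Y.presheaf.germ W y hy (b.appLE V.1 W hW s) ∈
      nonZeroDivisors (Y.presheaf.stalk y) := by
    rw [germ_appLE]
    set σ := b.app V.1 ≫ Y.presheaf.germ (b ⁻¹ᵁ V.1) y (hW hy)
    obtain ⟨c, hc⟩ := Ideal.mem_span_singleton.mp ((mem_quotientLocus _ _ y (hW hy)).mp hy)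
    -- Divisibility of `u` by `s` in the stalk gives a map from `B` to the stalk; as the ideal
    -- extends into `(s)` in `B`, the same holds in the stalk. So `s` divides the nonzerodivisor `γ`
    -- and is itself a nonzerodivisor.
    obtain ⟨θ, hθ, -⟩ := hB _ σ c hc.symm
    obtain ⟨γ, hγ, e⟩ := exists_stalk_generator hb.invertible V y (hW hy)
    have h1 : Ideal.span {γ} ≤ Ideal.span {σ s} := by
      rw [← e]
      change (I.ideal V).map σ.hom ≤ _
      rw [← hθ, CommRingCat.hom_comp, ← Ideal.map_map]
      refine (Ideal.map_mono hJ).trans ?_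
      rw [Ideal.map_span, Set.image_singleton]
      rfl
    have h2 : σ s ∈ Ideal.span {γ} := by
      rw [← e]
      exact Ideal.mem_map_of_mem σ.hom hs
    obtain ⟨α, hα⟩ := Ideal.mem_span_singleton.mp (h1 (Ideal.mem_span_singleton_self γ))
    rw [hα] at hγ
    exact (mul_mem_nonZeroDivisors.mp hγ).1
  obtain ⟨t', ht'⟩ : ∃ t', b.appLE V.1 W hW s * t' = b.appLE V.1 W hW u :=
    exists_quotient _ _ hgen fun y hy => by
      rw [germ_appLE, germ_appLE]
      exact (mem_quotientLocus _ _ y (hW hy)).mp hy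
  obtain ⟨θ, hθ, hθt⟩ := hB _ (b.appLE V.1 W hW) t' ht'
  -- the morphism in the other direction
  set f := toAffine hV φ
  have hnzd' : (Scheme.ΓSpecIso B).inv (φ s) ∈ nonZeroDivisors Γ(Spec B, ⊤) := by
    have e : (Scheme.ΓSpecIso B).inv (φ s) =
        (Scheme.ΓSpecIso B).symm.commRingCatIsoToRingEquiv (φ s) := rfl
    rw [e, mem_nonZeroDivisors_iff_right]
    intro r hr
    obtain ⟨r', rfl⟩ := (Scheme.ΓSpecIso B).symm.commRingCatIsoToRingEquiv.surjective r
    rw [← map_mul, map_eq_zero_iff _ (RingEquiv.injective _)] at hr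
    rw [hnzd.2 _ hr, map_zero]
  have hf : IsInvertibleIdeal (I.comap f) := by
    intro x
    refine ⟨⟨⊤, isAffineOpen_top _⟩, (Scheme.ΓSpecIso B).inv (φ s), trivial, hnzd', ?_⟩
    refine (ideal_comap_of_le I f V _ (le_toAffine_preimage hV φ)).trans ?_
    change (I.ideal V).map (f.appLE V.1 ⊤ (le_toAffine_preimage hV φ)).hom = _
    rw [show f.appLE V.1 ⊤ (le_toAffine_preimage hV φ) = _ from toAffine_appLE hV φ,
      CommRingCat.hom_comp, ← Ideal.map_map]
    apply le_antisymm
    · refine (Ideal.map_mono hJ).trans ?_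
      rw [Ideal.map_span, Set.image_singleton]
    · rw [Ideal.span_singleton_le_iff_mem]
      exact Ideal.mem_map_of_mem _ (Ideal.mem_map_of_mem _ hs)
  obtain ⟨g, hg, -⟩ := hb.existsUnique_lift _ f hf
  -- It is shown that `s` divides `u` in the stalk at `g q`. The plan is to prove first that `s`
  -- generates the stalk of the ideal there, and then to use `v * u ∈ I`.
  have hrange : Set.range g ⊆ Set.range W.ι := by
    rintro _ ⟨q, rfl⟩
    rw [Scheme.Opens.range_ι]
    have hqV : g q ∈ b ⁻¹ᵁ V.1 := by
      have := le_toAffine_preimage hV φ (x := q) trivial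
      change f q ∈ V.1 at this
      rw [← hg] at this
      exact this
    refine (mem_quotientLocus _ _ _ hqV).mpr ?_
    set σ := b.app V.1 ≫ Y.presheaf.germ (b ⁻¹ᵁ V.1) (g q) hqV
    set τ : B ⟶ (Spec B).presheaf.stalk q :=
      (Scheme.ΓSpecIso B).inv ≫ (Spec B).presheaf.germ ⊤ q trivial
    have hστ' (a) : g.stalkMap q (σ a) = τ (φ a) := by
      refine (stalkMap_germ_app hg (le_toAffine_preimage hV φ) q trivial hqV a).trans ?_
      exact congr((Spec B).presheaf.germ ⊤ q trivial ($(toAffine_appLE hV φ) a))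
    have hστ : σ ≫ g.stalkMap q = φ ≫ τ := by
      ext a
      exact hστ' a
    obtain ⟨γ, hγ, e⟩ := exists_stalk_generator hb.invertible V _ hqV
    have hsγ : σ s ∈ Ideal.span {γ} := by
      rw [← e]
      exact Ideal.mem_map_of_mem σ.hom hs
    obtain ⟨α, hα⟩ := Ideal.mem_span_singleton.mp hsγ
    have hτs : τ (φ s) ∈ nonZeroDivisors ((Spec B).presheaf.stalk q) :=
      germ_mem_nonZeroDivisors (isAffineOpen_top _) hnzd' q trivial
    have hγ' : g.stalkMap q γ ∈ Ideal.span {τ (φ s)} := by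
      have h1 : γ ∈ (I.ideal V).map σ.hom := by
        rw [e]
        exact Ideal.mem_span_singleton_self γ
      have h2 := Ideal.mem_map_of_mem (g.stalkMap q).hom h1
      rw [Ideal.map_map, ← CommRingCat.hom_comp, hστ, CommRingCat.hom_comp, ← Ideal.map_map] at h2
      have h3 := Ideal.map_mono (f := τ.hom) hJ h2
      rw [Ideal.map_span, Set.image_singleton] at h3
      exact h3
    obtain ⟨β, hβ⟩ := Ideal.mem_span_singleton.mp hγ'
    -- In the stalk of `Spec B` the images of `s` and of the generator `γ` divide each other and `s`
    -- is a nonzerodivisor, so `α` maps to a unit. Stalk maps are local, hence `α` is a unit.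
    have hα' : IsUnit (g.stalkMap q α) := by
      have h1 := congr(g.stalkMap q $hα)
      rw [map_mul, hστ', hβ] at h1
      refine IsUnit.of_mul_eq_one_right β ?_
      have h2 : (β * g.stalkMap q α - 1) * τ (φ s) = 0 := by linear_combination -h1
      exact sub_eq_zero.mp (hτs.2 _ h2)
    have hα'' : IsUnit α := isUnit_of_map_unit (g.stalkMap q).hom α hα'
    have hspan : Ideal.span {σ s} = Ideal.span {γ} := by
      rw [hα]
      exact Ideal.span_singleton_mul_right_unit hα'' γ
    change σ u ∈ Ideal.span {σ s}
    have hvu : σ v * σ u ∈ Ideal.span {σ s} := by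
      rw [hspan, ← e, ← map_mul]
      exact Ideal.mem_map_of_mem σ.hom hv
    -- This is where `v` serves: in a local ring one of the coprime elements `v`, `s` is a unit. If
    -- `v` is, then `u` lies in the ideal, which is `(s)`; if `s` is, there is nothing to divide.
    have hcop : IsUnit (τ (φ v)) ∨ IsUnit (τ (φ s)) := by
      obtain ⟨x, y, hxy⟩ := hvs.map τ.hom
      rcases IsLocalRing.isUnit_or_isUnit_of_add_one hxy with h | h
      · exact Or.inl (isUnit_of_mul_isUnit_right h)
      · exact Or.inr (isUnit_of_mul_isUnit_right h)
    rcases hcop with h | h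
    · rw [← hστ'] at h
      have h' : IsUnit (σ v) := isUnit_of_map_unit (g.stalkMap q).hom _ h
      exact (Ideal.unit_mul_mem_iff_mem _ h').mp hvu
    · rw [← hστ'] at h
      have h' : IsUnit (σ s) := isUnit_of_map_unit (g.stalkMap q).hom _ h
      rw [Ideal.span_singleton_eq_top.mpr h']
      trivial
  let g' := IsOpenImmersion.lift W.ι g hrange
  have hg' : g' ≫ W.ι = g := IsOpenImmersion.lift_fac _ _ _
  -- Both sides become lifts of the same morphism `W ⟶ X`, so the uniqueness in the universal
  -- property of the blow-up applies.
  have e1 : ofSections θ ≫ g' = 𝟙 _ := by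
    rw [← cancel_mono W.ι, Category.assoc, hg', Category.id_comp]
    have h1 : IsInvertibleIdeal (I.comap (W.ι ≫ b)) := by
      rw [Scheme.IdealSheafData.comap_comp]
      exact hb.invertible.comap_ι W
    refine (hb.existsUnique_lift _ _ h1).unique ?_ rfl
    rw [Category.assoc, hg]
    exact ofSections_toAffine hV b hW φ θ hθ
  have e2 : g' ≫ ofSections θ = 𝟙 _ := by
    obtain ⟨ψ, hψ⟩ := Spec.map_surjective (g' ≫ ofSections θ)
    rw [← hψ, ← Spec.map_id]
    congr 1
    have h1 : φ ≫ ψ = φ := by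
      apply toAffine_injective hV
      change Spec.map (φ ≫ ψ) ≫ hV.fromSpec = f
      rw [Spec.map_comp, hψ, Category.assoc, Category.assoc]
      change g' ≫ ofSections θ ≫ toAffine hV φ = f
      rw [ofSections_toAffine hV b hW φ θ hθ, ← Category.assoc, hg', hg]
    -- An endomorphism of `B` over the functions on `V` fixes `t`, because `s t = u` and `s` is a
    -- nonzerodivisor.
    refine hB' _ _ _ (by rw [h1, Category.comp_id]) ?_
    have h2 : ψ (φ s) = φ s := congr($h1 s)
    have h3 : ψ (φ u) = φ u := congr($h1 u)
    have h4 := congr(ψ $ht)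
    rw [map_mul, h2, h3] at h4
    have h5 : (ψ t - t) * φ s = 0 := by linear_combination h4 - ht
    exact sub_eq_zero.mp (hnzd.2 _ h5)
  have hiso := isAffineOpen_of_isIso θ ⟨g', e1, e2⟩
  exact ⟨⟨W, hiso.1⟩, hW, θ, hiso.2, hθ, fun y hy h => (mem_quotientLocus _ _ y hy).mpr h⟩

end BlowUpChart

/-! ### Functions coming from the base. -/

section Constants

variable {R : CommRingCat.{u}}

/-- The functions on an open of a scheme over `Spec R` coming from `R`. -/
noncomputable def constants (t : X ⟶ Spec R) (V : X.Opens) : R →+* Γ(X, V) :=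
  ((Scheme.ΓSpecIso R).inv ≫ t.appLE ⊤ V (fun _ _ => trivial)).hom

lemma map_constants (t : X ⟶ Spec R) {V W : X.Opens} (h : W ≤ V) (c : R) :
    X.presheaf.map (homOfLE h).op (constants t V c) = constants t W c :=
  appLE_map_apply t (U := ⊤) (fun _ _ => trivial) h _

lemma appLE_constants (f : Y ⟶ X) (t : X ⟶ Spec R) {V : X.Opens} {W : Y.Opens} (h : W ≤ f ⁻¹ᵁ V)
    (c : R) : f.appLE V W h (constants t V c) = constants (f ≫ t) W c := by
  have h1 : ⊤ ≤ t ⁻¹ᵁ ⊤ := fun _ _ => trivial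
  have h2 : V ≤ t ⁻¹ᵁ ⊤ := fun _ _ => trivial
  exact congr($(Scheme.Hom.appLE_comp_appLE f t ⊤ V W h2 h) ((Scheme.ΓSpecIso R).inv c))

lemma ofSections_constants (t : X ⟶ Spec R) (V : X.Opens) :
    ofSections (CommRingCat.ofHom (constants t V)) = V.ι ≫ t := by
  have h : V ≤ t ⁻¹ᵁ ⊤ := fun _ _ => trivial
  change V.toSpecΓ ≫ Spec.map ((Scheme.ΓSpecIso R).inv ≫ t.appLE ⊤ V h) = _
  rw [Spec.map_comp, Scheme.Opens.toSpecΓ_SpecMap_appLE_assoc]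
  have h2 : (⊤ : (Spec R).Opens).toSpecΓ ≫ Spec.map (Scheme.ΓSpecIso R).inv = (⊤ : (Spec R).Opens).ι := by
    rw [← (isAffineOpen_top (Spec R)).toSpecΓ_fromSpec, IsAffineOpen.fromSpec_top,
      Scheme.isoSpec_Spec_inv]
  rw [h2, Scheme.Hom.resLE_comp_ι]

/-- A structure map is determined by the constants, on a morphism from an affine scheme. -/
lemma constants_toAffine {t : X ⟶ Spec R} {V : X.Opens} (hV : IsAffineOpen V) {A : CommRingCat.{u}}
    (ψ : Γ(X, V) ⟶ A) :
    toAffine hV ψ ≫ t = Spec.map (CommRingCat.ofHom (ψ.hom.comp (constants t V))) := by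
  have h := IsAffineOpen.SpecMap_appLE_fromSpec t (isAffineOpen_top _) hV (fun _ _ => trivial)
  rw [toAffine, Category.assoc, ← h, IsAffineOpen.fromSpec_top, Scheme.isoSpec_Spec_inv,
    ← Spec.map_comp, ← Spec.map_comp]
  rfl

end Constants

/-! ### The standard charts of the projective line as affine lines. -/

section ProjectiveLine

open MvPolynomial HomogeneousLocalization

attribute [local instance] MvPolynomial.gradedAlgebra

lemma eval₂_mul_of_isHomogeneous {σ R A : Type*} [CommRing R] [CommRing A] (φ : R →+* A) (g : σ → A)
    (a : A) {n : ℕ} {F : MvPolynomial σ R} (hF : F.IsHomogeneous n) :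
    eval₂ φ (fun i => a * g i) F = a ^ n * eval₂ φ g F := by
  rw [eval₂_eq, eval₂_eq, Finset.mul_sum]
  refine Finset.sum_congr rfl fun d hd => ?_
  rw [hF.degree_eq_sum_deg_support hd]
  simp only [mul_pow, Finset.prod_mul_distrib, Finset.prod_pow_eq_pow_sum]
  ring

variable (R : Type u) [CommRing R]

lemma X_mem (k : Fin 2) : (MvPolynomial.X k : MvPolynomial (Fin 2) R) ∈ (MvPolynomial.homogeneousSubmodule (Fin 2) R) 1 :=
  (MvPolynomial.mem_homogeneousSubmodule _ _).mpr (MvPolynomial.isHomogeneous_X _ k)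

/-- The constants in the degree zero part of a localization. -/
noncomputable def awayConst (k : Fin 2) : R →+* Away (MvPolynomial.homogeneousSubmodule (Fin 2) R) (MvPolynomial.X k : MvPolynomial (Fin 2) R) :=
  (fromZeroRingHom (MvPolynomial.homogeneousSubmodule (Fin 2) R) _).comp (algebraMap R ((MvPolynomial.homogeneousSubmodule (Fin 2) R) 0))

/-- The fraction `MvPolynomial.X (1 - k) / MvPolynomial.X k`. -/
noncomputable def awayCoord (k : Fin 2) : Away (MvPolynomial.homogeneousSubmodule (Fin 2) R) (MvPolynomial.X k : MvPolynomial (Fin 2) R) :=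
  Away.mk (MvPolynomial.homogeneousSubmodule (Fin 2) R) (d := 1) (X_mem R k) 1 (MvPolynomial.X (1 - k)) (X_mem R (1 - k))

lemma val_awayConst (k : Fin 2) (c : R) :
    (awayConst R k c).val = algebraMap (MvPolynomial (Fin 2) R) (Localization.Away (MvPolynomial.X k : MvPolynomial (Fin 2) R)) (C c) :=
  Localization.mk_one_eq_algebraMap _

lemma val_awayCoord (k : Fin 2) : algebraMap (MvPolynomial (Fin 2) R)
    (Localization.Away (MvPolynomial.X k : MvPolynomial (Fin 2) R)) (MvPolynomial.X k) * (awayCoord R k).val =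
      algebraMap (MvPolynomial (Fin 2) R) _ (MvPolynomial.X (1 - k)) := by
  rw [awayCoord, Away.val_mk, Localization.mk_eq_mk']
  simp only [pow_one]
  rw [mul_comm]
  exact IsLocalization.mk'_spec _ _ _

/-- Polynomials in the coordinate. -/
noncomputable def awayEval (k : Fin 2) :
    Polynomial R →+* Away (MvPolynomial.homogeneousSubmodule (Fin 2) R) (MvPolynomial.X k : MvPolynomial (Fin 2) R) :=
  Polynomial.eval₂RingHom (awayConst R k) (awayCoord R k)

/-- Dehomogenisation `X k ↦ 1`, `X (1 - k) ↦ T` extends to the localization and is a left inverse,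
which gives injectivity. A fraction `F / X k ^ n` with `F` homogeneous of degree `n` is the value at
the dehomogenised `F`, which gives surjectivity. -/
lemma awayEval_bijective (k : Fin 2) : Function.Bijective (awayEval R k) := by
  let L := Localization.Away (MvPolynomial.X k : MvPolynomial (Fin 2) R)
  let ev : MvPolynomial (Fin 2) R →+* Polynomial R :=
    eval₂Hom Polynomial.C (fun i => if i = k then 1 else Polynomial.X)
  have hk : (1 - k : Fin 2) ≠ k := by fin_cases k <;> decide
  have hev : IsUnit (ev (MvPolynomial.X k)) := by simp [ev]
  let ev' : L →+* Polynomial R := IsLocalization.Away.lift (MvPolynomial.X k : MvPolynomial (Fin 2) R) hev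
  have hev' (a) : ev' (algebraMap _ _ a) = ev a := IsLocalization.Away.lift_eq _ _ _
  constructor
  · have h : (ev'.comp (algebraMap _ L)).comp (awayEval R k) = RingHom.id _ := by
      refine Polynomial.ringHom_ext (fun c => ?_) ?_
      · change ev' (awayEval R k (Polynomial.C c)).val = _
        rw [awayEval, Polynomial.coe_eval₂RingHom, Polynomial.eval₂_C, val_awayConst, hev']
        simp [ev]
      · change ev' (awayEval R k Polynomial.X).val = _
        rw [awayEval, Polynomial.coe_eval₂RingHom, Polynomial.eval₂_X]
        have h := congr(ev' $(val_awayCoord R k))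
        rw [map_mul, hev', hev'] at h
        simpa [ev, hk] using h
    intro F G hFG
    have := congr((ev'.comp (algebraMap _ L)) $hFG)
    rw [← RingHom.comp_apply, ← RingHom.comp_apply, h] at this
    exact this
  · intro ζ
    obtain ⟨n, F, hF, rfl⟩ := Away.mk_surjective (MvPolynomial.homogeneousSubmodule (Fin 2) R) (X_mem R k) ζ
    refine ⟨ev F, ?_⟩
    apply val_injective
    have hF' : F.IsHomogeneous n := by
      have := (MvPolynomial.mem_homogeneousSubmodule _ _).mp hF
      simpa using this
    have h1 : (awayEval R k (ev F)).val = eval₂ ((algebraMap (MvPolynomial (Fin 2) R) L).comp C)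
        (fun i => if i = k then 1 else (awayCoord R k).val) F := by
      change ((algebraMap (Away (MvPolynomial.homogeneousSubmodule (Fin 2) R) (MvPolynomial.X k)) L).comp ((awayEval R k).comp ev)) F =
        eval₂Hom ((algebraMap (MvPolynomial (Fin 2) R) L).comp C) (fun i => if i = k then 1 else (awayCoord R k).val) F
      congr 1
      refine MvPolynomial.ringHom_ext (fun c => ?_) (fun i => ?_)
      · simp only [RingHom.comp_apply, ev, coe_eval₂Hom, eval₂_C]
        rw [awayEval, Polynomial.coe_eval₂RingHom, Polynomial.eval₂_C]
        exact val_awayConst R k c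
      · simp only [RingHom.comp_apply, ev, coe_eval₂Hom, eval₂_X]
        split_ifs with hi
        · rw [map_one, map_one]
        · rw [awayEval, Polynomial.coe_eval₂RingHom, Polynomial.eval₂_X]
          rfl
    -- Homogeneity of degree `n` extracts the factor `X k ^ n` after writing each variable as `X k`
    -- times `1` or times the coordinate.
    have h2 : algebraMap (MvPolynomial (Fin 2) R) L F = algebraMap (MvPolynomial (Fin 2) R) L (MvPolynomial.X k) ^ n * (awayEval R k (ev F)).val := by
      rw [h1, ← eval₂_mul_of_isHomogeneous _ _ _ hF']
      change algebraMap (MvPolynomial (Fin 2) R) L F = eval₂Hom _ _ F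
      congr 1
      refine MvPolynomial.ringHom_ext (fun c => ?_) (fun i => ?_)
      · simp
      · simp only [coe_eval₂Hom, eval₂_X]
        split_ifs with hi
        · rw [hi, mul_one]
        · have : i = 1 - k := by revert hi; fin_cases i <;> fin_cases k <;> simp
          rw [val_awayCoord, this]
    rw [Away.val_mk, Localization.mk_eq_mk']
    rw [IsLocalization.eq_mk'_iff_mul_eq]
    rw [h2, map_pow]
    ring

end ProjectiveLine

section ProjectiveLineCharts

open HomogeneousLocalization

attribute [local instance] MvPolynomial.gradedAlgebra

variable (p : ℕ) [Fact p.Prime]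

/-- The constants arise from the structure morphism on one side and as fractions of degree zero on
the other. They are compared through the morphisms to `Spec ℤ_p` that they define on the affine
chart. -/
lemma constants_chart (k : Fin 2) (c : ℤ_[p]) :
    constants (projLineStr p) (chart p k).1 c =
      Proj.awayToSection (MvPolynomial.homogeneousSubmodule (Fin 2) ℤ_[p]) (MvPolynomial.X k) (awayConst ℤ_[p] k c) := by
  have h1 : (chart p k).1.ι ≫ projLineStr p = (chart p k).1.toSpecΓ ≫
      Spec.map (CommRingCat.ofHom (awayConst ℤ_[p] k) ≫
        Proj.awayToSection (MvPolynomial.homogeneousSubmodule (Fin 2) ℤ_[p]) (MvPolynomial.X k)) := by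
    have h2 := Proj.awayι_toSpecZero (MvPolynomial.homogeneousSubmodule (Fin 2) ℤ_[p]) (MvPolynomial.X k) (X_mem ℤ_[p] k) one_pos
    rw [← Proj.basicOpenIsoSpec_inv_ι, Category.assoc, Iso.inv_comp_eq] at h2
    rw [projLineStr, ← Category.assoc]
    refine congr($h2 ≫ _).trans ?_
    rw [Proj.basicOpenIsoSpec_hom, Proj.basicOpenToSpec, Category.assoc, Category.assoc,
      ← Spec.map_comp, ← Spec.map_comp]
    rfl
  rw [← ofSections_constants, ofSections] at h1
  have hU : IsAffineOpen (chart p k).1 := (chart p k).2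
  have : IsIso (chart p k).1.toSpecΓ := by rw [← hU.isoSpec_hom]; infer_instance
  rw [cancel_epi] at h1
  exact congr($(Spec.map_injective h1) c)

/-- The polynomials over the constants in a function. -/
noncomputable def polyEval {X : Scheme.{0}} (t : X ⟶ base p) {V : X.Opens} (z : Γ(X, V)) :
    Polynomial ℤ_[p] →+* Γ(X, V) :=
  Polynomial.eval₂RingHom (constants t V) z

lemma polyEval_chart_bijective (k : Fin 2) :
    Function.Bijective (polyEval p (projLineStr p) (coord p k)) := by
  have h : polyEval p (projLineStr p) (coord p k) =
      (Proj.awayToSection (MvPolynomial.homogeneousSubmodule (Fin 2) ℤ_[p]) (MvPolynomial.X k)).hom.comp (awayEval ℤ_[p] k) := by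
    refine Polynomial.ringHom_ext (fun c => ?_) ?_
    · exact (Polynomial.eval₂_C _ _).trans ((constants_chart p k c).trans
        (congrArg (Proj.awayToSection (MvPolynomial.homogeneousSubmodule (Fin 2) ℤ_[p]) (MvPolynomial.X k)) (Polynomial.eval₂_C _ _).symm))
    · exact (Polynomial.eval₂_X _ _).trans
        (congrArg (Proj.awayToSection (MvPolynomial.homogeneousSubmodule (Fin 2) ℤ_[p]) (MvPolynomial.X k)) (Polynomial.eval₂_X _ _).symm)
  rw [h]
  have h2 : Function.Bijective (Proj.awayToSection (MvPolynomial.homogeneousSubmodule (Fin 2) ℤ_[p]) (MvPolynomial.X k)) := by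
    rw [← ConcreteCategory.isIso_iff_bijective]
    have := (Proj.basicOpenIsoAway (MvPolynomial.homogeneousSubmodule (Fin 2) ℤ_[p]) (MvPolynomial.X k) (X_mem ℤ_[p] k) one_pos).isIso_hom
    rwa [Proj.basicOpenIsoAway_hom] at this
  exact h2.comp (awayEval_bijective _ k)

lemma exists_mem_chart (x : projLine p) : ∃ k, x ∈ (chart p k).1 := by
  have h := Proj.iSup_basicOpen_eq_top' (MvPolynomial.homogeneousSubmodule (Fin 2) ℤ_[p]) (fun k : Fin 2 => MvPolynomial.X k)
    (fun k => ⟨1, X_mem ℤ_[p] k⟩) (by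
      rw [eq_top_iff]
      intro F _
      induction F using MvPolynomial.induction_on with
      | C c => exact Subalgebra.algebraMap_mem _ (algebraMap ℤ_[p] ((MvPolynomial.homogeneousSubmodule (Fin 2) ℤ_[p]) 0) c)
      | add F G hF hG => exact add_mem (hF trivial) (hG trivial)
      | mul_X F i hF => exact mul_mem (hF trivial) (Algebra.subset_adjoin ⟨i, rfl⟩))
  have hx : x ∈ (⊤ : (projLine p).Opens) := trivial
  rw [← h] at hx
  exact Opens.mem_iSup.mp hx

/-- On the intersection of the two charts, the product of the coordinates is one. -/
lemma coord_mul_coord : (projLine p).presheaf.map (homOfLE (inf_le_left :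
      (chart p 0).1 ⊓ (chart p 1).1 ≤ (chart p 0).1)).op (coord p 0) *
    (projLine p).presheaf.map (homOfLE inf_le_right).op (coord p 1) = 1 := by
  have hU : (chart p 0).1 ⊓ (chart p 1).1 = Proj.basicOpen (MvPolynomial.homogeneousSubmodule (Fin 2) ℤ_[p]) (MvPolynomial.X 0 * MvPolynomial.X 1) :=
    (Proj.basicOpen_mul ..).symm
  have h0 := Proj.awayMap_awayToSection (MvPolynomial.homogeneousSubmodule (Fin 2) ℤ_[p]) (f := MvPolynomial.X 0) (X_mem ℤ_[p] 1) rfl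
  have h1 := Proj.awayMap_awayToSection (MvPolynomial.homogeneousSubmodule (Fin 2) ℤ_[p]) (f := MvPolynomial.X 1) (X_mem ℤ_[p] 0)
    (mul_comm (MvPolynomial.X 0) (MvPolynomial.X 1))
  have h2 : awayMap (MvPolynomial.homogeneousSubmodule (Fin 2) ℤ_[p]) (X_mem ℤ_[p] 1) rfl (awayCoord ℤ_[p] 0) *
      awayMap (MvPolynomial.homogeneousSubmodule (Fin 2) ℤ_[p]) (X_mem ℤ_[p] 0) (mul_comm (MvPolynomial.X 0) (MvPolynomial.X 1))
        (awayCoord ℤ_[p] 1) = 1 := by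
    apply val_injective
    rw [val_mul, val_one, val_awayMap, val_awayMap]
    have h01 := IsLocalization.Away.algebraMap_isUnit (S := Localization.Away
      (MvPolynomial.X 0 * MvPolynomial.X 1 : MvPolynomial (Fin 2) ℤ_[p]))
      (MvPolynomial.X 0 * MvPolynomial.X 1 : MvPolynomial (Fin 2) ℤ_[p])
    have e0 := congr(Localization.awayLift (algebraMap (MvPolynomial (Fin 2) ℤ_[p]) (Localization.Away
      (MvPolynomial.X 0 * MvPolynomial.X 1 : MvPolynomial (Fin 2) ℤ_[p]))) (MvPolynomial.X 0)
      (isUnit_of_dvd_unit (map_dvd _ ⟨_, rfl⟩) h01) $(val_awayCoord ℤ_[p] 0))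
    have e1 := congr(Localization.awayLift (algebraMap (MvPolynomial (Fin 2) ℤ_[p]) (Localization.Away
      (MvPolynomial.X 0 * MvPolynomial.X 1 : MvPolynomial (Fin 2) ℤ_[p]))) (MvPolynomial.X 1)
      (isUnit_of_dvd_unit (map_dvd _ ⟨_, mul_comm _ _⟩) h01) $(val_awayCoord ℤ_[p] 1))
    rw [map_mul, Localization.awayLift, IsLocalization.Away.lift_eq,
      IsLocalization.Away.lift_eq] at e0 e1
    rw [map_mul] at h01
    apply h01.mul_left_cancel
    change _ = algebraMap _ _ (MvPolynomial.X 1) at e0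
    change _ = algebraMap _ _ (MvPolynomial.X 0) at e1
    rw [mul_one, mul_mul_mul_comm]
    refine (congrArg₂ (· * ·) e0 e1).trans (mul_comm _ _)
  have h3 := congr((projLine p).presheaf.map (homOfLE hU.le).op
    (Proj.awayToSection (MvPolynomial.homogeneousSubmodule (Fin 2) ℤ_[p]) (MvPolynomial.X 0 * MvPolynomial.X 1) $h2))
  rw [map_mul, map_mul, map_one, map_one] at h3
  refine Eq.trans ?_ h3
  have h4 := congr($h0 (awayCoord ℤ_[p] 0))
  have h5 := congr($h1 (awayCoord ℤ_[p] 1))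
  refine congrArg₂ (· * ·) ?_ ?_
  · exact (map_map _ _ _).symm.trans congr((projLine p).presheaf.map (homOfLE hU.le).op $(h4.symm))
  · exact (map_map _ _ _).symm.trans congr((projLine p).presheaf.map (homOfLE hU.le).op $(h5.symm))

end ProjectiveLineCharts

/-! ### Polynomials modulo `p` and the ring of the equation `w ∏ (z - b) = p`. -/

section PolynomialAlgebra

open Polynomial

/-- Polynomials vanishing at `u / s`. -/
lemma dvd_of_eval₂_eq_zero {A K : Type*} [CommRing A] [IsDomain A] [Field K] (i : A →+* K)
    (hi : Function.Injective i) (s u : A) (hs : s ≠ 0) (hu : u ≠ 0) (hsu : ∀ a, u ∣ a * s → u ∣ a)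
    (F : A[X]) (hF : F.eval₂ i (i u / i s) = 0) : C s * Polynomial.X - C u ∣ F := by
  have his : i s ≠ 0 := (map_ne_zero_iff i hi).mpr hs
  have hiu : i u ≠ 0 := (map_ne_zero_iff i hi).mpr hu
  induction h : F.natDegree using Nat.strong_induction_on generalizing F with
  | _ n IH =>
  have h1 (G : A[X]) (hG : G.natDegree ≤ n) : ∃ c : A, i c = i s ^ n * G.eval₂ i (i u / i s) := by
    refine ⟨∑ j ∈ Finset.range (n + 1), G.coeff j * u ^ j * s ^ (n - j), ?_⟩
    rw [eval₂_eq_sum_range' i (Nat.lt_succ_of_le hG), map_sum, Finset.mul_sum]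
    refine Finset.sum_congr rfl fun j hj => ?_
    have hj' : j ≤ n := Nat.lt_succ_iff.mp (Finset.mem_range.mp hj)
    obtain ⟨r, rfl⟩ := Nat.exists_eq_add_of_le hj'
    simp only [map_mul, map_pow, add_tsub_cancel_left, div_pow, pow_add]
    field_simp
  have hdec := F.divX_mul_X_add
  -- Multiplying `F(u / s) = 0` by `s ^ (n + 1)` shows that `u` divides the constant coefficient
  -- times a power of `s`. The factors `s` are then removed one at a time by `hsu`.
  have hu0 : u ∣ F.coeff 0 := by
    obtain ⟨c, hc⟩ := h1 F.divX (by rw [natDegree_divX_eq_natDegree_tsub_one]; omega)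
    rw [← hdec, eval₂_add, eval₂_mul, eval₂_X, eval₂_C] at hF
    have h2 : i (u * c + F.coeff 0 * s ^ (n + 1)) = 0 := by
      rw [map_add, map_mul, map_mul, hc, map_pow]
      have h3 := congr($hF * i s ^ (n + 1))
      rw [zero_mul] at h3
      rw [← h3]
      field_simp
      ring
    have h3 : u ∣ F.coeff 0 * s ^ (n + 1) := by
      have h4 := (map_eq_zero_iff i hi).mp h2
      exact ⟨-c, by linear_combination h4⟩
    have h5 : ∀ N, u ∣ F.coeff 0 * s ^ N → u ∣ F.coeff 0 := by
      intro N
      induction N with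
      | zero => simp
      | succ N ih => exact fun h => ih (hsu _ (by rwa [mul_assoc, ← pow_succ]))
    exact h5 _ h3
  obtain ⟨d, hd⟩ := hu0
  -- Adding `d (s T - u)` to `F` kills the constant coefficient `d u`; dividing the result by `T`
  -- gives a polynomial of smaller degree with the same root.
  have hG : F = (F.divX + C (d * s)) * Polynomial.X - C d * (C s * Polynomial.X - C u) := by
    conv_lhs => rw [← hdec, hd]
    simp only [map_mul]
    ring
  have hev : (C s * Polynomial.X - C u).eval₂ i (i u / i s) = 0 := by
    simp only [eval₂_sub, eval₂_mul, eval₂_C, eval₂_X]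
    field_simp
    ring
  have hG0 : (F.divX + C (d * s)).eval₂ i (i u / i s) = 0 := by
    rw [hG, eval₂_sub, eval₂_mul, eval₂_mul, eval₂_X, hev, mul_zero, sub_zero] at hF
    exact (mul_eq_zero.mp hF).resolve_right (div_ne_zero hiu his)
  rw [hG]
  refine dvd_sub (Dvd.dvd.mul_right ?_ _) (Dvd.intro_left _ rfl)
  rcases Nat.eq_zero_or_pos n with hn | hn
  · have : F.divX = 0 := by
      have := eq_C_of_natDegree_eq_zero (h.trans hn)
      rw [this]
      exact divX_C _
    rw [this, zero_add, eval₂_C] at hG0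
    rw [this, (map_eq_zero_iff i hi).mp hG0, map_zero, add_zero]
    exact dvd_zero _
  · refine IH _ ?_ _ hG0 rfl
    refine (natDegree_add_le _ _).trans_lt ?_
    rw [natDegree_C, natDegree_divX_eq_natDegree_tsub_one, max_lt_iff]
    omega

/-- The root can be mapped to `u / s` in the fraction field, and the kernel of this map is the ideal
of `s T - u` by `dvd_of_eval₂_eq_zero`. -/
lemma isDomain_adjoinRoot {A : Type*} [CommRing A] [IsDomain A] (s u : A) (hs : s ≠ 0) (hu : u ≠ 0)
    (hsu : ∀ a, u ∣ a * s → u ∣ a) : IsDomain (AdjoinRoot (C s * Polynomial.X - C u)) := by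
  let i := algebraMap A (FractionRing A)
  have hi : Function.Injective i := IsFractionRing.injective _ _
  have his : i s ≠ 0 := (map_ne_zero_iff i hi).mpr hs
  have hev : (C s * Polynomial.X - C u).eval₂ i (i u / i s) = 0 := by
    simp only [eval₂_sub, eval₂_mul, eval₂_C, eval₂_X]
    field_simp
    ring
  refine Function.Injective.isDomain (AdjoinRoot.lift i (i u / i s) hev) ?_
  rw [injective_iff_map_eq_zero]
  intro a ha
  obtain ⟨F, rfl⟩ := AdjoinRoot.mk_surjective a
  rw [AdjoinRoot.lift_mk] at ha
  exact AdjoinRoot.mk_eq_zero.mpr (dvd_of_eval₂_eq_zero i hi s u hs hu hsu F ha)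

variable (p : ℕ) [Fact p.Prime]

/-- The product of the `T - b` for `0 ≤ b < p`. -/
noncomputable def residuePoly : ℤ_[p][X] := ∏ b ∈ Finset.range p, (Polynomial.X - C (b : ℤ_[p]))

lemma residuePoly_monic : (residuePoly p).Monic := monic_prod_of_monic _ _ fun _ _ => monic_X_sub_C _

lemma eval₂_residuePoly {A : Type*} [CommRing A] (c : ℤ_[p] →+* A) (ζ : A) :
    (residuePoly p).eval₂ c ζ = ∏ b ∈ Finset.range p, (ζ - b) := by
  rw [residuePoly, eval₂_finsetProd]
  simp

lemma C_dvd_iff_map_eq_zero (F : ℤ_[p][X]) :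
    C (p : ℤ_[p]) ∣ F ↔ F.map (PadicInt.toZMod (p := p)) = 0 := by
  rw [C_dvd_iff_dvd_coeff]
  simp only [Polynomial.ext_iff, coeff_map, coeff_zero]
  refine forall_congr' fun j => ?_
  rw [← RingHom.mem_ker, PadicInt.ker_toZMod, PadicInt.maximalIdeal_eq_span_p,
    Ideal.mem_span_singleton]

lemma prime_C_p : Prime (C (p : ℤ_[p])) := Polynomial.prime_C_iff.mpr PadicInt.prime_p

lemma not_C_p_dvd_residuePoly : ¬ C (p : ℤ_[p]) ∣ residuePoly p := by
  rw [C_dvd_iff_map_eq_zero]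
  exact ((residuePoly_monic p).map _).ne_zero

/-- A polynomial vanishing modulo `p` at all integers lies in the ideal `(p, ∏ (T - b))`. -/
lemma exists_eq_of_eval_toZMod (F : ℤ_[p][X])
    (hF : ∀ b ∈ Finset.range p, PadicInt.toZMod (F.eval (b : ℤ_[p])) = 0) :
    ∃ G H : ℤ_[p][X], F = C (p : ℤ_[p]) * G + residuePoly p * H := by
  have hm (b : ℕ) : (Polynomial.X - C (b : ℤ_[p])).map (PadicInt.toZMod (p := p)) =
      Polynomial.X - C (b : ZMod p) := by
    rw [Polynomial.map_sub, map_X, map_C, map_natCast]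
  have h1 : (residuePoly p).map (PadicInt.toZMod (p := p)) ∣ F.map PadicInt.toZMod := by
    -- Modulo `p` the factors `T - b` are pairwise coprime and each divides the reduction of `F`, so
    -- their product does. Lifting the quotient leaves a remainder divisible by `p`.
    rw [residuePoly, Polynomial.map_prod, Finset.prod_congr rfl fun b _ => hm b]
    refine Finset.prod_dvd_of_coprime (s := fun b : ℕ => Polynomial.X - C (b : ZMod p)) ?_ ?_
    · intro b hb c hc hbc
      refine isCoprime_X_sub_C_of_isUnit_sub (IsUnit.mk0 _ fun h => hbc ?_)
      have := congrArg ZMod.val (sub_eq_zero.mp h)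
      rwa [ZMod.val_natCast_of_lt (Finset.mem_range.mp hb),
        ZMod.val_natCast_of_lt (Finset.mem_range.mp hc)] at this
    · intro b hb
      rw [dvd_iff_isRoot, IsRoot.def, ← hF b hb, ← map_natCast (PadicInt.toZMod (p := p)) b,
        eval_map_apply]
  obtain ⟨H, hH⟩ := h1
  obtain ⟨H', rfl⟩ := map_surjective _ (ZMod.ringHom_surjective (PadicInt.toZMod (p := p))) H
  rw [← Polynomial.map_mul, ← sub_eq_zero, ← Polynomial.map_sub, ← C_dvd_iff_map_eq_zero] at hH
  obtain ⟨G, hG⟩ := hH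
  exact ⟨G, H', by rw [← hG]; ring⟩

lemma isUnit_natCast_sub_natCast {A : Type*} [CommRing A] (c : ℤ_[p] →+* A) {a b : ℕ} (ha : a < p)
    (hb : b < p) (hab : a ≠ b) : IsUnit ((a : A) - b) := by
  have h : IsUnit ((a : ℤ_[p]) - b) := by
    by_contra h
    have h1 : (a : ℤ_[p]) - b ∈ IsLocalRing.maximalIdeal ℤ_[p] := h
    rw [← PadicInt.ker_toZMod, RingHom.mem_ker, map_sub, map_natCast, map_natCast, sub_eq_zero] at h1
    have := congrArg ZMod.val h1
    rw [ZMod.val_natCast_of_lt ha, ZMod.val_natCast_of_lt hb] at this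
    exact hab this
  simpa using h.map c

/-- The constant `p` is prime in `ℤ_p[T]` and does not divide the monic polynomial `∏ (T - b)`. -/
lemma isDomain_adjoinRoot_residuePoly :
    IsDomain (AdjoinRoot (C (residuePoly p) * Polynomial.X - C (C (p : ℤ_[p])))) :=
  isDomain_adjoinRoot _ _ (residuePoly_monic p).ne_zero (prime_C_p p).ne_zero fun _ h =>
    ((prime_C_p p).dvd_or_dvd h).resolve_right (not_C_p_dvd_residuePoly p)

end PolynomialAlgebra

/-! ### Smooth rational points and the centre on an affine line. -/

section AffinePoints

lemma exists_eq_toAffine {V : X.Opens} (hV : IsAffineOpen V) {R : CommRingCat.{u}} (g : Spec R ⟶ X)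
    (h : ∀ q, g q ∈ V) : ∃ θ, g = toAffine hV θ := by
  have hr : Set.range g ⊆ Set.range hV.fromSpec := by
    rintro _ ⟨q, rfl⟩
    rw [hV.range_fromSpec]
    exact h q
  obtain ⟨θ, hθ⟩ := Spec.map_surjective (IsOpenImmersion.lift hV.fromSpec g hr)
  exact ⟨θ, by rw [toAffine, hθ, IsOpenImmersion.lift_fac]⟩

lemma toAffine_mem_basicOpen {V : X.Opens} (hV : IsAffineOpen V) {R : CommRingCat.{u}}
    (ψ : Γ(X, V) ⟶ R) (q : Spec R) (f : Γ(X, V)) :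
    toAffine hV ψ q ∈ X.basicOpen f ↔ ψ f ∉ q.asIdeal := by
  change (Spec.map ψ q) ∈ hV.fromSpec ⁻¹ᵁ X.basicOpen f ↔ _
  rw [hV.fromSpec_preimage_basicOpen]
  rfl

lemma toAffine_mem {V : X.Opens} (hV : IsAffineOpen V) {R : CommRingCat.{u}}
    (ψ : Γ(X, V) ⟶ R) (q : Spec R) : toAffine hV ψ q ∈ V :=
  le_toAffine_preimage hV ψ (x := q) trivial

/-- A basic open meets the closure of `Z` only if it meets `Z`, so no knowledge of the closure is
needed. -/
lemma mem_vanishingIdeal_closure (Z : Set X) (V : X.affineOpens) (f : Γ(X, V.1)) :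
    f ∈ (Scheme.IdealSheafData.vanishingIdeal (Closeds.closure Z)).ideal V ↔
      ∀ x ∈ Z, x ∉ X.basicOpen f := by
  have hV : IsAffineOpen V.1 := V.2
  have h1 : f ∈ (Scheme.IdealSheafData.vanishingIdeal (Closeds.closure Z)).ideal V ↔
      ∀ x ∈ closure Z, x ∉ X.basicOpen f := by
    rw [Scheme.IdealSheafData.vanishingIdeal_ideal, PrimeSpectrum.mem_vanishingIdeal]
    constructor
    · intro h x hx hf
      obtain ⟨q, rfl⟩ : x ∈ Set.range hV.fromSpec := by
        rw [hV.range_fromSpec]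
        exact X.basicOpen_le f hf
      change q ∈ hV.fromSpec ⁻¹ᵁ X.basicOpen f at hf
      rw [hV.fromSpec_preimage_basicOpen] at hf
      exact hf (h q hx)
    · intro h q hq
      by_contra hf
      refine h (hV.fromSpec q) hq ?_
      change q ∈ hV.fromSpec ⁻¹ᵁ X.basicOpen f
      rw [hV.fromSpec_preimage_basicOpen]
      exact hf
  rw [h1]
  refine ⟨fun h x hx => h x (subset_closure hx), fun h x hx hf => ?_⟩
  obtain ⟨y, hy, hyZ⟩ := mem_closure_iff.mp hx _ (X.basicOpen f).2 hf
  exact h y hyZ hy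

end AffinePoints

section Centre

variable (p : ℕ) [Fact p.Prime] {X : Scheme.{0}}

lemma exists_hom_of_mem_smoothRationalPoints {t : X ⟶ base p} {V : X.Opens} (hV : IsAffineOpen V) {x : X}
    {σ : specFp p ⟶ specialFibre p t} (hσ : σ ≫ specialFibreStr p t = 𝟙 _)
    (hx : x ∈ Set.range (σ ≫ Limits.pullback.fst t (closedPoint p))) (hxV : x ∈ V) :
    ∃ θ : Γ(X, V) ⟶ CommRingCat.of (ZMod p),
      σ ≫ Limits.pullback.fst t (closedPoint p) = toAffine hV θ ∧
      θ.hom.comp (constants t V) = PadicInt.toZMod := by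
  obtain ⟨q, rfl⟩ := hx
  obtain ⟨θ, hθ⟩ := exists_eq_toAffine hV (σ ≫ Limits.pullback.fst t (closedPoint p)) (fun q' => by
    rwa [Subsingleton.elim q' q])
  refine ⟨θ, hθ, ?_⟩
  have h1 : toAffine hV θ ≫ t = closedPoint p := by
    rw [← hθ, Category.assoc, Limits.pullback.condition, ← Category.assoc, hσ, Category.id_comp]
  rw [constants_toAffine, closedPoint] at h1
  exact congrArg CommRingCat.Hom.hom (Spec.map_injective h1)

lemma smooth_of_polyEval_bijective {t : X ⟶ base p} {V : X.Opens} (hV : IsAffineOpen V) (z : Γ(X, V))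
    (hz : Function.Bijective (polyEval p t z)) : Smooth (V.ι ≫ t) := by
  rw [← ofSections_constants, ofSections]
  have : IsIso V.toSpecΓ := by rw [← hV.isoSpec_hom]; infer_instance
  have : Smooth (Spec.map (CommRingCat.ofHom (constants t V))) := by
    rw [HasRingHomProperty.Spec_iff (P := @Smooth)]
    have h1 : constants t V = (polyEval p t z).comp Polynomial.C := by
      ext c
      exact (Polynomial.eval₂_C _ _).symm
    rw [CommRingCat.hom_ofHom, h1]
    refine RingHom.Smooth.comp ?_ ?_
    · have : Algebra.Smooth ℤ_[p] (Polynomial ℤ_[p]) :=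
        have : Algebra.Smooth ℤ_[p] (MvPolynomial Unit ℤ_[p]) :=
          ⟨inferInstance, inferInstance⟩
        Algebra.Smooth.of_equiv (MvPolynomial.uniqueAlgEquiv ℤ_[p] Unit)
      exact RingHom.smooth_algebraMap.mpr this
    · exact RingHom.smooth_def.mpr ⟨RingHom.FormallySmooth.of_bijective hz,
        RingHom.FinitePresentation.of_bijective hz⟩
  infer_instance

/-- The reduction `θ` defines a section of the special fibre; it lands in the preimage of `V`, which
is smooth over the residue field as a base change of the smooth `V`. -/
lemma mem_smoothRationalPoints {t : X ⟶ base p} {V : X.Opens} (hV : IsAffineOpen V)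
    (hs : Smooth (V.ι ≫ t)) (θ : Γ(X, V) ⟶ CommRingCat.of (ZMod p))
    (hθ : θ.hom.comp (constants t V) = PadicInt.toZMod) (q : specFp p) :
    toAffine hV θ q ∈ smoothRationalPoints p t := by
  have h1 : toAffine hV θ ≫ t = 𝟙 _ ≫ closedPoint p := by
    rw [constants_toAffine, closedPoint, hθ, Category.id_comp]
  refine ⟨Limits.pullback.lift _ _ h1, Limits.pullback.lift_snd _ _ _,
    ⟨Limits.pullback.fst t (closedPoint p) ⁻¹ᵁ V, ?_, ?_⟩, ?_⟩
  · rintro _ ⟨q', rfl⟩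
    change (Limits.pullback.lift _ _ h1 ≫ Limits.pullback.fst t (closedPoint p)) q' ∈ V
    rw [Limits.pullback.lift_fst]
    exact toAffine_mem hV θ q'
  · have h2 := (isPullback_morphismRestrict (Limits.pullback.fst t (closedPoint p)) V).paste_vert
      (IsPullback.of_hasPullback t (closedPoint p))
    exact MorphismProperty.of_isPullback h2 hs
  · rw [Limits.pullback.lift_fst]
    exact ⟨q, rfl⟩

lemma hom_polyEval {t : X ⟶ base p} {V : X.Opens} {A : CommRingCat.{0}} (θ : Γ(X, V) ⟶ A) (z : Γ(X, V))
    (F : Polynomial ℤ_[p]) : θ (polyEval p t z F) =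
      Polynomial.eval₂ (θ.hom.comp (constants t V)) (θ z) F :=
  Polynomial.hom_eval₂ F (constants t V) θ.hom z

/-- The centre of the blow-up, on an open that is an affine line. -/
lemma mem_centre_of_polyEval_bijective (t : X ⟶ base p) (V : X.affineOpens) (z : Γ(X, V.1))
    (hz : Function.Bijective (polyEval p t z)) (F : Polynomial ℤ_[p]) :
    polyEval p t z F ∈ (centre p t).ideal V ↔
      ∀ b ∈ Finset.range p, PadicInt.toZMod (F.eval (b : ℤ_[p])) = 0 := by
  have hV : IsAffineOpen V.1 := V.2
  refine (mem_vanishingIdeal_closure _ V _).trans ?_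
  constructor
  · intro h b hb
    let e := RingEquiv.ofBijective (polyEval p t z) hz
    let θ : Γ(X, V.1) ⟶ CommRingCat.of (ZMod p) := CommRingCat.ofHom
      (((PadicInt.toZMod (p := p)).comp (Polynomial.evalRingHom (b : ℤ_[p]))).comp e.symm.toRingHom)
    have he (G) : θ (polyEval p t z G) = PadicInt.toZMod (G.eval (b : ℤ_[p])) := by
      change PadicInt.toZMod (Polynomial.eval _ (e.symm (e G))) = _
      rw [e.symm_apply_apply]
    have hθ : θ.hom.comp (constants t V.1) = PadicInt.toZMod := by
      ext c
      have h1 := he (Polynomial.C c)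
      rw [Polynomial.eval_C] at h1
      rw [← h1]
      exact congrArg θ (Polynomial.eval₂_C _ _).symm
    have h1 := h _ (mem_smoothRationalPoints p hV (smooth_of_polyEval_bijective p hV z hz) θ hθ
      (⊥ : PrimeSpectrum (ZMod p)))
    have h2 := not_not.mp ((toAffine_mem_basicOpen hV θ _ _).not.mp h1)
    rw [he] at h2
    exact h2
  · rintro h x ⟨σ, hσ, -, hx⟩ hxf
    obtain ⟨θ, h1, h2⟩ := exists_hom_of_mem_smoothRationalPoints p hV hσ hx (X.basicOpen_le _ hxf)
    obtain ⟨q, rfl⟩ := hx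
    rw [h1, toAffine_mem_basicOpen, hom_polyEval, h2] at hxf
    apply hxf
    -- At a rational point `z` takes a residue as its value. Its representative between `0` and `p -
    -- 1` is one of the integers for which the hypothesis is available.
    have h3 : θ z = PadicInt.toZMod (((θ z : ZMod p).val : ℕ) : ℤ_[p]) := by
      rw [map_natCast, ZMod.natCast_val, ZMod.cast_id', id]
    rw [h3, Polynomial.eval₂_at_apply, h _ (Finset.mem_range.mpr (ZMod.val_lt _))]
    exact zero_mem _

end Centre

/-! ### Tangent vectors and the nonsmoothness of nodes. -/

section TruncatedPolynomials

variable (k : Type u) [Field k]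

/-- The ring `k[t] / (t ^ 3)`. -/
abbrev Truncated : Type u := AdjoinRoot (Polynomial.X ^ 3 : Polynomial k)

namespace Truncated

/-- The class of `t`. -/
noncomputable def t : Truncated k := AdjoinRoot.root _

lemma t_pow_three : t k ^ 3 = 0 := by
  have h : AdjoinRoot.mk (Polynomial.X ^ 3 : Polynomial k) (Polynomial.X ^ 3) = t k ^ 3 := by
    rw [map_pow, AdjoinRoot.mk_X]
    rfl
  rw [← h, AdjoinRoot.mk_self]

lemma t_sq_ne_zero : t k ^ 2 ≠ 0 := by
  intro h
  have h1 : AdjoinRoot.mk (Polynomial.X ^ 3 : Polynomial k) (Polynomial.X ^ 2) = 0 := by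
    rw [map_pow, AdjoinRoot.mk_X]
    exact h
  rw [AdjoinRoot.mk_eq_zero] at h1
  have := Polynomial.natDegree_le_of_dvd h1 (pow_ne_zero 2 Polynomial.X_ne_zero)
  simp at this

lemma exists_eq (a : Truncated k) : ∃ (c : k) (a' : Truncated k), a = algebraMap k _ c + t k * a' := by
  obtain ⟨F, rfl⟩ := AdjoinRoot.mk_surjective a
  refine ⟨F.coeff 0, AdjoinRoot.mk _ F.divX, ?_⟩
  conv_lhs => rw [← F.divX_mul_X_add]
  rw [map_add, map_mul, AdjoinRoot.mk_X, AdjoinRoot.mk_C]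
  exact (add_comm _ _).trans congr(_ + $(mul_comm _ _))

/-- The ring `k[t] / (t ^ 2)`. -/
abbrev Dual : Type u := Truncated k ⧸ Ideal.span {t k ^ 2}

/-- The class of `t`. -/
noncomputable def ε : Dual k := Ideal.Quotient.mk _ (t k)

lemma ε_sq : ε k ^ 2 = 0 := by
  rw [ε, ← map_pow, Ideal.Quotient.eq_zero_iff_mem]
  exact Ideal.mem_span_singleton_self _

lemma exists_eq_dual (a : Dual k) : ∃ (c : k) (a' : Dual k), a = algebraMap k _ c + ε k * a' := by
  obtain ⟨a, rfl⟩ := Ideal.Quotient.mk_surjective a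
  obtain ⟨c, a', rfl⟩ := exists_eq k a
  exact ⟨c, Ideal.Quotient.mk _ a', by rw [map_add, map_mul]; rfl⟩

/-- Evaluation at zero. -/
noncomputable def ev : Dual k →+* k :=
  Ideal.Quotient.lift _ (AdjoinRoot.lift (RingHom.id k) 0 (by simp)) (by
    intro a ha
    obtain ⟨b, rfl⟩ := Ideal.mem_span_singleton.mp ha
    rw [map_mul, map_pow, t, AdjoinRoot.lift_root]
    simp)

lemma ev_ε : ev k (ε k) = 0 := by
  rw [ev, ε, Ideal.Quotient.lift_mk, t, AdjoinRoot.lift_root]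

lemma ev_algebraMap (c : k) : ev k (algebraMap k _ c) = c := by
  change ev k (Ideal.Quotient.mk _ (AdjoinRoot.of _ c)) = c
  rw [ev, Ideal.Quotient.lift_mk, AdjoinRoot.lift_of]
  rfl

/-- Since `ε` is nilpotent, the spectrum has a single point. A tangent vector therefore stays inside
any open neighbourhood of its base point. -/
lemma asIdeal_eq (q : PrimeSpectrum (Dual k)) : q.asIdeal = RingHom.ker (ev k) := by
  have hε : ε k ∈ q.asIdeal := q.2.mem_of_pow_mem 2 (by rw [ε_sq]; exact zero_mem _)
  ext a
  rw [RingHom.mem_ker]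
  obtain ⟨c, a', rfl⟩ := exists_eq_dual k a
  rw [map_add, map_mul, ev_ε, zero_mul, add_zero, ev_algebraMap]
  rw [Ideal.add_mem_iff_left _ (Ideal.mul_mem_right _ _ hε)]
  constructor
  · intro h
    by_contra hc
    exact q.2.ne_top (Ideal.eq_top_of_isUnit_mem _ h ((IsUnit.mk0 c hc).map _))
  · rintro rfl
    rw [map_zero]
    exact zero_mem _

end Truncated

end TruncatedPolynomials

section Node

open Truncated

variable (p : ℕ) [Fact p.Prime] {X : Scheme.{0}}

/-- The functions `z` and `w` identify an open with the open subscheme of `w ∏ (z - b) = p` where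
`1 - w ^ (p - 1)` is invertible. -/
structure IsNodeCoord (t : X ⟶ base p) {V : X.Opens} (z w : Γ(X, V)) : Prop where
  mul_eq : w * polyEval p t z (residuePoly p) = p
  isUnit : IsUnit (1 - w ^ (p - 1))
  exists_poly : ∀ f : Γ(X, V), ∃ (e : ℕ) (F : Polynomial (Polynomial ℤ_[p])),
    f * (1 - w ^ (p - 1)) ^ e = F.eval₂ (polyEval p t z) w
  isDomain : IsDomain Γ(X, V)
  exists_hom : ∀ (C : CommRingCat.{0}) (c : ℤ_[p] →+* C) (ζ ω : C),
    ω * (residuePoly p).eval₂ c ζ = p → IsUnit (1 - ω ^ (p - 1)) →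
    ∃ θ : Γ(X, V) ⟶ C, θ.hom.comp (constants t V) = c ∧ θ z = ζ ∧ θ w = ω

variable {p}

/-- Every function becomes a polynomial in `z` and `w` after multiplication by a power of the unit
`1 - w ^ (p - 1)`. -/
lemma IsNodeCoord.hom_ext {t : X ⟶ base p} {V : X.Opens} {z w : Γ(X, V)} (h : IsNodeCoord p t z w)
    {C : CommRingCat.{0}} {θ θ' : Γ(X, V) ⟶ C}
    (hc : θ.hom.comp (constants t V) = θ'.hom.comp (constants t V)) (hz : θ z = θ' z)
    (hw : θ w = θ' w) : θ = θ' := by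
  ext f
  obtain ⟨e, F, hF⟩ := h.exists_poly f
  have h1 : θ (F.eval₂ (polyEval p t z) w) = θ' (F.eval₂ (polyEval p t z) w) := by
    change θ.hom _ = θ'.hom _
    rw [Polynomial.hom_eval₂, Polynomial.hom_eval₂]
    congr 1
    ext c
    · have := congr($hc c)
      simpa [polyEval] using this
    · simpa [polyEval] using hz
  rw [← hF, map_mul, map_mul, map_pow, map_pow, map_sub, map_sub, map_pow, map_pow, hw, map_one,
    map_one] at h1
  refine (IsUnit.pow e ?_).mul_right_cancel h1
  rw [← map_one θ'.hom]
  have := h.isUnit.map θ'.hom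
  rwa [map_sub, map_pow] at this

lemma toAffine_comp {X Y : Scheme.{u}} (f : Y ⟶ X) {V : X.Opens} {W : Y.Opens} (hV : IsAffineOpen V) (hW : IsAffineOpen W)
    (h : W ≤ f ⁻¹ᵁ V) {R : CommRingCat.{u}} (ψ : Γ(Y, W) ⟶ R) :
    toAffine hW ψ ≫ f = toAffine hV (f.appLE V W h ≫ ψ) := by
  rw [toAffine, toAffine, Spec.map_comp, Category.assoc, Category.assoc,
    IsAffineOpen.SpecMap_appLE_fromSpec f hV hW h]

lemma natCast_truncated_eq_zero : (p : Truncated (ZMod p)) = 0 := by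
  rw [← map_natCast (algebraMap (ZMod p) (Truncated (ZMod p))), ZMod.natCast_self, map_zero]

lemma natCast_dual_eq_zero : (p : Dual (ZMod p)) = 0 := by
  rw [← map_natCast (algebraMap (ZMod p) (Dual (ZMod p))), ZMod.natCast_self, map_zero]

/-- Of the factors `T - b`, only the one with `b ≡ β` becomes divisible by `t`, with the unit `d` as
quotient; the others have nonzero constant term and are units, as `t` is nilpotent. -/
lemma eval₂_residuePoly_truncated (c : ℤ_[p] →+* Truncated (ZMod p)) (β : ZMod p)
    (d : Truncated (ZMod p)) (hd : IsUnit d) : ∃ u : Truncated (ZMod p), IsUnit u ∧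
      (residuePoly p).eval₂ c (algebraMap _ _ β + t (ZMod p) * d) = t (ZMod p) * u := by
  have hβ : (β.val : Truncated (ZMod p)) = algebraMap _ _ β := by
    rw [← map_natCast (algebraMap (ZMod p) (Truncated (ZMod p))), ZMod.natCast_val,
      ZMod.cast_id', id]
  rw [eval₂_residuePoly, ← Finset.mul_prod_erase _ _ (Finset.mem_range.mpr (ZMod.val_lt β)), hβ]
  refine ⟨d * ∏ b ∈ (Finset.range p).erase β.val, (algebraMap _ _ β + t (ZMod p) * d - b),
    hd.mul ?_, by ring⟩
  rw [IsUnit.prod_iff]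
  intro b hb
  rw [Finset.mem_erase, Finset.mem_range] at hb
  have h1 : IsUnit ((β.val : Truncated (ZMod p)) - b) :=
    isUnit_natCast_sub_natCast p c (ZMod.val_lt β) hb.2 hb.1.symm
  rw [hβ] at h1
  have h2 : IsNilpotent (t (ZMod p) * d) :=
    ⟨3, by rw [mul_pow, t_pow_three, zero_mul]⟩
  have := h2.isUnit_add_left_of_commute h1 (Commute.all _ _)
  have e : algebraMap (ZMod p) (Truncated (ZMod p)) β + t (ZMod p) * d - b =
      t (ZMod p) * d + (algebraMap (ZMod p) (Truncated (ZMod p)) β - b) := by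
    rw [add_comm, add_sub_assoc]
  rw [e, add_comm]
  exact this

/-- A node is not smooth over the residue field. -/
lemma IsNodeCoord.not_mem_smoothRationalPoints {t' : X ⟶ base p} {V : X.Opens} {z w : Γ(X, V)}
    (h : IsNodeCoord p t' z w) (hV : IsAffineOpen V) (x : X) (hxV : x ∈ V) :
    x ∉ smoothRationalPoints p t' := by
  rintro ⟨σ, hσ, ⟨W, hσW, hW⟩, hx⟩
  obtain ⟨θ, hθ, hθc⟩ := exists_hom_of_mem_smoothRationalPoints p hV hσ hx hxV
  -- A nonzero residue satisfies `w ^ (p - 1) = 1` by Fermat, which is excluded because `1 - w ^ (p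
  -- - 1)` is invertible.
  have hw : θ w = 0 := by
    by_contra hw
    have h1 := h.isUnit.map θ.hom
    have h2 : (θ w : ZMod p) ^ (p - 1) = 1 := ZMod.pow_card_sub_one_eq_one hw
    rw [map_sub, map_one, map_pow] at h1
    change IsUnit (1 - (θ w : ZMod p) ^ (p - 1)) at h1
    rw [h2, sub_self] at h1
    exact not_isUnit_zero h1
  set β : ZMod p := θ z
  -- a tangent vector
  have hc : ∃ τ : Γ(X, V) ⟶ CommRingCat.of (Dual (ZMod p)),
      τ.hom.comp (constants t' V) = (algebraMap (ZMod p) (Dual (ZMod p))).comp PadicInt.toZMod ∧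
      τ z = algebraMap (ZMod p) _ β + ε (ZMod p) ∧ τ w = ε (ZMod p) := by
    refine h.exists_hom (CommRingCat.of (Dual (ZMod p))) _ _ _ ?_ ?_
    · obtain ⟨u, -, hu⟩ := eval₂_residuePoly_truncated
        ((algebraMap (ZMod p) (Truncated (ZMod p))).comp PadicInt.toZMod) β 1 isUnit_one
      have h1 := congr(Ideal.Quotient.mk (Ideal.span {t (ZMod p) ^ 2}) $hu)
      rw [Polynomial.hom_eval₂, map_mul, mul_one, map_add] at h1
      refine Eq.trans ?_ natCast_dual_eq_zero.symm
      refine (congrArg (ε (ZMod p) * ·) h1).trans ?_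
      change ε (ZMod p) * (ε (ZMod p) * _) = 0
      rw [← mul_assoc, ← sq, ε_sq, zero_mul]
    · have h2 : IsNilpotent (ε (ZMod p)) := ⟨2, ε_sq _⟩
      exact (h2.pow_of_pos (Nat.sub_ne_zero_of_lt (Fact.out : p.Prime).one_lt)).isUnit_one_sub
  obtain ⟨τ, hτc, hτz, hτw⟩ := hc
  let a : CommRingCat.of (ZMod p) ⟶ CommRingCat.of (Dual (ZMod p)) :=
    CommRingCat.ofHom (algebraMap (ZMod p) (Dual (ZMod p)))
  let r : CommRingCat.of (Dual (ZMod p)) ⟶ CommRingCat.of (ZMod p) := CommRingCat.ofHom (ev (ZMod p))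
  have har : a ≫ r = 𝟙 _ := by
    ext c
    exact ev_algebraMap _ c
  -- The tangent vector with direction `(1, 1)` in `(z, w)`, transversal to both branches of the
  -- node, is based at the given rational point.
  have hτr : τ ≫ r = θ := by
    refine h.hom_ext ?_ ?_ ?_
    · rw [CommRingCat.hom_comp, RingHom.comp_assoc, hτc, hθc, ← RingHom.comp_assoc]
      exact congr(RingHom.comp (CommRingCat.Hom.hom $har) PadicInt.toZMod)
    · change ev (ZMod p) (τ z) = _
      rw [hτz, map_add, ev_ε, ev_algebraMap, add_zero]
    · change ev (ZMod p) (τ w) = _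
      rw [hτw, ev_ε, hw]
  have h1 : toAffine hV τ ≫ t' = Spec.map a ≫ closedPoint p := by
    rw [constants_toAffine, closedPoint, hτc, ← Spec.map_comp]
    rfl
  let g := Limits.pullback.lift _ _ h1
  have hgσ : Spec.map r ≫ g = σ := by
    apply Limits.pullback.hom_ext
    · rw [Category.assoc, Limits.pullback.lift_fst, hθ, toAffine, ← Category.assoc, ← Spec.map_comp,
        hτr]
      rfl
    · rw [Category.assoc, Limits.pullback.lift_snd, ← Spec.map_comp, har, Spec.map_id]
      exact hσ.symm
  have hpt (q : Spec (CommRingCat.of (Dual (ZMod p)))) :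
      g q = σ (⊥ : PrimeSpectrum (ZMod p)) := by
    rw [← hgσ]
    have : q = Spec.map r (⊥ : PrimeSpectrum (ZMod p)) := by
      apply PrimeSpectrum.ext
      exact (asIdeal_eq _ q).trans rfl
    rw [this]
    rfl
  -- an affine neighbourhood that is smooth
  have hσV : σ (⊥ : PrimeSpectrum (ZMod p)) ∈ W ⊓ Limits.pullback.fst t' (closedPoint p) ⁻¹ᵁ V := by
    refine ⟨hσW ⟨_, rfl⟩, ?_⟩
    change (σ ≫ Limits.pullback.fst t' (closedPoint p)) (⊥ : PrimeSpectrum (ZMod p)) ∈ V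
    rw [hθ]
    exact toAffine_mem hV θ _
  obtain ⟨W', hW', hσW', hle⟩ := exists_isAffineOpen_mem_and_subset hσV
  have hle1 : W' ≤ W := fun _ hx => (hle hx).1
  have hle2 : W' ≤ Limits.pullback.fst t' (closedPoint p) ⁻¹ᵁ V := fun _ hx => (hle hx).2
  have hsm : (constants (specialFibreStr p t') W').Smooth := by
    have h2 : Smooth (W'.ι ≫ specialFibreStr p t') := by
      have := smooth_comp ((specialFibre p t').homOfLE hle1) (W.ι ≫ specialFibreStr p t')
      rwa [← Category.assoc, Scheme.homOfLE_ι] at this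
    rw [← ofSections_constants, ofSections] at h2
    have : IsIso W'.toSpecΓ := by rw [← IsAffineOpen.isoSpec_hom hW']; infer_instance
    have h3 := smooth_comp (inv W'.toSpecΓ) (W'.toSpecΓ ≫
      Spec.map (CommRingCat.ofHom (constants (specialFibreStr p t') W')))
    rw [IsIso.inv_hom_id_assoc, HasRingHomProperty.Spec_iff (P := @Smooth)] at h3
    exact h3
  obtain ⟨ρ, hρ⟩ := exists_eq_toAffine hW' g (fun q => by rw [hpt]; exact hσW')
  have hτρ : τ = (Limits.pullback.fst t' (closedPoint p)).appLE V W' hle2 ≫ ρ := by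
    apply toAffine_injective hV
    rw [← toAffine_comp _ hV hW' hle2, ← hρ, Limits.pullback.lift_fst]
  -- the tangent vector lifts
  obtain ⟨ρ', hρ'⟩ : ∃ ρ' : Γ(specialFibre p t', W') →+* Truncated (ZMod p),
      (Ideal.Quotient.mk (Ideal.span {Truncated.t (ZMod p) ^ 2})).comp ρ' = ρ.hom := by
    algebraize [constants (specialFibreStr p t') W']
    let ρa : Γ(specialFibre p t', W') →ₐ[ZMod p] Dual (ZMod p) :=
      { ρ.hom with commutes' := fun c => congr($(Subsingleton.elim (ρ.hom.comp
          (algebraMap (ZMod p) Γ(specialFibre p t', W'))) (algebraMap (ZMod p) (Dual (ZMod p)))) c) }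
    obtain ⟨l, hl⟩ := Algebra.FormallySmooth.exists_lift (Ideal.span {Truncated.t (ZMod p) ^ 2})
      ⟨2, by
        have h4 : (Truncated.t (ZMod p) ^ 2) ^ 2 = 0 := by
          linear_combination Truncated.t (ZMod p) * t_pow_three (ZMod p)
        rw [Ideal.span_singleton_pow, h4, Ideal.span_singleton_eq_bot.mpr rfl]
        rfl⟩ ρa
    exact ⟨l.toRingHom, RingHom.ext fun x => congr($hl x)⟩
  let κ := ρ'.comp ((Limits.pullback.fst t' (closedPoint p)).appLE V W' hle2).hom
  have hκ (f) : Ideal.Quotient.mk (Ideal.span {Truncated.t (ZMod p) ^ 2}) (κ f) = τ f := by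
    rw [hτρ]
    exact congr($hρ' _)
  have hκw : ∃ d, κ w = Truncated.t (ZMod p) * (1 + Truncated.t (ZMod p) * d) := by
    have h2 := hκ w
    rw [hτw, ε, Ideal.Quotient.mk_eq_mk_iff_sub_mem] at h2
    obtain ⟨d, hd⟩ := Ideal.mem_span_singleton.mp h2
    exact ⟨d, by linear_combination hd⟩
  have hκz : ∃ d, κ z = algebraMap (ZMod p) _ β +
      Truncated.t (ZMod p) * (1 + Truncated.t (ZMod p) * d) := by
    have h2 := hκ z
    have h3 : Ideal.Quotient.mk (Ideal.span {Truncated.t (ZMod p) ^ 2})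
        (algebraMap (ZMod p) _ β + Truncated.t (ZMod p)) = τ z := by
      rw [hτz, map_add]
      rfl
    rw [← h3, Ideal.Quotient.mk_eq_mk_iff_sub_mem] at h2
    obtain ⟨d, hd⟩ := Ideal.mem_span_singleton.mp h2
    exact ⟨d, by linear_combination hd⟩
  have hunit (d) : IsUnit (1 + Truncated.t (ZMod p) * d) :=
    IsNilpotent.isUnit_one_add ⟨3, by rw [mul_pow, t_pow_three, zero_mul]⟩
  obtain ⟨d, hd⟩ := hκw
  obtain ⟨d', hd'⟩ := hκz
  obtain ⟨u, hu, hu'⟩ := eval₂_residuePoly_truncated (κ.comp (constants t' V)) β _ (hunit d')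
  -- For the lift to `𝔽_p[t] / (t ^ 3)`, both `w` and `∏ (z - b)` are `t` times a unit. The relation
  -- `w ∏ (z - b) = p = 0` would then give `t ^ 2 = 0`.
  have h3 := congr(κ $h.mul_eq)
  rw [map_mul, map_natCast, natCast_truncated_eq_zero, polyEval, Polynomial.coe_eval₂RingHom,
    Polynomial.hom_eval₂, hd', hu', hd] at h3
  have h4 : Truncated.t (ZMod p) ^ 2 * ((1 + Truncated.t (ZMod p) * d) * u) = 0 := by
    rw [← h3]
    ring
  exact t_sq_ne_zero (ZMod p) ((((hunit d).mul hu).mul_left_eq_zero).mp h4)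

/-- The centre of the blow-up does not meet the nodes. -/
lemma IsNodeCoord.centre_ideal {t : X ⟶ base p} {V : X.affineOpens} {z w : Γ(X, V.1)}
    (h : IsNodeCoord p t z w) : (centre p t).ideal V = ⊤ := by
  rw [Ideal.eq_top_iff_one]
  refine (mem_vanishingIdeal_closure _ V _).mpr fun x hx hx1 => ?_
  exact h.not_mem_smoothRationalPoints V.2 x (X.basicOpen_le _ hx1) hx

end Node

/-! ### The two kinds of charts of the models. -/

section Charts

variable {p : ℕ} [Fact p.Prime] {X Y : Scheme.{0}}

variable (p) in
/-- The chart `V`, on which `x = a + p ^ m z` for the coordinate `x` of the chart `k` of the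
projective line, is an affine line with coordinate `z`. -/
structure IsDiscChart (π : X ⟶ projLine p) (k : Fin 2) (m a : ℕ) (V : X.affineOpens)
    (z : Γ(X, V.1)) : Prop where
  le : V.1 ≤ π ⁻¹ᵁ (chart p k).1
  coord_eq : π.appLE _ V.1 le (coord p k) = a + p ^ m * z
  bijective : Function.Bijective (polyEval p (π ≫ projLineStr p) z)

variable (p) in
/-- The chart `V`, on which `x = a + p ^ m z` for the coordinate `x` of the chart `k` of the
projective line, is a neighbourhood of nodes with coordinates `z`, `w`. -/
structure IsNodeChart (π : X ⟶ projLine p) (k : Fin 2) (m a : ℕ) (V : X.affineOpens)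
    (z w : Γ(X, V.1)) : Prop where
  le : V.1 ≤ π ⁻¹ᵁ (chart p k).1
  coord_eq : π.appLE _ V.1 le (coord p k) = a + p ^ m * z
  isNodeCoord : IsNodeCoord p (π ≫ projLineStr p) z w

lemma polyEval_C (t : X ⟶ base p) {V : X.Opens} (z : Γ(X, V)) (c : ℤ_[p]) :
    polyEval p t z (Polynomial.C c) = constants t V c := Polynomial.eval₂_C _ _

lemma polyEval_X (t : X ⟶ base p) {V : X.Opens} (z : Γ(X, V)) :
    polyEval p t z Polynomial.X = z := Polynomial.eval₂_X _ _

lemma appLE_polyEval (f : Y ⟶ X) (t : X ⟶ base p) {V : X.Opens} {W : Y.Opens} (h : W ≤ f ⁻¹ᵁ V)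
    (z : Γ(X, V)) (F : Polynomial ℤ_[p]) :
    f.appLE V W h (polyEval p t z F) = polyEval p (f ≫ t) (f.appLE V W h z) F := by
  rw [hom_polyEval]
  congr 1
  ext c
  exact appLE_constants f t h c

lemma map_polyEval (t : X ⟶ base p) {V W : X.Opens} (h : W ≤ V)
    (z : Γ(X, V)) (F : Polynomial ℤ_[p]) :
    X.presheaf.map (homOfLE h).op (polyEval p t z F) =
      polyEval p t (X.presheaf.map (homOfLE h).op z) F := by
  rw [hom_polyEval]
  congr 1
  ext c
  exact map_constants t h c

lemma comp_appLE_apply {Z : Scheme.{u}} {X Y : Scheme.{u}} (f : Y ⟶ X) (g : X ⟶ Z) {U : Z.Opens} {V : X.Opens} {W : Y.Opens}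
    (hV : V ≤ g ⁻¹ᵁ U) (hW : W ≤ f ⁻¹ᵁ V) (hW' : W ≤ (f ≫ g) ⁻¹ᵁ U) (a : Γ(Z, U)) :
    (f ≫ g).appLE U W hW' a = f.appLE V W hW (g.appLE U V hV a) :=
  congr($(Scheme.Hom.appLE_comp_appLE f g U V W hV hW) a).symm

lemma IsNodeCoord.of_bijective {t : X ⟶ base p} {V : X.Opens} {z w : Γ(X, V)}
    (h : IsNodeCoord p t z w) (f : Y ⟶ X) {W : Y.Opens} (hW : W ≤ f ⁻¹ᵁ V)
    (hf : IsIso (f.appLE V W hW)) :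
    IsNodeCoord p (f ≫ t) (f.appLE V W hW z) (f.appLE V W hW w) := by
  have hb : Function.Bijective (f.appLE V W hW) := (ConcreteCategory.isIso_iff_bijective _).mp hf
  refine ⟨?_, ?_, ?_, ?_, ?_⟩
  · rw [← appLE_polyEval, ← map_mul, h.mul_eq, map_natCast]
  · have := h.isUnit.map (f.appLE V W hW).hom
    rwa [map_sub, map_one, map_pow] at this
  · intro g
    obtain ⟨g, rfl⟩ := hb.2 g
    obtain ⟨e, F, hF⟩ := h.exists_poly g
    refine ⟨e, F, ?_⟩
    have := congr(f.appLE V W hW $hF)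
    rw [map_mul, map_pow, map_sub, map_one, map_pow] at this
    rw [this]
    refine (Polynomial.hom_eval₂ F _ (f.appLE V W hW).hom w).trans ?_
    congr 1
    ext G
    · simpa [polyEval] using appLE_constants f t hW G
    · simp [polyEval]
  · have := h.isDomain
    exact (RingEquiv.ofBijective (f.appLE V W hW).hom hb).symm.injective.isDomain
      (RingEquiv.ofBijective (f.appLE V W hW).hom hb).symm.toRingHom
  · intro C c ζ ω h1 h2
    obtain ⟨θ, hc, hz, hw⟩ := h.exists_hom C c ζ ω h1 h2
    refine ⟨inv (f.appLE V W hW) ≫ θ, ?_, ?_, ?_⟩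
    · rw [← hc]
      ext x
      change θ (inv (f.appLE V W hW) (constants (f ≫ t) W x)) = θ (constants t V x)
      rw [← appLE_constants f t hW]
      exact congr(θ ($(IsIso.hom_inv_id (f.appLE V W hW)) _))
    · rw [← hz]
      exact congr(θ ($(IsIso.hom_inv_id (f.appLE V W hW)) _))
    · rw [← hw]
      exact congr(θ ($(IsIso.hom_inv_id (f.appLE V W hW)) _))

variable (p) in
/-- The algebra `ℤ_p[z, w] / (w ∏ (z - b) - p)`. -/
abbrev NodeRing : Type :=
  AdjoinRoot (Polynomial.C (residuePoly p) * Polynomial.X - Polynomial.C (Polynomial.C (p : ℤ_[p])))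

variable (p) in
lemma nodeRing_root_mul : AdjoinRoot.of (Polynomial.C (residuePoly p) * Polynomial.X -
    Polynomial.C (Polynomial.C (p : ℤ_[p]))) (residuePoly p) * AdjoinRoot.root _ = (p : NodeRing p) := by
  have h := AdjoinRoot.mk_self (f := Polynomial.C (residuePoly p) * Polynomial.X -
    Polynomial.C (Polynomial.C (p : ℤ_[p])))
  rw [map_sub, map_mul, AdjoinRoot.mk_X, AdjoinRoot.mk_C, AdjoinRoot.mk_C, sub_eq_zero] at h
  rw [h]
  simp

-- The element takes the value `1` at the `𝔽_p`-point `z = w = 0`; the exponent `p - 1` is positive.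
variable (p) in
lemma one_sub_nodeRing_root_ne_zero : (1 - AdjoinRoot.root (Polynomial.C (residuePoly p) *
    Polynomial.X - Polynomial.C (Polynomial.C (p : ℤ_[p]))) ^ (p - 1)) ≠ 0 := by
  intro h
  have h1 : (Polynomial.C (residuePoly p) * Polynomial.X -
      Polynomial.C (Polynomial.C (p : ℤ_[p]))).eval₂
      ((PadicInt.toZMod (p := p)).comp (Polynomial.evalRingHom 0)) 0 = 0 := by
    simp
  have h2 := congr(AdjoinRoot.lift _ _ h1 $h)
  rw [map_sub, map_one, map_pow, AdjoinRoot.lift_root, map_zero,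
    zero_pow (Nat.sub_ne_zero_of_lt (Fact.out : p.Prime).one_lt), sub_zero] at h2
  exact one_ne_zero h2

/-- This is the passage from the full chart of the blow-up, with ring `NodeRing`, to the part on
which `1 - w ^ (p - 1)` is invertible. The rational points with `w ≠ 0` are thereby discarded; they
are covered by discs. -/
lemma isNodeCoord_basicOpen {t : Y ⟶ base p} {W : Y.Opens} (hW : IsAffineOpen W)
    (θ : CommRingCat.of (NodeRing p) ⟶ Γ(Y, W)) (hθ : IsIso θ)
    (hc : θ.hom.comp ((AdjoinRoot.of _).comp Polynomial.C) = constants t W) :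
    IsNodeCoord p t
      (Y.presheaf.map (homOfLE (Y.basicOpen_le (1 - θ (AdjoinRoot.root _) ^ (p - 1)))).op
        (θ (AdjoinRoot.of _ Polynomial.X)))
      (Y.presheaf.map (homOfLE (Y.basicOpen_le (1 - θ (AdjoinRoot.root _) ^ (p - 1)))).op
        (θ (AdjoinRoot.root _))) := by
  have hb : Function.Bijective θ := (ConcreteCategory.isIso_iff_bijective _).mp hθ
  set s := 1 - θ (AdjoinRoot.root _) ^ (p - 1) with hs
  have hpoly : polyEval p t (θ (AdjoinRoot.of _ Polynomial.X)) = θ.hom.comp (AdjoinRoot.of _) := by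
    refine Polynomial.ringHom_ext (fun c => ?_) ?_
    · rw [polyEval_C, ← hc]
      rfl
    · rw [polyEval_X]
      rfl
  have hdom := isDomain_adjoinRoot_residuePoly p
  have hdomW : IsDomain Γ(Y, W) :=
    (RingEquiv.ofBijective θ.hom hb).symm.injective.isDomain
      (RingEquiv.ofBijective θ.hom hb).symm.toRingHom
  have hs0 : s ≠ 0 := by
    intro h
    have h1 : θ (1 - AdjoinRoot.root _ ^ (p - 1)) = θ 0 := by
      rw [map_sub, map_one, map_pow, map_zero]
      exact h
    exact one_sub_nodeRing_root_ne_zero p (hb.1 h1)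
  let ρ := Y.presheaf.map (homOfLE (Y.basicOpen_le s)).op
  have hloc := hW.isLocalization_basicOpen s
  have hρ (f) : algebraMap Γ(Y, W) Γ(Y, Y.basicOpen s) f = ρ f := rfl
  have hρs : ρ s = 1 - ρ (θ (AdjoinRoot.root _)) ^ (p - 1) :=
    (congrArg ρ hs).trans (by rw [map_sub, map_one, map_pow])
  refine ⟨?_, ?_, ?_, ?_, ?_⟩
  · rw [← map_polyEval, hpoly, ← map_mul]
    have h1 : ρ (θ (AdjoinRoot.of _ (residuePoly p) * AdjoinRoot.root _)) = p := by
      rw [nodeRing_root_mul]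
      exact (congrArg ρ (map_natCast θ.hom p)).trans (map_natCast ρ.hom p)
    rw [mul_comm]
    exact (congrArg ρ (map_mul θ.hom _ _).symm).trans h1
  · have h1 := IsLocalization.Away.algebraMap_isUnit (S := Γ(Y, Y.basicOpen s)) s
    rw [hρ, hρs] at h1
    exact h1
  · intro f
    obtain ⟨n, g, hg⟩ := IsLocalization.Away.surj s f
    obtain ⟨g, rfl⟩ := hb.2 g
    obtain ⟨F, rfl⟩ := AdjoinRoot.mk_surjective g
    refine ⟨n, F, ?_⟩
    rw [hρ, hρ, hρs] at hg
    refine hg.trans ?_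
    have h1 : AdjoinRoot.mk (Polynomial.C (residuePoly p) * Polynomial.X -
        Polynomial.C (Polynomial.C (p : ℤ_[p]))) F =
        F.eval₂ (AdjoinRoot.of _) (AdjoinRoot.root _) :=
      (AdjoinRoot.aeval_eq F).symm.trans
        (by rw [Polynomial.aeval_def, AdjoinRoot.algebraMap_eq])
    rw [h1]
    refine (congrArg ρ (Polynomial.hom_eval₂ F _ θ.hom _)).trans
      ((Polynomial.hom_eval₂ F _ ρ.hom _).trans ?_)
    congr 1
    rw [← hpoly]
    ext G
    · simpa [polyEval] using map_constants t _ G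
    · simp [polyEval, ρ]
  · exact IsLocalization.isDomain_of_le_nonZeroDivisors (R := Γ(Y, W)) (M := Submonoid.powers s) _
      (powers_le_nonZeroDivisors_of_noZeroDivisors hs0)
  · intro C c ζ ω h1 h2
    have h3 : (Polynomial.C (residuePoly p) * Polynomial.X -
        Polynomial.C (Polynomial.C (p : ℤ_[p]))).eval₂ (Polynomial.eval₂RingHom c ζ) ω = 0 := by
      simp only [Polynomial.eval₂_sub, Polynomial.eval₂_mul, Polynomial.eval₂_C, Polynomial.eval₂_X,
        Polynomial.coe_eval₂RingHom, map_natCast]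
      rw [mul_comm, h1, Polynomial.eval₂_natCast, sub_self]
    let θ₁ : Γ(Y, W) →+* C := (AdjoinRoot.lift _ _ h3).comp (inv θ).hom
    have hinv (x) : inv θ (θ x) = x := congr($(IsIso.hom_inv_id θ) x)
    have hu : IsUnit (θ₁ s) := by
      rw [hs, map_sub, map_one, map_pow]
      change IsUnit (1 - AdjoinRoot.lift _ _ h3 (inv θ (θ _)) ^ (p - 1))
      rw [hinv, AdjoinRoot.lift_root]
      exact h2
    let θ₂ : Γ(Y, Y.basicOpen s) →+* C := IsLocalization.Away.lift s hu
    have hθ₂ (f) : θ₂ (ρ f) = θ₁ f := IsLocalization.Away.lift_eq s hu f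
    refine ⟨CommRingCat.ofHom θ₂, ?_, ?_, ?_⟩
    · ext x
      change θ₂ (constants t _ x) = _
      rw [← map_constants t (Y.basicOpen_le s), hθ₂, ← hc]
      change AdjoinRoot.lift _ _ h3 (inv θ (θ _)) = _
      rw [hinv, RingHom.comp_apply, AdjoinRoot.lift_of]
      simp
    · refine (hθ₂ _).trans ?_
      change AdjoinRoot.lift _ _ h3 (inv θ (θ _)) = _
      rw [hinv, AdjoinRoot.lift_of]
      simp
    · refine (hθ₂ _).trans ?_
      change AdjoinRoot.lift _ _ h3 (inv θ (θ _)) = _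
      rw [hinv, AdjoinRoot.lift_root]

end Charts

/-! ### The charts after one blow-up. -/

section LocalRing

/-- In a local ring, if two elements generate a principal ideal with a nonzerodivisor as generator,
one of them divides the other. If `p` divides the product of the `ζ - j`, at most one factor is not
a unit, since the factors differ by units, and `p` divides that factor; if all are units, so is `p`.
If the product divides `p` with quotient `ω` and `1 - ω ^ (p - 1)` is not a unit, then `ω` is a unit
and the first case applies again. -/
lemma dvd_sub_or_exists_of_span_eq {p : ℕ} [Fact p.Prime] {L : Type*} [CommRing L] [IsLocalRing L]
    (c : ℤ_[p] →+* L) (ζ γ : L) (hγ : γ ∈ nonZeroDivisors L)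
    (h : Ideal.span {(p : L), (residuePoly p).eval₂ c ζ} = Ideal.span {γ}) :
    (∃ j < p, (p : L) ∣ ζ - j) ∨ ∃ ω, (residuePoly p).eval₂ c ζ * ω = p ∧ IsUnit (1 - ω ^ (p - 1)) := by
  have hp1 := (Fact.out : p.Prime).one_lt
  have key (h : (p : L) ∣ (residuePoly p).eval₂ c ζ) : ∃ j < p, (p : L) ∣ ζ - j := by
    rw [eval₂_residuePoly] at h
    by_cases hu : ∀ j ∈ Finset.range p, IsUnit (ζ - (j : L))
    · exact ⟨0, by omega, (isUnit_of_dvd_unit h (IsUnit.prod_iff.mpr hu)).dvd⟩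
    · push Not at hu
      obtain ⟨j, hj, hju⟩ := hu
      refine ⟨j, Finset.mem_range.mp hj, ?_⟩
      rw [← Finset.mul_prod_erase _ _ hj] at h
      refine (IsUnit.dvd_mul_right (IsUnit.prod_iff.mpr fun i hi => ?_)).mp h
      rw [Finset.mem_erase, Finset.mem_range] at hi
      by_contra hiu
      refine IsLocalRing.nonunits_add (a := ζ - (j : L)) (b := -(ζ - (i : L))) hju
        (by rwa [mem_nonunits_iff, IsUnit.neg_iff]) ?_
      have := isUnit_natCast_sub_natCast p c hi.2 (Finset.mem_range.mp hj) hi.1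
      convert this using 1
      ring
  obtain ⟨α, hα⟩ := Ideal.mem_span_singleton.mp
    (h ▸ Ideal.subset_span (by simp) : (p : L) ∈ Ideal.span {γ})
  obtain ⟨β, hβ⟩ := Ideal.mem_span_singleton.mp
    (h ▸ Ideal.subset_span (by simp) : (residuePoly p).eval₂ c ζ ∈ Ideal.span {γ})
  obtain ⟨x, y, hxy⟩ := Ideal.mem_span_pair.mp
    (h.symm ▸ Ideal.mem_span_singleton_self γ :
      γ ∈ Ideal.span {(p : L), (residuePoly p).eval₂ c ζ})
  have h1 : x * α + y * β = 1 := by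
    refine (mul_cancel_left_mem_nonZeroDivisors hγ).mp ?_
    rw [hα, hβ] at hxy
    linear_combination hxy
  rcases IsLocalRing.isUnit_or_isUnit_of_add_one h1 with hu | hu
  · refine .inl (key ?_)
    obtain ⟨α', rfl⟩ := isUnit_of_mul_isUnit_right hu
    exact ⟨↑α'⁻¹ * β, by rw [hα, hβ, mul_assoc, Units.mul_inv_cancel_left]⟩
  · obtain ⟨β', rfl⟩ := isUnit_of_mul_isUnit_right hu
    have hω : (residuePoly p).eval₂ c ζ * (↑β'⁻¹ * α) = p := by
      rw [hα, hβ, mul_assoc, Units.mul_inv_cancel_left]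
    by_cases hv : IsUnit (1 - (↑β'⁻¹ * α) ^ (p - 1))
    · exact .inr ⟨_, hω, hv⟩
    · refine .inl (key ?_)
      have h2 := (IsLocalRing.isUnit_or_isUnit_of_add_one
        (sub_add_cancel 1 ((↑β'⁻¹ * α) ^ (p - 1)))).resolve_left hv
      obtain ⟨ω', hω'⟩ := (isUnit_pow_iff (by omega)).mp h2
      rw [← hω'] at hω
      exact ⟨↑ω'⁻¹, by rw [← hω, mul_assoc, Units.mul_inv, mul_one]⟩

end LocalRing

section BlowUpStep

variable {p : ℕ} [Fact p.Prime] {X Y : Scheme.{0}} {π : X ⟶ projLine p} {b : Y ⟶ X}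
  (hb : IsBlowUp b (centre p (π ≫ projLineStr p)))

lemma exists_ringEquiv_of_bijective {t : X ⟶ base p} {V : X.Opens} {z : Γ(X, V)}
    (hz : Function.Bijective (polyEval p t z)) :
    ∃ e : Γ(X, V) →+* Polynomial ℤ_[p], Function.Bijective e ∧ (∀ F, e (polyEval p t z F) = F) ∧
      ∀ f, polyEval p t z (e f) = f :=
  ⟨(RingEquiv.ofBijective _ hz).symm.toRingHom, (RingEquiv.ofBijective _ hz).symm.bijective,
    (RingEquiv.ofBijective _ hz).symm_apply_apply, (RingEquiv.ofBijective _ hz).apply_symm_apply⟩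

lemma ringHom_ext_of_bijective {t : X ⟶ base p} {V : X.Opens} {z : Γ(X, V)}
    (hz : Function.Bijective (polyEval p t z)) {A : Type*} [CommRing A] {ψ ψ' : Γ(X, V) →+* A}
    (hc : ∀ c, ψ (constants t V c) = ψ' (constants t V c)) (h : ψ z = ψ' z) : ψ = ψ' := by
  have h1 : ψ.comp (polyEval p t z) = ψ'.comp (polyEval p t z) := by
    refine Polynomial.ringHom_ext (fun c => ?_) ?_
    · simpa [polyEval_C] using hc c
    · simpa [polyEval_X] using h
  ext f
  obtain ⟨F, rfl⟩ := hz.2 f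
  exact congr($h1 F)

lemma le_comp_preimage {V : X.Opens} {W : Y.Opens} {U : (projLine p).Opens} (hV : V ≤ π ⁻¹ᵁ U)
    (h : W ≤ b ⁻¹ᵁ V) : W ≤ (b ≫ π) ⁻¹ᵁ U := fun _ hx => hV (h hx)

include hb

/-- The chart of the blow-up of an affine line along which `p` divides `z - c`. -/
lemma IsDiscChart.exists_disc {k : Fin 2} {m a : ℕ} {V : X.affineOpens} {z : Γ(X, V.1)}
    (h : IsDiscChart p π k m a V z) (c : ℕ) (hc : c < p) :
    ∃ (W : Y.affineOpens) (z' : Γ(Y, W.1)), IsDiscChart p (b ≫ π) k (m + 1) (a + p ^ m * c) W z' ∧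
      ∀ (y : Y) (hy : y ∈ b ⁻¹ᵁ V.1),
        Y.presheaf.germ (b ⁻¹ᵁ V.1) y hy (b.app V.1 (z - c)) ∈
          Ideal.span {Y.presheaf.germ (b ⁻¹ᵁ V.1) y hy (b.app V.1 p)} → y ∈ W.1 := by
  set t := π ≫ projLineStr p with ht
  have hz := h.bijective
  obtain ⟨e, he, he1, he2⟩ := exists_ringEquiv_of_bijective hz
  let B : CommRingCat.{0} := CommRingCat.of (Polynomial ℤ_[p])
  -- The ring of the chart is again `ℤ_p[T]`, where `T` stands for `(z - c) / p`: the map from the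
  -- functions on `V` is the substitution `z = c + p T`.
  let τ : Polynomial ℤ_[p] →+* Polynomial ℤ_[p] :=
    Polynomial.eval₂RingHom Polynomial.C ((c : Polynomial ℤ_[p]) + (p : Polynomial ℤ_[p]) * Polynomial.X)
  let φ : Γ(X, V.1) ⟶ B := CommRingCat.ofHom (τ.comp e)
  have hφ (F) : φ (polyEval p t z F) = τ F := congrArg τ (he1 F)
  have hφp : φ (p : Γ(X, V.1)) = Polynomial.C (p : ℤ_[p]) :=
    (map_natCast φ.hom p).trans (map_natCast Polynomial.C p).symm
  have hφz : φ z = ((c : Polynomial ℤ_[p]) + (p : Polynomial ℤ_[p]) * Polynomial.X) := by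
    rw [← polyEval_X t z, hφ]
    exact Polynomial.eval₂_X _ _
  have hφc (x) : φ (constants t V.1 x) = Polynomial.C x := by
    rw [← polyEval_C t z, hφ]
    exact Polynomial.eval₂_C _ _
  have hmem (F) := mem_centre_of_polyEval_bijective p t V z hz F
  -- The auxiliary element of `IsBlowUp.exists_chart`: the product of the other factors `z - j`, so
  -- that `v (z - c) = ∏ (z - b)` lies in the centre.
  let v : Polynomial ℤ_[p] := ∏ j ∈ (Finset.range p).erase c, (Polynomial.X - Polynomial.C (j : ℤ_[p]))
  have hv : v * (Polynomial.X - Polynomial.C (c : ℤ_[p])) = residuePoly p :=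
    Finset.prod_erase_mul _ _ (Finset.mem_range.mpr hc)
  have hres (j) (hj : j ∈ Finset.range p) : (residuePoly p).eval (j : ℤ_[p]) = 0 := by
    rw [residuePoly, Polynomial.eval_prod]
    exact Finset.prod_eq_zero hj (by simp)
  have hpoly : ∀ (C : CommRingCat.{0}) (ψ : Γ(X, V.1) ⟶ C) (x : C),
      ψ (p : Γ(X, V.1)) * x = ψ (z - c) → ∃ θ : B ⟶ C, φ ≫ θ = ψ ∧ θ (Polynomial.X : Polynomial ℤ_[p]) = x := by
    intro C ψ x hx
    let θ : Polynomial ℤ_[p] →+* C := Polynomial.eval₂RingHom (ψ.hom.comp (constants t V.1)) x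
    refine ⟨CommRingCat.ofHom θ, CommRingCat.hom_ext (ringHom_ext_of_bijective hz ?_ ?_), ?_⟩
    · intro y
      refine (congrArg θ (hφc y)).trans ?_
      exact Polynomial.eval₂_C _ _
    · refine (congrArg θ hφz).trans ?_
      rw [map_add, map_mul, map_natCast, map_natCast]
      change _ + _ * Polynomial.eval₂ _ _ Polynomial.X = _
      rw [Polynomial.eval₂_X]
      rw [map_sub] at hx
      have h1 : ψ (p : Γ(X, V.1)) = p := map_natCast ψ.hom p
      have h2 : ψ (c : Γ(X, V.1)) = c := map_natCast ψ.hom c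
      rw [h1, h2] at hx
      rw [hx]
      exact add_sub_cancel _ _
    · exact Polynomial.eval₂_X _ _
  obtain ⟨W, hW, θ, hθ, hφθ, hcov⟩ := hb.exists_chart V φ (p : Γ(X, V.1)) (z - c)
    (polyEval p t z v) (by
      have h1 := (hmem (p : Polynomial ℤ_[p])).mpr fun j _ => by simp
      rwa [map_natCast] at h1) (Polynomial.X : Polynomial ℤ_[p])
    (by
      rw [hφp, map_sub, hφz]
      have h2 : φ (c : Γ(X, V.1)) = (c : Polynomial ℤ_[p]) := map_natCast φ.hom c
      rw [h2, map_natCast]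
      exact (add_sub_cancel_left _ _).symm) hpoly
    (by
      intro C θ θ' h1 h2
      apply CommRingCat.hom_ext
      refine Polynomial.ringHom_ext (fun x => ?_) h2
      rw [← hφc]
      exact congr($h1 _))
    (by
      rw [hφp]
      exact mem_nonZeroDivisors_of_ne_zero (prime_C_p p).ne_zero)
    (by
      rw [Ideal.map_le_iff_le_comap]
      intro f hf
      obtain ⟨F, rfl⟩ := hz.2 f
      obtain ⟨G, H, rfl⟩ := exists_eq_of_eval_toZMod p F ((hmem F).mp hf)
      rw [Ideal.mem_comap, Ideal.mem_span_singleton]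
      change φ (p : Γ(X, V.1)) ∣ φ _
      rw [hφp, hφ, map_add, map_mul, map_mul, ← hv, map_mul, map_sub]
      have h1 (x) : τ (Polynomial.C x) = Polynomial.C x := Polynomial.eval₂_C _ _
      have h2 : τ Polynomial.X = ((c : Polynomial ℤ_[p]) + (p : Polynomial ℤ_[p]) * Polynomial.X) := Polynomial.eval₂_X _ _
      rw [h1, h1, h2, map_natCast, map_natCast, add_sub_cancel_left]
      exact dvd_add (Dvd.intro _ rfl) (Dvd.dvd.mul_right (Dvd.dvd.mul_left (Dvd.intro _ rfl) _) _))
    (by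
      have h1 := (hmem (residuePoly p)).mpr fun j hj => by rw [hres j hj, map_zero]
      rw [← hv, map_mul, map_sub, polyEval_X, map_natCast, map_natCast] at h1
      exact h1)
    (by
      rw [hφp, hφ, map_prod]
      -- After the substitution, `z - j` is `(c - j) + p T`, and `c - j` is a unit of `ℤ_p`.
      refine IsCoprime.prod_left fun j hj => ?_
      rw [Finset.mem_erase, Finset.mem_range] at hj
      have h1 (x) : τ (Polynomial.C x) = Polynomial.C x := Polynomial.eval₂_C _ _
      have h2 : τ Polynomial.X = ((c : Polynomial ℤ_[p]) + (p : Polynomial ℤ_[p]) * Polynomial.X) := Polynomial.eval₂_X _ _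
      rw [map_sub, h1, h2, map_natCast, map_natCast, add_sub_right_comm]
      have h3 := isUnit_natCast_sub_natCast p (Polynomial.C (R := ℤ_[p])) hc hj.2 hj.1.symm
      exact (isCoprime_one_left.of_isCoprime_of_dvd_left h3.dvd).add_mul_left_left _)
  have hθb : Function.Bijective θ := (ConcreteCategory.isIso_iff_bijective _).mp hθ
  have hφθ' (f) : θ (φ f) = b.appLE V.1 W.1 hW f := congr($hφθ f)
  refine ⟨W, θ (Polynomial.X : Polynomial ℤ_[p]), ⟨le_comp_preimage h.le hW, ?_, ?_⟩, hcov⟩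
  · rw [comp_appLE_apply b π h.le hW, h.coord_eq, ← hφθ', map_add, map_mul, hφz]
    have h1 (j : ℕ) : θ (φ (j : Γ(X, V.1))) = j :=
      (congrArg θ (map_natCast φ.hom j)).trans (map_natCast θ.hom j)
    have h2 (j : ℕ) : θ (j : Polynomial ℤ_[p]) = j := map_natCast θ.hom j
    rw [map_pow, map_add, map_mul, map_pow, map_add, map_mul, h1, h1, h2, h2]
    push_cast
    ring
  · have h1 : polyEval p ((b ≫ π) ≫ projLineStr p) (θ (Polynomial.X : Polynomial ℤ_[p])) = θ.hom := by
      refine Polynomial.ringHom_ext (fun x => ?_) ?_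
      · rw [polyEval_C, Category.assoc, ← appLE_constants b t hW, ← hφθ', hφc]
      · rw [polyEval_X]
    rw [h1]
    exact hθb

/-- The chart of the blow-up of an affine line along which `∏ (z - b)` divides `p`. -/
lemma IsDiscChart.exists_node {k : Fin 2} {m a : ℕ} {V : X.affineOpens} {z : Γ(X, V.1)}
    (h : IsDiscChart p π k m a V z) :
    ∃ (W : Y.affineOpens) (z' w : Γ(Y, W.1)), IsNodeChart p (b ≫ π) k m a W z' w ∧
      ∀ (y : Y) (hy : y ∈ b ⁻¹ᵁ V.1) (ω : Y.presheaf.stalk y),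
        Y.presheaf.germ (b ⁻¹ᵁ V.1) y hy (b.app V.1 (polyEval p (π ≫ projLineStr p) z
          (residuePoly p))) * ω = Y.presheaf.germ (b ⁻¹ᵁ V.1) y hy (b.app V.1 p) →
        IsUnit (1 - ω ^ (p - 1)) → y ∈ W.1 := by
  set t := π ≫ projLineStr p with ht
  have hz := h.bijective
  obtain ⟨e, he, he1, he2⟩ := exists_ringEquiv_of_bijective hz
  have hdom : IsDomain (NodeRing p) := isDomain_adjoinRoot_residuePoly p
  let B : CommRingCat.{0} := CommRingCat.of (NodeRing p)
  let ι : Polynomial ℤ_[p] →+* NodeRing p := AdjoinRoot.of _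
  let ρ : NodeRing p := AdjoinRoot.root _
  have hρ : ι (residuePoly p) * ρ = (p : NodeRing p) := nodeRing_root_mul p
  have hι : ι (Polynomial.C (p : ℤ_[p])) = (p : NodeRing p) :=
    (congrArg ι (map_natCast Polynomial.C p)).trans (map_natCast ι p)
  let φ : Γ(X, V.1) ⟶ B := CommRingCat.ofHom (ι.comp e)
  have hφ (F) : φ (polyEval p t z F) = ι F := congrArg ι (he1 F)
  have hφp : φ (p : Γ(X, V.1)) = (p : NodeRing p) := map_natCast φ.hom p
  have hmem (F) := mem_centre_of_polyEval_bijective p t V z hz F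
  have hres (j) (hj : j ∈ Finset.range p) : (residuePoly p).eval (j : ℤ_[p]) = 0 := by
    rw [residuePoly, Polynomial.eval_prod]
    exact Finset.prod_eq_zero hj (by simp)
  have hp0 : (p : NodeRing p) ≠ 0 := by
    intro h0
    have h1 : AdjoinRoot.mk (Polynomial.C (residuePoly p) * Polynomial.X -
        Polynomial.C (Polynomial.C (p : ℤ_[p]))) (Polynomial.C (Polynomial.C (p : ℤ_[p]))) = 0 := by
      rw [map_natCast, map_natCast, map_natCast]
      exact h0
    rw [AdjoinRoot.mk_eq_zero] at h1
    have h2 : (Polynomial.C (residuePoly p) * Polynomial.X -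
        Polynomial.C (Polynomial.C (p : ℤ_[p]))).natDegree = 1 := by
      rw [Polynomial.natDegree_sub_C, Polynomial.natDegree_C_mul_X _ (residuePoly_monic p).ne_zero]
    have h3 := Polynomial.natDegree_le_of_dvd h1
      (Polynomial.C_ne_zero.mpr (prime_C_p p).ne_zero)
    rw [h2, Polynomial.natDegree_C] at h3
    omega
  have hP0 : ι (residuePoly p) ≠ 0 := fun h0 => hp0 (by rw [← hρ, h0, zero_mul])
  -- Here `s = ∏ (z - b)` and `u = p`, and the adjoined quotient is `w`. As `u` itself lies in the
  -- centre, `v = 1` works.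
  obtain ⟨W, hW, θ, hθ, hφθ, hcov⟩ := hb.exists_chart V φ (polyEval p t z (residuePoly p))
    (p : Γ(X, V.1)) 1
    ((hmem (residuePoly p)).mpr fun j hj => by rw [hres j hj, map_zero]) ρ
    (by rw [hφp, hφ]; exact hρ)
    (by
      intro C ψ x hx
      have h1 : (Polynomial.C (residuePoly p) * Polynomial.X -
          Polynomial.C (Polynomial.C (p : ℤ_[p]))).eval₂ (ψ.hom.comp (polyEval p t z)) x = 0 := by
        simp only [Polynomial.eval₂_sub, Polynomial.eval₂_mul, Polynomial.eval₂_C,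
          Polynomial.eval₂_X, map_natCast]
        rw [sub_eq_zero]
        exact hx.trans ((map_natCast ψ.hom p).trans (Polynomial.eval₂_natCast _ _ _).symm)
      refine ⟨CommRingCat.ofHom (AdjoinRoot.lift _ x h1), ?_, AdjoinRoot.lift_root h1⟩
      ext f
      refine (AdjoinRoot.lift_of h1).trans ?_
      exact congrArg ψ (he2 f))
    (by
      intro C θ θ' h1 h2
      apply CommRingCat.hom_ext
      refine AdjoinRoot.ringHom_ext (RingHom.ext fun F => ?_) h2
      have := congr($h1 (polyEval p t z F))
      change θ (φ _) = θ' (φ _) at this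
      rwa [hφ] at this)
    (by
      rw [hφ]
      exact mem_nonZeroDivisors_of_ne_zero hP0)
    (by
      rw [Ideal.map_le_iff_le_comap]
      intro f hf
      obtain ⟨F, rfl⟩ := hz.2 f
      obtain ⟨G, H, rfl⟩ := exists_eq_of_eval_toZMod p F ((hmem F).mp hf)
      rw [Ideal.mem_comap, Ideal.mem_span_singleton]
      change φ _ ∣ φ _
      rw [hφ, hφ, map_add, map_mul, map_mul, hι, ← hρ, mul_assoc]
      exact dvd_add (Dvd.intro _ rfl) (Dvd.intro _ rfl))
    (by
      have h1 := (hmem (p : Polynomial ℤ_[p])).mpr fun j _ => by simp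
      rwa [map_natCast, ← one_mul (p : Γ(X, V.1))] at h1)
    (by
      rw [map_one]
      exact isCoprime_one_left)
  have hW' : IsAffineOpen W.1 := W.2
  have hθb : Function.Bijective θ := (ConcreteCategory.isIso_iff_bijective _).mp hθ
  have hφθ' (f) : θ (φ f) = b.appLE V.1 W.1 hW f := congr($hφθ f)
  have hc : θ.hom.comp ((AdjoinRoot.of _).comp Polynomial.C) = constants (b ≫ t) W.1 := by
    ext x
    rw [← appLE_constants b t hW, ← hφθ', ← polyEval_C t z, hφ]
    rfl
  have hnode := isNodeCoord_basicOpen hW' θ hθ hc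
  set r := Y.presheaf.map (homOfLE (Y.basicOpen_le (1 - θ (AdjoinRoot.root _) ^ (p - 1)))).op
  have hle : Y.basicOpen (1 - θ (AdjoinRoot.root _) ^ (p - 1)) ≤ b ⁻¹ᵁ V.1 :=
    (Y.basicOpen_le _).trans hW
  refine ⟨⟨_, hW'.basicOpen (1 - θ (AdjoinRoot.root _) ^ (p - 1))⟩, r (θ (AdjoinRoot.of _ Polynomial.X)),
    r (θ (AdjoinRoot.root _)),
    ⟨le_comp_preimage h.le hle, ?_, ?_⟩, ?_⟩
  · rw [comp_appLE_apply b π h.le hle, h.coord_eq]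
    have h1 : θ (AdjoinRoot.of _ Polynomial.X) = b.appLE V.1 W.1 hW z := by
      rw [← hφθ', ← polyEval_X t z, hφ]
    rw [h1, appLE_map_apply]
    have h2 (j : ℕ) : b.appLE V.1 _ hle (j : Γ(X, V.1)) = j := map_natCast (b.appLE V.1 _ hle).hom j
    rw [map_add, map_mul, map_pow, h2, h2]
  · rw [Category.assoc]
    exact hnode
  · intro y hy ω hω hu
    have hyW : y ∈ W.1 := hcov y hy (by rw [← hω]; exact Ideal.mem_span_singleton.mpr (Dvd.intro _ rfl))
    change y ∈ Y.basicOpen _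
    rw [Y.mem_basicOpen _ y hyW]
    have hg (f : Γ(X, V.1)) : Y.presheaf.germ W.1 y hyW (θ (φ f)) =
        Y.presheaf.germ (b ⁻¹ᵁ V.1) y hy (b.app V.1 f) := by
      rw [hφθ', germ_appLE]
    have h1 : θ (ι (residuePoly p)) ∈ nonZeroDivisors Γ(Y, W.1) := by
      have hd : IsDomain Γ(Y, W.1) := (RingEquiv.ofBijective θ.hom hθb).symm.injective.isDomain
        (RingEquiv.ofBijective θ.hom hθb).symm.toRingHom
      refine mem_nonZeroDivisors_of_ne_zero fun h0 => hP0 (hθb.1 ?_)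
      rw [h0]
      exact (map_zero θ.hom).symm
    have h2 := germ_mem_nonZeroDivisors hW' h1 y hyW
    -- The quotient of `p` by `∏ (z - b)` is unique, because the image of `∏ (z - b)` is a
    -- nonzerodivisor; so `ω` is the germ of `w`.
    have h3 : ω = Y.presheaf.germ W.1 y hyW (θ ρ) := by
      rw [← hg, ← hg, hφ, hφp, ← hρ] at hω
      refine (mul_cancel_left_mem_nonZeroDivisors h2).mp (hω.trans ?_)
      exact (congrArg _ (map_mul θ.hom _ _)).trans (map_mul (Y.presheaf.germ W.1 y hyW).hom _ _)
    rw [h3] at hu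
    have h4 : Y.presheaf.germ W.1 y hyW (1 - θ ρ ^ (p - 1)) =
        1 - Y.presheaf.germ W.1 y hyW (θ ρ) ^ (p - 1) := by rw [map_sub, map_one, map_pow]
    exact (congrArg IsUnit h4).mpr hu

/-- The blow-up is an isomorphism above the nodes. -/
lemma IsNodeChart.exists_node {k : Fin 2} {m a : ℕ} {V : X.affineOpens} {z w : Γ(X, V.1)}
    (h : IsNodeChart p π k m a V z w) :
    ∃ (W : Y.affineOpens) (z' w' : Γ(Y, W.1)), IsNodeChart p (b ≫ π) k m a W z' w' ∧
      b ⁻¹ᵁ V.1 ≤ W.1 := by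
  have htop := h.isNodeCoord.centre_ideal
  -- Degenerate use of the chart lemma: the centre is the unit ideal here, so `s = 1`, and `u = v =
  -- 0` adjoins nothing. The divisibility locus is everything above `V`.
  obtain ⟨W, hW, θ, hθ, hφθ, hcov⟩ := hb.exists_chart V (φ := 𝟙 Γ(X, V.1)) 1 0 0
    (by rw [htop]; exact Submodule.mem_top) 0 (by simp)
    (by
      intro C ψ c hc
      refine ⟨ψ, Category.id_comp _, ?_⟩
      rw [map_one, one_mul] at hc
      rw [hc, map_zero])
    (by
      intro C θ θ' h1 _
      simpa using h1)
    (by simp [one_mem]) (by simp)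
    (by simp) (by simpa using isCoprime_one_right)
  rw [Category.id_comp] at hφθ
  subst hφθ
  refine ⟨W, b.appLE V.1 W.1 hW z, b.appLE V.1 W.1 hW w, ⟨le_comp_preimage h.le hW, ?_, ?_⟩, ?_⟩
  rotate_left
  · rw [Category.assoc]
    exact h.isNodeCoord.of_bijective b hW hθ
  · intro y hy
    refine hcov y hy ?_
    rw [map_zero, map_zero]
    exact zero_mem _
  · rw [comp_appLE_apply b π h.le hW, h.coord_eq]
    have h2 (j : ℕ) : b.appLE V.1 _ hW (j : Γ(X, V.1)) = j := map_natCast (b.appLE V.1 _ hW).hom j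
    rw [map_add, map_mul, map_pow, h2, h2]


/-- The charts of the blow-up of an affine line cover it. -/
lemma IsDiscChart.exists_mem {k : Fin 2} {m a : ℕ} {V : X.affineOpens} {z : Γ(X, V.1)}
    (h : IsDiscChart p π k m a V z) (y : Y) (hy : y ∈ b ⁻¹ᵁ V.1) :
    (∃ c < p, ∃ (W : Y.affineOpens) (z' : Γ(Y, W.1)),
      IsDiscChart p (b ≫ π) k (m + 1) (a + p ^ m * c) W z' ∧ y ∈ W.1) ∨
    ∃ (W : Y.affineOpens) (z' w : Γ(Y, W.1)), IsNodeChart p (b ≫ π) k m a W z' w ∧ y ∈ W.1 := by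
  obtain ⟨γ, hγ, e⟩ := exists_stalk_generator hb.invertible V y hy
  have hz := h.bijective
  set σ := b.app V.1 ≫ Y.presheaf.germ (b ⁻¹ᵁ V.1) y hy
  have hσ (f) : Y.presheaf.germ (b ⁻¹ᵁ V.1) y hy (b.app V.1 f) = σ f := rfl
  have hmem (F) := mem_centre_of_polyEval_bijective p (π ≫ projLineStr p) V z hz F
  have hI : (centre p (π ≫ projLineStr p)).ideal V = Ideal.span {(p : Γ(X, V.1)),
      polyEval p (π ≫ projLineStr p) z (residuePoly p)} := by
    apply le_antisymm
    · intro f hf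
      obtain ⟨F, rfl⟩ := hz.2 f
      obtain ⟨G, H, rfl⟩ := exists_eq_of_eval_toZMod p F ((hmem F).mp hf)
      rw [map_add, map_mul, map_mul, map_natCast, map_natCast]
      exact add_mem (Ideal.mul_mem_right _ _ (Ideal.subset_span (by simp)))
        (Ideal.mul_mem_right _ _ (Ideal.subset_span (by simp)))
    · rw [Ideal.span_le]
      rintro f (rfl | rfl)
      · have h1 := (hmem (p : Polynomial ℤ_[p])).mpr fun j _ => by simp
        rwa [map_natCast] at h1
      · refine (hmem (residuePoly p)).mpr fun j hj => ?_
        rw [residuePoly, Polynomial.eval_prod, Finset.prod_eq_zero hj (by simp), map_zero]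
  have hp : σ (p : Γ(X, V.1)) = p := map_natCast σ.hom p
  rw [hI, Ideal.map_span, Set.image_pair] at e
  have hP : σ (polyEval p (π ≫ projLineStr p) z (residuePoly p)) =
      (residuePoly p).eval₂ (σ.hom.comp (constants (π ≫ projLineStr p) V.1)) (σ z) :=
    Polynomial.hom_eval₂ _ _ σ.hom _
  have e' : Ideal.span {(p : Y.presheaf.stalk y), (residuePoly p).eval₂
      (σ.hom.comp (constants (π ≫ projLineStr p) V.1)) (σ z)} = Ideal.span {γ} := by
    rw [← hP, ← hp]
    exact e
  -- On the blow-up the centre `(p, ∏ (z - b))` becomes principal in the stalk, and the dichotomy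
  -- for local rings decides which chart contains the point.
  rcases dvd_sub_or_exists_of_span_eq _ _ γ hγ e' with ⟨c, hc, hd⟩ | ⟨ω, hω, hu⟩
  · obtain ⟨W, z', hW, hcov⟩ := h.exists_disc hb c hc
    refine .inl ⟨c, hc, W, z', hW, hcov y hy ?_⟩
    have h2 : σ (c : Γ(X, V.1)) = c := map_natCast σ.hom c
    rw [hσ, hσ, hp, map_sub, h2]
    exact Ideal.mem_span_singleton.mpr hd
  · obtain ⟨W, z', w, hW, hcov⟩ := h.exists_node hb
    refine .inr ⟨W, z', w, hW, hcov y hy ω ?_ hu⟩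
    rw [hσ, hσ, hP, hp, hω]

end BlowUpStep

/-! ### Transcendental values of coordinates, and the common properties of charts. -/

section PolynomialAlgebra

variable (p : ℕ) [Fact p.Prime]

/-- Clearing denominators, a relation `F(ζ) = 0` becomes a polynomial relation for `ξ = a + s ζ`. If
`s` is a zero of `c`, the scaled polynomial is still nonzero when `F` is, so no condition on `s` is
needed. -/
lemma injective_eval₂_of_eq {A K : Type*} [CommRing A] [IsDomain A] [Field K] (c : A →+* K)
    {ξ ζ : K} (s a : A) (h : ξ = c a + c s * ζ)
    (hξ : Function.Injective (Polynomial.eval₂RingHom c ξ)) :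
    Function.Injective (Polynomial.eval₂RingHom c ζ) := by
  rw [injective_iff_map_eq_zero]
  intro F hF
  have h1 : Polynomial.eval₂RingHom c ξ
      ((Polynomial.scaleRoots F s).comp (Polynomial.X - Polynomial.C a)) = 0 := by
    rw [Polynomial.coe_eval₂RingHom, Polynomial.eval₂_comp, Polynomial.eval₂_sub,
      Polynomial.eval₂_X, Polynomial.eval₂_C, h, add_sub_cancel_left,
      Polynomial.scaleRoots_eval₂_mul]
    rw [Polynomial.coe_eval₂RingHom] at hF
    rw [hF, mul_zero]
  have h2 := (injective_iff_map_eq_zero _).mp hξ _ h1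
  rw [sub_eq_add_neg, ← Polynomial.C_neg, Polynomial.comp_X_add_C_eq_zero_iff] at h2
  by_contra h3
  exact Polynomial.scaleRoots_ne_zero h3 s h2

/-- A relation for `ξ⁻¹` becomes a relation for `ξ` with the reversed polynomial. -/
lemma injective_eval₂_inv {A K : Type*} [CommRing A] [Field K] (c : A →+* K) {ξ : K} (h0 : ξ ≠ 0)
    (hξ : Function.Injective (Polynomial.eval₂RingHom c ξ)) :
    Function.Injective (Polynomial.eval₂RingHom c ξ⁻¹) := by
  rw [injective_iff_map_eq_zero]
  intro F hF
  have : Invertible (ξ⁻¹) := invertibleOfNonzero (inv_ne_zero h0)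
  have h1 := (Polynomial.eval₂_reverse_eq_zero_iff c ξ⁻¹ F).mpr hF
  rw [invOf_eq_inv, inv_inv] at h1
  exact Polynomial.reverse_eq_zero.mp ((injective_iff_map_eq_zero _).mp hξ _ h1)

/-- Each `w` is absorbed by one factor `P`, through `w P = p`. Thus functions on a node chart become
fractions in `z` alone. -/
lemma exists_pow_mul_eval₂_eq {A : Type*} [CommRing A] (ε : Polynomial ℤ_[p] →+* A) (w P : A)
    (P' : Polynomial ℤ_[p]) (hP : ε P' = P) (h : w * P = p) (F : Polynomial (Polynomial ℤ_[p])) :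
    ∃ (N : ℕ) (G : Polynomial ℤ_[p]), P ^ N * F.eval₂ ε w = ε G := by
  induction F using Polynomial.induction_on' with
  | add F F' hF hF' =>
    obtain ⟨N, G, e⟩ := hF
    obtain ⟨N', G', e'⟩ := hF'
    refine ⟨N + N', P' ^ N' * G + P' ^ N * G', ?_⟩
    rw [map_add, map_mul, map_mul, map_pow, map_pow, hP, ← e, ← e', Polynomial.eval₂_add]
    ring
  | monomial i a =>
    refine ⟨i, a * (p : Polynomial ℤ_[p]) ^ i, ?_⟩
    rw [Polynomial.eval₂_monomial, map_mul, map_pow, map_natCast, ← h]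
    ring

end PolynomialAlgebra

section CoordCharts

variable (p : ℕ) [Fact p.Prime] {X : Scheme.{0}}

/-- The common properties of the two kinds of charts. -/
structure IsCoordChart (π : X ⟶ projLine p) (k : Fin 2) (m a : ℕ) (V : X.affineOpens)
    (z : Γ(X, V.1)) : Prop where
  le : V.1 ≤ π ⁻¹ᵁ (chart p k).1
  coord_eq : π.appLE _ V.1 le (coord p k) = a + p ^ m * z
  isDomain : IsDomain Γ(X, V.1)
  exists_mul : ∀ f : Γ(X, V.1), ∃ s G : Polynomial ℤ_[p], ¬ Polynomial.C (p : ℤ_[p]) ∣ s ∧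
    f * polyEval p (π ≫ projLineStr p) z s = polyEval p (π ≫ projLineStr p) z G
  exists_hom : ∀ (K : Type) [Field K] (c : ℤ_[p] →+* K) (ζ : K),
    Function.Injective (Polynomial.eval₂RingHom c ζ) → ∃ θ : Γ(X, V.1) →+* K,
      θ.comp (constants (π ≫ projLineStr p) V.1) = c ∧ θ z = ζ

variable {p} {π : X ⟶ projLine p} {k : Fin 2} {m a : ℕ} {V : X.affineOpens}

lemma IsDiscChart.isCoordChart {z : Γ(X, V.1)} (h : IsDiscChart p π k m a V z) :
    IsCoordChart p π k m a V z := by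
  obtain ⟨e, he, he1, he2⟩ := exists_ringEquiv_of_bijective h.bijective
  refine ⟨h.le, h.coord_eq, he.1.isDomain e, fun f => ?_, fun K _ c ζ hζ => ?_⟩
  · obtain ⟨F, rfl⟩ := h.bijective.2 f
    refine ⟨1, F, fun h1 => (prime_C_p p).not_isUnit (isUnit_of_dvd_one h1), ?_⟩
    rw [map_one, mul_one]
  · refine ⟨(Polynomial.eval₂RingHom c ζ).comp e, ?_, ?_⟩
    · ext x
      rw [RingHom.comp_apply, ← polyEval_C _ z, RingHom.comp_apply, he1]
      exact Polynomial.eval₂_C _ _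
    · conv_lhs => rw [← polyEval_X (π ≫ projLineStr p) z]
      rw [RingHom.comp_apply, he1]
      exact Polynomial.eval₂_X _ _

/-- Denominators in `w` are eliminated by powers of `P = ∏ (z - b)`, and `P ^ (p - 1) (1 - w ^ (p -
1)) = P ^ (p - 1) - p ^ (p - 1)`. Neither `P` nor this difference is divisible by `p`, so the
denominators stay prime to `p`. In a field with transcendental `z`, the value of `w` must be `p /
P(z)`. -/
lemma IsNodeChart.isCoordChart {z w : Γ(X, V.1)} (h : IsNodeChart p π k m a V z w) :
    IsCoordChart p π k m a V z := by
  have hn := h.isNodeCoord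
  have hp1 := (Fact.out : p.Prime).one_lt
  have hS : ¬ Polynomial.C (p : ℤ_[p]) ∣ residuePoly p ^ (p - 1) - Polynomial.C (p : ℤ_[p]) ^ (p - 1) := by
    intro hd
    exact not_C_p_dvd_residuePoly p ((prime_C_p p).dvd_of_dvd_pow
      ((dvd_sub_left (dvd_pow_self _ (by omega))).mp hd))
  refine ⟨h.le, h.coord_eq, hn.isDomain, fun f => ?_, fun K _ c ζ hζ => ?_⟩
  · obtain ⟨e, F, hF⟩ := hn.exists_poly f
    obtain ⟨N, G, hG⟩ := exists_pow_mul_eval₂_eq p (polyEval p (π ≫ projLineStr p) z) w _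
      (residuePoly p) rfl hn.mul_eq F
    refine ⟨(residuePoly p ^ (p - 1) - Polynomial.C (p : ℤ_[p]) ^ (p - 1)) ^ e * residuePoly p ^ N,
      residuePoly p ^ ((p - 1) * e) * G, ?_, ?_⟩
    · intro hd
      rcases (prime_C_p p).dvd_or_dvd hd with hd | hd
      · exact hS ((prime_C_p p).dvd_of_dvd_pow hd)
      · exact not_C_p_dvd_residuePoly p ((prime_C_p p).dvd_of_dvd_pow hd)
    · have h1 : polyEval p (π ≫ projLineStr p) z
          (residuePoly p ^ (p - 1) - Polynomial.C (p : ℤ_[p]) ^ (p - 1)) =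
          polyEval p (π ≫ projLineStr p) z (residuePoly p) ^ (p - 1) * (1 - w ^ (p - 1)) := by
        rw [map_sub, map_pow, map_pow, map_natCast, map_natCast, ← hn.mul_eq]
        ring
      rw [map_mul, map_pow, h1, map_mul, ← hG, ← hF, map_pow, map_pow, mul_pow]
      ring
  · have h1 : (residuePoly p).eval₂ c ζ ≠ 0 := by
      intro h0
      exact (residuePoly_monic p).ne_zero ((injective_iff_map_eq_zero _).mp hζ _ h0)
    have h2 : (residuePoly p).eval₂ c ζ ^ (p - 1) - (p : K) ^ (p - 1) ≠ 0 := by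
      intro h0
      have h3 := (injective_iff_map_eq_zero _).mp hζ (residuePoly p ^ (p - 1) -
        Polynomial.C (p : ℤ_[p]) ^ (p - 1))
      refine hS ((h3 ?_).symm ▸ dvd_zero _)
      rw [map_sub, map_pow, map_pow, map_natCast, map_natCast]
      exact h0
    obtain ⟨θ, h3, h4, -⟩ := hn.exists_hom (CommRingCat.of K) c ζ (p / (residuePoly p).eval₂ c ζ)
      (div_mul_cancel₀ _ h1) (by
        rw [isUnit_iff_ne_zero]
        intro h0
        apply h2
        rw [div_pow, sub_eq_zero] at h0
        rw [sub_eq_zero]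
        exact ((div_eq_one_iff_eq (pow_ne_zero _ h1)).mp h0.symm).symm)
    exact ⟨θ.hom, h3, h4⟩

namespace IsCoordChart
variable {z : Γ(X, V.1)} (h : IsCoordChart p π k m a V z)

include h

/-- A function with image zero is a fraction `G / s` in `z`; transcendence of the value of `z` gives
`G = 0`, and `s ≠ 0` since `p` does not divide it. -/
lemma hom_injective {K : Type*} [Field K] (θ : Γ(X, V.1) →+* K)
    (hθ : Function.Injective (Polynomial.eval₂RingHom
      (θ.comp (constants (π ≫ projLineStr p) V.1)) (θ z))) : Function.Injective θ := by
  have := h.isDomain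
  have hF (F : Polynomial ℤ_[p]) : θ (polyEval p (π ≫ projLineStr p) z F) = Polynomial.eval₂RingHom
      (θ.comp (constants (π ≫ projLineStr p) V.1)) (θ z) F :=
    Polynomial.hom_eval₂ F _ θ z
  rw [injective_iff_map_eq_zero]
  intro f hf
  obtain ⟨s, G, hs, e⟩ := h.exists_mul f
  have h1 : G = 0 := by
    refine (injective_iff_map_eq_zero _).mp hθ _ ?_
    rw [← hF, ← e, map_mul, hf, zero_mul]
  rw [h1, map_zero] at e
  refine (mul_eq_zero.mp e).resolve_right fun h2 => hs ?_
  rw [(injective_iff_map_eq_zero _).mp hθ s (by rw [← hF, h2, map_zero])]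
  exact dvd_zero _

end IsCoordChart

end CoordCharts

/-! ### The generic point, and the integrality of the models. -/

section GenericPoint

variable (p : ℕ) [Fact p.Prime]

attribute [local instance] MvPolynomial.gradedAlgebra

/-- The homogeneous prime zero, which contains neither of the two homogeneous coordinates. -/
lemma exists_mem_chart_inf : ∃ x : projLine p, x ∈ (chart p 0).1 ⊓ (chart p 1).1 := by
  let x : ProjectiveSpectrum (MvPolynomial.homogeneousSubmodule (Fin 2) ℤ_[p]) :=
    ⟨⊥, by
      rw [HomogeneousIdeal.toIdeal_bot]
      infer_instance, by
      intro h
      have h1 : (MvPolynomial.X 0 : MvPolynomial (Fin 2) ℤ_[p]) ∈ HomogeneousIdeal.irrelevant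
          (MvPolynomial.homogeneousSubmodule (Fin 2) ℤ_[p]) :=
        (HomogeneousIdeal.mem_irrelevant_iff _ _).mpr (by
          rw [GradedRing.proj_apply]
          exact DirectSum.decompose_of_mem_ne _ (X_mem ℤ_[p] 0) one_ne_zero)
      have h2 : (MvPolynomial.X 0 : MvPolynomial (Fin 2) ℤ_[p]) ∈
        (⊥ : HomogeneousIdeal (MvPolynomial.homogeneousSubmodule (Fin 2) ℤ_[p])).toIdeal := h h1
      rw [HomogeneousIdeal.toIdeal_bot, Ideal.mem_bot] at h2
      exact MvPolynomial.X_ne_zero _ h2⟩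
  have hx (k : Fin 2) : x ∈ ProjectiveSpectrum.basicOpen
      (MvPolynomial.homogeneousSubmodule (Fin 2) ℤ_[p]) (MvPolynomial.X k) := by
    rw [ProjectiveSpectrum.mem_basicOpen]
    intro h
    have h2 : (MvPolynomial.X k : MvPolynomial (Fin 2) ℤ_[p]) ∈
        (⊥ : HomogeneousIdeal (MvPolynomial.homogeneousSubmodule (Fin 2) ℤ_[p])).toIdeal := h
    rw [HomogeneousIdeal.toIdeal_bot, Ideal.mem_bot] at h2
    exact MvPolynomial.X_ne_zero _ h2
  exact ⟨x, hx 0, hx 1⟩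

lemma appLE_of_eq_toAffine {X : Scheme.{u}} {V : X.Opens} (hV : IsAffineOpen V) {R : CommRingCat.{u}}
    (ψ : Γ(X, V) ⟶ R) (g : Spec R ⟶ X) (hg : g = toAffine hV ψ) :
    ∃ h : ⊤ ≤ g ⁻¹ᵁ V, ∀ f, (Scheme.ΓSpecIso R).hom (g.appLE V ⊤ h f) = ψ f := by
  subst hg
  refine ⟨le_toAffine_preimage hV ψ, fun f => ?_⟩
  rw [toAffine_appLE]
  exact congr($(Iso.inv_hom_id (Scheme.ΓSpecIso R)) (ψ f))

lemma toAffine_mul_eq_one {X : Scheme.{u}} {U U' : X.Opens} (hU : IsAffineOpen U)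
    (hU' : IsAffineOpen U') (f : Γ(X, U)) (f' : Γ(X, U'))
    (hf : X.presheaf.map (homOfLE (inf_le_left : U ⊓ U' ≤ U)).op f *
      X.presheaf.map (homOfLE (inf_le_right : U ⊓ U' ≤ U')).op f' = 1)
    {R : CommRingCat.{u}} (θ : Γ(X, U) ⟶ R) (θ' : Γ(X, U') ⟶ R)
    (h : toAffine hU θ = toAffine hU' θ') : θ f * θ' f' = 1 := by
  obtain ⟨h0, e0⟩ := appLE_of_eq_toAffine hU θ _ rfl
  obtain ⟨h1, e1⟩ := appLE_of_eq_toAffine hU' θ' _ h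
  have h2 := congrArg (toAffine hU θ |>.appLE _ ⊤ (le_preimage_inf _ h0 h1)) hf
  rw [map_mul, map_one, map_appLE_apply _ _ _ h0, map_appLE_apply _ _ _ h1] at h2
  rw [← e0, ← e1, ← map_mul, h2, map_one]

variable {p} in
lemma exists_hom_of_bijective {X : Scheme.{0}} {t : X ⟶ base p} {V : X.Opens} {z : Γ(X, V)}
    (hz : Function.Bijective (polyEval p t z)) {K : Type} [CommRing K] (ε : Polynomial ℤ_[p] →+* K) :
    ∃ θ : Γ(X, V) ⟶ CommRingCat.of K, ∀ F, θ (polyEval p t z F) = ε F := by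
  obtain ⟨e, -, he, -⟩ := exists_ringEquiv_of_bijective hz
  exact ⟨CommRingCat.ofHom (ε.comp e), fun F => congrArg ε (he F)⟩

/-- A geometric generic point of the projective line. -/
lemma exists_genericPoint : ∃ (K : Type) (_ : Field K) (c : ℤ_[p] →+* K)
    (θ : ∀ k, Γ(projLine p, (chart p k).1) ⟶ CommRingCat.of K),
    (∀ k, (θ k).hom.comp (constants (projLineStr p) _) = c ∧
      Function.Injective (Polynomial.eval₂RingHom c (θ k (coord p k)))) ∧
    ∀ k l, toAffine (chart p k).2 (θ k) = toAffine (chart p l).2 (θ l) := by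
  let K := FractionRing (Polynomial ℤ_[p])
  let ι : Polynomial ℤ_[p] →+* K := algebraMap _ _
  have hι : Function.Injective ι := IsFractionRing.injective _ _
  let c : ℤ_[p] →+* K := ι.comp Polynomial.C
  have hU : IsAffineOpen (chart p 0).1 := (chart p 0).2
  have hU1 : IsAffineOpen (chart p 1).1 := (chart p 1).2
  have hb := polyEval_chart_bijective p 0
  obtain ⟨θ₀, hθ₀⟩ := exists_hom_of_bijective hb ι
  have hξ : θ₀ (coord p 0) = ι Polynomial.X := by
    rw [← polyEval_X (projLineStr p) (coord p 0), hθ₀]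
  have hc₀ : θ₀.hom.comp (constants (projLineStr p) _) = c := by
    ext x
    change θ₀ (constants _ _ x) = _
    rw [← polyEval_C _ (coord p 0), hθ₀]
    rfl
  have hinj : Function.Injective (Polynomial.eval₂RingHom c (ι Polynomial.X)) := by
    have : Polynomial.eval₂RingHom c (ι Polynomial.X) = ι :=
      Polynomial.ringHom_ext (fun x => Polynomial.eval₂_C _ _) (Polynomial.eval₂_X _ _)
    rwa [this]
  obtain ⟨x, hx0, hx1⟩ := exists_mem_chart_inf p
  have hx : x ∈ (chart p 0).1 ⊓ (chart p 1).1 := ⟨hx0, hx1⟩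
  obtain ⟨f, hf, hxf⟩ := hU.exists_basicOpen_le ⟨x, hx⟩ hx0
  -- The overlap of the charts contains a nonempty basic open of the first chart, and the embedding
  -- `θ₀` into the field keeps its equation nonzero. So the point also lies in the second chart.
  have hmem (q) : toAffine hU θ₀ q ∈ (chart p 1).1 := by
    refine (hf ?_ : _ ∈ (chart p 0).1 ⊓ (chart p 1).1).2
    rw [toAffine_mem_basicOpen]
    intro hq
    have hf0 : f ≠ 0 := by
      rintro rfl
      rw [Scheme.basicOpen_zero] at hxf
      exact hxf
    have hq' : θ₀ f ≠ 0 := by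
      obtain ⟨F, rfl⟩ := hb.2 f
      rw [hθ₀]
      intro h0
      exact hf0 (by rw [(injective_iff_map_eq_zero ι).mp hι F h0, map_zero])
    exact q.2.ne_top (Ideal.eq_top_of_isUnit_mem _ hq (isUnit_iff_ne_zero.mpr hq'))
  obtain ⟨θ₁, hθ₁⟩ := exists_eq_toAffine hU1 _ hmem
  let θ : ∀ k, Γ(projLine p, (chart p k).1) ⟶ CommRingCat.of K := fun k =>
    match k with
    | 0 => θ₀
    | 1 => θ₁
  have hc₁ : θ₁.hom.comp (constants (projLineStr p) _) = c := by
    have h1 := constants_toAffine hU1 (t := projLineStr p) θ₁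
    rw [← hθ₁, constants_toAffine hU, hc₀] at h1
    exact congr(($(Spec.map_injective h1)).hom).symm
  have hmul : θ₀ (coord p 0) * θ₁ (coord p 1) = 1 := 
    toAffine_mul_eq_one hU hU1 _ _ (coord_mul_coord p) θ₀ θ₁ hθ₁
  rw [hξ] at hmul
  refine ⟨K, inferInstance, c, θ, ?_, ?_⟩
  · intro k
    fin_cases k
    · refine ⟨hc₀, ?_⟩
      change Function.Injective (Polynomial.eval₂RingHom c (θ₀ (coord p 0)))
      rwa [hξ]
    · refine ⟨hc₁, ?_⟩
      change Function.Injective (Polynomial.eval₂RingHom c (θ₁ (coord p 1)))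
      have h1 : θ₁ (coord p 1) = (ι Polynomial.X)⁻¹ := eq_inv_of_mul_eq_one_right hmul
      rw [h1]
      refine injective_eval₂_inv c (left_ne_zero_of_mul_eq_one hmul) hinj
  · intro k l
    fin_cases k <;> fin_cases l
    exacts [rfl, hθ₁, hθ₁.symm, rfl]

end GenericPoint

section Charts

variable {p : ℕ} [Fact p.Prime]

lemma id_appLE_self {X : Scheme.{u}} {U : X.Opens} (h : U ≤ (𝟙 X : X ⟶ X) ⁻¹ᵁ U) (a : Γ(X, U)) :
    (𝟙 X : X ⟶ X).appLE U U h a = a :=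
  (id_appLE_apply h le_rfl a).trans (map_self a)

lemma IsModel.exists_isDiscChart {n : ℕ} {X : Scheme.{0}} {π : X ⟶ projLine p} (hX : IsModel p n X π)
    (k : Fin 2) (a : ℕ) : ∃ (V : X.affineOpens) (z : Γ(X, V.1)), IsDiscChart p π k n a V z := by
  have hp := (Fact.out : p.Prime).pos
  induction hX generalizing a with
  | zero =>
    obtain ⟨e, -, he, he'⟩ := exists_ringEquiv_of_bijective (polyEval_chart_bijective p k)
    have hle : (chart p k).1 ≤ (𝟙 (projLine p)) ⁻¹ᵁ (chart p k).1 := le_rfl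
    refine ⟨chart p k, coord p k - (a : Γ(projLine p, (chart p k).1)), hle, ?_, ?_⟩
    · rw [id_appLE_self, pow_zero, one_mul]
      exact (add_sub_cancel _ _).symm
    · rw [Category.id_comp]
      have h1 : polyEval p (projLineStr p) (coord p k - (a : Γ(projLine p, (chart p k).1))) =
          (polyEval p (projLineStr p) (coord p k)).comp
            ((Polynomial.taylorEquiv (-(a : ℤ_[p]))).toRingHom) := by
        refine Polynomial.ringHom_ext (fun c => ?_) ?_
        · rw [polyEval_C]
          simp [Polynomial.taylorEquiv, polyEval_C]
        · rw [polyEval_X]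
          simp [Polynomial.taylorEquiv, polyEval_X, sub_eq_add_neg]
      rw [h1]
      exact (polyEval_chart_bijective p k).comp (Polynomial.taylorEquiv (-(a : ℤ_[p]))).bijective
  | @succ n X Y π hX b hb ih =>
    -- The digit of `a` at `p ^ n` is split off: the disc around the remaining number is blown up,
    -- and the chart of that digit is the disc around `a`.
    have h0 : p ^ n * (a / p ^ n % p) ≤ a :=
      (Nat.mul_le_mul_left _ (Nat.mod_le _ _)).trans (Nat.mul_div_le _ _)
    obtain ⟨V, z, hV⟩ := ih (a - p ^ n * (a / p ^ n % p))
    obtain ⟨W, z', hW, -⟩ := hV.exists_disc hb (a / p ^ n % p) (Nat.mod_lt _ hp)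
    rw [Nat.sub_add_cancel h0] at hW
    exact ⟨W, z', hW⟩

/-- The first blow-up creates this chart and the later ones do not change it. On it `x = z`, and the
functions are fractions in `x` with denominators prime to `p`; this is what controls powers of `p`
in `IsModel.exists_app_eq`. -/
lemma IsModel.exists_isNodeChart {n : ℕ} {X : Scheme.{0}} {π : X ⟶ projLine p} (hX : IsModel p n X π)
    (hn : n ≠ 0) (k : Fin 2) :
    ∃ (V : X.affineOpens) (z w : Γ(X, V.1)), IsNodeChart p π k 0 0 V z w := by
  induction hX with
  | zero => exact absurd rfl hn
  | @succ n X Y π hX b hb ih =>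
    by_cases hn : n = 0
    · subst hn
      obtain ⟨V, z, hV⟩ := hX.exists_isDiscChart k 0
      obtain ⟨W, z', w, hW, -⟩ := hV.exists_node hb
      exact ⟨W, z', w, hW⟩
    · obtain ⟨V, z, w, hV⟩ := ih hn
      obtain ⟨W, z', w', hW, -⟩ := hV.exists_node hb
      exact ⟨W, z', w', hW⟩

/-- Each blow-up replaces a disc of level `n` by discs of level `n + 1` and a node chart of level
`n`, and leaves the older node charts unchanged. -/
lemma IsModel.exists_mem_chart {n : ℕ} {X : Scheme.{0}} {π : X ⟶ projLine p} (hX : IsModel p n X π)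
    (k : Fin 2) (y : X) (hy : y ∈ π ⁻¹ᵁ (chart p k).1) :
    (∃ (a : ℕ) (V : X.affineOpens) (z : Γ(X, V.1)), IsDiscChart p π k n a V z ∧ y ∈ V.1) ∨
    ∃ (m a : ℕ) (V : X.affineOpens) (z w : Γ(X, V.1)), m < n ∧ IsNodeChart p π k m a V z w ∧
      y ∈ V.1 := by
  induction hX with
  | zero =>
    have hle : (chart p k).1 ≤ (𝟙 (projLine p)) ⁻¹ᵁ (chart p k).1 := le_rfl
    refine .inl ⟨0, chart p k, coord p k, ⟨hle, ?_, ?_⟩, hy⟩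
    · rw [id_appLE_self, pow_zero, one_mul]
      simp
    · rw [Category.id_comp]
      exact polyEval_chart_bijective p k
  | @succ n X Y π hX b hb ih =>
    rcases ih (b y) hy with ⟨a, V, z, hV, hyV⟩ | ⟨m, a, V, z, w, hm, hV, hyV⟩
    · rcases hV.exists_mem hb y hyV with ⟨c, -, W, z', hW, hyW⟩ | ⟨W, z', w, hW, hyW⟩
      · exact .inl ⟨_, W, z', hW, hyW⟩
      · exact .inr ⟨n, a, W, z', w, Nat.lt_succ_self n, hW, hyW⟩
    · obtain ⟨W, z', w', hW, hle⟩ := hV.exists_node hb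
      exact .inr ⟨m, a, W, z', w', hm.trans (Nat.lt_succ_self n), hW, hle hyV⟩

/-- The last assertion says that the centre lies over `p = 0`: on discs it contains `p`, on node
charts it is the unit ideal. `IsModel.hom_ext` rests on this. -/
lemma IsModel.exists_mem_coordChart {n : ℕ} {X : Scheme.{0}} {π : X ⟶ projLine p}
    (hX : IsModel p n X π) (y : X) : ∃ (k : Fin 2) (m a : ℕ) (V : X.affineOpens) (z : Γ(X, V.1)),
      IsCoordChart p π k m a V z ∧ y ∈ V.1 ∧
        (p : Γ(X, V.1)) ∈ (centre p (π ≫ projLineStr p)).ideal V := by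
  obtain ⟨k, hk⟩ := SemistableModel.exists_mem_chart p (π y)
  rcases hX.exists_mem_chart k y hk with ⟨a, V, z, hV, hy⟩ | ⟨m, a, V, z, w, hm, hV, hy⟩
  · refine ⟨k, n, a, V, z, hV.isCoordChart, hy, ?_⟩
    have h1 := (mem_centre_of_polyEval_bijective p _ V z hV.bijective
      (p : Polynomial ℤ_[p])).mpr fun j _ => by simp
    rwa [map_natCast] at h1
  · refine ⟨k, m, a, V, z, hV.isCoordChart, hy, ?_⟩
    rw [hV.isNodeCoord.centre_ideal]
    trivial

/-- The points of the generic fibre lift uniquely. -/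
lemma IsModel.hom_ext {n : ℕ} {X : Scheme.{0}} {π : X ⟶ projLine p} (hX : IsModel p n X π)
    {R : CommRingCat.{0}} (hR : IsUnit (p : R)) {g g' : Spec R ⟶ X} (h : g ≫ π = g' ≫ π) : g = g' := by
  induction hX with
  | zero => simpa using h
  | @succ n X Y π hX b hb ih =>
    have h1 : g ≫ b = g' ≫ b := ih (by simpa using h)
    refine (hb.existsUnique_lift _ (g ≫ b) ?_).unique rfl h1.symm
    intro y
    obtain ⟨k, m, a, V, z, hV, hy, hp⟩ := hX.exists_mem_coordChart ((g ≫ b) y)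
    obtain ⟨U, hU, hyU, hle⟩ := exists_isAffineOpen_mem_and_subset
      (show y ∈ (g ≫ b) ⁻¹ᵁ V.1 from hy)
    -- Since `p` is a unit, the centre pulls back to the unit ideal, and the uniqueness of lifts to
    -- the blow-up applies.
    refine ⟨⟨U, hU⟩, 1, hyU, one_mem _, ?_⟩
    rw [Ideal.span_singleton_one, ideal_comap_of_le _ _ V ⟨U, hU⟩ hle]
    refine Ideal.eq_top_of_isUnit_mem _ (Ideal.mem_map_of_mem _ hp) ?_
    rw [map_natCast]
    have h2 := hR.map ((Scheme.ΓSpecIso R).inv ≫ (Spec R).presheaf.map (homOfLE le_top : U ⟶ ⊤).op).hom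
    rwa [map_natCast] at h2

/-- The model is an integral scheme. -/
lemma IsModel.isIntegral {n : ℕ} {X : Scheme.{0}} {π : X ⟶ projLine p} (hX : IsModel p n X π) :
    IsIntegral X := by
  obtain ⟨K, _, c, θ, hθ, hg⟩ := exists_genericPoint p
  have hcinj : Function.Injective c := by
    intro x y hxy
    refine Polynomial.C_injective ((hθ 0).2 ?_)
    simpa using hxy
  have hp0 : (p : ℤ_[p]) ≠ 0 := PadicInt.prime_p.ne_zero
  have hpK : (p : K) ≠ 0 := by
    rw [← map_natCast c]
    exact (map_ne_zero_iff c hcinj).mpr hp0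
  let q : Spec (CommRingCat.of K) := IsLocalRing.closedPoint K
  -- In each chart the generic point has a lift with `z = (x - a) / p ^ m`, which is again
  -- transcendental; hence the lift is an embedding of the functions on the chart.
  have hlift (k : Fin 2) (m a : ℕ) (V : X.affineOpens) (z : Γ(X, V.1)) (hV : IsCoordChart p π k m a V z) :
      ∃ ψ : Γ(X, V.1) ⟶ CommRingCat.of K, Function.Injective ψ ∧
        toAffine (show IsAffineOpen V.1 from V.2) ψ ≫ π = toAffine (chart p 0).2 (θ 0) := by
    have h1 : θ k (coord p k) = c (a : ℤ_[p]) + c ((p : ℤ_[p]) ^ m) *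
        ((θ k (coord p k) - (a : K)) / (p : K) ^ m) := by
      rw [map_natCast, map_pow, map_natCast, mul_div_cancel₀ _ (pow_ne_zero m hpK)]
      exact (add_sub_cancel _ _).symm
    have hζ := injective_eval₂_of_eq c _ _ h1 (hθ k).2
    obtain ⟨ψ, hψc, hψz⟩ := hV.exists_hom K c _ hζ
    refine ⟨CommRingCat.ofHom ψ, hV.hom_injective ψ (by rwa [hψc, hψz]), ?_⟩
    rw [hg 0 k, toAffine_comp π (chart p k).2 V.2 hV.le]
    congr 1
    refine CommRingCat.hom_ext (ringHom_ext_of_bijective (polyEval_chart_bijective p k) ?_ ?_)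
    · intro x
      change ψ (π.appLE _ _ hV.le (constants _ _ x)) = (θ k).hom.comp (constants _ _) x
      rw [appLE_constants, (hθ k).1, ← hψc]
      rfl
    · change ψ (π.appLE _ _ hV.le (coord p k)) = θ k (coord p k)
      rw [hV.coord_eq, map_add, map_mul, map_pow, map_natCast, map_natCast, hψz,
        mul_div_cancel₀ _ (pow_ne_zero m hpK)]
      exact add_sub_cancel _ _
  obtain ⟨V₀, z₀, hV₀⟩ := hX.exists_isDiscChart 0 0
  obtain ⟨ψ₀, hψ₀, e₀⟩ := hlift _ _ _ _ _ hV₀.isCoordChart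
  set η : X := toAffine V₀.2 ψ₀ q with hη
  -- The lifts found in different charts coincide by `IsModel.hom_ext`. As they are injective on
  -- functions, the one point `η` lies in every nonempty open.
  have hηO (O : X.Opens) (y : X) (hy : y ∈ O) : η ∈ O := by
    obtain ⟨k, m, a, V, z, hV, hyV, -⟩ := hX.exists_mem_coordChart y
    obtain ⟨ψ, hψ, e⟩ := hlift k m a V z hV
    have hV' : IsAffineOpen V.1 := V.2
    have h1 : toAffine V₀.2 ψ₀ = toAffine hV' ψ :=
      hX.hom_ext (isUnit_iff_ne_zero.mpr hpK) (e₀.trans e.symm)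
    obtain ⟨f, hf, hyf⟩ := hV'.exists_basicOpen_le (V := O ⊓ V.1) ⟨y, ⟨hy, hyV⟩⟩ hyV
    have h2 : η ∈ X.basicOpen f := by
      rw [hη, h1]
      refine (toAffine_mem_basicOpen hV' ψ q f).mpr ?_
      intro hq
      have hf0 : f ≠ 0 := by
        rintro rfl
        rw [Scheme.basicOpen_zero] at hyf
        exact hyf
      have hq' : ψ f ≠ 0 := fun h0 => hf0 (hψ (h0.trans (map_zero ψ.hom).symm))
      exact q.2.ne_top (Ideal.eq_top_of_isUnit_mem _ hq (isUnit_iff_ne_zero.mpr hq'))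
    exact (hf h2 : η ∈ O ⊓ V.1).1
  have hirr : IrreducibleSpace X :=
    { toPreirreducibleSpace := PreirreducibleSpace.of_forall_nonempty_inter
        (fun {U V} hU hV ⟨x, hx⟩ ⟨y, hy⟩ => ⟨η, hηO ⟨U, hU⟩ x hx, hηO ⟨V, hV⟩ y hy⟩)
      toNonempty := ⟨η⟩ }
  have hred : ∀ x : X, _root_.IsReduced (X.presheaf.stalk x) := by
    intro x
    obtain ⟨k, m, a, V, z, hV, hxV, -⟩ := hX.exists_mem_coordChart x
    have hV' : IsAffineOpen V.1 := V.2
    have := hV.isDomain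
    let _ := X.presheaf.algebra_section_stalk ⟨x, hxV⟩
    have hloc := hV'.isLocalization_stalk ⟨x, hxV⟩
    have : IsDomain (X.presheaf.stalk x) := @IsLocalization.isDomain_of_le_nonZeroDivisors Γ(X, V.1) _
      (M := (hV'.primeIdealOf ⟨x, hxV⟩).asIdeal.primeCompl) _ _ _ hloc _
      (hV'.primeIdealOf ⟨x, hxV⟩).asIdeal.primeCompl_le_nonZeroDivisors
    infer_instance
  have := isReduced_of_isReduced_stalk X
  exact isIntegral_of_irreducibleSpace_of_isReduced X

end Charts

/-! ### Functions on integral schemes. -/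

section Integral

lemma map_injective_of_mem [IsIntegral X] {W W' : X.Opens} (h : W' ≤ W) {x : X} (hx : x ∈ W') :
    Function.Injective (X.presheaf.map (homOfLE h).op) := by
  have : Nonempty W' := ⟨⟨x, hx⟩⟩
  exact map_injective_of_isIntegral _ (homOfLE h)

lemma preimage_le_preimage (f : Y ⟶ X) {W W' : X.Opens} (h : W' ≤ W) : f ⁻¹ᵁ W' ≤ f ⁻¹ᵁ W :=
  fun _ hx => h hx

lemma app_map (f : Y ⟶ X) {W W' : X.Opens} (h : W' ≤ W) (a : Γ(X, W)) :
    f.app W' (X.presheaf.map (homOfLE h).op a) =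
      Y.presheaf.map (homOfLE (preimage_le_preimage f h)).op (f.app W a) :=
  congr($(f.naturality (homOfLE h).op) a)

lemma exists_mem_basicOpen [IsIntegral X] {W : X.Opens} {f : Γ(X, W)} (hf : f ≠ 0) :
    ∃ x, x ∈ X.basicOpen f := by
  by_contra h
  push Not at h
  exact hf ((basicOpen_eq_bot_iff f).mp (eq_bot_iff.mpr h))

lemma ne_zero_of_mem_basicOpen {W : X.Opens} {f : Γ(X, W)} {x : X} (hx : x ∈ X.basicOpen f) : f ≠ 0 := by
  rintro rfl
  rw [Scheme.basicOpen_zero] at hx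
  exact hx

lemma exists_mem_inf [IsIntegral X] {W W' : X.Opens} {x y : X} (hx : x ∈ W) (hy : y ∈ W') :
    ∃ z, z ∈ W ⊓ W' :=
  nonempty_preirreducible_inter W.2 W'.2 ⟨x, hx⟩ ⟨y, hy⟩

/-- A power of `g` clears the denominator of `r`. The free exponent `M` lets two such powers be made
equal later. -/
lemma exists_pow_mul_eq {V : X.Opens} (hV : IsAffineOpen V) (g : Γ(X, V)) {O : X.Opens}
    (hO : X.basicOpen g ≤ O) (r : Γ(X, O)) : ∃ (N : ℕ) (f : Γ(X, V)), ∀ M,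
      X.presheaf.map (homOfLE (X.basicOpen_le g)).op (g ^ M * f) =
        X.presheaf.map (homOfLE (X.basicOpen_le g)).op g ^ (N + M) *
          X.presheaf.map (homOfLE hO).op r := by
  have := hV.isLocalization_basicOpen g
  obtain ⟨N, f, hf⟩ := IsLocalization.Away.surj g (X.presheaf.map (homOfLE hO).op r)
  refine ⟨N, f, fun M => ?_⟩
  have hf' : X.presheaf.map (homOfLE hO).op r *
      X.presheaf.map (homOfLE (X.basicOpen_le g)).op g ^ N =
      X.presheaf.map (homOfLE (X.basicOpen_le g)).op f := hf
  rw [map_mul, map_pow, ← hf', pow_add]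
  ring

lemma basicOpen_appLE_le (f : Y ⟶ X) {U : X.Opens} {V : Y.Opens} (h : V ≤ f ⁻¹ᵁ U) (g : Γ(X, U)) :
    Y.basicOpen (f.appLE U V h g) ≤ f ⁻¹ᵁ X.basicOpen g := by
  rw [Scheme.preimage_basicOpen]
  have : f.appLE U V h g = Y.presheaf.map (homOfLE h).op (f.app U g) := rfl
  rw [this, Scheme.basicOpen_res]
  exact inf_le_right

lemma mem_basicOpen_appLE (f : Y ⟶ X) {U : X.Opens} {V : Y.Opens} (h : V ≤ f ⁻¹ᵁ U) (g : Γ(X, U))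
    {y : Y} (hy : y ∈ V) (hg : f y ∈ X.basicOpen g) : y ∈ Y.basicOpen (f.appLE U V h g) := by
  have : f.appLE U V h g = Y.presheaf.map (homOfLE h).op (f.app U g) := rfl
  rw [this, Scheme.basicOpen_res]
  refine ⟨hy, ?_⟩
  have h1 : y ∈ f ⁻¹ᵁ X.basicOpen g := hg
  rwa [Scheme.preimage_basicOpen] at h1

end Integral

/-! ### Functions on the model come from the projective line. -/

section Projection

variable {p : ℕ} [Fact p.Prime] {X : Scheme.{0}} {π : X ⟶ projLine p}

lemma polyEval_comp (t : X ⟶ base p) {V : X.Opens} (ξ z : Γ(X, V)) (m a : ℕ)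
    (h : ξ = a + p ^ m * z) (F : Polynomial ℤ_[p]) : polyEval p t ξ F =
      polyEval p t z (F.comp (Polynomial.C (a : ℤ_[p]) + Polynomial.C ((p : ℤ_[p]) ^ m) * Polynomial.X)) := by
  have h1 : polyEval p t ξ = (polyEval p t z).comp (Polynomial.compRingHom
      (Polynomial.C (a : ℤ_[p]) + Polynomial.C ((p : ℤ_[p]) ^ m) * Polynomial.X)) := by
    refine Polynomial.ringHom_ext (fun c => ?_) ?_
    · simp [polyEval_C]
    · rw [polyEval_X]
      simp [polyEval_X, h]
  rw [h1]
  rfl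

lemma comp_affine_injective (m a : ℕ) : Function.Injective fun F : Polynomial ℤ_[p] =>
    F.comp (Polynomial.C (a : ℤ_[p]) + Polynomial.C ((p : ℤ_[p]) ^ m) * Polynomial.X) := by
  change Function.Injective (Polynomial.compRingHom _)
  rw [injective_iff_map_eq_zero]
  intro F hF
  rcases Polynomial.comp_eq_zero_iff.mp hF with h | ⟨-, h⟩
  · exact h
  · have h1 := congr(Polynomial.coeff $h 1)
    rw [Polynomial.coeff_add, Polynomial.coeff_C_mul, Polynomial.coeff_X_one,
      Polynomial.coeff_C_succ, Polynomial.coeff_C_succ, zero_add, mul_one] at h1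
    exact absurd h1 (pow_ne_zero _ PadicInt.prime_p.ne_zero)

/-- A polynomial in `z` becomes a polynomial in `a + p ^ m z` after multiplication by a power of `p`. -/
lemma exists_pow_mul_polyEval (t : X ⟶ base p) {V : X.Opens} (ξ z : Γ(X, V)) (m a : ℕ)
    (h : ξ = a + p ^ m * z) (F : Polynomial ℤ_[p]) : ∃ (M : ℕ) (H : Polynomial ℤ_[p]),
      (p : Γ(X, V)) ^ M * polyEval p t z F = polyEval p t ξ H := by
  refine ⟨m * F.natDegree, (Polynomial.scaleRoots F ((p : ℤ_[p]) ^ m)).comp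
    (Polynomial.X - Polynomial.C (a : ℤ_[p])), ?_⟩
  have h1 : (constants t V) ((p : ℤ_[p]) ^ m) * z = ξ - a := by
    rw [map_pow, map_natCast, h]
    ring
  have h2 := Polynomial.scaleRoots_eval₂_mul (p := F) (constants t V) z ((p : ℤ_[p]) ^ m)
  rw [h1, map_pow, map_natCast, ← pow_mul] at h2
  refine h2.symm.trans ?_
  change _ = Polynomial.eval₂ (constants t V) ξ _
  rw [Polynomial.eval₂_comp, Polynomial.eval₂_sub, Polynomial.eval₂_X, Polynomial.eval₂_C, map_natCast]

lemma IsDiscChart.appLE_injective {k : Fin 2} {m a : ℕ} {V : X.affineOpens} {z : Γ(X, V.1)}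
    (h : IsDiscChart p π k m a V z) : Function.Injective (π.appLE _ V.1 h.le) := by
  intro f g hfg
  obtain ⟨F, rfl⟩ := (polyEval_chart_bijective p k).2 f
  obtain ⟨G, rfl⟩ := (polyEval_chart_bijective p k).2 g
  rw [appLE_polyEval, appLE_polyEval, h.coord_eq, polyEval_comp _ _ z m a rfl,
    polyEval_comp _ _ z m a rfl] at hfg
  rw [comp_affine_injective m a (h.bijective.1 hfg)]

/-- A single disc already dominates the chart, as `F ↦ F(a + p ^ n z)` is injective; so a nonzero
`g` does not vanish identically on it. -/
lemma IsModel.exists_mem_preimage {n : ℕ} (hX : IsModel p n X π) {O : (projLine p).Opens}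
    {x : projLine p} (hx : x ∈ O) : ∃ y, y ∈ π ⁻¹ᵁ O := by
  have := hX.isIntegral
  obtain ⟨k, hk⟩ := SemistableModel.exists_mem_chart p x
  have hU : IsAffineOpen (chart p k).1 := (chart p k).2
  obtain ⟨g, hg, hxg⟩ := hU.exists_basicOpen_le (V := O ⊓ (chart p k).1) ⟨x, ⟨hx, hk⟩⟩ hk
  obtain ⟨V, z, hV⟩ := hX.exists_isDiscChart k 0
  have h1 : π.appLE _ V.1 hV.le g ≠ 0 := fun h0 => ne_zero_of_mem_basicOpen hxg
    (hV.appLE_injective (h0.trans (map_zero _).symm))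
  obtain ⟨y, hy⟩ := exists_mem_basicOpen h1
  exact ⟨y, (hg (basicOpen_appLE_le π hV.le g hy) : π y ∈ O ⊓ (chart p k).1).1⟩

lemma IsModel.app_injective {n : ℕ} (hX : IsModel p n X π) (U : (projLine p).Opens) :
    Function.Injective (π.app U) := by
  have := hX.isIntegral
  have : IsIntegral (projLine p) := (IsModel.zero (p := p)).isIntegral
  rw [injective_iff_map_eq_zero]
  intro f hf
  by_contra h0
  obtain ⟨x, hx⟩ := exists_mem_basicOpen h0
  obtain ⟨y, hy⟩ := hX.exists_mem_preimage hx
  rw [Scheme.preimage_basicOpen, hf] at hy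
  exact ne_zero_of_mem_basicOpen hy rfl

/-- On a disc around `0`, `r` is, up to powers of `g`, a polynomial in `x` divided by a power of
`p`. On the node chart of level `0`, it is a fraction in `x` with denominator prime to `p`.
Comparing both on the overlap removes the power of `p`. -/
lemma IsModel.exists_app_eq {n : ℕ} (hX : IsModel p n X π) (hn : n ≠ 0) (k : Fin 2)
    (g : Γ(projLine p, (chart p k).1)) (hg : g ≠ 0)
    (r : Γ(X, π ⁻¹ᵁ (projLine p).basicOpen g)) : ∃ s, π.app ((projLine p).basicOpen g) s = r := by
  have := hX.isIntegral
  obtain ⟨V, z, hV⟩ := hX.exists_isDiscChart k 0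
  obtain ⟨V', z', w, hV'⟩ := hX.exists_isNodeChart hn k
  have hVa : IsAffineOpen V.1 := V.2
  have hVa' : IsAffineOpen V'.1 := V'.2
  set t := π ≫ projLineStr p
  obtain ⟨N, f, hf⟩ := exists_pow_mul_eq hVa (π.appLE _ V.1 hV.le g)
    (basicOpen_appLE_le π hV.le g) r
  obtain ⟨N', f', hf'⟩ := exists_pow_mul_eq hVa' (π.appLE _ V'.1 hV'.le g)
    (basicOpen_appLE_le π hV'.le g) r
  have h1 : π.appLE _ V.1 hV.le g ≠ 0 := fun h0 => hg (hV.appLE_injective (h0.trans (map_zero _).symm))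
  obtain ⟨y₁, hy₁⟩ := exists_mem_basicOpen h1
  have hnt : (1 : Γ(X, V'.1)) ≠ 0 := hV'.isNodeCoord.isDomain.toNontrivial.exists_pair_ne.elim
    fun a ⟨b, hab⟩ h0 => hab (by rw [← mul_one a, ← mul_one b, h0, mul_zero, mul_zero])
  obtain ⟨y₂, hy₂⟩ := exists_mem_basicOpen hnt
  obtain ⟨y, hyE⟩ := exists_mem_inf hy₁ (X.basicOpen_le _ hy₂)
  -- An open on which both descriptions of `r` make sense; it is nonempty because the model is
  -- irreducible.
  set E := X.basicOpen (π.appLE _ V.1 hV.le g) ⊓ V'.1 with hE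
  have hEV : E ≤ V.1 := inf_le_left.trans (X.basicOpen_le _)
  have hEV' : E ≤ V'.1 := inf_le_right
  have hEg : E ≤ π ⁻¹ᵁ (projLine p).basicOpen g := inf_le_left.trans (basicOpen_appLE_le π hV.le g)
  have hEg1 : E ≤ X.basicOpen (π.appLE _ V.1 hV.le g) := inf_le_left
  have hEg2 : E ≤ X.basicOpen (π.appLE _ V'.1 hV'.le g) := fun x hx =>
    mem_basicOpen_appLE π hV'.le g (hEV' hx) (hEg hx)
  have hEU : E ≤ π ⁻¹ᵁ (chart p k).1 := hEV.trans hV.le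
  let ξ : Γ(X, E) := π.appLE _ E hEU (coord p k)
  let ζ : Γ(X, E) := X.presheaf.map (homOfLE hEV).op z
  let γ : Γ(X, E) := π.appLE _ E hEU g
  let ρ : Γ(X, E) := X.presheaf.map (homOfLE hEg).op r
  have hξζ : ξ = (0 : ℕ) + p ^ n * ζ := by
    have := congr(X.presheaf.map (homOfLE hEV).op $(hV.coord_eq))
    rw [appLE_map_apply, map_add, map_mul, map_pow, map_natCast, map_natCast] at this
    exact this
  have hξζ' : X.presheaf.map (homOfLE hEV').op z' = ξ := by
    have := congr(X.presheaf.map (homOfLE hEV').op $(hV'.coord_eq))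
    rw [appLE_map_apply, pow_zero, one_mul, Nat.cast_zero, zero_add] at this
    exact this.symm
  have e1 : X.presheaf.map (homOfLE hEV).op (π.appLE _ V.1 hV.le g ^ N' * f) = γ ^ (N + N') * ρ := by
    have := congr(X.presheaf.map (homOfLE hEg1).op $(hf N'))
    rw [map_map, map_mul (X.presheaf.map (homOfLE hEg1).op).hom, map_pow, map_map, map_map,
      appLE_map_apply] at this
    exact this
  have e2 : X.presheaf.map (homOfLE hEV').op (π.appLE _ V'.1 hV'.le g ^ N * f') = γ ^ (N + N') * ρ := by
    have := congr(X.presheaf.map (homOfLE hEg2).op $(hf' N))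
    rw [map_map, map_mul (X.presheaf.map (homOfLE hEg2).op).hom, map_pow, map_map, map_map,
      appLE_map_apply, add_comm] at this
    exact this
  obtain ⟨F, hF⟩ := hV.bijective.2 (π.appLE _ V.1 hV.le g ^ N' * f)
  obtain ⟨s, G, hs, hsG⟩ := hV'.isCoordChart.exists_mul (π.appLE _ V'.1 hV'.le g ^ N * f')
  obtain ⟨M, H, hMH⟩ := exists_pow_mul_polyEval t ξ ζ n 0 hξζ F
  rw [← hF, map_polyEval] at e1
  have e3 := congr(X.presheaf.map (homOfLE hEV').op $hsG)
  rw [map_mul, e2, map_polyEval, map_polyEval, hξζ'] at e3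
  have hinj : Function.Injective (polyEval p t ξ) := by
    intro F F' hFF'
    rw [polyEval_comp t ξ ζ n 0 hξζ, polyEval_comp t ξ ζ n 0 hξζ, ← map_polyEval, ← map_polyEval] at hFF'
    exact comp_affine_injective n 0 (hV.bijective.1 (map_injective_of_mem hEV hyE hFF'))
  -- The two descriptions compared as polynomials in `x`. As `p` is prime in `ℤ_p[T]` and does not
  -- divide `s`, the factor `p ^ M` divides `H`.
  have e4 : H * s = Polynomial.C (p : ℤ_[p]) ^ M * G := by
    apply hinj
    rw [map_mul, map_mul, map_pow, map_natCast, map_natCast, ← hMH, ← e3, e1]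
    ring
  obtain ⟨H', rfl⟩ : Polynomial.C (p : ℤ_[p]) ^ M ∣ H :=
    (prime_C_p p).pow_dvd_of_dvd_mul_right M hs (e4 ▸ Dvd.intro _ rfl)
  have : Nonempty E := ⟨⟨y, hyE⟩⟩
  have hp0 : (p : Γ(X, E)) ≠ 0 := by
    intro h0
    refine (prime_C_p p).ne_zero (hinj ?_)
    rw [map_natCast, map_natCast, h0, map_zero]
  have e5 : γ ^ (N + N') * ρ = polyEval p t ξ H' := by
    rw [map_mul, map_pow, map_natCast, map_natCast] at hMH
    rw [← e1]
    exact mul_left_cancel₀ (pow_ne_zero M hp0) hMH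
  have hUa : IsAffineOpen (chart p k).1 := (chart p k).2
  have hloc := hUa.isLocalization_basicOpen g
  obtain ⟨u, hu⟩ : IsUnit ((projLine p).presheaf.map (homOfLE ((projLine p).basicOpen_le g)).op g) :=
    IsLocalization.Away.algebraMap_isUnit (S := Γ(projLine p, (projLine p).basicOpen g)) g
  refine ⟨↑u⁻¹ ^ (N + N') * (projLine p).presheaf.map (homOfLE ((projLine p).basicOpen_le g)).op
    (polyEval p (projLineStr p) (coord p k) H'), map_injective_of_mem hEg hyE ?_⟩
  have e6 (a) : X.presheaf.map (homOfLE hEg).op (π.app ((projLine p).basicOpen g) a) =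
      π.appLE _ E hEg a := rfl
  have e7 : γ = π.appLE _ E hEg u := by
    rw [hu, map_appLE_apply]
  have e8 : π.appLE _ E hEg (↑u⁻¹ : Γ(projLine p, (projLine p).basicOpen g)) * γ = 1 := by
    rw [e7, ← map_mul, Units.inv_mul, map_one]
  rw [e6, map_mul, map_pow, map_appLE_apply π hEg _ hEU, appLE_polyEval]
  change _ * polyEval p t ξ H' = ρ
  rw [← e5, ← mul_assoc, ← mul_pow, e8, one_pow, one_mul]

lemma IsModel.app_bijective {n : ℕ} (hX : IsModel p n X π) (U : (projLine p).Opens) :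
    Function.Bijective (π.app U) := by
  refine ⟨hX.app_injective U, fun r => ?_⟩
  by_cases hn : n = 0
  · subst hn
    cases hX
    refine ⟨r, ?_⟩
    rw [Scheme.Hom.id_app]
    rfl
  obtain ⟨s, hs⟩ := exists_section_of_local (V := U) (fun W hW s => π.app W s =
      X.presheaf.map (homOfLE (preimage_le_preimage π hW)).op r) (by
    intro W W' hW h a ha
    rw [app_map, ha, map_map]) (fun W hW a b ha hb => hX.app_injective W (ha.trans hb.symm)) (by
    intro x hx
    obtain ⟨k, hk⟩ := SemistableModel.exists_mem_chart p x
    have hUa : IsAffineOpen (chart p k).1 := (chart p k).2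
    obtain ⟨g, hg, hxg⟩ := hUa.exists_basicOpen_le (V := U ⊓ (chart p k).1) ⟨x, ⟨hx, hk⟩⟩ hk
    have hg' : (projLine p).basicOpen g ≤ U := hg.trans inf_le_left
    obtain ⟨s, hs⟩ := hX.exists_app_eq hn k g (ne_zero_of_mem_basicOpen hxg)
      (X.presheaf.map (homOfLE (preimage_le_preimage π hg')).op r)
    exact ⟨_, hg', s, hxg, hs⟩)
  refine ⟨s, section_eq_of_local _ _ fun y hy => ?_⟩
  obtain ⟨W, hW, hyW, e⟩ := hs (π y) hy
  exact ⟨π ⁻¹ᵁ W, preimage_le_preimage π hW, hyW, (app_map π hW s).symm.trans e⟩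

end Projection

/-! ### Powers of the ideals `(z - b, q)`. -/

section IdealPowers

variable {A : Type*} [CommRing A]

/-- A polynomial in `a + q T` that is divisible by `q ^ d` lies in `(T - a, q) ^ d`. -/
lemma mem_span_pow_of_dvd_comp [IsDomain A] (q a : A) (hq : q ≠ 0) (d : ℕ) (F : Polynomial A)
    (h : Polynomial.C q ^ d ∣ F.comp (Polynomial.C a + Polynomial.C q * Polynomial.X)) :
    F ∈ Ideal.span {Polynomial.X - Polynomial.C a, Polynomial.C q} ^ d := by
  let G := F.comp (Polynomial.X + Polynomial.C a)
  have hFG : F = G.comp (Polynomial.X - Polynomial.C a) := by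
    rw [Polynomial.comp_assoc]
    simp
  have h1 : F.comp (Polynomial.C a + Polynomial.C q * Polynomial.X) =
      G.comp (Polynomial.C q * Polynomial.X) := by
    rw [Polynomial.comp_assoc, Polynomial.add_comp, Polynomial.X_comp, Polynomial.C_comp, add_comm]
  rw [h1, ← Polynomial.C_pow, Polynomial.C_dvd_iff_dvd_coeff] at h
  rw [hFG, Polynomial.comp, Polynomial.eval₂_eq_sum_range]
  have hX : Polynomial.X - Polynomial.C a ∈
      Ideal.span {Polynomial.X - Polynomial.C a, Polynomial.C q} := Ideal.subset_span (by simp)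
  have hC : Polynomial.C q ∈
      Ideal.span {Polynomial.X - Polynomial.C a, Polynomial.C q} := Ideal.subset_span (by simp)
  refine sum_mem fun i _ => ?_
  rcases le_or_gt d i with hi | hi
  · exact Ideal.mul_mem_left _ _ (Ideal.pow_le_pow_right hi (Ideal.pow_mem_pow hX i))
  · have h2 := h i
    rw [Polynomial.comp_C_mul_X_coeff] at h2
    -- The coefficient of `T ^ i` in `G(q T)` is `q ^ i` times that of `G` and is divisible by `q ^
    -- d`; for `i < d` the factor `q ^ i` is cancelled.
    obtain ⟨c, hc⟩ : q ^ (d - i) ∣ G.coeff i := by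
      refine (mul_dvd_mul_iff_right (pow_ne_zero i hq)).mp ?_
      rwa [← pow_add, Nat.sub_add_cancel hi.le]
    rw [hc, Polynomial.C_mul, mul_comm (Polynomial.C (q ^ (d - i))), mul_assoc,
      mul_comm (Polynomial.C (q ^ (d - i))), Polynomial.C_pow]
    refine Ideal.mul_mem_left _ _ ?_
    have h3 := Ideal.mul_mem_mul (Ideal.pow_mem_pow hX i) (Ideal.pow_mem_pow hC (d - i))
    rwa [← pow_add, Nat.add_sub_cancel' hi.le] at h3

/-- Expanding the product, every term other than the product of the `u i` contains a factor `q`. -/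
lemma prod_span_pair_le {ι : Type*} (s : Finset ι) (u : ι → A) (q : A) :
    ∏ i ∈ s, Ideal.span {u i, q} ≤ Ideal.span {∏ i ∈ s, u i, q} := by
  classical
  induction s using Finset.induction_on with
  | empty =>
    rw [Finset.prod_empty, Finset.prod_empty]
    exact le_of_le_of_eq le_top ((Ideal.eq_top_iff_one _).mpr (Ideal.subset_span (by simp))).symm
  | insert i s hi ih =>
    rw [Finset.prod_insert hi, Finset.prod_insert hi]
    refine (Ideal.mul_mono_right ih).trans ?_
    rw [Ideal.span_pair_mul_span_pair, Ideal.span_le]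
    have hq : q ∈ Ideal.span {u i * ∏ i ∈ s, u i, q} := Ideal.subset_span (by simp)
    rintro f (rfl | rfl | rfl | rfl)
    · exact Ideal.subset_span (by simp)
    · exact Ideal.mul_mem_left _ _ hq
    · exact Ideal.mul_mem_right _ _ hq
    · exact Ideal.mul_mem_left _ _ hq

/-- The intersection of the powers of pairwise comaximal ideals `(z - b, q)`. -/
lemma iInf_span_pair_pow_le {ι : Type*} (s : Finset ι) (u : ι → A) (q : A) (d : ℕ)
    (hu : ∀ i ∈ s, ∀ j ∈ s, i ≠ j → IsUnit (u i - u j)) :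
    ⨅ i ∈ s, Ideal.span {u i, q} ^ d ≤ Ideal.span {∏ i ∈ s, u i, q} ^ d := by
  -- The ideals are comaximal because the `u i` differ by units, so the intersection of their powers
  -- is a product.
  rw [← Ideal.prod_eq_iInf_of_pairwise_isCoprime (J := fun i => Ideal.span {u i, q} ^ d), Finset.prod_pow]
  · exact Ideal.pow_right_mono (prod_span_pair_le s u q) d
  · intro i hi j hj hij
    refine IsCoprime.pow ?_
    rw [Ideal.isCoprime_iff_sup_eq, Ideal.eq_top_iff_one]
    obtain ⟨v, hv⟩ := hu i hi j hj hij
    have h1 : (1 : A) = ↑v⁻¹ * u i - ↑v⁻¹ * u j := by rw [← mul_sub, ← hv, Units.inv_mul]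
    rw [h1]
    exact sub_mem (Ideal.mul_mem_left _ _ (Ideal.mem_sup_left (Ideal.subset_span (by simp))))
      (Ideal.mul_mem_left _ _ (Ideal.mem_sup_right (Ideal.subset_span (by simp))))

end IdealPowers

/-! ### The chart ideals and divisibility on the charts. -/

section Coefficients

variable {p : ℕ} [Fact p.Prime] {X : Scheme.{0}} {π : X ⟶ projLine p} {k : Fin 2} {m a : ℕ}
  {V : X.affineOpens} {z : Γ(X, V.1)}

/-- Some homomorphism to a field maps `z` to a transcendental element. -/
lemma IsCoordChart.polyEval_injective (h : IsCoordChart p π k m a V z) :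
    Function.Injective (polyEval p (π ≫ projLineStr p) z) := by
  obtain ⟨K, _, c, θ, hθ, -⟩ := exists_genericPoint p
  obtain ⟨ψ, hc, hz⟩ := h.exists_hom K c _ (hθ 0).2
  have h1 : Polynomial.eval₂RingHom c (θ 0 (coord p 0)) =
      ψ.comp (polyEval p (π ≫ projLineStr p) z) := by
    refine Polynomial.ringHom_ext (fun x => ?_) ?_
    · rw [RingHom.comp_apply, polyEval_C, ← hc]
      exact Polynomial.eval₂_C _ _
    · rw [RingHom.comp_apply, polyEval_X, hz]
      exact Polynomial.eval₂_X _ _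
  have h2 := (hθ 0).2
  rw [h1, RingHom.coe_comp] at h2
  exact h2.of_comp

lemma IsCoordChart.natCast_ne_zero (h : IsCoordChart p π k m a V z) : (p : Γ(X, V.1)) ≠ 0 := by
  intro h0
  refine (prime_C_p p).ne_zero (h.polyEval_injective ?_)
  rw [map_natCast, map_natCast, h0, map_zero]

/-- Of the intersection only the component at the class of `a + p ^ m j` is used: modulo `p ^ n`, `x
- (a + p ^ m j)` is `p ^ m (z - j)`. The free `j` is what node charts need. -/
lemma IsCoordChart.appLE_mem_of_mem_chartIdeal (h : IsCoordChart p π k m a V z) (n d j : ℕ)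
    {f : Γ(projLine p, (chart p k).1)} (hf : f ∈ chartIdeal p n d k) :
    π.appLE _ V.1 h.le f ∈ Ideal.span {(p : Γ(X, V.1)) ^ m * (z - (j : Γ(X, V.1))),
      (p : Γ(X, V.1)) ^ n} ^ d := by
  set α : ZMod (p ^ n) := ((a + p ^ m * j : ℕ) : ZMod (p ^ n)) with hα
  have h1 := (Submodule.mem_iInf _).mp hf α
  have h2 := Ideal.mem_map_of_mem (π.appLE _ V.1 h.le).hom h1
  rw [Ideal.map_pow] at h2
  refine Ideal.pow_right_mono ?_ d h2
  set J := Ideal.span {(p : Γ(X, V.1)) ^ m * (z - (j : Γ(X, V.1))), (p : Γ(X, V.1)) ^ n}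
  rw [Ideal.map_le_iff_le_comap, Ideal.span_le]
  rintro g (rfl | rfl)
  · change π.appLE _ V.1 h.le (coord p k - (α.val : Γ(projLine p, (chart p k).1))) ∈ J
    have h3 : π.appLE _ V.1 h.le (α.val : Γ(projLine p, (chart p k).1)) = (α.val : Γ(X, V.1)) :=
      map_natCast (π.appLE _ V.1 h.le).hom _
    rw [map_sub, h.coord_eq, h3, hα, ZMod.val_natCast]
    have h4 : (((a + p ^ m * j) % p ^ n : ℕ) : Γ(X, V.1)) + p ^ n * ((a + p ^ m * j) / p ^ n : ℕ) =
        a + p ^ m * j := by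
      exact_mod_cast congrArg (Nat.cast : ℕ → Γ(X, V.1)) (Nat.mod_add_div (a + p ^ m * j) (p ^ n))
    have h5 : (a : Γ(X, V.1)) + p ^ m * z - (((a + p ^ m * j) % p ^ n : ℕ) : Γ(X, V.1)) =
        p ^ m * (z - j) + ((a + p ^ m * j) / p ^ n : ℕ) * p ^ n := by
      linear_combination -h4
    rw [h5]
    exact add_mem (Ideal.subset_span (by simp)) (Ideal.mul_mem_left _ _ (Ideal.subset_span (by simp)))
  · change π.appLE _ V.1 h.le ((p : Γ(projLine p, (chart p k).1)) ^ n) ∈ J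
    have h3 : π.appLE _ V.1 h.le (p : Γ(projLine p, (chart p k).1)) = (p : Γ(X, V.1)) :=
      map_natCast (π.appLE _ V.1 h.le).hom _
    rw [map_pow, h3]
    exact Ideal.subset_span (by simp)

lemma IsDiscChart.dvd_of_mem_chartIdeal (h : IsDiscChart p π k m a V z) (d : ℕ)
    {f : Γ(projLine p, (chart p k).1)} (hf : f ∈ chartIdeal p m d k) :
    ((p : Γ(X, V.1)) ^ m) ^ d ∣ π.appLE _ V.1 h.le f := by
  rw [← Ideal.mem_span_singleton, ← Ideal.span_singleton_pow]
  refine Ideal.pow_right_mono ?_ d (h.isCoordChart.appLE_mem_of_mem_chartIdeal m d 0 hf)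
  rw [Ideal.span_le]
  rintro g (rfl | rfl)
  · exact Ideal.mul_mem_right _ _ (Ideal.mem_span_singleton_self _)
  · exact Ideal.mem_span_singleton_self _

/-- As `m < n`, the pull-back lies in `p ^ (m d) (z - j, p) ^ d` for every `j`. After cancelling `p
^ (m d)`, the quotient lies in all the comaximal ideals `(z - j, p) ^ d`, hence in `(P(z), p) ^ d`,
and this is `(P(z)) ^ d` since `p = w P(z)`. -/
lemma IsNodeChart.dvd_of_mem_chartIdeal {w : Γ(X, V.1)} (h : IsNodeChart p π k m a V z w) {n : ℕ}
    (hm : m < n) (d : ℕ) {f : Γ(projLine p, (chart p k).1)} (hf : f ∈ chartIdeal p n d k) :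
    ((p : Γ(X, V.1)) ^ m * polyEval p (π ≫ projLineStr p) z (residuePoly p)) ^ d ∣
      π.appLE _ V.1 h.le f := by
  have := h.isNodeCoord.isDomain
  have hp0 := h.isCoordChart.natCast_ne_zero
  have h1 (j : ℕ) : π.appLE _ V.1 h.le f ∈ Ideal.span {((p : Γ(X, V.1)) ^ m) ^ d} *
      Ideal.span {z - (j : Γ(X, V.1)), (p : Γ(X, V.1))} ^ d := by
    rw [← Ideal.span_singleton_pow, ← mul_pow]
    refine Ideal.pow_right_mono ?_ d (h.isCoordChart.appLE_mem_of_mem_chartIdeal n d j hf)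
    rw [Ideal.span_le]
    rintro g (rfl | rfl)
    · exact Ideal.mul_mem_mul (Ideal.mem_span_singleton_self _) (Ideal.subset_span (by simp))
    · rw [← Nat.sub_add_cancel hm, pow_add, pow_succ]
      exact Ideal.mul_mem_left _ _
        (Ideal.mul_mem_mul (Ideal.mem_span_singleton_self _) (Ideal.subset_span (by simp)))
  obtain ⟨g, -, hg⟩ := Ideal.mem_span_singleton_mul.mp (h1 0)
  have h2 (j : ℕ) : g ∈ Ideal.span {z - (j : Γ(X, V.1)), (p : Γ(X, V.1))} ^ d := by
    obtain ⟨g', hg', e⟩ := Ideal.mem_span_singleton_mul.mp (h1 j)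
    rwa [← mul_left_cancel₀ (pow_ne_zero d (pow_ne_zero m hp0)) (e.trans hg.symm)]
  have h3 := iInf_span_pair_pow_le (Finset.range p) (fun j => z - (j : Γ(X, V.1))) (p : Γ(X, V.1)) d
    (by
      intro i hi j hj hij
      have := isUnit_natCast_sub_natCast p (constants (π ≫ projLineStr p) V.1)
        (Finset.mem_range.mp hj) (Finset.mem_range.mp hi) hij.symm
      convert this using 1
      ring) (by
      simp only [Submodule.mem_iInf]
      exact fun j _ => h2 j)
  rw [← eval₂_residuePoly p (constants (π ≫ projLineStr p) V.1)] at h3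
  change g ∈ Ideal.span {polyEval p (π ≫ projLineStr p) z (residuePoly p), (p : Γ(X, V.1))} ^ d at h3
  have h4 : Ideal.span {polyEval p (π ≫ projLineStr p) z (residuePoly p), (p : Γ(X, V.1))} ≤
      Ideal.span {polyEval p (π ≫ projLineStr p) z (residuePoly p)} := by
    rw [Ideal.span_le]
    rintro g (rfl | rfl)
    · exact Ideal.mem_span_singleton_self _
    · rw [← h.isNodeCoord.mul_eq]
      exact Ideal.mul_mem_left _ _ (Ideal.mem_span_singleton_self _)
  have h5 := Ideal.pow_right_mono h4 d h3
  rw [Ideal.span_singleton_pow, Ideal.mem_span_singleton] at h5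
  rw [← hg, mul_pow]
  exact mul_dvd_mul_left _ h5

/-- Discs alone suffice for the converse: on the disc around `a`, the divisibility is one of `F(a +
p ^ n z)` in a polynomial ring, where it can be tested on coefficients. -/
lemma mem_chartIdeal (n d : ℕ)
    {f : Γ(projLine p, (chart p k).1)}
    (hf : ∀ a < p ^ n, ∃ (V : X.affineOpens) (z : Γ(X, V.1)) (h : IsDiscChart p π k n a V z),
      ((p : Γ(X, V.1)) ^ n) ^ d ∣ π.appLE _ V.1 h.le f) : f ∈ chartIdeal p n d k := by
  refine (Submodule.mem_iInf _).mpr fun α => ?_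
  have : NeZero (p ^ n) := ⟨pow_ne_zero n (Fact.out : p.Prime).ne_zero⟩
  obtain ⟨V, z, hV, h1⟩ := hf _ (ZMod.val_lt α)
  obtain ⟨F, rfl⟩ := (polyEval_chart_bijective p k).2 f
  rw [appLE_polyEval, hV.coord_eq, polyEval_comp _ _ z n _ rfl] at h1
  obtain ⟨g, hg⟩ := h1
  obtain ⟨G, rfl⟩ := hV.bijective.2 g
  have h2 := mem_span_pow_of_dvd_comp ((p : ℤ_[p]) ^ n) (α.val : ℤ_[p])
    (pow_ne_zero n PadicInt.prime_p.ne_zero) d F ⟨G, by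
      apply hV.bijective.1
      rw [hg, map_mul, map_pow, map_pow, map_pow, map_natCast, map_natCast]⟩
  have h3 := Ideal.mem_map_of_mem (polyEval p (projLineStr p) (coord p k)) h2
  rw [Ideal.map_pow, Ideal.map_span, Set.image_pair, map_sub, polyEval_X, map_pow, map_pow,
    map_natCast, map_natCast, map_natCast, map_natCast] at h3
  exact h3

end Coefficients

/-! ### The ideal sheaf on the projective line. -/

section IdealSheaf

variable {p : ℕ} [Fact p.Prime]

lemma appLE_coord_mul_appLE_coord {Y : Scheme.{0}} (f : Y ⟶ projLine p) {W : Y.Opens} {k l : Fin 2} (hkl : k ≠ l)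
    (hk : W ≤ f ⁻¹ᵁ (chart p k).1) (hl : W ≤ f ⁻¹ᵁ (chart p l).1) :
    f.appLE _ W hk (coord p k) * f.appLE _ W hl (coord p l) = 1 := by
  have key (h0 : W ≤ f ⁻¹ᵁ (chart p 0).1) (h1 : W ≤ f ⁻¹ᵁ (chart p 1).1) :
      f.appLE _ W h0 (coord p 0) * f.appLE _ W h1 (coord p 1) = 1 := by
    have h2 := congrArg (f.appLE _ W (le_preimage_inf f h0 h1)) (coord_mul_coord p)
    rw [map_mul, map_one, map_appLE_apply f _ _ h0, map_appLE_apply f _ _ h1] at h2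
    exact h2
  fin_cases k <;> fin_cases l
  · exact absurd rfl hkl
  · exact key hk hl
  · exact (mul_comm _ _).trans (key hl hk)
  · exact absurd rfl hkl

/-- In the second coordinate the point `x = α` is `y = α⁻¹` when `α` is a unit; when `α` is
nilpotent, the point does not meet the other chart. -/
lemma exists_inverse_or_pow_eq_zero (n : ℕ) (α : ZMod (p ^ n)) : (∃ β, α * β = 1) ∨ α ^ n = 0 := by
  have : NeZero (p ^ n) := ⟨pow_ne_zero n (Fact.out : p.Prime).ne_zero⟩
  by_cases h : p ∣ α.val
  · obtain ⟨c, hc⟩ := h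
    right
    rw [← ZMod.natCast_zmod_val α, hc, ← Nat.cast_pow, mul_pow, Nat.cast_mul, ZMod.natCast_self,
      zero_mul]
  · left
    have h1 : IsUnit ((α.val : ℕ) : ZMod (p ^ n)) := (ZMod.isUnit_iff_coprime _ _).mpr
      (Nat.Coprime.pow_right n (((Fact.out : p.Prime).coprime_iff_not_dvd.mpr h).symm))
    rw [ZMod.natCast_zmod_val] at h1
    exact h1.exists_right_inv

-- The point `x = α` with values in `ℤ / p ^ n`. On the other chart it is `y = β` with `α β = 1`, or
-- it misses the chart; then the ring of functions on the preimage is zero and `β = 0` serves.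
variable (p) in
lemma exists_point (n : ℕ) (k : Fin 2) (α : ZMod (p ^ n)) :
    ∃ s : Spec (CommRingCat.of (ZMod (p ^ n))) ⟶ projLine p,
      RingHom.ker (s.app (chart p k).1).hom ≤ Ideal.span {coord p k -
        (α.val : Γ(projLine p, (chart p k).1)), (p : Γ(projLine p, (chart p k).1)) ^ n} ∧
      ∀ l, ∃ β : ZMod (p ^ n), Ideal.span {coord p l - (β.val : Γ(projLine p, (chart p l).1)),
        (p : Γ(projLine p, (chart p l).1)) ^ n} ≤ RingHom.ker (s.app (chart p l).1).hom := by
  have : NeZero (p ^ n) := ⟨pow_ne_zero n (Fact.out : p.Prime).ne_zero⟩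
  have hU : IsAffineOpen (chart p k).1 := (chart p k).2
  have hb := polyEval_chart_bijective p k
  obtain ⟨θ, hθ⟩ := exists_hom_of_bijective hb (Polynomial.eval₂RingHom (PadicInt.toZModPow n) α)
  set s := toAffine hU θ with hs
  obtain ⟨htop, hsθ⟩ := appLE_of_eq_toAffine hU θ s rfl
  refine ⟨s, ?_, fun l => ?_⟩
  · intro f hf
    have h1 : θ f = 0 := by
      have h2 : s.appLE _ ⊤ htop f = 0 := by
        have h3 : s.appLE _ ⊤ htop f = (Spec _).presheaf.map (homOfLE htop).op (s.app _ f) := rfl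
        have h4 : s.app _ f = 0 := hf
        rw [h3, h4, map_zero]
      rw [← hsθ, h2, map_zero]
    obtain ⟨F, rfl⟩ := hb.2 f
    rw [hθ] at h1
    obtain ⟨Q, hQ⟩ := Polynomial.X_sub_C_dvd_sub_C_eval (p := F) (a := (α.val : ℤ_[p]))
    have h2 : (PadicInt.toZModPow n) (F.eval (α.val : ℤ_[p])) = 0 := by
      rw [← Polynomial.eval₂_at_apply, map_natCast, ZMod.natCast_zmod_val]
      exact h1
    rw [← RingHom.mem_ker, PadicInt.ker_toZModPow, Ideal.mem_span_singleton] at h2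
    obtain ⟨c, hc⟩ := h2
    rw [sub_eq_iff_eq_add.mp hQ, hc, map_add, map_mul, map_sub, polyEval_X, Polynomial.C_mul, map_mul,
      Polynomial.C_pow, map_pow, map_natCast, map_natCast, map_natCast, map_natCast]
    exact add_mem (Ideal.mul_mem_right _ _ (Ideal.subset_span (by simp)))
      (Ideal.mul_mem_right _ _ (Ideal.subset_span (by simp)))
  · set T := s ⁻¹ᵁ (chart p l).1 with hT
    let j : ZMod (p ^ n) →+* Γ(Spec (CommRingCat.of (ZMod (p ^ n))), T) :=
      ((Scheme.ΓSpecIso _).inv ≫ (Spec (CommRingCat.of (ZMod (p ^ n)))).presheaf.map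
        (homOfLE (le_top : T ≤ ⊤)).op).hom
    have hTk : T ≤ s ⁻¹ᵁ (chart p k).1 := le_top.trans htop
    have hTl : T ≤ s ⁻¹ᵁ (chart p l).1 := le_rfl
    have hk : s.appLE _ T hTk (coord p k) = j α := by
      have h1 : s.appLE _ ⊤ htop (coord p k) =
          (Scheme.ΓSpecIso (CommRingCat.of (ZMod (p ^ n)))).inv α := by
        have h2 : θ (coord p k) = α := by
          conv_lhs => rw [← polyEval_X (projLineStr p) (coord p k)]
          exact (hθ _).trans (Polynomial.eval₂_X _ _)
        rw [← h2, ← hsθ]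
        exact congr($(Iso.hom_inv_id (Scheme.ΓSpecIso (CommRingCat.of (ZMod (p ^ n)))))
          (s.appLE _ ⊤ htop (coord p k))).symm
      rw [← appLE_map_apply s htop le_top, h1]
      rfl
    have hl : ∃ β, s.appLE _ T hTl (coord p l) = j β := by
      by_cases hkl : k = l
      · subst hkl
        exact ⟨α, hk⟩
      · have h1 := appLE_coord_mul_appLE_coord s hkl hTk hTl
        rw [hk] at h1
        rcases exists_inverse_or_pow_eq_zero n α with ⟨β, hβ⟩ | h0
        · refine ⟨β, ?_⟩
          have h2 : j α * j β = 1 := by rw [← map_mul, hβ, map_one]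
          have h3 : IsUnit (j α) := IsUnit.of_mul_eq_one _ h2
          exact h3.mul_left_cancel (h1.trans h2.symm)
        · have h2 := congr($h1 ^ n)
          rw [mul_pow, ← map_pow, h0, map_zero, zero_mul, one_pow] at h2
          refine ⟨0, ?_⟩
          rw [← mul_one (s.appLE _ T hTl (coord p l)), ← h2, mul_zero, map_zero]
    obtain ⟨β, hβ⟩ := hl
    refine ⟨β, ?_⟩
    rw [Ideal.span_le]
    have happ (f) : s.appLE _ T hTl f = s.app (chart p l).1 f := by rw [Scheme.Hom.appLE_eq_app]
    have hnat (i : ℕ) : s.appLE _ T hTl (i : Γ(projLine p, (chart p l).1)) = i :=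
      map_natCast (s.appLE _ T hTl).hom i
    rintro f (rfl | rfl)
    · refine (happ _).symm.trans ?_
      rw [map_sub, hβ, hnat, ← map_natCast j, ZMod.natCast_zmod_val, sub_self]
    · refine (happ _).symm.trans ?_
      rw [map_pow, hnat, ← map_natCast j, ← map_pow, ← Nat.cast_pow, ZMod.natCast_self, map_zero]

-- The ideal sheaf is the intersection of the `d`-th powers of the kernels of all these points,
-- taken from both charts. On a given chart the points of the other one impose no new condition.
variable (p) in
lemma exists_idealSheaf (n d : ℕ) : ∃ I : (projLine p).IdealSheafData,
    ∀ k, I.ideal (chart p k) = chartIdeal p n d k := by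
  have : NeZero (p ^ n) := ⟨pow_ne_zero n (Fact.out : p.Prime).ne_zero⟩
  choose s hs hs' using fun q : Fin 2 × ZMod (p ^ n) => exists_point p n q.1 q.2
  have hqc (q) : QuasiCompact (s q) := inferInstance
  refine ⟨⨅ q, (s q).ker ^ d, fun k => ?_⟩
  rw [Scheme.IdealSheafData.ideal_iInf, iInf_apply]
  simp only [Scheme.IdealSheafData.ideal_pow, Pi.pow_apply, Scheme.Hom.ker_apply]
  apply le_antisymm
  · exact le_iInf fun α => (iInf_le _ (k, α)).trans (Ideal.pow_right_mono (hs (k, α)) d)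
  · refine le_iInf fun q => ?_
    obtain ⟨β, hβ⟩ := hs' q k
    exact (iInf_le _ β).trans (Ideal.pow_right_mono hβ d)

end IdealSheaf

/-! ### Local criterion for membership in the ideal sheaf. -/

section LocalCriterion

variable {p : ℕ} [Fact p.Prime] {X : Scheme.{0}}

variable (p) in
/-- The chart `V` and the coefficient `g` by which, on `V`, the generators of the sheaf of logarithmic
derivations and of the inverse image of the tangent sheaf of the projective line differ. -/
inductive IsModelCoeff (n : ℕ) (π : X ⟶ projLine p) (k : Fin 2) : ∀ V : X.Opens, Γ(X, V) → Prop
  | disc {a : ℕ} {W : X.affineOpens} {z : Γ(X, W.1)} (h : IsDiscChart p π k n a W z) :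
      IsModelCoeff n π k W.1 ((p : Γ(X, W.1)) ^ n)
  | node {m a : ℕ} {W : X.affineOpens} {z w : Γ(X, W.1)} (hm : m < n)
      (h : IsNodeChart p π k m a W z w) : IsModelCoeff n π k W.1
        ((p : Γ(X, W.1)) ^ m * polyEval p (π ≫ projLineStr p) z (residuePoly p))

variable {n : ℕ} {π : X ⟶ projLine p} {k : Fin 2}

lemma IsModel.exists_isModelCoeff (hX : IsModel p n X π) (y : X) (hy : y ∈ π ⁻¹ᵁ (chart p k).1) :
    ∃ V g, IsModelCoeff p n π k V g ∧ y ∈ V := by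
  rcases hX.exists_mem_chart k y hy with ⟨a, V, z, hV, hyV⟩ | ⟨m, a, V, z, w, hm, hV, hyV⟩
  · exact ⟨_, _, .disc hV, hyV⟩
  · exact ⟨_, _, .node hm hV, hyV⟩

lemma IsModelCoeff.isCoordChart {V : X.Opens} {g : Γ(X, V)} (h : IsModelCoeff p n π k V g) :
    ∃ (m a : ℕ) (hV : IsAffineOpen V) (z : Γ(X, V)), IsCoordChart p π k m a ⟨V, hV⟩ z := by
  cases h with
  | disc h => exact ⟨_, _, _, _, h.isCoordChart⟩
  | node _ h => exact ⟨_, _, _, _, h.isCoordChart⟩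

lemma IsModelCoeff.ne_zero {V : X.Opens} {g : Γ(X, V)} (h : IsModelCoeff p n π k V g) : g ≠ 0 := by
  cases h with
  | disc h =>
    have := h.isCoordChart.isDomain
    exact pow_ne_zero _ h.isCoordChart.natCast_ne_zero
  | node _ h =>
    have := h.isCoordChart.isDomain
    refine mul_ne_zero (pow_ne_zero _ h.isCoordChart.natCast_ne_zero) fun h0 => ?_
    exact (residuePoly_monic p).ne_zero (h.isCoordChart.polyEval_injective (h0.trans (map_zero _).symm))

lemma IsModelCoeff.dvd_of_mem_chartIdeal {V : X.Opens} {g : Γ(X, V)} (h : IsModelCoeff p n π k V g)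
    (hV : V ≤ π ⁻¹ᵁ (chart p k).1) (d : ℕ) {f : Γ(projLine p, (chart p k).1)}
    (hf : f ∈ chartIdeal p n d k) : g ^ d ∣ π.appLE _ V hV f := by
  cases h with
  | disc h => exact h.dvd_of_mem_chartIdeal d hf
  | node hm h => exact h.dvd_of_mem_chartIdeal hm d hf

lemma germ_ne_zero [IsIntegral X] {W : X.Opens} (y : X) (hy : y ∈ W) {f : Γ(X, W)} (hf : f ≠ 0) :
    X.presheaf.germ W y hy f ∈ nonZeroDivisors (X.presheaf.stalk y) := by
  refine mem_nonZeroDivisors_of_ne_zero fun h0 => hf (germ_injective_of_isIntegral X y hy ?_)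
  exact h0.trans (map_zero (X.presheaf.germ W y hy).hom).symm

/-- Divisibility by the nonzerodivisor `g ^ d` can be checked on stalks. There `r` lies in the ideal
generated by the chart ideal, all of whose elements become divisible by `g ^ d` on the chart. -/
lemma IsModel.exists_coeff_mul (hX : IsModel p n X π) (d : ℕ) (I : (projLine p).IdealSheafData)
    (hI : I.ideal (chart p k) = chartIdeal p n d k) (O : (projLine p).Opens)
    (r : Γ(projLine p, O))
    (hr : ∀ x ∈ O, ∃ (V : (projLine p).affineOpens) (h : V.1 ≤ O), x ∈ V.1 ∧
      (projLine p).presheaf.map (homOfLE h).op r ∈ I.ideal V)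
    {V : X.Opens} {g : Γ(X, V)} (hg : IsModelCoeff p n π k V g) :
    ∃ c : Γ(X, V ⊓ π ⁻¹ᵁ O), π.appLE O (V ⊓ π ⁻¹ᵁ O) inf_le_right r =
      X.presheaf.map (homOfLE inf_le_left).op g ^ d * c := by
  have := hX.isIntegral
  obtain ⟨m, a, hVa, z, hz⟩ := hg.isCoordChart
  have hle : V ≤ π ⁻¹ᵁ (chart p k).1 := hz.le
  obtain ⟨c, hc⟩ := exists_quotient (X.presheaf.map (homOfLE (inf_le_left : V ⊓ π ⁻¹ᵁ O ≤ V)).op g ^ d)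
    (π.appLE O (V ⊓ π ⁻¹ᵁ O) inf_le_right r) (by
      intro y hy
      rw [map_pow, germ_map]
      exact pow_mem (germ_ne_zero y _ hg.ne_zero) d) (by
      intro y hy
      have hyV : y ∈ V := hy.1
      have hyO : π y ∈ O := hy.2
      obtain ⟨V₁, h₁, hx, hr₁⟩ := hr (π y) hyO
      have h1 := Ideal.mem_map_of_mem ((projLine p).presheaf.germ V₁.1 (π y) hx).hom hr₁
      rw [map_germ_ideal_eq I (chart p k) V₁ (π y) (hle hyV) hx, hI] at h1
      have h2 : (projLine p).presheaf.germ O (π y) hyO r ∈ (chartIdeal p n d k).map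
          ((projLine p).presheaf.germ (chart p k).1 (π y) (hle hyV)).hom := by
        rw [← germ_map h₁ (π y) hx]
        exact h1
      have h3 := Ideal.mem_map_of_mem (π.stalkMap y).hom h2
      have h4 : (π.stalkMap y) ((projLine p).presheaf.germ O (π y) hyO r) =
          X.presheaf.germ (V ⊓ π ⁻¹ᵁ O) y hy (π.appLE O (V ⊓ π ⁻¹ᵁ O) inf_le_right r) := by
        rw [germ_appLE, Scheme.Hom.germ_stalkMap_apply]
      rw [← h4, map_pow, germ_map]
      rw [Ideal.map_map] at h3
      refine Ideal.map_le_iff_le_comap.mpr (fun f hf => ?_) h3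
      rw [Ideal.mem_comap, Ideal.mem_span_singleton, RingHom.comp_apply]
      have h5 : π.stalkMap y ((projLine p).presheaf.germ (chart p k).1 (π y) (hle hyV) f) =
          X.presheaf.germ V y hyV (π.appLE _ V hle f) := by
        rw [germ_appLE]
        exact Scheme.Hom.germ_stalkMap_apply π _ y (hle hyV) f
      have h6 := map_dvd (X.presheaf.germ V y hyV).hom (hg.dvd_of_mem_chartIdeal hle d hf)
      rw [map_pow] at h6
      refine h6.trans (dvd_of_eq ?_)
      exact h5.symm)
  exact ⟨c, hc.symm⟩

/-- On a basic open, `r` becomes a function `f` on the whole chart after multiplication by a power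
of `γ`. The given divisibility holds only where `γ` is invertible on the disc and extends to the
disc after a further power of `γ`. -/
lemma IsModel.exists_mem_ideal (hX : IsModel p n X π) (d : ℕ) (I : (projLine p).IdealSheafData)
    (hI : I.ideal (chart p k) = chartIdeal p n d k) (O : (projLine p).Opens) (hO : O ≤ (chart p k).1)
    (r : Γ(projLine p, O))
    (hr : ∀ V g, IsModelCoeff p n π k V g → ∃ c : Γ(X, V ⊓ π ⁻¹ᵁ O),
      π.appLE O (V ⊓ π ⁻¹ᵁ O) inf_le_right r = X.presheaf.map (homOfLE inf_le_left).op g ^ d * c)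
    (x : projLine p) (hx : x ∈ O) :
    ∃ (V : (projLine p).affineOpens) (h : V.1 ≤ O), x ∈ V.1 ∧
      (projLine p).presheaf.map (homOfLE h).op r ∈ I.ideal V := by
  have := hX.isIntegral
  have hU : IsAffineOpen (chart p k).1 := (chart p k).2
  obtain ⟨γ, hγ, hxγ⟩ := hU.exists_basicOpen_le (V := O) ⟨x, hx⟩ (hO hx)
  have hγ0 := ne_zero_of_mem_basicOpen hxγ
  obtain ⟨N, f, hf⟩ := exists_pow_mul_eq hU γ hγ r
  -- the quotient exists on each disc, after multiplication by a power of `γ`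
  have key (a : ℕ) (V : X.affineOpens) (z : Γ(X, V.1)) (h : IsDiscChart p π k n a V z) :
      ∃ M, ((p : Γ(X, V.1)) ^ n) ^ d ∣ π.appLE _ V.1 h.le (γ ^ M * f) := by
    have hVa : IsAffineOpen V.1 := V.2
    obtain ⟨c, hc⟩ := hr _ _ (.disc h)
    set D := X.basicOpen (π.appLE _ V.1 h.le γ) with hD
    have hDV : D ≤ V.1 := X.basicOpen_le _
    have hDγ : D ≤ π ⁻¹ᵁ (projLine p).basicOpen γ := basicOpen_appLE_le π h.le γ
    have hDO : D ≤ V.1 ⊓ π ⁻¹ᵁ O := le_inf hDV (hDγ.trans (preimage_le_preimage π hγ))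
    have hDU : D ≤ π ⁻¹ᵁ (chart p k).1 := hDV.trans h.le
    obtain ⟨M, c', hc'⟩ := exists_pow_mul_eq hVa (π.appLE _ V.1 h.le γ) hDO c
    obtain ⟨y, hy⟩ := exists_mem_basicOpen (f := π.appLE _ V.1 h.le γ)
      fun h0 => hγ0 (h.appLE_injective (h0.trans (map_zero _).symm))
    refine ⟨M, π.appLE _ V.1 h.le γ ^ N * c', map_injective_of_mem hDV hy ?_⟩
    have e1 := congrArg (π.appLE _ D hDγ) (hf M)
    rw [map_appLE_apply π hDγ _ hDU, map_mul, map_mul, map_pow, map_pow, map_appLE_apply π hDγ _ hDU,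
      map_appLE_apply π hDγ _ (hDγ.trans (preimage_le_preimage π hγ))] at e1
    have e2 := congrArg (X.presheaf.map (homOfLE hDO).op) hc
    rw [appLE_map_apply, map_mul, map_pow, map_map] at e2
    have e3 : X.presheaf.map (homOfLE hDV).op (π.appLE _ V.1 h.le γ ^ N * c') =
        π.appLE _ D hDU γ ^ (M + N) * X.presheaf.map (homOfLE hDO).op c :=
      (hc' N).trans (by rw [appLE_map_apply])
    have e4 : X.presheaf.map (homOfLE hDV).op (((p : Γ(X, V.1)) ^ n) ^ d) =
      X.presheaf.map (homOfLE hDV).op ((p : Γ(X, V.1)) ^ n) ^ d := map_pow _ _ _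
    rw [appLE_map_apply, map_mul, map_pow, e1, e2, map_mul, e3, e4]
    ring
  have hNZ : NeZero (p ^ n) := ⟨pow_ne_zero n (Fact.out : p.Prime).ne_zero⟩
  choose W ζ hW using fun a : ℕ => hX.exists_isDiscChart k a
  choose M hM using fun a : ℕ => key a (W a) (ζ a) (hW a)
  -- Only the finitely many discs around the residues modulo `p ^ n` are needed, so one exponent
  -- works for all of them.
  set M' := (Finset.range (p ^ n)).sup M
  have hmem : γ ^ M' * f ∈ chartIdeal p n d k := by
    refine mem_chartIdeal n d fun a ha => ⟨W a, ζ a, hW a, ?_⟩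
    have hle : M a ≤ M' := Finset.le_sup (Finset.mem_range.mpr ha)
    rw [← Nat.sub_add_cancel hle, pow_add, mul_assoc,
      map_mul]
    exact (hM a).mul_left _
  refine ⟨(projLine p).affineBasicOpen γ, hγ, hxγ, ?_⟩
  have hmem' := Ideal.mem_map_of_mem ((projLine p).presheaf.map (homOfLE ((projLine p).basicOpen_le γ)).op).hom
    (hI.symm ▸ hmem : γ ^ M' * f ∈ I.ideal (chart p k))
  rw [I.map_ideal_basicOpen] at hmem'
  have hloc := hU.isLocalization_basicOpen γ
  have hu : IsUnit ((projLine p).presheaf.map (homOfLE ((projLine p).basicOpen_le γ)).op γ) :=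
    IsLocalization.Away.algebraMap_isUnit (S := Γ(projLine p, (projLine p).basicOpen γ)) γ
  refine (Ideal.unit_mul_mem_iff_mem _ (hu.pow (N + M'))).mp ?_
  exact (congrArg (· ∈ I.ideal ((projLine p).affineBasicOpen γ)) (hf M')).mp hmem'

end LocalCriterion

/-! ### Derivations are determined by the value at a coordinate. -/

namespace DerivationAlong

section General

variable {f : Y ⟶ X} {s : X ⟶ S} {V : Y.Opens} (D : DerivationAlong f s V)

/-- A derivation that vanishes on the functions on an affine open vanishes. -/
lemma eq_zero_of_isAffineOpen {U : X.Opens} (hU : IsAffineOpen U) (hV : V ≤ f ⁻¹ᵁ U)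
    (h : ∀ (W : Y.Opens) (hW : W ≤ V) (a : Γ(X, U)), D.app U W hW (hW.trans hV) a = 0) : D = 0 := by
  refine ext_app fun U' W hW hWU' a => section_eq_of_local _ _ fun y hy => ?_
  have hyU : f y ∈ U := hV (hW hy)
  have hyU' : f y ∈ U' := hWU' hy
  obtain ⟨g, hg, hyg⟩ := hU.exists_basicOpen_le (V := U' ⊓ U) ⟨f y, ⟨hyU', hyU⟩⟩ hyU
  have hgU : X.basicOpen g ≤ U := X.basicOpen_le g
  have hgU' : X.basicOpen g ≤ U' := hg.trans inf_le_left
  obtain ⟨N, b, hb⟩ := exists_pow_mul_eq hU g hgU' a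
  set W' := W ⊓ f ⁻¹ᵁ X.basicOpen g with hW'
  have i : W' ≤ W := inf_le_left
  have hW'g : W' ≤ f ⁻¹ᵁ X.basicOpen g := inf_le_right
  refine ⟨W', i, ⟨hy, hyg⟩, ?_⟩
  rw [zero_app, map_zero, ← D.map_res U' (X.basicOpen g) W W' hW hWU' hW'g hgU' i a]
  have h1 (r : Γ(X, U)) : D.app (X.basicOpen g) W' (i.trans hW) hW'g
      (X.presheaf.map (homOfLE hgU).op r) = 0 := by
    rw [D.map_res U (X.basicOpen g) W' W' (i.trans hW) (hW'g.trans (preimage_le_preimage f hgU)) hW'g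
      hgU le_rfl r, h W' (i.trans hW) r, map_zero]
  -- On the basic open, `g ^ N a` extends to `U`. Leibniz gives `g ^ N D(a) = 0`, and `g` is a unit
  -- there.
  have h2 := D.leibniz (X.basicOpen g) W' (i.trans hW) hW'g
    (X.presheaf.map (homOfLE hgU).op (g ^ N)) (X.presheaf.map (homOfLE hgU').op a)
  have h3 : X.presheaf.map (homOfLE hgU).op (g ^ N) * X.presheaf.map (homOfLE hgU').op a =
      X.presheaf.map (homOfLE hgU).op b := by
    have := hb 0
    rw [pow_zero, one_mul, add_zero] at this
    rw [this, map_pow]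
  rw [h3, h1, h1, mul_zero, add_zero] at h2
  have hu : IsUnit (f.appLE (X.basicOpen g) W' hW'g (X.presheaf.map (homOfLE hgU).op (g ^ N))) := by
    have := hU.isLocalization_basicOpen g
    have h4 : IsUnit (X.presheaf.map (homOfLE hgU).op g) :=
      IsLocalization.Away.algebraMap_isUnit (S := Γ(X, X.basicOpen g)) g
    rw [map_pow]
    exact (h4.pow N).map (f.appLE (X.basicOpen g) W' hW'g).hom
  exact hu.mul_right_eq_zero.mp h2.symm

lemma ext_of_isAffineOpen {D E : DerivationAlong f s V} {U : X.Opens} (hU : IsAffineOpen U)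
    (hV : V ≤ f ⁻¹ᵁ U)
    (h : ∀ (W : Y.Opens) (hW : W ≤ V) (a : Γ(X, U)), D.app U W hW (hW.trans hV) a =
      E.app U W hW (hW.trans hV) a) : D = E := by
  rw [← sub_eq_zero, sub_eq_add_neg]
  refine eq_zero_of_isAffineOpen _ hU hV fun W hW a => ?_
  rw [add_app, neg_app, h, add_neg_cancel]

end General

section Polynomials

variable {p : ℕ} [Fact p.Prime] {X Y : Scheme.{0}} {f : Y ⟶ X} {t : X ⟶ base p} {V : Y.Opens}
  (D : DerivationAlong f t V)

lemma app_constants (U W hV hU) (c : ℤ_[p]) : D.app U W hV hU (constants t U c) = 0 := by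
  have hle : U ≤ t ⁻¹ᵁ ⊤ := fun _ _ => trivial
  have hW : W ≤ f ⁻¹ᵁ (t ⁻¹ᵁ ⊤) := fun _ _ => trivial
  have h1 := D.map_base ⊤ W hV hW ((Scheme.ΓSpecIso _).inv c)
  have h2 := D.map_res (t ⁻¹ᵁ ⊤) U W W hV hW hU hle le_rfl (t.app ⊤ ((Scheme.ΓSpecIso _).inv c))
  rw [h1, map_zero] at h2
  exact h2

lemma app_polyEval (U W hV hU) (z : Γ(X, U)) (F : Polynomial ℤ_[p]) :
    D.app U W hV hU (polyEval p t z F) =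
      f.appLE U W hU (polyEval p t z (Polynomial.derivative F)) * D.app U W hV hU z := by
  induction F using Polynomial.induction_on with
  | C c => rw [polyEval_C, app_constants, Polynomial.derivative_C, map_zero, map_zero, zero_mul]
  | add F G hF hG => rw [map_add, map_add, hF, hG, Polynomial.derivative_add, map_add, map_add, add_mul]
  | monomial n c h =>
    have hd : Polynomial.derivative (Polynomial.C c * Polynomial.X ^ n * Polynomial.X) =
        Polynomial.derivative (Polynomial.C c * Polynomial.X ^ n) * Polynomial.X +
          Polynomial.C c * Polynomial.X ^ n := by
      rw [Polynomial.derivative_mul (f := Polynomial.C c * Polynomial.X ^ n),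
        Polynomial.derivative_X, mul_one]
    rw [pow_succ, ← mul_assoc, hd]
    generalize Polynomial.C c * Polynomial.X ^ n = M at h ⊢
    rw [map_mul, D.leibniz, h, polyEval_X, map_add, map_add, map_mul,
      map_mul, polyEval_X]
    ring

end Polynomials

end DerivationAlong

section Charts

variable {p : ℕ} [Fact p.Prime] {Y : Scheme.{0}}

/-- A derivation along a morphism to a chart of the projective line is determined by its value at the
coordinate. -/
lemma DerivationAlong.ext_of_chart {f : Y ⟶ projLine p} {k : Fin 2} {V : Y.Opens}
    (hV : V ≤ f ⁻¹ᵁ (chart p k).1) {D E : DerivationAlong f (projLineStr p) V}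
    (h : D.app _ V le_rfl hV (coord p k) = E.app _ V le_rfl hV (coord p k)) : D = E := by
  refine ext_of_isAffineOpen (chart p k).2 hV fun W hW a => ?_
  obtain ⟨F, rfl⟩ := (polyEval_chart_bijective p k).2 a
  have h1 (D : DerivationAlong f (projLineStr p) V) :
      D.app _ W hW (hW.trans hV) (coord p k) =
        Y.presheaf.map (homOfLE hW).op (D.app _ V le_rfl hV (coord p k)) := by
    rw [← D.map_res _ _ V W le_rfl hV (hW.trans hV) le_rfl hW, map_self]
  rw [app_polyEval, app_polyEval, h1, h1, h]

variable {π : Y ⟶ projLine p} {k : Fin 2} {m a : ℕ} {V : Y.affineOpens} {z : Γ(Y, V.1)}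

/-- A derivation is determined by its value at the coordinate of a chart. -/
lemma IsCoordChart.derivation_ext [IsIntegral Y] (h : IsCoordChart p π k m a V z) {V' : Y.Opens}
    (hV' : V' ≤ V.1) {D E : DerivationAlong (𝟙 Y) (π ≫ projLineStr p) V'}
    (hDE : D.act V.1 V' le_rfl hV' z = E.act V.1 V' le_rfl hV' z) : D = E := by
  have hV : IsAffineOpen V.1 := V.2
  refine DerivationAlong.ext_of_isAffineOpen (U := V.1) hV hV' fun W hW g => ?_
  change D.act V.1 W hW (hW.trans hV') g = E.act V.1 W hW (hW.trans hV') g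
  refine section_eq_of_local _ _ fun y hy => ⟨W, le_rfl, hy, congrArg _ ?_⟩
  have hWV : W ≤ V.1 := hW.trans hV'
  -- The function is a fraction `G / s` in `z`, so its derivative is determined by that of `z`
  -- through the Leibniz rule; `s ≠ 0` as `p` does not divide it.
  obtain ⟨s, G, hs, e⟩ := h.exists_mul g
  have h1 (D : DerivationAlong (𝟙 Y) (π ≫ projLineStr p) V') : D.act V.1 W hW hWV z =
      Y.presheaf.map (homOfLE hW).op (D.act V.1 V' le_rfl hV' z) := by
    rw [← D.act_res _ _ V' W le_rfl hV' hWV le_rfl hW, map_self]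
  have h2 (D : DerivationAlong (𝟙 Y) (π ≫ projLineStr p) V') (F : Polynomial ℤ_[p]) : D.act V.1 W hW hWV (polyEval p (π ≫ projLineStr p) z F) =
      Y.presheaf.map (homOfLE hWV).op (polyEval p (π ≫ projLineStr p) z (Polynomial.derivative F)) *
        Y.presheaf.map (homOfLE hW).op (D.act V.1 V' le_rfl hV' z) := by
    rw [← h1, ← id_appLE_apply hWV hWV]
    exact D.app_polyEval V.1 W hW hWV z F
  have h3 (D : DerivationAlong (𝟙 Y) (π ≫ projLineStr p) V') := congrArg (D.act V.1 W hW hWV) e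
  simp only [DerivationAlong.act_mul, h2] at h3
  have h4 := h3 D
  rw [hDE, ← h3 E, add_right_inj] at h4
  have : Nonempty W := ⟨⟨y, hy⟩⟩
  refine mul_left_cancel₀ ?_ h4
  intro h0
  refine hs (h.polyEval_injective (?_ : polyEval p (π ≫ projLineStr p) z s = polyEval p (π ≫ projLineStr p) z 0) ▸ dvd_zero _)
  refine map_injective_of_mem hWV hy ?_
  rw [h0, map_zero, map_zero]

/-- The differential of the projection is injective. -/
lemma IsModel.precomp_injective {n : ℕ} (hX : IsModel p n Y π) {V : Y.Opens}
    {D E : DerivationAlong (𝟙 Y) (π ≫ projLineStr p) V}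
    (h : D.precomp π (projLineStr p) = E.precomp π (projLineStr p)) : D = E := by
  have := hX.isIntegral
  refine DerivationAlong.ext_app fun U W hV hU g => section_eq_of_local _ _ fun y hy => ?_
  obtain ⟨k, m, a, V₀, z, hz, hy₀, -⟩ := hX.exists_mem_coordChart y
  have hle : W ⊓ V₀.1 ≤ V := inf_le_left.trans hV
  have hV₀ : W ⊓ V₀.1 ≤ V₀.1 := inf_le_right
  have key : DerivationAlong.res hle D = DerivationAlong.res hle E := by
    refine hz.derivation_ext inf_le_right ?_
    have : Nonempty (W ⊓ V₀.1 : Y.Opens) := ⟨⟨y, hy, hy₀⟩⟩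
    -- From `x = a + p ^ m z` one gets `D(x) = p ^ m D(z)`, and `p` is not a zero divisor.
    have h1 (D : DerivationAlong (𝟙 Y) (π ≫ projLineStr p) V) :
        (D.precomp π (projLineStr p)).app _ (W ⊓ V₀.1) hle (hV₀.trans hz.le) (coord p k) =
          p ^ m * (DerivationAlong.res hle D).act V₀.1 (W ⊓ V₀.1) le_rfl hV₀ z := by
      change D.act (π ⁻¹ᵁ (chart p k).1) (W ⊓ V₀.1) hle (hV₀.trans hz.le) (π.app _ (coord p k)) =
        _ * D.act V₀.1 (W ⊓ V₀.1) hle hV₀ z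
      have h2 := D.act_res _ _ (W ⊓ V₀.1) (W ⊓ V₀.1) hle (hV₀.trans hz.le) hV₀ hz.le le_rfl
        (π.app _ (coord p k))
      rw [map_self] at h2
      have h3 : Y.presheaf.map (homOfLE hz.le).op (π.app _ (coord p k)) = a + p ^ m * z := hz.coord_eq
      have hnat (j : ℕ) : D.act V₀.1 (W ⊓ V₀.1) hle hV₀ (j : Γ(Y, V₀.1)) = 0 := by
        rw [← map_natCast (constants (π ≫ projLineStr p) V₀.1)]
        exact D.app_constants V₀.1 _ _ _ _
      rw [← h2, h3, map_add, hnat, zero_add, D.act_mul, ← Nat.cast_pow, hnat, mul_zero, add_zero,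
        map_natCast, Nat.cast_pow]
    have h4 : (p : Γ(Y, W ⊓ V₀.1)) ≠ 0 := by
      intro h0
      refine hz.natCast_ne_zero (map_injective_of_mem hV₀ ⟨hy, hy₀⟩ ?_)
      rw [map_natCast, h0, map_zero]
    refine mul_left_cancel₀ (pow_ne_zero m h4) ?_
    rw [← h1, ← h1, h]
  refine ⟨W ⊓ V₀.1, inf_le_left, ⟨hy, hy₀⟩, ?_⟩
  rw [← D.map_res U U W (W ⊓ V₀.1) hV hU (inf_le_left.trans hU) le_rfl inf_le_left,
    ← E.map_res U U W (W ⊓ V₀.1) hV hU (inf_le_left.trans hU) le_rfl inf_le_left, map_self]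
  exact congr($(key).app U (W ⊓ V₀.1) le_rfl (inf_le_left.trans hU) g)

end Charts

/-! ### Extension of derivations from affine opens. -/

section Extension

/-- The ring homomorphism to the dual numbers that is defined by a derivation along a ring
homomorphism. -/
def dualNumberHom {A B : Type*} [CommRing A] [CommRing B] (φ : A →+* B) (δ : A →+ B)
    (hδ : ∀ a b, δ (a * b) = φ a * δ b + φ b * δ a) : A →+* DualNumber B where
  toFun a := TrivSqZeroExt.inl (φ a) + TrivSqZeroExt.inr (δ a)
  map_one' := by
    have h := hδ 1 1
    rw [mul_one (1 : A), map_one φ, one_mul] at h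
    rw [map_one φ, left_eq_add.mp h]
    ext <;> simp
  map_zero' := by ext <;> simp
  map_add' a b := by ext <;> simp
  map_mul' a b := by
    ext
    · simp
    · simp [hδ, mul_comm]

/-- A derivation is a ring homomorphism to the dual numbers with the given first component.
Nonzerodivisors of `A` become units there, since their first components are nonzero in `K`; so the
homomorphism extends to `K`. -/
lemma exists_derivation_fractionRing {A K : Type*} [CommRing A] [Field K] [Algebra A K]
    [IsFractionRing A K] (δ : A →+ A) (hδ : ∀ a b, δ (a * b) = a * δ b + b * δ a) :
    ∃ Δ : K →+ K, (∀ a b, Δ (a * b) = a * Δ b + b * Δ a) ∧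
      ∀ a, Δ (algebraMap A K a) = algebraMap A K (δ a) := by
  have : IsDomain A := (IsFractionRing.injective A K).isDomain
  let g := dualNumberHom (algebraMap A K) ((algebraMap A K).toAddMonoidHom.comp δ) fun a b => by
    simp [hδ]
  have hg : ∀ y : nonZeroDivisors A, IsUnit (g y) := fun y => by
    refine TrivSqZeroExt.isUnit_iff_isUnit_fst.mpr ?_
    have : algebraMap A K y ≠ 0 := IsFractionRing.to_map_ne_zero_of_mem_nonZeroDivisors y.2
    simp [g, dualNumberHom]
  let G := IsLocalization.lift (M := nonZeroDivisors A) (S := K) hg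
  have hG (a : A) : G (algebraMap A K a) = g a := IsLocalization.lift_eq hg a
  have h1 : (TrivSqZeroExt.fstHom K K K).toRingHom.comp G = RingHom.id K := by
    refine IsLocalization.ringHom_ext (nonZeroDivisors A) (RingHom.ext fun a => ?_)
    change TrivSqZeroExt.fst (G (algebraMap A K a)) = algebraMap A K a
    rw [hG]
    simp [g, dualNumberHom]
  have h2 (a : K) : TrivSqZeroExt.fst (G a) = a := congr($h1 a)
  refine ⟨⟨⟨fun a => TrivSqZeroExt.snd (G a), by simp⟩, by simp⟩, fun a b => ?_, fun a => ?_⟩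
  · change TrivSqZeroExt.snd (G (a * b)) = _
    rw [map_mul, TrivSqZeroExt.snd_mul, h2, h2]
    exact congrArg (_ + ·) (mul_comm _ _)
  · change TrivSqZeroExt.snd (G (algebraMap A K a)) = _
    rw [hG]
    simpa [g, dualNumberHom] using (Algebra.algebraMap_eq_smul_one _).symm

lemma germToFunctionField_map [IsIntegral X] {W W' : X.Opens} (h : W' ≤ W) [Nonempty W]
    [Nonempty W'] (a : Γ(X, W)) :
    X.germToFunctionField W' (X.presheaf.map (homOfLE h).op a) = X.germToFunctionField W a :=
  TopCat.Presheaf.germ_res_apply ..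

/-- A derivation of the ring of functions on an affine open extends to the sheaf of functions. -/
lemma exists_derivationAlong [IsIntegral X] [IsAffine S] {t : X ⟶ S} {V : X.Opens} (hV : IsAffineOpen V)
    (δ : Γ(X, V) →+ Γ(X, V)) (hδ : ∀ a b, δ (a * b) = a * δ b + b * δ a)
    (hc : ∀ c, δ (t.appLE ⊤ V (fun _ _ => trivial) c) = 0) :
    ∃ D : DerivationAlong (𝟙 X) t V, ∀ a, D.act V V le_rfl le_rfl a = δ a := by
  by_cases hne : Nonempty V
  swap
  · have : Subsingleton Γ(X, V) := by
      have : V = ⊥ := by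
        ext x
        exact ⟨fun hx => (hne ⟨⟨x, hx⟩⟩).elim, fun hx => hx.elim⟩
      subst this
      infer_instance
    exact ⟨0, fun a => Subsingleton.elim _ _⟩
  have := functionField_isFractionRing_of_isAffineOpen X V hV
  obtain ⟨Δ, hΔ, hΔδ⟩ := exists_derivation_fractionRing (K := X.functionField) δ hδ
  replace hΔδ : ∀ a, Δ (X.germToFunctionField V a) = X.germToFunctionField V (δ a) := hΔδ
  -- The derivation is first extended to the function field. What remains is that it maps functions
  -- to functions, which is local and follows from the quotient rule.
  have key : ∀ (U W : X.Opens) (_ : W ≤ V) (_ : W ≤ (𝟙 X : X ⟶ X) ⁻¹ᵁ U)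
      (a : Γ(X, U)), ∃ b : Γ(X, W),
      ∀ [Nonempty W] [Nonempty U], X.germToFunctionField W b = Δ (X.germToFunctionField U a) := by
    intro U W hW hU' a
    have hU : W ≤ U := hU'
    obtain ⟨b, hb⟩ := exists_section_of_local (V := W) (fun W' _ b =>
      ∀ [Nonempty W'] [Nonempty U], X.germToFunctionField W' b = Δ (X.germToFunctionField U a))
      (fun W' W'' hW' h b hb h1 h2 => by
        have : Nonempty W' := h1.map fun x => ⟨x.1, h x.2⟩
        rw [germToFunctionField_map, hb])
      (fun W' hW' b b' hb hb' => by
        refine section_eq_of_local _ _ fun y hy => ?_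
        have : Nonempty W' := ⟨⟨y, hy⟩⟩
        have : Nonempty U := ⟨⟨y, hU (hW' hy)⟩⟩
        rw [X.germToFunctionField_injective W' (hb.trans hb'.symm)]
        exact ⟨W', le_rfl, hy, rfl⟩)
      (fun y hy => by
        obtain ⟨g, hg, hyg⟩ := hV.exists_basicOpen_le (V := W) ⟨y, hy⟩ (hW hy)
        obtain ⟨N, f, hf⟩ := exists_pow_mul_eq hV g (hg.trans hU) a
        have h0 := hf 0
        rw [pow_zero, one_mul, add_zero] at h0
        have hu : IsUnit (X.presheaf.map (homOfLE (X.basicOpen_le g)).op g) :=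
          X.toRingedSpace.isUnit_res_basicOpen g
        obtain ⟨u, hu⟩ := (hu.pow N).exists_right_inv
        have : Nonempty (X.basicOpen g) := ⟨⟨y, hyg⟩⟩
        refine ⟨X.basicOpen g, hg, u ^ 2 * X.presheaf.map (homOfLE (X.basicOpen_le g)).op
          (g ^ N * δ f - f * δ (g ^ N)), hyg, fun {_ _} => ?_⟩
        have e1 := congrArg (X.germToFunctionField (X.basicOpen g)) h0
        have e2 := congrArg (X.germToFunctionField (X.basicOpen g)) hu
        rw [← map_pow, map_mul, germToFunctionField_map, germToFunctionField_map,
          germToFunctionField_map] at e1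
        rw [← map_pow, map_mul, germToFunctionField_map, map_one] at e2
        have e3 := hΔδ f
        rw [e1, hΔ, hΔδ] at e3
        rw [map_mul, map_pow, germToFunctionField_map, map_sub, map_mul, map_mul, ← e3, e1]
        generalize X.germToFunctionField V (g ^ N) = G at *
        generalize X.germToFunctionField _ u = u' at *
        linear_combination (Δ (X.germToFunctionField U a)) * (G * u' + 1) * e2)
    refine ⟨b, fun {hW' hU'} => ?_⟩
    obtain ⟨⟨x, hx⟩⟩ := id hW'
    obtain ⟨W', h, hx', hb⟩ := hb x hx
    have : Nonempty W' := ⟨⟨x, hx'⟩⟩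
    rw [← hb, germToFunctionField_map]
  choose D hD using key
  have uniq {W : X.Opens} {b b' : Γ(X, W)} (h : ∀ [Nonempty W], X.germToFunctionField W b =
      X.germToFunctionField W b') : b = b' := by
    refine section_eq_of_local _ _ fun y hy => ?_
    have : Nonempty W := ⟨⟨y, hy⟩⟩
    rw [X.germToFunctionField_injective W h]
    exact ⟨W, le_rfl, hy, rfl⟩
  have ne {U W : X.Opens} (h : W ≤ U) (hW : Nonempty W) : Nonempty U := hW.map fun x => ⟨x.1, h x.2⟩
  refine ⟨{
    app := fun U W hV hU => ⟨⟨D U W hV hU, uniq fun {h} => ?_⟩, fun a b => uniq fun {h} => ?_⟩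
    leibniz := fun U W hV hU a b => uniq fun {h} => ?_
    map_base := fun Z W hV hU c => uniq fun {h} => ?_
    map_res := fun U U' W W' hV hU hU' iU iW a => uniq fun {h} => ?_ }, fun a => uniq fun {h} => ?_⟩
  · have := ne (U := U) hU h
    rw [hD, map_zero, map_zero, map_zero]
  · have := ne (U := U) hU h
    change X.germToFunctionField W (D U W _ _ _) = X.germToFunctionField W (D U W _ _ _ + D U W _ _ _)
    rw [map_add, hD, hD, hD, map_add, map_add]
  · have := ne (U := U) hU h
    have hU' : W ≤ U := hU
    change X.germToFunctionField W (D U W _ _ _) = X.germToFunctionField W (_ * D U W _ _ _ + _ * D U W _ _ _)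
    rw [map_add, map_mul, map_mul, hD, hD, hD, map_mul, hΔ, id_appLE_apply hU hU', id_appLE_apply hU hU',
      germToFunctionField_map, germToFunctionField_map]
  · have := ne (U := t ⁻¹ᵁ Z) hU h
    change X.germToFunctionField W (D _ W _ _ _) = _
    rw [hD, map_zero]
    obtain ⟨⟨x, hx⟩⟩ := id h
    have hxZ : t x ∈ Z := hU hx
    -- The hypothesis concerns global functions of `S` only; a function on `Z` is locally a fraction
    -- of global ones, and derivations killing numerator and denominator kill it.
    obtain ⟨g, hg, hyg⟩ := (isAffineOpen_top S).exists_basicOpen_le (V := Z) ⟨t x, hxZ⟩ trivial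
    obtain ⟨N, f, hf⟩ := exists_pow_mul_eq (isAffineOpen_top S) g hg c
    have hf' := hf 0
    rw [pow_zero, one_mul, add_zero] at hf'
    have : Nonempty (t ⁻¹ᵁ (S.basicOpen g)) := ⟨⟨x, hyg⟩⟩
    have e1 := congrArg (fun r => X.germToFunctionField _ (t.app (S.basicOpen g) r)) hf'
    have hres {Z Z' : S.Opens} (i : Z' ≤ Z) (r : Γ(S, Z)) [Nonempty (t ⁻¹ᵁ Z')] [Nonempty (t ⁻¹ᵁ Z)] :
        X.germToFunctionField (t ⁻¹ᵁ Z') (t.app Z' (S.presheaf.map (homOfLE i).op r)) =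
          X.germToFunctionField (t ⁻¹ᵁ Z) (t.app Z r) := by
      rw [← germToFunctionField_map (preimage_le_preimage t i), app_map]
    have : Nonempty (t ⁻¹ᵁ ⊤) := ⟨⟨x, trivial⟩⟩
    have h0 (r : Γ(S, ⊤)) : Δ (X.germToFunctionField (t ⁻¹ᵁ ⊤) (t.app ⊤ r)) = 0 := by
      have := germToFunctionField_map (show V ≤ t ⁻¹ᵁ ⊤ from fun _ _ => trivial) (t.app ⊤ r)
      rw [← this]
      exact (hΔδ _).trans ((congrArg _ (hc r)).trans (map_zero _))
    dsimp only at e1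
    rw [← map_pow, map_mul, map_mul, hres, hres, hres] at e1
    have e2 := h0 f
    rw [e1, hΔ, h0, mul_zero, add_zero] at e2
    refine (mul_eq_zero.mp e2).resolve_left ?_
    have hu : IsUnit (S.presheaf.map (homOfLE (S.basicOpen_le g)).op g) :=
      S.toRingedSpace.isUnit_res_basicOpen g
    have hu' := ((hu.pow N).map (t.app (S.basicOpen g)).hom).map (X.germToFunctionField _).hom
    rw [← map_pow] at hu'
    have := hu'.ne_zero
    intro h
    exact this ((hres _ _).trans h)
  · have := ne iW h
    have := ne (U := U) (W := W') (iW.trans hU) h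
    have := ne (U := U') hU' h
    change X.germToFunctionField W' (D _ W' _ _ _) = X.germToFunctionField W' (X.presheaf.map _ (D _ W _ _ _))
    rw [germToFunctionField_map, hD, hD, germToFunctionField_map]
  · exact (hD _ _ _ _ _).trans (hΔδ a)

end Extension

/-! ### Bases of the tangent sheaf and of its inverse image. -/

section Line

variable {p : ℕ} [Fact p.Prime] {X Y : Scheme.{0}}

lemma exists_derivationAlong_base [IsIntegral X] {t : X ⟶ base p} {V : X.Opens} (hV : IsAffineOpen V)
    (δ : Γ(X, V) →+ Γ(X, V)) (hδ : ∀ a b, δ (a * b) = a * δ b + b * δ a)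
    (hc : ∀ c, δ (constants t V c) = 0) :
    ∃ D : DerivationAlong (𝟙 X) t V, ∀ a, D.act V V le_rfl le_rfl a = δ a := by
  refine exists_derivationAlong hV δ hδ fun c => ?_
  have h : (Scheme.ΓSpecIso (CommRingCat.of ℤ_[p])).inv ((Scheme.ΓSpecIso _).hom c) = c :=
    congr($((Scheme.ΓSpecIso (CommRingCat.of ℤ_[p])).hom_inv_id) c)
  rw [← h]
  exact hc _

/-- The derivation with respect to the coordinate of an affine line. -/
lemma exists_derivationAlong_of_bijective [IsIntegral X] {t : X ⟶ base p} {V : X.Opens}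
    (hV : IsAffineOpen V) {z : Γ(X, V)} (hz : Function.Bijective (polyEval p t z)) :
    ∃ D : DerivationAlong (𝟙 X) t V, D.act V V le_rfl le_rfl z = 1 := by
  let e := RingEquiv.ofBijective _ hz
  obtain ⟨D, hD⟩ := exists_derivationAlong_base (t := t) hV (e.toAddMonoidHom.comp
    (Polynomial.derivative.toAddMonoidHom.comp e.symm.toAddMonoidHom)) (fun a b => by
      change e (Polynomial.derivative (e.symm (a * b))) = a * e (Polynomial.derivative (e.symm b)) +
        b * e (Polynomial.derivative (e.symm a))
      rw [map_mul, Polynomial.derivative_mul, map_add, map_mul, map_mul, e.apply_symm_apply,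
        e.apply_symm_apply]
      ring) (fun c => by
      change e (Polynomial.derivative (e.symm _)) = 0
      have : e (Polynomial.C c) = constants t V c := polyEval_C t z c
      rw [← this, e.symm_apply_apply, Polynomial.derivative_C, map_zero])
  refine ⟨D, (hD z).trans ?_⟩
  change e (Polynomial.derivative (e.symm z)) = 1
  have : e.symm z = Polynomial.X := (e.symm_apply_eq).mpr (polyEval_X t z).symm
  rw [this, Polynomial.derivative_X, map_one]

/-- Evaluation at the coordinate identifies these derivations with functions, and `E` corresponds to
`1`. -/
lemma isGen_tangentAlong {f : Y ⟶ projLine p} {k : Fin 2}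
    (E : DerivationAlong f (projLineStr p) (f ⁻¹ᵁ (chart p k).1))
    (hE : E.app _ _ le_rfl le_rfl (coord p k) = 1) :
    IsGen (tangentAlong f (projLineStr p)) (U := f ⁻¹ᵁ (chart p k).1) E := by
  intro V hV
  have h1 : ∀ r : Γ(Y, V), (r • DerivationAlong.res hV E).app _ V le_rfl hV (coord p k) = r := by
    intro r
    rw [DerivationAlong.smul_app, DerivationAlong.res_app, map_self]
    have := E.map_res (chart p k).1 (chart p k).1 _ V le_rfl le_rfl hV le_rfl hV (coord p k)
    rw [map_self, hE, map_one] at this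
    rw [this, mul_one]
  refine ⟨fun r r' h => ?_, fun σ => ?_⟩
  · change r • DerivationAlong.res hV E = r' • DerivationAlong.res hV E at h
    rw [← h1 r, h, h1]
  · refine ⟨DerivationAlong.app (f := f) (s := projLineStr p) (V := V) σ _ V le_rfl hV (coord p k), ?_⟩
    exact DerivationAlong.ext_of_chart hV (h1 _)

/-- The derivation is `d/dx`; both it and its composite with the pull-back of functions take the
value `1` at the coordinate. -/
lemma exists_mapsGen_tangent (π : Y ⟶ projLine p) (k : Fin 2) :
    ∃ e : DerivationAlong (𝟙 _) (projLineStr p) (chart p k).1,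
      e.act (chart p k).1 _ le_rfl le_rfl (coord p k) = 1 ∧
      MapsGen (M := tangentSheaf (projLineStr p)) (tangentToPushforward π (projLineStr p))
        (chart p k).1 e := by
  have : IsIntegral (projLine p) := IsModel.zero.isIntegral
  have hV : IsAffineOpen (chart p k).1 := (chart p k).2
  obtain ⟨e, he⟩ := exists_derivationAlong_of_bijective (t := projLineStr p) hV
    (polyEval_chart_bijective p k)
  refine ⟨e, he, isGen_tangentAlong (f := 𝟙 _) e he,
    isGen_tangentAlong (f := π) (e.postcomp π (projLineStr p)) ?_⟩
  rw [DerivationAlong.postcomp_app]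
  have := e.act_res (chart p k).1 (chart p k).1 (chart p k).1 ((chart p k).1 ⊓ (chart p k).1) le_rfl
    le_rfl inf_le_right le_rfl inf_le_left (coord p k)
  rw [map_self, he, map_one] at this
  rw [this, map_one]

/-- The basis `d/dx` of the tangent sheaf maps to a basis of the derivations along `π`. The
differential can therefore be turned into a map to the inverse image of the tangent sheaf. -/
instance isIso_pullbackTangentToAlong (π : Y ⟶ projLine p) :
    IsIso (pullbackTangentToAlong π (projLineStr p)) := by
  refine isIso_homEquiv_symm _ fun x => ?_
  obtain ⟨k, hk⟩ := exists_mem_chart p x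
  obtain ⟨e, -, he⟩ := exists_mapsGen_tangent π k
  exact ⟨_, _, hk, he⟩

lemma pullbackTangentToAlong_pullSec (π : Y ⟶ projLine p) {U : (projLine p).Opens}
    (e : Γ(tangentSheaf (projLineStr p), U)) :
    (pullbackTangentToAlong π (projLineStr p)).app (π ⁻¹ᵁ U) (pullSec π e) =
      pushSec π (tangentToPushforward π (projLineStr p)) U e := by
  let adj := Scheme.Modules.pullbackPushforwardAdjunction π
  have : adj.unit.app _ ≫ (Scheme.Modules.pushforward π).map
      (pullbackTangentToAlong π (projLineStr p)) = tangentToPushforward π (projLineStr p) :=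
    (adj.homEquiv_unit (f := pullbackTangentToAlong π (projLineStr p))).symm.trans
      (Equiv.apply_symm_apply _ _)
  exact congr(($this).app U e)

lemma isGen_pullSec (π : Y ⟶ projLine p) {U : (projLine p).Opens}
    {e : Γ(tangentSheaf (projLineStr p), U)}
    (he : MapsGen (tangentToPushforward π (projLineStr p)) U e) : IsGen _ (pullSec π e) := by
  have h := he.2.map_iso (inv (pullbackTangentToAlong π (projLineStr p)))
  rw [← pullbackTangentToAlong_pullSec] at h
  have h2 : (inv (pullbackTangentToAlong π (projLineStr p))).app (π ⁻¹ᵁ U)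
      ((pullbackTangentToAlong π (projLineStr p)).app (π ⁻¹ᵁ U) (pullSec π e)) = pullSec π e :=
    congr(($(IsIso.hom_inv_id (pullbackTangentToAlong π (projLineStr p)))).app _ (pullSec π e))
  rwa [h2] at h

lemma isInvertibleModule_pullback_tangentSheaf (π : Y ⟶ projLine p) :
    IsInvertibleModule ((Scheme.Modules.pullback π).obj (tangentSheaf (projLineStr p))) := by
  intro y
  obtain ⟨k, hk⟩ := exists_mem_chart p (π y)
  obtain ⟨e, -, he⟩ := exists_mapsGen_tangent π k
  exact ⟨_, _, hk, isGen_pullSec π he⟩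

end Line

/-! ### The inclusion of the logarithmic tangent sheaf. -/

section Inclusion

variable {p : ℕ} [Fact p.Prime] {X : Scheme.{0}} {π : X ⟶ projLine p} {n : ℕ}

variable (p π) in
/-- The inclusion of the logarithmic tangent sheaf in the pull-back of the tangent sheaf. -/
noncomputable def logTangentInclusion :
    logTangentSheaf (π ≫ projLineStr p) (genericFibre p (π ≫ projLineStr p)) ⟶
      (Scheme.Modules.pullback π).obj (tangentSheaf (projLineStr p)) :=
  logTangentToAlong π (projLineStr p) _ ≫ inv (pullbackTangentToAlong π (projLineStr p))

lemma logTangentInclusion_comp : logTangentInclusion p π ≫ pullbackTangentToAlong π (projLineStr p) =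
    logTangentToAlong π (projLineStr p) (genericFibre p (π ≫ projLineStr p)) := by
  rw [logTangentInclusion, Category.assoc, IsIso.inv_hom_id, Category.comp_id]

lemma IsModel.mono_logTangentInclusion (hX : IsModel p n X π) : Mono (logTangentInclusion p π) := by
  have : Mono (logTangentToAlong π (projLineStr p) (genericFibre p (π ≫ projLineStr p))) := by
    refine mono_of_injective_app _ fun U D E h => ?_
    exact Subtype.ext (hX.precomp_injective h)
  exact mono_comp _ _

end Inclusion

/-! ### Logarithmic derivations and prime factors of `p`. -/

section Divisibility

/-- A derivation that preserves the ideals generated by some primes preserves, up to a factor `s`, the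
ideals generated by the divisors of `s` times their product. -/
lemma dvd_mul_derivation {A : Type*} [CommRing A] [IsDomain A] (δ : A →+ A)
    (hδ : ∀ a b, δ (a * b) = a * δ b + b * δ a) (s : A) (Q : Multiset A)
    (hQ : ∀ q ∈ Q, Prime q ∧ q ∣ δ q) (α β : A) (h : s * Q.prod = α * β) : α ∣ s * δ α := by
  induction Q using Multiset.induction_on generalizing α β with
  | empty =>
    rw [Multiset.prod_zero, mul_one] at h
    exact (Dvd.intro _ h.symm).mul_right _
  | cons q Q ih =>
    rw [Multiset.prod_cons] at h
    obtain ⟨hq, hqδ⟩ := hQ q (Multiset.mem_cons_self q Q)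
    replace ih := ih fun q' hq' => hQ q' (Multiset.mem_cons_of_mem hq')
    -- The prime `q` divides one of the two factors and is cancelled from it. If it was in `α = q
    -- α'`, then `δ(α) = q δ(α') + α' δ(q)`, and `q` divides `δ(q)`.
    rcases hq.dvd_or_dvd (show q ∣ α * β from ⟨s * Q.prod, by rw [← h]; ring⟩) with ⟨α, rfl⟩ | ⟨β, rfl⟩
    · have := ih α β (mul_left_cancel₀ hq.ne_zero (by linear_combination h))
      rw [hδ]
      obtain ⟨c, hc⟩ := this
      obtain ⟨c', hc'⟩ := hqδ
      exact ⟨c + s * c', by rw [hc']; linear_combination q * hc⟩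
    · exact ih α β (mul_left_cancel₀ hq.ne_zero (by linear_combination h))

/-- The quotient rule in a stalk: `m` is `α / a` with `a` a unit, and `α` divides `δ(α)` up to a
unit `s`. -/
lemma eq_mul_of_inverses {R : Type*} [CommRing R] {a s u v α γ m δα δa δm : R} (hα : α = a * m)
    (hδ : δα = a * δm + m * δa) (hγ : s * δα = α * γ) (hu : a * u = 1) (hv : s * v = 1) :
    δm = m * (u * (v * a * γ - δa)) := by
  linear_combination (-δm) * hu - u * hδ + u * v * hγ - u * δα * hv +
    u * v * γ * hα

end Divisibility

section Log

variable {p : ℕ} [Fact p.Prime] {X : Scheme.{0}}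

lemma inf_genericFibre (t : X ⟶ base p) (V : X.Opens) :
    V ⊓ genericFibre p t = X.basicOpen (p : Γ(X, V)) := by
  have h1 : (PrimeSpectrum.basicOpen (p : ℤ_[p]) : (base p).Opens) =
      (base p).basicOpen ((Scheme.ΓSpecIso _).inv (p : ℤ_[p])) := (basicOpen_eq_of_affine _).symm
  have h2 : (p : Γ(X, V)) = X.presheaf.map (homOfLE (show V ≤ t ⁻¹ᵁ ⊤ from fun _ _ => trivial)).op
      (t.app ⊤ ((Scheme.ΓSpecIso _).inv (p : ℤ_[p]))) :=
    (map_natCast (constants t V) p).symm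
  rw [genericFibre, h1, Scheme.preimage_basicOpen, h2, Scheme.basicOpen_res]

/-- A function `m` that is invertible where `p` is divides a power of `p` locally. Clearing
denominators with a `g` that is a unit at `y`, the numerator `α` of `m` divides a power of `g` times
a product of the primes in `Q`. By `dvd_mul_derivation` it divides a power of `g` times its own
derivative. -/
lemma isLog_of_prod [IsIntegral X] {t : X ⟶ base p} {V : X.Opens} (hV : IsAffineOpen V)
    (hp : (p : Γ(X, V)) ≠ 0) (D : DerivationAlong (𝟙 X) t V) (Q : Multiset Γ(X, V))
    (hQp : Q.prod = p) (hQ : ∀ q ∈ Q, Prime q ∧ q ∣ D.act V V le_rfl le_rfl q) :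
    D.IsLog (genericFibre p t) := by
  intro W hW m hm y hy
  have : Nonempty V := ⟨⟨y, hW hy⟩⟩
  obtain ⟨g, hg, hyg⟩ := hV.exists_basicOpen_le (V := W) ⟨y, hy⟩ (hW hy)
  have hgV := X.basicOpen_le g
  have hg' : IsAffineOpen (X.basicOpen g) := hV.basicOpen g
  -- `m` divides a power of `p`
  obtain ⟨N, f, hf⟩ : ∃ (N : ℕ) (f : Γ(X, X.basicOpen g)),
      X.presheaf.map (homOfLE hg).op m * f = (p : Γ(X, X.basicOpen g)) ^ N := by
    have hp' : (p : Γ(X, X.basicOpen g)) ≠ 0 := fun h0 => hp (map_injective_of_mem hgV hyg (by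
      rw [map_natCast, h0, map_zero]))
    obtain ⟨x, hx⟩ := exists_mem_basicOpen hp'
    have hle : X.basicOpen (p : Γ(X, X.basicOpen g)) ≤ W ⊓ genericFibre p t := by
      rw [← inf_genericFibre t]
      exact inf_le_inf_right _ hg
    obtain ⟨u, hu⟩ := (hm.map (X.presheaf.map (homOfLE hle).op).hom).exists_right_inv
    obtain ⟨N, f, hf⟩ := exists_pow_mul_eq hg' (p : Γ(X, X.basicOpen g)) le_rfl u
    have hf := hf 0
    rw [pow_zero, one_mul, add_zero, map_self] at hf
    refine ⟨N, f, map_injective_of_mem (X.basicOpen_le _) hx ?_⟩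
    have hu' : X.presheaf.map (homOfLE (hle.trans inf_le_left)).op m * u = 1 := by
      rw [← map_map inf_le_left hle]
      exact hu
    rw [map_mul, hf, map_map, map_pow, mul_left_comm, hu', mul_one]
  obtain ⟨N₁, α, hα⟩ := exists_pow_mul_eq hV g hg m
  obtain ⟨N₂, β, hβ⟩ := exists_pow_mul_eq hV g le_rfl f
  have hα := hα 0
  have hβ := hβ 0
  rw [pow_zero, one_mul, add_zero] at hα hβ
  rw [map_self] at hβ
  have hαβ : g ^ (N₁ + N₂) * (N • Q).prod = α * β := by
    refine map_injective_of_mem hgV hyg ?_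
    rw [Multiset.prod_nsmul, hQp, map_mul, map_mul, hα, hβ, map_pow, map_pow, map_natCast, ← hf]
    ring
  obtain ⟨γ, hγ⟩ := dvd_mul_derivation (D.act V V le_rfl le_rfl) (fun a b => by
    rw [D.act_mul, map_self, map_self]) _ (N • Q) (fun q hq => hQ q (Multiset.mem_of_mem_nsmul hq))
    α β hαβ
  -- pass to the stalk
  have hact (a : Γ(X, V)) : D.act V _ hgV hgV a =
      X.presheaf.map (homOfLE hgV).op (D.act V V le_rfl le_rfl a) := by
    rw [← D.act_res V V V _ le_rfl le_rfl hgV le_rfl hgV, map_self]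
  have hm' : D.act W _ hgV hg m = X.presheaf.map (homOfLE hg).op (D.act W W hW le_rfl m) := by
    rw [← D.act_res W W W _ hW le_rfl hg le_rfl hg, map_self]
  have h1 := D.act_res V (X.basicOpen g) _ _ hgV hgV le_rfl hgV le_rfl
  have h2 := D.act_res W (X.basicOpen g) _ _ hgV hg le_rfl hg le_rfl m
  have e := congrArg (D.act (X.basicOpen g) _ hgV le_rfl) hα
  rw [← map_pow, D.act_mul, h1, h1, h2, map_self, map_self, map_self, map_self, map_self, hact, hact,
    hm'] at e
  replace e := congrArg (X.presheaf.germ _ y hyg) e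
  simp only [map_add, map_mul, germ_map] at e
  replace hγ := congrArg (X.presheaf.germ V y (hgV hyg)) hγ
  replace hα := congrArg (X.presheaf.germ _ y hyg) hα
  rw [← map_pow] at hα
  simp only [map_mul, germ_map] at hα hγ
  have hu : IsUnit (X.presheaf.germ V y (hgV hyg) g) := (X.mem_basicOpen g y (hgV hyg)).mp hyg
  obtain ⟨u, hu⟩ := hu.exists_right_inv
  rw [map_pow] at hα e hγ
  rw [Ideal.mem_span_singleton]
  refine ⟨_, eq_mul_of_inverses (u := u ^ N₁) (v := u ^ (N₁ + N₂)) hα e hγ ?_ ?_⟩ <;>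
    rw [← mul_pow, hu, one_pow]

end Log

/-! ### Prime factors of `p` and the derivation on a node chart. -/

section Node

variable {p : ℕ} [Fact p.Prime] {X : Scheme.{0}} {t : X ⟶ base p}

lemma prime_of_ker_eq {A K : Type*} [CommRing A] [CommRing K] [IsDomain K] (θ : A →+* K) {q : A}
    (hq : q ≠ 0) (h0 : θ q = 0) (h : ∀ a, θ a = 0 → q ∣ a) : Prime q := by
  rw [← Ideal.span_singleton_prime hq]
  have : Ideal.span {q} = RingHom.ker θ := by
    ext a
    rw [Ideal.mem_span_singleton, RingHom.mem_ker]
    exact ⟨fun ⟨b, hb⟩ => by rw [hb, map_mul, h0, zero_mul], h a⟩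
  rw [this]
  exact RingHom.ker_isPrime θ

variable {V : X.Opens} {z w : Γ(X, V)}

lemma IsNodeCoord.mul_prod (h : IsNodeCoord p t z w) :
    w * ∏ b ∈ Finset.range p, (z - b) = p := by
  rw [← h.mul_eq, ← eval₂_residuePoly p (constants t V) z]
  rfl

lemma natCast_dvd_polyEval (F : Polynomial ℤ_[p]) (h : F.map (PadicInt.toZMod (p := p)) = 0) :
    (p : Γ(X, V)) ∣ polyEval p t z F := by
  rw [← C_dvd_iff_map_eq_zero] at h
  obtain ⟨G, rfl⟩ := h
  rw [map_mul, polyEval_C, map_natCast]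
  exact dvd_mul_right _ _

variable (p) in
/-- A field of rational functions over the residue field. -/
abbrev ResidueFunctions : Type := FractionRing (Polynomial (ZMod p))

variable (p) in
lemma residueFunctions_natCast_eq_zero : (p : ResidueFunctions p) = 0 := by
  rw [← map_natCast (algebraMap (Polynomial (ZMod p)) (ResidueFunctions p)),
    ← map_natCast (Polynomial.C : ZMod p →+* _), ZMod.natCast_self, map_zero, map_zero]

/-- The line `w = 0` of the special fibre: mapping `z` to the variable and `w` to `0` in `𝔽_p(T)`. A
function in the kernel is, up to a unit, a polynomial in `w` whose constant coefficient is divisible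
by `p`, hence by `w`. -/
lemma IsNodeCoord.prime_w (h : IsNodeCoord p t z w) (hp : (p : Γ(X, V)) ≠ 0) : Prime w := by
  have h2 := (Fact.out : p.Prime).two_le
  let ι := algebraMap (Polynomial (ZMod p)) (ResidueFunctions p)
  let c : ℤ_[p] →+* ResidueFunctions p := ι.comp (Polynomial.C.comp PadicInt.toZMod)
  obtain ⟨θ, hc, hz, hw⟩ := h.exists_hom (CommRingCat.of (ResidueFunctions p)) c (ι Polynomial.X) 0
    (by rw [zero_mul]; exact (residueFunctions_natCast_eq_zero p).symm)
    (by rw [zero_pow (by omega), sub_zero]; exact isUnit_one)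
  refine prime_of_ker_eq θ.hom (fun h0 => hp ?_) hw fun f hf => ?_
  · rw [← h.mul_eq, h0, zero_mul]
  obtain ⟨e, F, hF⟩ := h.exists_poly f
  have hcz : θ.hom.comp (polyEval p t z) =
      ι.comp (Polynomial.mapRingHom (PadicInt.toZMod (p := p))) := by
    ext a
    · have := congr($hc a)
      simpa [polyEval_C, c] using this
    · simpa [polyEval_X] using hz
  have h1 := congrArg θ.hom hF
  rw [map_mul, hf, zero_mul, Polynomial.hom_eval₂, hcz, show θ.hom w = 0 from hw,
    Polynomial.eval₂_at_zero] at h1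
  have h3 : (F.coeff 0).map (PadicInt.toZMod (p := p)) = 0 :=
    (IsFractionRing.injective (Polynomial (ZMod p)) (ResidueFunctions p)) (h1.symm.trans (map_zero _).symm)
  have h4 : w ∣ F.eval₂ (polyEval p t z) w := by
    have h5 := (Dvd.intro _ h.mul_eq : w ∣ p).trans (natCast_dvd_polyEval (t := t) (z := z) _ h3)
    rw [← Polynomial.divX_mul_X_add F, Polynomial.eval₂_add, Polynomial.eval₂_mul, Polynomial.eval₂_X,
      Polynomial.eval₂_C]
    exact dvd_add (dvd_mul_left _ _) h5
  rw [← hF] at h4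
  exact ((h.isUnit.pow e).dvd_mul_right).mp h4

/-- The line `z = b` of the special fibre: mapping `w` to the variable and `z` to `b` in `𝔽_p(T)`. A
polynomial in `w` in the kernel has coefficients that at `z = b` are divisible by `p`, hence by `z -
b`. -/
lemma IsNodeCoord.prime_sub (h : IsNodeCoord p t z w) (hp : (p : Γ(X, V)) ≠ 0) {b : ℕ} (hb : b < p) :
    Prime (z - (b : Γ(X, V))) := by
  have h2 := (Fact.out : p.Prime).two_le
  let ι := algebraMap (Polynomial (ZMod p)) (ResidueFunctions p)
  let c : ℤ_[p] →+* ResidueFunctions p := ι.comp (Polynomial.C.comp PadicInt.toZMod)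
  have hι : Function.Injective ι := IsFractionRing.injective _ _
  obtain ⟨θ, hc, hz, hw⟩ := h.exists_hom (CommRingCat.of (ResidueFunctions p)) c b (ι Polynomial.X)
    (by
      rw [eval₂_residuePoly, Finset.prod_eq_zero (Finset.mem_range.mpr hb) (sub_self _), mul_zero]
      exact (residueFunctions_natCast_eq_zero p).symm)
    (by
      refine IsUnit.mk0 (G₀ := ResidueFunctions p) _ fun h0 => ?_
      change 1 - ι Polynomial.X ^ (p - 1) = 0 at h0
      rw [← map_pow, ← map_one ι, ← map_sub] at h0
      have h3 := hι (h0.trans (map_zero ι).symm)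
      have h4 := congrArg (Polynomial.eval 0) h3
      rw [Polynomial.eval_sub, Polynomial.eval_one, Polynomial.eval_pow, Polynomial.eval_X,
        zero_pow (by omega), sub_zero, Polynomial.eval_zero] at h4
      exact one_ne_zero h4)
  have hdvd : z - (b : Γ(X, V)) ∣ p := by
    rw [← h.mul_prod]
    exact (Finset.dvd_prod_of_mem _ (Finset.mem_range.mpr hb)).mul_left _
  refine prime_of_ker_eq θ.hom (fun h0 => hp ?_) ?_ fun f hf => ?_
  · rw [h0] at hdvd
    exact zero_dvd_iff.mp hdvd
  · change θ (z - (b : Γ(X, V))) = 0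
    rw [map_sub, hz, map_natCast, sub_self]
  obtain ⟨e, F, hF⟩ := h.exists_poly f
  let β : Polynomial ℤ_[p] →+* ℤ_[p] := Polynomial.evalRingHom (b : ℤ_[p])
  have hcz : θ.hom.comp (polyEval p t z) = (ι.comp Polynomial.C).comp (PadicInt.toZMod.comp β) := by
    ext a
    · have := congr($hc a)
      simpa [polyEval_C, β, c] using this
    · simpa [polyEval_X, β] using hz
  have h1 := congrArg θ.hom hF
  rw [map_mul, hf, zero_mul, Polynomial.hom_eval₂, hcz, show θ.hom w = _ from hw,
    ← Polynomial.eval₂_map, ← Polynomial.hom_eval₂ _ _ ι, Polynomial.eval₂_C_X] at h1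
  have h3 : F.map (PadicInt.toZMod.comp β) = 0 := hι (h1.symm.trans (map_zero _).symm)
  have h4 : z - (b : Γ(X, V)) ∣ F.eval₂ (polyEval p t z) w := by
    rw [Polynomial.eval₂_eq_sum_range]
    refine Finset.dvd_sum fun i _ => Dvd.dvd.mul_right ?_ _
    obtain ⟨G, hG⟩ := Polynomial.X_sub_C_dvd_sub_C_eval (p := F.coeff i) (a := (b : ℤ_[p]))
    have h5 : polyEval p t z (F.coeff i) = (z - (b : Γ(X, V))) * polyEval p t z G +
        polyEval p t z (Polynomial.C (β (F.coeff i))) := by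
      rw [← sub_eq_iff_eq_add, ← map_sub]
      refine (congrArg _ hG).trans ?_
      rw [map_mul, map_sub, polyEval_X, polyEval_C, map_natCast]
    rw [h5]
    refine dvd_add (dvd_mul_right _ _) (hdvd.trans (natCast_dvd_polyEval _ ?_))
    have := congrArg (Polynomial.coeff · i) h3
    rw [Polynomial.map_C]
    simpa using this
  rw [← hF] at h4
  exact ((h.isUnit.pow e).dvd_mul_right).mp h4

/-- The derivation `P(z) d/dz`; differentiating `w P(z) = p` shows that it must map `w` to `-w
P'(z)`. It is obtained from the universal property of the node chart, applied to the dual numbers.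
-/
lemma IsNodeCoord.exists_derivationAlong [IsIntegral X] (h : IsNodeCoord p t z w)
    (hV : IsAffineOpen V) : ∃ D : DerivationAlong (𝟙 X) t V,
      D.act V V le_rfl le_rfl z = polyEval p t z (residuePoly p) ∧
      D.act V V le_rfl le_rfl w = - (w * polyEval p t z (Polynomial.derivative (residuePoly p))) := by
  let A := Γ(X, V)
  let P := polyEval p t z (residuePoly p)
  let P' := polyEval p t z (Polynomial.derivative (residuePoly p))
  let c : ℤ_[p] →+* DualNumber A := (TrivSqZeroExt.inlHom A A).comp (constants t V)
  let ζ : DualNumber A := TrivSqZeroExt.inl z + TrivSqZeroExt.inr P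
  let ω : DualNumber A := TrivSqZeroExt.inl w - TrivSqZeroExt.inr (w * P')
  -- Taylor expansion to first order: `F(z + P ε) = F(z) + P F'(z) ε`.
  have hζ (F : Polynomial ℤ_[p]) : F.eval₂ c ζ = TrivSqZeroExt.inl (polyEval p t z F) +
      TrivSqZeroExt.inr (P * polyEval p t z (Polynomial.derivative F)) := by
    let d := dualNumberHom (polyEval p t z) ((AddMonoidHom.mulLeft P).comp
      ((polyEval p t z).toAddMonoidHom.comp Polynomial.derivative.toAddMonoidHom)) fun F G => by
        change P * polyEval p t z (Polynomial.derivative (F * G)) = _ *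
          (P * polyEval p t z (Polynomial.derivative G)) + _ * (P * polyEval p t z (Polynomial.derivative F))
        rw [Polynomial.derivative_mul, map_add, map_mul, map_mul]
        ring
    have : Polynomial.eval₂RingHom c ζ = d := by
      ext a
      · simp [d, dualNumberHom, c, polyEval_C]
      · simp [d, dualNumberHom, c, polyEval_C]
      · simp [d, dualNumberHom, ζ, polyEval_X]
      · simp [d, dualNumberHom, ζ, polyEval_X]
    exact congr($this F)
  obtain ⟨θ, hc, hz, hw⟩ := h.exists_hom (CommRingCat.of (DualNumber A)) c ζ ω (by
      rw [hζ]
      have := h.mul_eq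
      ext
      · simpa [ω] using this
      · simp [ω, P, P']
        ring)
    (by
      rw [TrivSqZeroExt.isUnit_iff_isUnit_fst]
      simpa [ω] using h.isUnit)
  have hfst : θ ≫ CommRingCat.ofHom (TrivSqZeroExt.fstHom A A A).toRingHom = 𝟙 _ := by
    refine h.hom_ext ?_ ?_ ?_
    · ext a
      have := congr(TrivSqZeroExt.fst ($hc a))
      simpa [c] using this
    · have := congrArg TrivSqZeroExt.fst hz
      simpa [ζ] using this
    · have := congrArg TrivSqZeroExt.fst hw
      simpa [ω] using this
  have hfst' (a : A) : (θ a).fst = a := congr($hfst a)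
  obtain ⟨D, hD⟩ := exists_derivationAlong_base (t := t) hV
    ((TrivSqZeroExt.sndHom A A).toAddMonoidHom.comp θ.hom.toAddMonoidHom) (fun a b => by
      change (θ (a * b)).snd = a * (θ b).snd + b * (θ a).snd
      rw [map_mul]
      refine (TrivSqZeroExt.snd_mul _ _).trans ?_
      rw [hfst', hfst']
      exact congrArg (_ + ·) (mul_comm _ _)) (fun a => by
      have := congr(TrivSqZeroExt.snd ($hc a))
      simpa [c] using this)
  refine ⟨D, (hD z).trans ?_, (hD w).trans ?_⟩
  · change (θ z).snd = _
    rw [hz]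
    simp [ζ, P]
  · change (θ w).snd = _
    rw [hw]
    simp [ω, P']

end Node

/-! ### Bases of the logarithmic tangent sheaf and their coefficients. -/

section Generators

variable {p : ℕ} [Fact p.Prime] {X : Scheme.{0}}

lemma DerivationAlong.act_natCast {t : X ⟶ base p} {V : X.Opens} (D : DerivationAlong (𝟙 X) t V)
    (U W : X.Opens) (hV : W ≤ V) (hU : W ≤ U) (n : ℕ) : D.act U W hV hU n = 0 := by
  rw [← map_natCast (constants t U)]
  exact D.app_constants U W hV hU n

lemma DerivationAlong.act_map {t : X ⟶ base p} {V : X.Opens} (D : DerivationAlong (𝟙 X) t V)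
    {W : X.Opens} (h : W ≤ V) (a : Γ(X, V)) :
    D.act V W h h a = X.presheaf.map (homOfLE h).op (D.act V V le_rfl le_rfl a) := by
  rw [← D.act_res V V V _ le_rfl le_rfl h le_rfl h, map_self]

lemma polyEval_residuePoly (t : X ⟶ base p) {V : X.Opens} (z : Γ(X, V)) :
    polyEval p t z (residuePoly p) = ∏ b ∈ Finset.range p, (z - (b : Γ(X, V))) :=
  eval₂_residuePoly p (constants t V) z

lemma isLog_of_bijective [IsIntegral X] {t : X ⟶ base p} {V : X.Opens} (hV : IsAffineOpen V)
    {z : Γ(X, V)} (hz : Function.Bijective (polyEval p t z)) (D : DerivationAlong (𝟙 X) t V) :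
    D.IsLog (genericFibre p t) := by
  have h : Prime (p : Γ(X, V)) := by
    have := (MulEquiv.prime_iff (RingEquiv.ofBijective _ hz)).mpr (prime_C_p p)
    have h2 : (RingEquiv.ofBijective _ hz) (Polynomial.C (p : ℤ_[p])) = p :=
      (polyEval_C t z p).trans (map_natCast _ _)
    rwa [h2] at this
  refine isLog_of_prod hV h.ne_zero D {(p : Γ(X, V))} (Multiset.prod_singleton _) fun q hq => ?_
  rw [Multiset.mem_singleton] at hq
  subst hq
  rw [D.act_natCast]
  exact ⟨h, dvd_zero _⟩

/-- The prime factors of `p` are `w` and the `z - b`. The derivative of `z - b` is the full product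
`∏ (z - b)`, a multiple of each factor. -/
lemma IsNodeCoord.isLog [IsIntegral X] {t : X ⟶ base p} {V : X.Opens} (hV : IsAffineOpen V)
    {z w : Γ(X, V)} (h : IsNodeCoord p t z w) (hp : (p : Γ(X, V)) ≠ 0)
    {D : DerivationAlong (𝟙 X) t V}
    (hz : D.act V V le_rfl le_rfl z = polyEval p t z (residuePoly p))
    (hw : w ∣ D.act V V le_rfl le_rfl w) : D.IsLog (genericFibre p t) := by
  refine isLog_of_prod hV hp D (w ::ₘ (Finset.range p).val.map fun b : ℕ => z - (b : Γ(X, V))) ?_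
    fun q hq => ?_
  · rw [Multiset.prod_cons]
    exact h.mul_prod
  · rcases Multiset.mem_cons.mp hq with rfl | hq
    · exact ⟨h.prime_w hp, hw⟩
    · obtain ⟨b, hb, rfl⟩ := Multiset.mem_map.mp hq
      refine ⟨h.prime_sub hp (Finset.mem_range.mp hb), ?_⟩
      rw [map_sub, hz, D.act_natCast, sub_zero, polyEval_residuePoly]
      exact Finset.dvd_prod_of_mem _ hb

/-- A logarithmic derivation maps the coordinate `z` to a multiple of `∏ (z - b)`. -/
lemma IsNodeCoord.exists_act_eq [IsIntegral X] {t : X ⟶ base p} {V : X.Opens} {z w : Γ(X, V)}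
    (h : IsNodeCoord p t z w) (hP : polyEval p t z (residuePoly p) ≠ 0) {V' : X.Opens} (hV' : V' ≤ V)
    {E : DerivationAlong (𝟙 X) t V'} (hE : E.IsLog (genericFibre p t)) :
    ∃ r, E.act V V' le_rfl hV' z =
      X.presheaf.map (homOfLE hV').op (polyEval p t z (residuePoly p)) * r := by
  suffices h : ∃ r, X.presheaf.map (homOfLE hV').op (polyEval p t z (residuePoly p)) * r =
      E.act V V' le_rfl hV' z by
    obtain ⟨r, hr⟩ := h
    exact ⟨r, hr.symm⟩
  refine exists_quotient _ _ (fun y hy => ?_) (fun y hy => ?_)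
  · rw [germ_map]
    exact germ_ne_zero y _ hP
  · rw [germ_map, Ideal.mem_span_singleton, polyEval_residuePoly, map_prod]
    -- The `z - b` are pairwise coprime, so it suffices that each divides `E(z) = E(z - b)`. This is
    -- the logarithmic condition, as `z - b` divides `p` and so is invertible on the generic fibre.
    refine Finset.prod_dvd_of_coprime (fun b hb b' hb' hne => ?_) fun b hb => ?_
    · have h1 : IsUnit ((b' : Γ(X, V)) - b) := isUnit_natCast_sub_natCast p (constants t V)
        (Finset.mem_range.mp hb') (Finset.mem_range.mp hb) hne.symm
      obtain ⟨u, hu⟩ := h1.exists_left_inv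
      have h2 : IsCoprime (z - (b : Γ(X, V))) (z - (b' : Γ(X, V))) :=
        ⟨u, -u, by linear_combination hu⟩
      exact h2.map (X.presheaf.germ V y (hV' hy)).hom
    · have hm : IsUnit (X.presheaf.map (homOfLE (inf_le_left : V' ⊓ genericFibre p t ≤ V')).op
          (X.presheaf.map (homOfLE hV').op (z - (b : Γ(X, V))))) := by
        refine isUnit_of_dvd_unit (y := (p : Γ(X, V' ⊓ genericFibre p t))) ?_ ?_
        · have : z - (b : Γ(X, V)) ∣ p := by
            rw [← h.mul_prod]
            exact (Finset.dvd_prod_of_mem _ hb).mul_left _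
          have h2 := map_dvd (X.presheaf.map (homOfLE (inf_le_left.trans hV' :
            V' ⊓ genericFibre p t ≤ V)).op).hom this
          rw [map_natCast] at h2
          rw [map_map]
          exact h2
        · rw [inf_genericFibre]
          have := X.toRingedSpace.isUnit_res_basicOpen (p : Γ(X, V'))
          rw [map_natCast] at this
          exact this
      have h3 := hE V' le_rfl _ hm y hy
      have h4 := E.act_res V V' V' V' le_rfl hV' le_rfl hV' le_rfl (z - (b : Γ(X, V)))
      rw [map_self, map_sub (E.act V V' le_rfl hV'), E.act_natCast, sub_zero] at h4
      rw [h4, germ_map, Ideal.mem_span_singleton] at h3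
      exact h3

variable {π : X ⟶ projLine p} {k : Fin 2} {n m a : ℕ} {V : X.affineOpens} {z : Γ(X, V.1)}

/-- Derivations on the chart are determined by their value at `z`. So a logarithmic `D` whose value
`c` divides the values of all logarithmic derivations is a basis, and `x = a + p ^ m z` gives `D(x)
= p ^ m c`. -/
lemma IsCoordChart.hasCoeff [IsIntegral X] (h : IsCoordChart p π k m a V z)
    {e : DerivationAlong (𝟙 _) (projLineStr p) (chart p k).1}
    (he : e.act (chart p k).1 _ le_rfl le_rfl (coord p k) = 1)
    {D : DerivationAlong (𝟙 X) (π ≫ projLineStr p) V.1}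
    (hD : D.IsLog (genericFibre p (π ≫ projLineStr p))) (c : Γ(X, V.1)) (hc0 : c ≠ 0)
    (hc : D.act V.1 V.1 le_rfl le_rfl z = c)
    (hdiv : ∀ (V' : X.Opens) (hV' : V' ≤ V.1) (E : DerivationAlong (𝟙 X) (π ≫ projLineStr p) V'),
      E.IsLog (genericFibre p (π ≫ projLineStr p)) →
        ∃ r, E.act V.1 V' le_rfl hV' z = X.presheaf.map (homOfLE hV').op c * r) :
    HasCoeff (M := tangentSheaf (projLineStr p)) (logTangentInclusion p π) e V.1
      ((p : Γ(X, V.1)) ^ m * c) := by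
  have hdom := h.isDomain
  have tf : ∀ (W : X.Opens) (hW : W ≤ V.1) (g : Γ(X, V.1)), g ≠ 0 → ∀ r : Γ(X, W),
      X.presheaf.map (homOfLE hW).op g * r = 0 → r = 0 := by
    intro W hW g hg r hr
    refine section_eq_of_local _ _ fun y hy => ⟨W, le_rfl, hy, congrArg _ ?_⟩
    have : Nonempty W := ⟨⟨y, hy⟩⟩
    refine (mul_eq_zero.mp hr).resolve_left fun h0 => hg (map_injective_of_mem hW hy ?_)
    rw [h0, map_zero]
  have hp := pow_ne_zero m h.natCast_ne_zero
  refine ⟨h.le, ⟨D, hD⟩, ?_, ?_, fun W hW r => tf W hW _ (mul_ne_zero hp hc0) r⟩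
  · intro V' hV'
    have hact (r : Γ(X, V')) : (r • DerivationAlong.res hV' D).act V.1 V' le_rfl hV' z =
        X.presheaf.map (homOfLE hV').op c * r := by
      rw [DerivationAlong.smul_act, map_self, mul_comm]
      exact congrArg (· * r) ((D.act_map hV' z).trans (congrArg _ hc))
    refine ⟨fun r r' hr => ?_, fun σ => ?_⟩
    · have h1 : r • DerivationAlong.res hV' D = r' • DerivationAlong.res hV' D :=
        congrArg Subtype.val hr
      have h2 := (hact r).symm.trans ((congrArg (fun E : DerivationAlong (𝟙 X) (π ≫ projLineStr p) V' =>
        E.act V.1 V' le_rfl hV' z) h1).trans (hact r'))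
      refine sub_eq_zero.mp (tf V' hV' c hc0 _ ?_)
      rw [mul_sub, h2, sub_self]
    · obtain ⟨r, hr⟩ := hdiv V' hV' σ.1 σ.2
      refine ⟨r, Subtype.ext ?_⟩
      exact h.derivation_ext hV' ((hact r).trans hr.symm)
  · have hinj : Function.Injective ((pullbackTangentToAlong π (projLineStr p)).app V.1) := by
      intro σ τ hστ
      have h1 := congrArg ((inv (pullbackTangentToAlong π (projLineStr p))).app V.1) hστ
      have h2 (σ) : (inv (pullbackTangentToAlong π (projLineStr p))).app V.1
          ((pullbackTangentToAlong π (projLineStr p)).app V.1 σ) = σ :=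
        congr(($(IsIso.hom_inv_id (pullbackTangentToAlong π (projLineStr p)))).app V.1 σ)
      rwa [h2, h2] at h1
    apply hinj
    have h5 := pullbackTangentToAlong_pullSec π (U := (chart p k).1) e
    rw [Scheme.Modules.Hom.app_smul, modules_app_map]
    refine Eq.trans ?_ (congrArg (fun σ => ((p : Γ(X, V.1)) ^ m * c) •
      (tangentAlong π (projLineStr p)).presheaf.map (homOfLE h.le).op σ) h5.symm)
    refine (congr(($(logTangentInclusion_comp (π := π))).app V.1 ⟨D, hD⟩)).trans ?_
    change D.precomp π (projLineStr p) = ((p : Γ(X, V.1)) ^ m * c) •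
      DerivationAlong.res h.le (e.postcomp π (projLineStr p))
    refine DerivationAlong.ext_of_chart h.le ?_
    rw [DerivationAlong.smul_app, map_self, DerivationAlong.res_app, DerivationAlong.postcomp_app,
      DerivationAlong.precomp_app]
    have h1 := e.act_res (chart p k).1 (chart p k).1 (chart p k).1 ((chart p k).1 ⊓ (chart p k).1) le_rfl
      le_rfl inf_le_right le_rfl inf_le_left (coord p k)
    rw [map_self, he, map_one] at h1
    rw [h1, map_one, mul_one]
    have h2 := D.act_res _ V.1 V.1 V.1 le_rfl h.le le_rfl h.le le_rfl (π.app _ (coord p k))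
    rw [map_self] at h2
    have h3 : X.presheaf.map (homOfLE h.le).op (π.app _ (coord p k)) = a + p ^ m * z := h.coord_eq
    rw [← h2, h3, map_add, D.act_natCast, zero_add, D.act_mul, ← Nat.cast_pow, D.act_natCast, mul_zero,
      add_zero, map_natCast, hc]

/-- The bases are `d/dz` on a disc, with `c = 1`, and `P(z) d/dz` on a node chart, with `c = P(z)`.
-/
lemma IsModelCoeff.hasCoeff [IsIntegral X]
    {e : DerivationAlong (𝟙 _) (projLineStr p) (chart p k).1}
    (he : e.act (chart p k).1 _ le_rfl le_rfl (coord p k) = 1) {V : X.Opens} {g : Γ(X, V)}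
    (h : IsModelCoeff p n π k V g) :
    HasCoeff (M := tangentSheaf (projLineStr p)) (logTangentInclusion p π) e V g := by
  cases h with
  | @disc a W z h =>
    have hW : IsAffineOpen W.1 := W.2
    have := h.isCoordChart.isDomain
    obtain ⟨D, hD⟩ := exists_derivationAlong_of_bijective hW h.bijective
    have := h.isCoordChart.hasCoeff he (isLog_of_bijective hW h.bijective D) 1 one_ne_zero hD
      fun V' hV' E _ => ⟨_, by rw [map_one, one_mul]⟩
    rwa [mul_one] at this
  | @node m a W z w hm h =>
    have hW : IsAffineOpen W.1 := W.2
    have := h.isCoordChart.isDomain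
    have hP : polyEval p (π ≫ projLineStr p) z (residuePoly p) ≠ 0 := fun h0 =>
      (residuePoly_monic p).ne_zero (h.isCoordChart.polyEval_injective (h0.trans (map_zero _).symm))
    obtain ⟨D, hD, hDw⟩ := h.isNodeCoord.exists_derivationAlong hW
    refine h.isCoordChart.hasCoeff he (h.isNodeCoord.isLog hW h.isCoordChart.natCast_ne_zero hD ?_) _ hP
      hD fun V' hV' E hE => h.isNodeCoord.exists_act_eq hP hV' hE
    rw [hDw]
    exact (dvd_mul_right _ _).neg_right

end Generators

end SemistableModel

theorem mainTheorem6 (p : ℕ) [Fact p.Prime] (n : ℕ) (X : Scheme.{0}) (π : X ⟶ projLine p)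
    (hX : IsModel p n X π) :
    IsInvertibleModule ((Scheme.Modules.pullback π).obj (tangentSheaf (projLineStr p))) ∧
    (∀ U : (projLine p).Opens, Function.Bijective (π.app U)) ∧
    ∃ i : logTangentSheaf (π ≫ projLineStr p) (genericFibre p (π ≫ projLineStr p)) ⟶
        (Scheme.Modules.pullback π).obj (tangentSheaf (projLineStr p)),
      Mono i ∧
      i ≫ pullbackTangentToAlong π (projLineStr p) =
        logTangentToAlong π (projLineStr p) (genericFibre p (π ≫ projLineStr p)) ∧
      ∀ d : ℕ, ∃ I : (projLine p).IdealSheafData,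
        (∀ k : Fin 2, I.ideal (chart p k) = chartIdeal p n d k) ∧
        Mono (tensorPowComparison π d (tangentSheaf (projLineStr p))) ∧
        Mono ((Scheme.Modules.pushforward π).map ((tensorPow X d).map i)) ∧
        ∀ U : (projLine p).Opens,
          Set.range (((Scheme.Modules.pushforward π).map ((tensorPow X d).map i)).app U) =
            (tensorPowComparison π d (tangentSheaf (projLineStr p))).app U ''
              idealMulSections I ((tensorPow (projLine p) d).obj (tangentSheaf (projLineStr p))) U := by
  have := hX.isIntegral
  have hcov : ∀ x : projLine p, ∃ (k : Fin 2) (e : DerivationAlong (𝟙 _) (projLineStr p) (chart p k).1),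
      x ∈ (chart p k).1 ∧ IsGen (tangentSheaf (projLineStr p)) (U := (chart p k).1) e ∧
      IsGen _ (pullSec (M := tangentSheaf (projLineStr p)) (U := (chart p k).1) π e) ∧
      ∀ (V : X.Opens) (g : Γ(X, V)), IsModelCoeff p n π k V g →
        HasCoeff (M := tangentSheaf (projLineStr p)) (logTangentInclusion p π) e V g := by
    intro x
    obtain ⟨k, hk⟩ := exists_mem_chart p x
    obtain ⟨e, he, hgen⟩ := exists_mapsGen_tangent π k
    exact ⟨k, e, hk, hgen.1, isGen_pullSec π hgen, fun V g hg => hg.hasCoeff he⟩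
  refine ⟨isInvertibleModule_pullback_tangentSheaf π, hX.app_bijective, logTangentInclusion p π,
    hX.mono_logTangentInclusion, logTangentInclusion_comp, fun d => ?_⟩
  obtain ⟨I, hI⟩ := exists_idealSheaf p n d
  refine ⟨I, hI, ?_, ?_, fun U => ?_⟩
  · have := isIso_tensorPowComparison (π := π) (M := tangentSheaf (projLineStr p)) (d := d)
      hX.app_bijective fun x => by
        obtain ⟨k, e, hk, he, he', -⟩ := hcov x
        exact ⟨_, e, hk, he, he'⟩
    infer_instance
  · refine mono_of_injective_app _ fun U => ?_
    refine tensorPow_map_injective d (logTangentInclusion p π) (fun y => ?_) (π ⁻¹ᵁ U)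
    obtain ⟨k, e, hk, -, he', h⟩ := hcov (π y)
    obtain ⟨V, g, hg, hy⟩ := hX.exists_isModelCoeff y hk
    exact ⟨_, e, V, g, hy, he', h V g hg⟩
  -- The two implications of the local criterion: divisibility on the discs forces membership in the
  -- chart ideal, and membership gives divisibility on all charts.
  · refine range_tensorPow_map (i := logTangentInclusion p π) hX.app_bijective I (fun x => ?_) U
    obtain ⟨k, e, hk, he, he', h⟩ := hcov x
    exact ⟨_, e, fun V g => IsModelCoeff p n π k V g, hk, he, he', h,
      fun y hy => hX.exists_isModelCoeff y hy, fun O hO r =>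
      ⟨fun hr x hx => hX.exists_mem_ideal d I (hI k) O hO r hr x hx,
        fun hr V g hg => hX.exists_coeff_mul d I (hI k) O r hr hg⟩⟩
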